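/- Let $\mathbb F$ be $\mathbb R$ or $\mathbb C$; all algebras and tensor products are over $\mathbb F$. A graded $C^*$-algebra is a (real or complex) $C^*$-algebra with a $*$-automorphism $\delta$ of order two (for $\mathbb F=\mathbb R$, $1+a^*a$ is required to be invertible for all $a$). $A\widehat\otimes B$ is the graded tensor product: $(a\otimes b)(c\otimes d)=(-1)^{\deg b\deg c}ac\otimes bd$, $(a\otimes b)^*=(-1)^{\deg a\deg b}a^*\otimes b^*$, completed in the norm $\|\sum a_i\otimes b_i\|=\sup\|\sum\varphi(a_i)\psi(b_i)\|$ over all pairs of graded $*$-homomorphisms $\varphi:A\to C$, $\psi:B\to C$ into a common graded $C^*$-algebra which commute in the graded sense. Let $\mathcal S=C_0(\mathbb R)$ with $\delta(f)(x)=f(-x)$; let $\mathcal K$ be the compact operators on a graded Hilbert space $H=H_0\oplus H_1$ (operators preserving the decomposition are even, those exchanging the summands are odd); let $\mathbb F_{m,0}$ be the Clifford algebra of $\mathbb R^m$, $v^2=\|v\|^2$, with self-adjoint odd generators $e_1,\dots,e_m$. A graded asymptotic morphism $A\dashrightarrow B$ is a family $\varphi_t:A\to B$, $t\in[1,\infty)$,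 such that $t\mapsto\varphi_t(a)$ is continuous and bounded for each $a$ and $\varphi_t(ab)-\varphi_t(a)\varphi_t(b)$, $\varphi_t(a+\lambda b)-\varphi_t(a)-\lambda\varphi_t(b)$, $\varphi_t(a^*)-\varphi_t(a)^*$, $\varphi_t(\delta a)-\delta\varphi_t(a)$ tend to $0$ in norm for all $a,b\in A$, $\lambda\in\mathbb F$. It is asymptotically equivalent to $\psi$ if $\varphi_t(a)-\psi_t(a)\to0$ for all $a$. A quasi-topology on a set $X$ is a class of maps $C\to X$ ($C$ compact Hausdorff), called quasi-continuous, which contains the constant maps, is stable under composition with continuous maps $C'\to C$, is determined on $C_1\amalg C_2$ by the restrictions to $C_1$ and $C_2$, and contains $h:C_2\to X$ if it contains $hf$ for some continuous surjection $f:C_1\to C_2$. A map of quasi-topological spaces is quasi-continuous if composition with it preserves these classes. A topological space has the quasi-topology of continuous maps; products and quotients (hence smash products) of quasi-topological spaces are formed in the usual way, a map $C\to X/{\sim}$ being quasi-continuous if it lifts to a quasi-continuous map $C'\to X$ along some continuous surjection $C'\to C$. The Dadarlat–Meyer quasi-topology on the set of graded asymptotic morphisms $A\dashrightarrow B$ has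 as quasi-continuous maps $Y\to\mathrm{Asy}(A,B)$ those given by the elements of $\mathrm{Asy}(A,C(Y,B))$. Let $\mathrm{Asy}_g(A,B)$ be the quotient by asymptotic equivalence, with the quotient quasi-topology, based at the class of $0$. An orthogonal quasi-spectrum consists of based quasi-topological spaces $X_m$ ($m\ge0$), a basepoint-preserving quasi-continuous left action of $O(m)$ on each $X_m$, and based quasi-continuous maps $\sigma_m:X_m\wedge S^1\to X_{m+1}$ such that, for all $m,n\ge0$, the iterated map $\sigma^n_m:X_m\wedge S^n\to X_{m+n}$, $x\wedge(s_1,\dots,s_n)\mapsto\sigma_{m+n-1}(\cdots\sigma_m(x\wedge s_1)\cdots\wedge s_n)$, is quasi-continuous and $O(m)\times O(n)$-equivariant. Here $S^n=\mathbb R^n\cup\{\infty\}$ is based at $\infty$ with the usual action of $O(n)$, and $O(m)\times O(n)\subset O(m+n)$ by block sum. **Proposition.** Let $A$ and $B$ be graded $C^*$-algebras, and let $$X_m=\mathrm{Asy}_g(\mathcal S\widehat\otimes A\widehat\otimes\mathcal K,\;B\widehat\otimes\mathbb F_{m,0}\widehat\otimes\mathcal K),\qquad m\ge0,$$ with the action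 of $O(m)$ given by composition with $b\otimes x\otimes k\mapsto b\otimes U(x)\otimes k$, where $U(v_1\cdots v_k)=U(v_1)\cdots U(v_k)$ on $\mathbb F_{m,0}$. (1) There is a graded $*$-homomorphism $\Delta:\mathcal S\to\mathcal S\widehat\otimes\mathcal S$ such that for every $R>0$ the image of $\Delta(f)$ in $C[-R,R]\widehat\otimes C[-R,R]$ is $f(X_R\otimes1+1\otimes X_R)$ (continuous functional calculus, $X_R$ the coordinate function), for all $f\in\mathcal S$. (2) For every asymptotic morphism $x:\mathcal S\widehat\otimes A\widehat\otimes\mathcal K\dashrightarrow B\widehat\otimes\mathbb F_{m,0}\widehat\otimes\mathcal K$ there is an asymptotic morphism $\mathrm{id}_{\mathcal S}\widehat\otimes x$, characterized up to asymptotic equivalence by $(\mathrm{id}_{\mathcal S}\widehat\otimes x)_t(f\otimes a)-f\otimes x_t(a)\to0$. With the Bott map $b_s:\mathcal S\to\mathbb F_{1,0}$, $b_s(f)=f(se_1)=\tfrac{f(s)+f(-s)}2+\tfrac{f(s)-f(-s)}2e_1$ for $s\in\mathbb R$, and with the graded $*$-homomorphism $\theta_m:\mathbb F_{1,0}\widehat\otimes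 B\widehat\otimes\mathbb F_{m,0}\widehat\otimes\mathcal K\to B\widehat\otimes\mathbb F_{m+1,0}\widehat\otimes\mathcal K$, $c\otimes b\otimes y\otimes k\mapsto(-1)^{\deg c(\deg b+\deg y)}b\otimes yc\otimes k$ for homogeneous $c,b,y$ (the generators of $\mathbb F_{m,0}$ are $e_1,\dots,e_m$, and that of $\mathbb F_{1,0}$ becomes $e_{m+1}$), which exists, the formula $$\sigma_m([x]\wedge s)=\big[\theta_m\circ(b_s\widehat\otimes\mathrm{id})\circ(\mathrm{id}_{\mathcal S}\widehat\otimes x)\circ(\Delta\widehat\otimes\mathrm{id}_{A\widehat\otimes\mathcal K})\big],\qquad s\in\mathbb R,$$ (with $(\mathcal S\widehat\otimes\mathcal S)\widehat\otimes(A\widehat\otimes\mathcal K)$ mapped to $\mathcal S\widehat\otimes(\mathcal S\widehat\otimes(A\widehat\otimes\mathcal K))$ by the associativity homomorphism) defines a based quasi-continuous map $\sigma_m:X_m\wedge S^1\to X_{m+1}$. (3) The spaces $X_m$ with the actions of $O(m)$ and the structure maps $\sigma_m$ form an orthogonal quasi-spectrum. -/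

import Mathlib

noncomputable section

namespace ETheory

/-! ### Graded C*-algebras -/

/-- A graded `*`-algebra over `𝕜 = ℝ` or `ℂ` (no norm): a `*`-algebra, not necessarily unital, with
a `*`-automorphism `grade` of order two. -/
structure GrStarAlg (𝕜 : Type) [RCLike 𝕜] where
  carrier : Type
  [ring : NonUnitalRing carrier]
  [module : Module 𝕜 carrier]
  [tower : IsScalarTower 𝕜 carrier carrier]
  [comm : SMulCommClass 𝕜 carrier carrier]
  [starRing : StarRing carrier]
  [starModule : StarModule 𝕜 carrier]
  grade : carrier →ₗ[𝕜] carrier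
  grade_grade : ∀ a, grade (grade a) = a
  grade_mul : ∀ a b, grade (a * b) = grade a * grade b
  grade_star : ∀ a, grade (star a) = star (grade a)

attribute [instance] GrStarAlg.ring GrStarAlg.module GrStarAlg.tower GrStarAlg.comm
  GrStarAlg.starRing GrStarAlg.starModule

/-- A graded C*-algebra over `𝕜 = ℝ` or `ℂ`.

For `𝕜 = ℂ` the field `norm_sq_le` holds in every C*-algebra. For `𝕜 = ℝ` it is the standard norm
form of the requirement on a real C*-algebra that `1 + a* a` be invertible for all `a` (given the
other fields, the two are equivalent). The grading is a `*`-automorphism of order two, hence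
isometric; the last field records this. -/
structure GrCStar (𝕜 : Type) [RCLike 𝕜] where
  carrier : Type
  [normedRing : NonUnitalNormedRing carrier]
  [complete : CompleteSpace carrier]
  [normedSpace : NormedSpace 𝕜 carrier]
  [tower : IsScalarTower 𝕜 carrier carrier]
  [comm : SMulCommClass 𝕜 carrier carrier]
  [starRing : StarRing carrier]
  [starModule : StarModule 𝕜 carrier]
  [cstar : CStarRing carrier]
  norm_sq_le : ∀ a b : carrier, ‖a‖ ^ 2 ≤ ‖star a * a + star b * b‖
  grade : carrier →ₗ[𝕜] carrier
  grade_grade : ∀ a, grade (grade a) = a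
  grade_mul : ∀ a b, grade (a * b) = grade a * grade b
  grade_star : ∀ a, grade (star a) = star (grade a)
  norm_grade : ∀ a, ‖grade a‖ = ‖a‖

attribute [instance] GrCStar.normedRing GrCStar.complete GrCStar.normedSpace GrCStar.tower
  GrCStar.comm GrCStar.starRing GrCStar.starModule GrCStar.cstar

variable {𝕜 : Type} [RCLike 𝕜]

/-- A graded `*`-homomorphism between graded C*-algebras. A `*`-homomorphism of C*-algebras is
automatically contractive; the field `norm_le` records this. -/
structure GrHom (A B : GrCStar 𝕜) where
  toHom : A.carrier →⋆ₙₐ[𝕜] B.carrier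
  map_grade : ∀ a, toHom (A.grade a) = B.grade (toHom a)
  norm_le : ∀ a, ‖toHom a‖ ≤ ‖a‖

instance (A B : GrCStar 𝕜) : CoeFun (GrHom A B) (fun _ => A.carrier → B.carrier) :=
  ⟨fun f => f.toHom⟩

/-- The identity homomorphism. -/
def GrHom.id (A : GrCStar 𝕜) : GrHom A A where
  toHom := NonUnitalStarAlgHom.id 𝕜 A.carrier
  map_grade _ := rfl
  norm_le _ := le_rfl

/-- Composition of graded `*`-homomorphisms. -/
def GrHom.comp {A B C : GrCStar 𝕜} (g : GrHom B C) (f : GrHom A B) : GrHom A C where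
  toHom := g.toHom.comp f.toHom
  map_grade a := by simp [f.map_grade, g.map_grade]
  norm_le a := (g.norm_le _).trans (f.norm_le a)

/-- A graded `*`-homomorphism between graded `*`-algebras. -/
structure AlgMap (P Q : GrStarAlg 𝕜) where
  toHom : P.carrier →⋆ₙₐ[𝕜] Q.carrier
  map_grade : ∀ a, toHom (P.grade a) = Q.grade (toHom a)

/-- A graded `*`-representation of a graded `*`-algebra in a graded C*-algebra. -/
structure Rep (P : GrStarAlg 𝕜) (C : GrCStar 𝕜) where
  toHom : P.carrier →⋆ₙₐ[𝕜] C.carrier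
  map_grade : ∀ a, toHom (P.grade a) = C.grade (toHom a)

/-- Pulling back a representation. -/
def Rep.comp {P Q : GrStarAlg 𝕜} {C : GrCStar 𝕜} (π : Rep Q C) (f : AlgMap P Q) : Rep P C where
  toHom := π.toHom.comp f.toHom
  map_grade a := by simp [f.map_grade, π.map_grade]

/-! ### The completion of a graded `*`-algebra in a norm given by representations -/

/-- A class of representations of `P` that is bounded on each element of `P`. -/
structure RepClass (P : GrStarAlg 𝕜) where
  mem : ∀ C : GrCStar 𝕜, Set (Rep P C)
  bdd : ∀ x : P.carrier, ∃ M : ℝ, ∀ (C : GrCStar 𝕜) (π : Rep P C), π ∈ mem C → ‖π.toHom x‖ ≤ M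

namespace RepClass

variable {P : GrStarAlg 𝕜} (R : RepClass P)

/-- The values `‖π x‖`, for `π` in the class (and `0`). -/
def values (x : P.carrier) : Set ℝ :=
  {r | r = 0 ∨ ∃ (C : GrCStar 𝕜) (π : Rep P C), π ∈ R.mem C ∧ r = ‖π.toHom x‖}

/-- The seminorm `x ↦ sup ‖π x‖` over the representations in the class. -/
def nrm (x : P.carrier) : ℝ := sSup (R.values x)

theorem bddAbove (x : P.carrier) : BddAbove (R.values x) := by
  obtain ⟨M, hM⟩ := R.bdd x
  refine ⟨max 0 M, ?_⟩
  rintro r (rfl | ⟨C, π, hπ, rfl⟩)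
  · exact le_max_left _ _
  · exact (hM C π hπ).trans (le_max_right _ _)

theorem nrm_nonneg (x : P.carrier) : 0 ≤ R.nrm x :=
  le_csSup (R.bddAbove x) (Or.inl rfl)

theorem le_nrm {C : GrCStar 𝕜} {π : Rep P C} (h : π ∈ R.mem C) (x : P.carrier) :
    ‖π.toHom x‖ ≤ R.nrm x :=
  le_csSup (R.bddAbove x) (Or.inr ⟨C, π, h, rfl⟩)

theorem nrm_le {x : P.carrier} {M : ℝ} (h0 : 0 ≤ M)
    (h : ∀ (C : GrCStar 𝕜) (π : Rep P C), π ∈ R.mem C → ‖π.toHom x‖ ≤ M) : R.nrm x ≤ M := by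
  refine csSup_le ⟨0, Or.inl rfl⟩ ?_
  rintro r (rfl | ⟨C, π, hπ, rfl⟩)
  · exact h0
  · exact h C π hπ

theorem nrm_add (x y : P.carrier) : R.nrm (x + y) ≤ R.nrm x + R.nrm y :=
  R.nrm_le (add_nonneg (R.nrm_nonneg x) (R.nrm_nonneg y)) fun C π h => by
    rw [map_add]
    exact (norm_add_le _ _).trans (add_le_add (R.le_nrm h x) (R.le_nrm h y))

theorem nrm_smul_le (c : 𝕜) (x : P.carrier) : R.nrm (c • x) ≤ ‖c‖ * R.nrm x :=
  R.nrm_le (mul_nonneg (norm_nonneg c) (R.nrm_nonneg x)) fun C π h => by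
    rw [map_smul, norm_smul]
    exact mul_le_mul_of_nonneg_left (R.le_nrm h x) (norm_nonneg c)

theorem nrm_mul (x y : P.carrier) : R.nrm (x * y) ≤ R.nrm x * R.nrm y :=
  R.nrm_le (mul_nonneg (R.nrm_nonneg x) (R.nrm_nonneg y)) fun C π h => by
    rw [map_mul]
    exact (norm_mul_le _ _).trans
      (mul_le_mul (R.le_nrm h x) (R.le_nrm h y) (norm_nonneg _) (R.nrm_nonneg x))

theorem nrm_star_le (x : P.carrier) : R.nrm (star x) ≤ R.nrm x :=
  R.nrm_le (R.nrm_nonneg x) fun C π h => by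
    rw [map_star, norm_star]
    exact R.le_nrm h x

theorem nrm_grade_le (x : P.carrier) : R.nrm (P.grade x) ≤ R.nrm x :=
  R.nrm_le (R.nrm_nonneg x) fun C π h => by
    rw [π.map_grade, C.norm_grade]
    exact R.le_nrm h x

theorem nrm_sq_le (x y : P.carrier) : R.nrm x ^ 2 ≤ R.nrm (star x * x + star y * y) := by
  have h1 : R.nrm x ≤ Real.sqrt (R.nrm (star x * x + star y * y)) :=
    R.nrm_le (Real.sqrt_nonneg _) fun C π h => by
      refine Real.le_sqrt_of_sq_le ((C.norm_sq_le (π.toHom x) (π.toHom y)).trans ?_)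
      have := R.le_nrm h (star x * x + star y * y)
      simpa only [map_add, map_mul, map_star] using this
  calc R.nrm x ^ 2 ≤ Real.sqrt (R.nrm (star x * x + star y * y)) ^ 2 :=
        pow_le_pow_left₀ (R.nrm_nonneg x) h1 2
    _ = _ := Real.sq_sqrt (R.nrm_nonneg _)

/-- The seminorm of the class, as a bundled seminorm. -/
def seminorm : Seminorm 𝕜 P.carrier :=
  Seminorm.ofSMulLE R.nrm
    (le_antisymm (R.nrm_le le_rfl fun C π _ => by simp) (R.nrm_nonneg 0)) R.nrm_add R.nrm_smul_le

/-- The underlying space of `P`, with the seminorm of the class. -/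
def Pre (_R : RepClass P) : Type := P.carrier

instance : NonUnitalRing R.Pre := P.ring
instance : Module 𝕜 R.Pre := P.module
instance : IsScalarTower 𝕜 R.Pre R.Pre := P.tower
instance : SMulCommClass 𝕜 R.Pre R.Pre := P.comm
instance : StarRing R.Pre := P.starRing
instance : StarModule 𝕜 R.Pre := P.starModule

instance : SeminormedAddCommGroup R.Pre := R.seminorm.toSeminormedAddCommGroup
theorem pre_norm (x : R.Pre) : ‖x‖ = R.nrm x := rfl
instance : NormedSpace 𝕜 R.Pre where
  norm_smul_le := R.nrm_smul_le

/-- The completion of `P` in the seminorm of the class. -/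
abbrev Compl : Type := UniformSpace.Completion R.Pre

open UniformSpace

instance : ContinuousMul R.Pre where
  continuous_mul := by
    let B : R.Pre →ₗ[𝕜] R.Pre →ₗ[𝕜] R.Pre := LinearMap.mul 𝕜 R.Pre
    let B' : R.Pre →L[𝕜] R.Pre →L[𝕜] R.Pre :=
      B.mkContinuous₂ 1 (fun x y => by rw [one_mul]; exact R.nrm_mul x y)
    exact B'.continuous₂

instance : Mul R.Compl :=
  ⟨Function.curry <| (Completion.isDenseInducing_coe.prodMap
    Completion.isDenseInducing_coe).extend
      (((↑) : R.Pre → R.Compl) ∘ Function.uncurry (· * ·))⟩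

theorem coe_mul (a b : R.Pre) : ((a * b : R.Pre) : R.Compl) = a * b :=
  ((Completion.isDenseInducing_coe.prodMap Completion.isDenseInducing_coe).extend_eq
      ((Completion.continuous_coe R.Pre).comp (@continuous_mul R.Pre _ _ _)) (a, b)).symm

instance : ContinuousMul R.Compl where
  continuous_mul := by
    let m := (AddMonoidHom.mul : R.Pre →+ R.Pre →+ R.Pre).compr₂ Completion.toCompl
    have : Continuous fun p : R.Pre × R.Pre => m p.1 p.2 :=
      (Completion.continuous_coe R.Pre).comp continuous_mul
    have di : IsDenseInducing (Completion.toCompl : R.Pre → R.Compl) :=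
      Completion.isDenseInducing_coe
    exact (di.extend_Z_bilin di this :)

theorem uc_star : UniformContinuous (star : R.Pre → R.Pre) :=
  uniformContinuous_addMonoidHom_of_continuous
    (f := (starAddEquiv : R.Pre ≃+ R.Pre).toAddMonoidHom)
    (AddMonoidHomClass.continuous_of_bound _ 1 fun x => by
      rw [one_mul]; exact R.nrm_star_le x)

instance : Star R.Compl := ⟨Completion.map star⟩

theorem coe_star (a : R.Pre) : ((star a : R.Pre) : R.Compl) = star (a : R.Compl) :=
  (Completion.map_coe R.uc_star a).symm

theorem continuous_star' : Continuous (star : R.Compl → R.Compl) := Completion.continuous_map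

instance : NonUnitalNormedRing R.Compl :=
  { (inferInstance : NormedAddCommGroup R.Compl), (inferInstance : Mul R.Compl) with
    zero_mul a :=
      Completion.induction_on a (isClosed_eq (by fun_prop) continuous_const)
        fun a => by rw [← Completion.coe_zero, ← coe_mul, zero_mul]
    mul_zero a :=
      Completion.induction_on a (isClosed_eq (by fun_prop) continuous_const)
        fun a ↦ by rw [← Completion.coe_zero, ← coe_mul, mul_zero]
    mul_assoc a b c :=
      Completion.induction_on₃ a b c
        (isClosed_eq (by fun_prop) (by fun_prop))
        fun a b c => by rw [← coe_mul, ← coe_mul, ← coe_mul, ← coe_mul, mul_assoc]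
    left_distrib a b c :=
      Completion.induction_on₃ a b c
        (isClosed_eq (by fun_prop) (by fun_prop))
        fun a b c => by
          rw [← Completion.coe_add, ← coe_mul, ← coe_mul, ← coe_mul, ← Completion.coe_add, mul_add]
    right_distrib a b c :=
      Completion.induction_on₃ a b c
        (isClosed_eq (by fun_prop) (by fun_prop))
        fun a b c => by
          rw [← Completion.coe_add, ← coe_mul, ← coe_mul, ← coe_mul, ← Completion.coe_add, add_mul]
    norm_mul_le x y :=
      Completion.induction_on₂ x y (isClosed_le (by fun_prop) (by fun_prop))
        fun a b => by
          rw [← coe_mul, Completion.norm_coe, Completion.norm_coe, Completion.norm_coe]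
          exact R.nrm_mul a b }

theorem compl_smul_mul (c : 𝕜) (x y : R.Compl) : (c • x) * y = c • (x * y) := by
  induction x, y using Completion.induction_on₂ with
  | hp =>
    exact isClosed_eq ((continuous_fst.const_smul c).mul continuous_snd)
      ((continuous_fst.mul continuous_snd).const_smul c)
  | ih a b =>
    rw [← Completion.coe_smul, ← coe_mul, ← coe_mul, ← Completion.coe_smul, smul_mul_assoc]

theorem compl_mul_smul (c : 𝕜) (x y : R.Compl) : x * (c • y) = c • (x * y) := by
  induction x, y using Completion.induction_on₂ with
  | hp =>
    exact isClosed_eq (continuous_fst.mul (continuous_snd.const_smul c))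
      ((continuous_fst.mul continuous_snd).const_smul c)
  | ih a b =>
    rw [← Completion.coe_smul, ← coe_mul, ← coe_mul, ← Completion.coe_smul, mul_smul_comm]

instance : IsScalarTower 𝕜 R.Compl R.Compl := ⟨R.compl_smul_mul⟩

instance : SMulCommClass 𝕜 R.Compl R.Compl := ⟨fun c x y => (R.compl_mul_smul c x y).symm⟩

theorem compl_star_star (x : R.Compl) : star (star x) = x := by
  have hs := R.continuous_star'
  induction x using Completion.induction_on with
  | hp => exact isClosed_eq (hs.comp hs) continuous_id
  | ih a => rw [← coe_star, ← coe_star, star_star]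

theorem compl_star_mul (x y : R.Compl) : star (x * y) = star y * star x := by
  have hs := R.continuous_star'
  induction x, y using Completion.induction_on₂ with
  | hp => exact isClosed_eq (by fun_prop) (by fun_prop)
  | ih a b => rw [← coe_star, ← coe_star, ← coe_mul, ← coe_mul, ← coe_star, star_mul]

theorem compl_star_add (x y : R.Compl) : star (x + y) = star x + star y := by
  have hs := R.continuous_star'
  induction x, y using Completion.induction_on₂ with
  | hp => exact isClosed_eq (by fun_prop) (by fun_prop)
  | ih a b =>
    rw [← coe_star, ← coe_star, ← Completion.coe_add, ← Completion.coe_add, ← coe_star, star_add]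

instance : StarRing R.Compl where
  star_involutive := R.compl_star_star
  star_mul := R.compl_star_mul
  star_add := R.compl_star_add

instance : StarModule 𝕜 R.Compl where
  star_smul c x := by
    have hs := R.continuous_star'
    induction x using Completion.induction_on with
    | hp => exact isClosed_eq (hs.comp (continuous_const_smul c)) (hs.const_smul (star c))
    | ih a => rw [← coe_star, ← Completion.coe_smul, ← Completion.coe_smul, ← coe_star, star_smul]

theorem compl_norm_sq_le (x y : R.Compl) : ‖x‖ ^ 2 ≤ ‖star x * x + star y * y‖ := by
  have hs := R.continuous_star'
  induction x, y using Completion.induction_on₂ with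
  | hp => exact isClosed_le (by fun_prop) (by fun_prop)
  | ih a b =>
    rw [← coe_star, ← coe_star, ← coe_mul, ← coe_mul, ← Completion.coe_add, Completion.norm_coe,
      Completion.norm_coe]
    exact R.nrm_sq_le a b

instance : CStarRing R.Compl where
  norm_mul_self_le x := by
    have := R.compl_norm_sq_le x 0
    rwa [mul_zero, add_zero, sq] at this

/-- The grading of `P`, as a contraction for the seminorm. -/
def preGrade : R.Pre →L[𝕜] R.Pre :=
  LinearMap.mkContinuous (E := R.Pre) (F := R.Pre) P.grade 1
    (fun x => by rw [one_mul]; exact R.nrm_grade_le x)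

/-- The grading of the completion. -/
def complGradeFun : R.Compl → R.Compl := Completion.map R.preGrade

theorem continuous_complGrade : Continuous R.complGradeFun := Completion.continuous_map

theorem complGrade_coe (a : R.Pre) :
    R.complGradeFun (a : R.Compl) = (R.preGrade a : R.Compl) :=
  Completion.map_coe R.preGrade.uniformContinuous a

/-- The grading of the completion, as a linear map. -/
def complGrade : R.Compl →ₗ[𝕜] R.Compl where
  toFun := R.complGradeFun
  map_add' x y := by
    have hg := R.continuous_complGrade
    induction x, y using Completion.induction_on₂ with
    | hp => exact isClosed_eq (by fun_prop) (by fun_prop)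
    | ih a b =>
      rw [← Completion.coe_add, complGrade_coe, complGrade_coe, complGrade_coe, map_add,
        Completion.coe_add]
  map_smul' c x := by
    have hg := R.continuous_complGrade
    induction x using Completion.induction_on with
    | hp => exact isClosed_eq (hg.comp (continuous_const_smul c)) (hg.const_smul c)
    | ih a =>
      rw [← Completion.coe_smul, complGrade_coe, complGrade_coe, map_smul, Completion.coe_smul,
        RingHom.id_apply]

theorem nrm_grade (x : P.carrier) : R.nrm (P.grade x) = R.nrm x :=
  le_antisymm (R.nrm_grade_le x) (by simpa [P.grade_grade] using R.nrm_grade_le (P.grade x))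

theorem complGrade_grade (x : R.Compl) : R.complGradeFun (R.complGradeFun x) = x := by
  have hg := R.continuous_complGrade
  induction x using Completion.induction_on with
  | hp => exact isClosed_eq (hg.comp hg) continuous_id
  | ih a =>
    rw [complGrade_coe, complGrade_coe]
    exact congrArg _ (P.grade_grade a)

theorem complGrade_mul (x y : R.Compl) :
    R.complGradeFun (x * y) = R.complGradeFun x * R.complGradeFun y := by
  have hg := R.continuous_complGrade
  induction x, y using Completion.induction_on₂ with
  | hp => exact isClosed_eq (by fun_prop) (by fun_prop)
  | ih a b =>
    rw [← coe_mul, complGrade_coe, complGrade_coe, complGrade_coe, ← coe_mul]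
    exact congrArg _ (P.grade_mul a b)

theorem complGrade_star (x : R.Compl) :
    R.complGradeFun (star x) = star (R.complGradeFun x) := by
  have hg := R.continuous_complGrade
  have hs := R.continuous_star'
  induction x using Completion.induction_on with
  | hp => exact isClosed_eq (hg.comp hs) (hs.comp hg)
  | ih a =>
    rw [← coe_star, complGrade_coe, complGrade_coe, ← coe_star]
    exact congrArg _ (P.grade_star a)

theorem norm_complGrade (x : R.Compl) : ‖R.complGradeFun x‖ = ‖x‖ := by
  have hg := R.continuous_complGrade
  induction x using Completion.induction_on with
  | hp => exact isClosed_eq hg.norm continuous_norm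
  | ih a =>
    rw [complGrade_coe, Completion.norm_coe, Completion.norm_coe]
    exact R.nrm_grade a

/-- The graded C*-algebra obtained from `P` by completion (and division by the null space) in the
seminorm `x ↦ sup ‖π x‖`. -/
def envelope : GrCStar 𝕜 where
  carrier := R.Compl
  norm_sq_le := R.compl_norm_sq_le
  grade := R.complGrade
  grade_grade := R.complGrade_grade
  grade_mul := R.complGrade_mul
  grade_star := R.complGrade_star
  norm_grade := R.norm_complGrade

/-- The image in the completion of an element of `P`. -/
def of (x : P.carrier) : R.envelope.carrier :=
  (Completion.coe' (α := R.Pre) x : R.Compl)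

section Map

variable {Q : GrStarAlg 𝕜} {R : RepClass P} {R' : RepClass Q}

/-- The condition that a homomorphism pulls back the second class into the first one. -/
def Pulls (R : RepClass P) (R' : RepClass Q) (f : AlgMap P Q) : Prop :=
  ∀ (C : GrCStar 𝕜) (π : Rep Q C), π ∈ R'.mem C → π.comp f ∈ R.mem C

theorem Pulls.nrm_le {f : AlgMap P Q} (h : Pulls R R' f) (x : P.carrier) :
    R'.nrm (f.toHom x) ≤ R.nrm x :=
  R'.nrm_le (R.nrm_nonneg x) fun C π hπ => R.le_nrm (h C π hπ) x

/-- A homomorphism that pulls back the second class into the first one, as a contraction. -/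
def preMap (f : AlgMap P Q) (h : Pulls R R' f) : R.Pre →L[𝕜] R'.Pre :=
  LinearMap.mkContinuous (E := R.Pre) (F := R'.Pre)
    (f.toHom : P.carrier →ₗ[𝕜] Q.carrier) 1 (fun x => by rw [one_mul]; exact h.nrm_le x)

/-- The extension to the completions. -/
def mapFun (f : AlgMap P Q) (h : Pulls R R' f) : R.Compl → R'.Compl := Completion.map (preMap f h)

variable (f : AlgMap P Q) (h : Pulls R R' f)

theorem continuous_mapFun : Continuous (mapFun f h) := Completion.continuous_map

theorem mapFun_coe (a : R.Pre) : mapFun f h (a : R.Compl) = (preMap f h a : R'.Compl) :=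
  Completion.map_coe (preMap f h).uniformContinuous a

theorem mapFun_add (x y : R.Compl) : mapFun f h (x + y) = mapFun f h x + mapFun f h y := by
  have hg := continuous_mapFun f h
  induction x, y using Completion.induction_on₂ with
  | hp => exact isClosed_eq (by fun_prop) (by fun_prop)
  | ih a b =>
    rw [← Completion.coe_add, mapFun_coe, mapFun_coe, mapFun_coe, map_add, Completion.coe_add]

theorem mapFun_smul (c : 𝕜) (x : R.Compl) : mapFun f h (c • x) = c • mapFun f h x := by
  have hg := continuous_mapFun f h
  induction x using Completion.induction_on with
  | hp => exact isClosed_eq (hg.comp (continuous_const_smul c)) (hg.const_smul c)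
  | ih a => rw [← Completion.coe_smul, mapFun_coe, mapFun_coe, map_smul, Completion.coe_smul]

theorem mapFun_mul (x y : R.Compl) : mapFun f h (x * y) = mapFun f h x * mapFun f h y := by
  have hg := continuous_mapFun f h
  induction x, y using Completion.induction_on₂ with
  | hp => exact isClosed_eq (by fun_prop) (by fun_prop)
  | ih a b =>
    rw [← coe_mul, mapFun_coe, mapFun_coe, mapFun_coe, ← coe_mul]
    exact congrArg _ (map_mul f.toHom a b)

theorem mapFun_star (x : R.Compl) : mapFun f h (star x) = star (mapFun f h x) := by
  have hg := continuous_mapFun f h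
  have hs := R.continuous_star'
  have hs' := R'.continuous_star'
  induction x using Completion.induction_on with
  | hp => exact isClosed_eq (hg.comp hs) (hs'.comp hg)
  | ih a =>
    rw [← coe_star, mapFun_coe, mapFun_coe, ← coe_star]
    exact congrArg _ (map_star f.toHom a)

theorem mapFun_grade (x : R.Compl) :
    mapFun f h (R.complGradeFun x) = R'.complGradeFun (mapFun f h x) := by
  have hg := continuous_mapFun f h
  have hs := R.continuous_complGrade
  have hs' := R'.continuous_complGrade
  induction x using Completion.induction_on with
  | hp => exact isClosed_eq (hg.comp hs) (hs'.comp hg)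
  | ih a =>
    rw [complGrade_coe, mapFun_coe, mapFun_coe, complGrade_coe]
    exact congrArg _ (f.map_grade a)

theorem norm_mapFun_le (x : R.Compl) : ‖mapFun f h x‖ ≤ ‖x‖ := by
  have hg := continuous_mapFun f h
  induction x using Completion.induction_on with
  | hp => exact isClosed_le hg.norm continuous_norm
  | ih a =>
    rw [mapFun_coe, Completion.norm_coe, Completion.norm_coe]
    exact h.nrm_le a

/-- Functoriality: a graded `*`-homomorphism that pulls back the second class into the first one
extends to the completions. -/
def map : GrHom R.envelope R'.envelope where
  toHom :=
    { toFun := mapFun f h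
      map_smul' := mapFun_smul f h
      map_zero' := by
        have := mapFun_smul f h (0 : 𝕜) 0
        rw [zero_smul, zero_smul] at this
        exact this
      map_add' := mapFun_add f h
      map_mul' := mapFun_mul f h
      map_star' := mapFun_star f h }
  map_grade := mapFun_grade f h
  norm_le := norm_mapFun_le f h

theorem map_of (x : P.carrier) : map f h (R.of x) = R'.of (f.toHom x) := mapFun_coe f h x

end Map

end RepClass

/-! ### Even and odd parts -/

namespace GrStarAlg

variable (P : GrStarAlg 𝕜)

/-- The even part of an element. -/
def even : P.carrier →ₗ[𝕜] P.carrier := (2⁻¹ : 𝕜) • (LinearMap.id + P.grade)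

/-- The odd part of an element. -/
def odd : P.carrier →ₗ[𝕜] P.carrier := (2⁻¹ : 𝕜) • (LinearMap.id - P.grade)

theorem even_add_odd (a : P.carrier) : P.even a + P.odd a = a := by
  simp only [even, odd, LinearMap.smul_apply, LinearMap.add_apply, LinearMap.sub_apply,
    LinearMap.id_apply, ← smul_add]
  rw [show a + P.grade a + (a - P.grade a) = (2 : 𝕜) • a by rw [two_smul]; abel, smul_smul,
    inv_mul_cancel₀ two_ne_zero, one_smul]

theorem grade_even (a : P.carrier) : P.grade (P.even a) = P.even a := by
  simp only [even, LinearMap.smul_apply, LinearMap.add_apply, LinearMap.id_apply, map_smul, map_add,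
    P.grade_grade]
  rw [add_comm]

theorem grade_odd (a : P.carrier) : P.grade (P.odd a) = -P.odd a := by
  simp only [odd, LinearMap.smul_apply, LinearMap.sub_apply, LinearMap.id_apply, map_smul, map_sub,
    P.grade_grade]
  rw [← smul_neg, neg_sub]

theorem even_of_even {a : P.carrier} (h : P.grade a = a) : P.even a = a := by
  simp only [even, LinearMap.smul_apply, LinearMap.add_apply, LinearMap.id_apply, h]
  rw [← two_smul 𝕜 a, smul_smul, inv_mul_cancel₀ two_ne_zero, one_smul]

theorem odd_of_even {a : P.carrier} (h : P.grade a = a) : P.odd a = 0 := by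
  simp [odd, h]

theorem even_of_odd {a : P.carrier} (h : P.grade a = -a) : P.even a = 0 := by
  simp [even, h]

theorem odd_of_odd {a : P.carrier} (h : P.grade a = -a) : P.odd a = a := by
  simp only [odd, LinearMap.smul_apply, LinearMap.sub_apply, LinearMap.id_apply, h, sub_neg_eq_add]
  rw [← two_smul 𝕜 a, smul_smul, inv_mul_cancel₀ two_ne_zero, one_smul]

/-- The grading raised to the power `i`. -/
def gradePow (i : Bool) : P.carrier →ₗ[𝕜] P.carrier := if i then P.grade else LinearMap.id

/-- `a` is homogeneous of degree `i` (`false` means even, `true` means odd). -/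
def IsHomog (i : Bool) (a : P.carrier) : Prop := P.grade a = if i then -a else a

theorem homog_induction {p : P.carrier → Prop} (hadd : ∀ a b, p a → p b → p (a + b))
    (h : ∀ i a, P.IsHomog i a → p a) (a : P.carrier) : p a := by
  rw [← P.even_add_odd a]
  exact hadd _ _ (h false _ (P.grade_even a)) (h true _ (P.grade_odd a))

variable {P}

theorem IsHomog.mul {i j : Bool} {a b : P.carrier} (ha : P.IsHomog i a) (hb : P.IsHomog j b) :
    P.IsHomog (i ^^ j) (a * b) := by
  unfold IsHomog at *
  rw [P.grade_mul, ha, hb]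
  cases i <;> cases j <;> simp

theorem IsHomog.star {i : Bool} {a : P.carrier} (ha : P.IsHomog i a) :
    P.IsHomog i (star a) := by
  unfold IsHomog at *
  rw [P.grade_star, ha]
  cases i <;> simp

theorem gradePow_gradePow (i j : Bool) (a : P.carrier) :
    P.gradePow i (P.gradePow j a) = P.gradePow (i ^^ j) a := by
  cases i <;> cases j <;> simp [gradePow, P.grade_grade]

theorem gradePow_mul (i : Bool) (a b : P.carrier) :
    P.gradePow i (a * b) = P.gradePow i a * P.gradePow i b := by
  cases i <;> simp [gradePow, P.grade_mul]

theorem gradePow_star (i : Bool) (a : P.carrier) :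
    P.gradePow i (star a) = star (P.gradePow i a) := by
  cases i <;> simp [gradePow, P.grade_star]

theorem gradePow_grade (i : Bool) (a : P.carrier) :
    P.gradePow i (P.grade a) = P.grade (P.gradePow i a) := by
  cases i <;> simp [gradePow]

end GrStarAlg

/-! ### The graded tensor product -/

open TensorProduct

section AlgTensor

variable (P Q : GrStarAlg 𝕜)

/-- The underlying vector space of the algebraic graded tensor product. -/
def AlgTensor : Type := P.carrier ⊗[𝕜] Q.carrier

namespace AlgTensor

instance : AddCommGroup (AlgTensor P Q) := inferInstanceAs (AddCommGroup (P.carrier ⊗[𝕜] Q.carrier))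
instance : Module 𝕜 (AlgTensor P Q) := inferInstanceAs (Module 𝕜 (P.carrier ⊗[𝕜] Q.carrier))

variable {P Q}

/-- Elementary tensors. -/
def mk (a : P.carrier) (b : Q.carrier) : AlgTensor P Q := a ⊗ₜ[𝕜] b

theorem mk_add (a : P.carrier) (b b' : Q.carrier) : mk a (b + b') = mk a b + mk a b' :=
  TensorProduct.tmul_add a b b'

theorem add_mk (a a' : P.carrier) (b : Q.carrier) : mk (a + a') b = mk a b + mk a' b :=
  TensorProduct.add_tmul a a' b

theorem zero_mk (b : Q.carrier) : mk (0 : P.carrier) b = 0 := TensorProduct.zero_tmul _ b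

@[elab_as_elim]
theorem induction {p : AlgTensor P Q → Prop} (hadd : ∀ x y, p x → p y → p (x + y))
    (h : ∀ a b, p (mk a b)) (x : AlgTensor P Q) : p x :=
  TensorProduct.induction_on x (by simpa [mk] using h 0 0) h hadd

/-- It suffices to check additive properties on elementary tensors whose first factor is
homogeneous. -/
theorem induction_left {p : AlgTensor P Q → Prop} (hadd : ∀ x y, p x → p y → p (x + y))
    (h : ∀ i a b, P.IsHomog i a → p (mk a b)) (x : AlgTensor P Q) : p x := by
  refine induction hadd (fun a b => ?_) x
  refine P.homog_induction (p := fun a => p (mk a b)) (fun a a' ha ha' => ?_)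
    (fun i a ha => h i a b ha) a
  rw [add_mk]
  exact hadd _ _ ha ha'

variable (P Q)

/-- The bilinear product with `(a ⊗ b)(c ⊗ d) = a c ⊗ δ^i(b) d` for `c` homogeneous of degree `i`,
that is, `(-1)^(deg b deg c) ac ⊗ bd` for homogeneous `b` and `c`. -/
def mulMap : AlgTensor P Q →ₗ[𝕜] AlgTensor P Q →ₗ[𝕜] AlgTensor P Q :=
  TensorProduct.map₂ ((LinearMap.mul 𝕜 P.carrier).compl₂ P.even) (LinearMap.mul 𝕜 Q.carrier) +
  TensorProduct.map₂ ((LinearMap.mul 𝕜 P.carrier).compl₂ P.odd)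
    ((LinearMap.mul 𝕜 Q.carrier).comp Q.grade)

instance : Mul (AlgTensor P Q) := ⟨fun x y => mulMap P Q x y⟩

variable {P Q}

theorem mul_def (a c : P.carrier) (b d : Q.carrier) :
    mk a b * mk c d = mk (a * P.even c) (b * d) + mk (a * P.odd c) (Q.grade b * d) := rfl

theorem mul_homog {i : Bool} (a : P.carrier) {c : P.carrier} (b d : Q.carrier)
    (hc : P.IsHomog i c) : mk a b * mk c d = mk (a * c) (Q.gradePow i b * d) := by
  rw [mul_def]
  cases i
  · simp only [GrStarAlg.IsHomog, Bool.false_eq_true, if_false] at hc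
    rw [P.even_of_even hc, P.odd_of_even hc, mul_zero, zero_mk, add_zero]
    rfl
  · simp only [GrStarAlg.IsHomog, if_true] at hc
    rw [P.even_of_odd hc, P.odd_of_odd hc, mul_zero, zero_mk, zero_add]
    rfl

theorem add_mul' (x y z : AlgTensor P Q) : (x + y) * z = x * z + y * z :=
  LinearMap.congr_fun ((mulMap P Q).map_add x y) z

theorem mul_add' (x y z : AlgTensor P Q) : x * (y + z) = x * y + x * z :=
  (mulMap P Q x).map_add y z

theorem mul_assoc' (x y z : AlgTensor P Q) : x * y * z = x * (y * z) := by
  refine induction (p := fun x => x * y * z = x * (y * z)) ?_ (fun a b => ?_) x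
  · intro x x' h h'
    rw [add_mul', add_mul', add_mul', h, h']
  refine induction_left (p := fun y => mk a b * y * z = mk a b * (y * z)) ?_
    (fun i c d hc => ?_) y
  · intro y y' h h'
    rw [add_mul', mul_add', add_mul', mul_add', h, h']
  refine induction_left (p := fun z => mk a b * mk c d * z = mk a b * (mk c d * z)) ?_
    (fun j e f he => ?_) z
  · intro z z' h h'
    rw [mul_add', mul_add', mul_add', h, h']
  rw [mul_homog a b d hc, mul_homog _ _ f he, mul_homog c d f he, mul_homog a b _ (hc.mul he),
    mul_assoc, GrStarAlg.gradePow_mul, GrStarAlg.gradePow_gradePow, mul_assoc, Bool.xor_comm i j]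

instance : NonUnitalRing (AlgTensor P Q) where
  left_distrib := mul_add'
  right_distrib := add_mul'
  zero_mul x := LinearMap.congr_fun (mulMap P Q).map_zero x
  mul_zero x := (mulMap P Q x).map_zero
  mul_assoc := mul_assoc'

variable (P Q)

/-- The linear map `a ⊗ b ↦ (-1)^(deg a deg b) a ⊗ b`. -/
def koszul : P.carrier ⊗[𝕜] Q.carrier →ₗ[𝕜] P.carrier ⊗[𝕜] Q.carrier :=
  TensorProduct.map P.even LinearMap.id + TensorProduct.map P.odd Q.grade

/-- The involution `(a ⊗ b)* = (-1)^(deg a deg b) a* ⊗ b*`. -/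
instance : Star (AlgTensor P Q) :=
  ⟨fun x => (star (koszul P Q x) : P.carrier ⊗[𝕜] Q.carrier)⟩

variable {P Q}

theorem star_homog {i : Bool} {a : P.carrier} (b : Q.carrier) (ha : P.IsHomog i a) :
    star (mk a b) = mk (star a) (Q.gradePow i (star b)) := by
  have h : star (mk a b) = mk (star (P.even a)) (star b) + mk (star (P.odd a)) (star (Q.grade b)) := by
    change star (P.even a ⊗ₜ[𝕜] b + P.odd a ⊗ₜ[𝕜] Q.grade b) = _
    rw [star_add, TensorProduct.star_tmul, TensorProduct.star_tmul]
    rfl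
  rw [h]
  cases i
  · simp only [GrStarAlg.IsHomog, Bool.false_eq_true, if_false] at ha
    rw [P.even_of_even ha, P.odd_of_even ha, star_zero, zero_mk, add_zero]
    rfl
  · simp only [GrStarAlg.IsHomog, if_true] at ha
    rw [P.even_of_odd ha, P.odd_of_odd ha, star_zero, zero_mk, zero_add, ← Q.grade_star]
    rfl

theorem star_add' (x y : AlgTensor P Q) : star (x + y) = star x + star y :=
  (congrArg star ((koszul P Q).map_add x y)).trans (star_add _ _)

theorem star_star' (x : AlgTensor P Q) : star (star x) = x := by
  refine induction_left (p := fun x => star (star x) = x) ?_ (fun i a b ha => ?_) x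
  · intro x y h h'
    rw [star_add', star_add', h, h']
  rw [star_homog b ha, star_homog _ ha.star, star_star, ← GrStarAlg.gradePow_star, star_star,
    GrStarAlg.gradePow_gradePow]
  cases i <;> rfl

theorem star_mul' (x y : AlgTensor P Q) : star (x * y) = star y * star x := by
  refine induction_left (p := fun x => star (x * y) = star y * star x) ?_ (fun i a b ha => ?_) x
  · intro x x' h h'
    rw [add_mul', star_add', star_add', mul_add', h, h']
  refine induction_left (p := fun y => star (mk a b * y) = star y * star (mk a b)) ?_
    (fun j c d hc => ?_) y
  · intro y y' h h'
    rw [mul_add', star_add', star_add', add_mul', h, h']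
  rw [mul_homog a b d hc, star_homog _ (ha.mul hc), star_homog d hc, star_homog b ha,
    mul_homog _ _ _ ha.star, star_mul, star_mul, GrStarAlg.gradePow_mul,
    GrStarAlg.gradePow_gradePow, ← GrStarAlg.gradePow_star, GrStarAlg.gradePow_gradePow]
  cases i <;> cases j <;> rfl

instance : StarRing (AlgTensor P Q) where
  star_involutive := star_star'
  star_mul := star_mul'
  star_add := star_add'

instance : StarModule 𝕜 (AlgTensor P Q) :=
  ⟨fun c x => (congrArg star ((koszul P Q).map_smul c x)).trans (star_smul _ _)⟩

end AlgTensor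

/-- The algebraic graded tensor product of two graded `*`-algebras:
`(a ⊗ b)(c ⊗ d) = (-1)^(deg b deg c) ac ⊗ bd`, `(a ⊗ b)* = (-1)^(deg a deg b) a* ⊗ b*`, with the
grading `a ⊗ b ↦ δ a ⊗ δ b`. -/
abbrev algTensor : GrStarAlg 𝕜 where
  carrier := AlgTensor P Q
  tower := ⟨fun c x y => LinearMap.congr_fun ((AlgTensor.mulMap P Q).map_smul c x) y⟩
  comm := ⟨fun c x y => ((AlgTensor.mulMap P Q x).map_smul c y).symm⟩
  grade := (TensorProduct.map P.grade Q.grade : P.carrier ⊗[𝕜] Q.carrier →ₗ[𝕜] _)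
  grade_grade x := by
    refine AlgTensor.induction (p := fun x => (TensorProduct.map P.grade Q.grade
      (TensorProduct.map P.grade Q.grade x : P.carrier ⊗[𝕜] Q.carrier) : AlgTensor P Q) = x)
      (fun x y h h' => ?_) (fun a b => ?_) x
    · exact ((congrArg _ (map_add (TensorProduct.map P.grade Q.grade) x y)).trans
        (map_add _ _ _)).trans (congrArg₂ (· + ·) h h')
    · change AlgTensor.mk (P.grade (P.grade a)) (Q.grade (Q.grade b)) = _
      rw [P.grade_grade, Q.grade_grade]
  grade_mul x y := by
    let G : AlgTensor P Q →ₗ[𝕜] AlgTensor P Q :=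
      (TensorProduct.map P.grade Q.grade : P.carrier ⊗[𝕜] Q.carrier →ₗ[𝕜] _)
    have hG : ∀ a b, G (AlgTensor.mk a b) = AlgTensor.mk (P.grade a) (Q.grade b) := fun _ _ => rfl
    change G (x * y) = G x * G y
    refine AlgTensor.induction (p := fun x => G (x * y) = G x * G y) ?_ (fun a b => ?_) x
    · intro x x' h h'
      rw [add_mul, map_add, map_add, add_mul, h, h']
    refine AlgTensor.induction_left
      (p := fun y => G (AlgTensor.mk a b * y) = G (AlgTensor.mk a b) * G y) ?_
      (fun j c d hc => ?_) y
    · intro y y' h h'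
      rw [mul_add, map_add, map_add, mul_add, h, h']
    have hc' : P.IsHomog j (P.grade c) := by
      unfold GrStarAlg.IsHomog at *
      rw [hc]
      cases j <;> simp [hc]
    rw [AlgTensor.mul_homog a b d hc, hG, hG, hG, AlgTensor.mul_homog _ _ _ hc', P.grade_mul,
      Q.grade_mul, GrStarAlg.gradePow_grade]
  grade_star x := by
    let G : AlgTensor P Q →ₗ[𝕜] AlgTensor P Q :=
      (TensorProduct.map P.grade Q.grade : P.carrier ⊗[𝕜] Q.carrier →ₗ[𝕜] _)
    have hG : ∀ a b, G (AlgTensor.mk a b) = AlgTensor.mk (P.grade a) (Q.grade b) := fun _ _ => rfl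
    change G (star x) = star (G x)
    refine AlgTensor.induction_left (p := fun x => G (star x) = star (G x)) ?_ (fun j c d hc => ?_) x
    · intro x x' h h'
      rw [star_add, map_add, map_add, star_add, h, h']
    have hc' : P.IsHomog j (P.grade c) := by
      unfold GrStarAlg.IsHomog at *
      rw [hc]
      cases j <;> simp [hc]
    rw [AlgTensor.star_homog d hc, hG, hG, AlgTensor.star_homog _ hc', P.grade_star,
      ← Q.grade_star d, GrStarAlg.gradePow_grade]

end AlgTensor

/-- The graded `*`-algebra underlying a graded C*-algebra. -/
abbrev GrCStar.toAlg (A : GrCStar 𝕜) : GrStarAlg 𝕜 where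
  carrier := A.carrier
  grade := A.grade
  grade_grade := A.grade_grade
  grade_mul := A.grade_mul
  grade_star := A.grade_star

/-- `φ : A → C` and `ψ : B → C` commute in the graded sense: for homogeneous `a` and `b`,
`φ(a) ψ(b) = (-1)^(deg a deg b) ψ(b) φ(a)`. -/
def GradedCommute {A B C : GrCStar 𝕜} (φ : GrHom A C) (ψ : GrHom B C) : Prop :=
  ∀ (i j : Bool) (a : A.carrier) (b : B.carrier), A.toAlg.IsHomog i a → B.toAlg.IsHomog j b →
    φ a * ψ b = if i && j then -(ψ b * φ a) else ψ b * φ a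

section Pair

variable {A B C : GrCStar 𝕜}

theorem GradedCommute.swap {φ : GrHom A C} {ψ : GrHom B C} (h : GradedCommute φ ψ) {i : Bool}
    {a : A.carrier} (b : B.carrier) (ha : A.toAlg.IsHomog i a) :
    ψ b * φ a = φ a * ψ (B.toAlg.gradePow i b) := by
  refine B.toAlg.homog_induction
    (p := fun b => ψ b * φ a = φ a * ψ (B.toAlg.gradePow i b)) ?_ (fun j b hb => ?_) b
  · intro b b' hb hb'
    have e : ψ (B.toAlg.gradePow i (b + b')) =
        ψ (B.toAlg.gradePow i b) + ψ (B.toAlg.gradePow i b') :=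
      (congrArg ψ.toHom (map_add (B.toAlg.gradePow i) b b')).trans (map_add ψ.toHom _ _)
    have e' : ψ (b + b') = ψ b + ψ b' := map_add ψ.toHom b b'
    rw [e, mul_add, ← hb, ← hb', ← add_mul]
    exact congrArg (· * _) e'
  · have h1 := h i j a b ha hb
    cases i
    · simpa [GrStarAlg.gradePow] using h1.symm
    · have e : B.toAlg.gradePow true b = B.grade b := rfl
      have hb' : B.grade b = if j then -b else b := hb
      rw [e, hb']
      cases j
      · simpa using h1.symm
      · simp only [if_true]
        have e3 : ψ (-b) = -ψ b := map_neg ψ.toHom b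
        have h2 : φ a * ψ b = -(ψ b * φ a) := h1
        rw [e3]
        refine Eq.trans ?_ (mul_neg (φ a) (ψ b)).symm
        rw [h2, neg_neg]

/-- The linear map `∑ aᵢ ⊗ bᵢ ↦ ∑ φ(aᵢ) ψ(bᵢ)`. -/
def pairFun (φ : GrHom A C) (ψ : GrHom B C) : A.carrier ⊗[𝕜] B.carrier →ₗ[𝕜] C.carrier :=
  TensorProduct.lift ((LinearMap.mul 𝕜 C.carrier).compl₁₂
    (φ.toHom : A.carrier →ₗ[𝕜] C.carrier) (ψ.toHom : B.carrier →ₗ[𝕜] C.carrier))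

/-- The representation `∑ aᵢ ⊗ bᵢ ↦ ∑ φ(aᵢ) ψ(bᵢ)` of the algebraic graded tensor product given by a
pair of graded `*`-homomorphisms to a common graded C*-algebra that commute in the graded sense. -/
def pairRep (φ : GrHom A C) (ψ : GrHom B C) (h : GradedCommute φ ψ) :
    Rep (algTensor A.toAlg B.toAlg) C :=
  let F : AlgTensor A.toAlg B.toAlg →ₗ[𝕜] C.carrier := pairFun φ ψ
  have hF : ∀ (a : A.carrier) (b : B.carrier),
    F (AlgTensor.mk (P := A.toAlg) (Q := B.toAlg) a b) = φ a * ψ b := fun _ _ => rfl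
  { toHom :=
      { toFun := F
        map_smul' := F.map_smul
        map_zero' := F.map_zero
        map_add' := F.map_add
        map_mul' := fun x y => by
          change F (x * y) = F x * F y
          refine AlgTensor.induction (p := fun x => F (x * y) = F x * F y) ?_ (fun a b => ?_) x
          · intro x x' h h'
            rw [add_mul, map_add, map_add, add_mul, h, h']
          refine AlgTensor.induction_left (p := fun y =>
            F ((AlgTensor.mk a b : AlgTensor A.toAlg B.toAlg) * y) =
              F (AlgTensor.mk a b) * F y) ?_ (fun j c d hc => ?_) y
          · intro y y' h h'
            rw [mul_add, map_add, map_add, mul_add, h, h']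
          have e1 : φ (a * c) = φ a * φ c := map_mul φ.toHom a c
          have e2 : ψ (B.toAlg.gradePow j b * d) = ψ (B.toAlg.gradePow j b) * ψ d :=
            map_mul ψ.toHom _ d
          rw [AlgTensor.mul_homog a b d hc]
          refine (hF _ _).trans ?_
          refine (congrArg₂ (· * ·) e1 e2).trans ?_
          change φ a * φ c * (ψ (B.toAlg.gradePow j b) * ψ d) = φ a * ψ b * (φ c * ψ d)
          rw [mul_assoc, ← mul_assoc (φ c), ← h.swap b hc, mul_assoc, mul_assoc]
        map_star' := fun x => by
          change F (star x) = star (F x)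
          refine AlgTensor.induction_left (p := fun x => F (star x) = star (F x)) ?_
            (fun j a b ha => ?_) x
          · intro x x' h h'
            rw [star_add, map_add, map_add, star_add, h, h']
          have e1 : φ (star a) = star (φ a) := map_star φ.toHom a
          have e2 : ψ (star b) = star (ψ b) := map_star ψ.toHom b
          rw [AlgTensor.star_homog b ha]
          refine (hF _ _).trans ?_
          refine (h.swap (star b : B.carrier) ha.star).symm.trans ?_
          refine (congrArg₂ (· * ·) e2 e1).trans ?_
          exact (star_mul _ _).symm.trans (congrArg star (hF a b).symm) }
    map_grade := fun x => by
      change F ((algTensor A.toAlg B.toAlg).grade x) = C.grade (F x)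
      refine AlgTensor.induction
        (p := fun x => F ((algTensor A.toAlg B.toAlg).grade x) = C.grade (F x)) ?_
        (fun a b => ?_) x
      · intro x x' h h'
        have e := map_add (algTensor A.toAlg B.toAlg).grade x x'
        refine (congrArg F e).trans ?_
        refine (F.map_add _ _).trans ?_
        rw [map_add F x x', map_add C.grade]
        exact congrArg₂ (· + ·) h h'
      · refine (hF (A.grade a) (B.grade b)).trans ?_
        exact ((congrArg₂ (· * ·) (φ.map_grade a) (ψ.map_grade b)).trans
          (C.grade_mul _ _).symm).trans (congrArg C.grade (hF a b).symm) }

theorem pairRep_mk (φ : GrHom A C) (ψ : GrHom B C) (h : GradedCommute φ ψ) (a : A.carrier)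
    (b : B.carrier) :
    (pairRep φ ψ h).toHom (AlgTensor.mk (P := A.toAlg) (Q := B.toAlg) a b) = φ a * ψ b := rfl

end Pair

/-- The representations of `A ⊙ B` given by pairs of graded-commuting graded `*`-homomorphisms from
`A` and `B` to a common graded C*-algebra. -/
def tensorClass (A B : GrCStar 𝕜) : RepClass (algTensor A.toAlg B.toAlg) where
  mem C := {π | ∃ (φ : GrHom A C) (ψ : GrHom B C) (h : GradedCommute φ ψ), π = pairRep φ ψ h}
  bdd x := by
    refine AlgTensor.induction (p := fun x => ∃ M : ℝ, ∀ (C : GrCStar 𝕜)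
      (π : Rep (algTensor A.toAlg B.toAlg) C), (∃ (φ : GrHom A C) (ψ : GrHom B C)
      (h : GradedCommute φ ψ), π = pairRep φ ψ h) → ‖π.toHom x‖ ≤ M) ?_ (fun a b => ?_) x
    · rintro x y ⟨M, hM⟩ ⟨N, hN⟩
      refine ⟨M + N, fun C π hπ => ?_⟩
      refine (congrArg norm (map_add π.toHom x y)).le.trans ?_
      exact (norm_add_le _ _).trans (add_le_add (hM C π hπ) (hN C π hπ))
    · refine ⟨‖(a : A.carrier)‖ * ‖(b : B.carrier)‖, ?_⟩
      rintro C π ⟨φ, ψ, h, rfl⟩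
      rw [pairRep_mk]
      exact (norm_mul_le _ _).trans
        (mul_le_mul (φ.norm_le a) (ψ.norm_le b) (norm_nonneg _) (norm_nonneg _))

/-- The graded tensor product `A ⊗̂ B`: the completion of the algebraic graded tensor product in the
norm `‖∑ aᵢ ⊗ bᵢ‖ = sup ‖∑ φ(aᵢ) ψ(bᵢ)‖`, over all pairs of graded `*`-homomorphisms `φ`, `ψ` from `A`
and `B` to a common graded C*-algebra that commute in the graded sense. -/
def GrCStar.tensor (A B : GrCStar 𝕜) : GrCStar 𝕜 := (tensorClass A B).envelope

/-- Elementary tensors `a ⊗̂ b`. -/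
def tmul {A B : GrCStar 𝕜} (a : A.carrier) (b : B.carrier) : (A.tensor B).carrier :=
  (tensorClass A B).of (AlgTensor.mk (P := A.toAlg) (Q := B.toAlg) a b)

section AlgTensorMap

variable {P P' Q Q' : GrStarAlg 𝕜} (f : AlgMap P P') (g : AlgMap Q Q')

theorem AlgMap.homog {i : Bool} {a : P.carrier} (h : P.IsHomog i a) :
    P'.IsHomog i (f.toHom a) := by
  have h' : P.grade a = if i then -a else a := h
  change P'.grade (f.toHom a) = if i then -f.toHom a else f.toHom a
  rw [← f.map_grade, h']
  cases i
  · rfl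
  · exact map_neg f.toHom a

theorem AlgMap.map_gradePow (i : Bool) (a : P.carrier) :
    f.toHom (P.gradePow i a) = P'.gradePow i (f.toHom a) := by
  cases i
  · rfl
  · exact f.map_grade a

/-- The linear map `a ⊗ b ↦ f(a) ⊗ g(b)`. -/
def algTensorMapFun : AlgTensor P Q →ₗ[𝕜] AlgTensor P' Q' :=
  (TensorProduct.map (f.toHom : P.carrier →ₗ[𝕜] P'.carrier)
    (g.toHom : Q.carrier →ₗ[𝕜] Q'.carrier) : P.carrier ⊗[𝕜] Q.carrier →ₗ[𝕜] _)

theorem algTensorMapFun_mk (a : P.carrier) (b : Q.carrier) :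
    algTensorMapFun f g (AlgTensor.mk a b) = AlgTensor.mk (f.toHom a) (g.toHom b) := rfl

theorem algTensorMapFun_mul (x y : AlgTensor P Q) :
    algTensorMapFun f g (x * y) = algTensorMapFun f g x * algTensorMapFun f g y := by
  refine AlgTensor.induction (p := fun x => algTensorMapFun f g (x * y) =
    algTensorMapFun f g x * algTensorMapFun f g y) ?_ (fun a b => ?_) x
  · intro x x' h h'
    rw [add_mul, map_add, map_add, add_mul, h, h']
  refine AlgTensor.induction_left (p := fun y => algTensorMapFun f g (AlgTensor.mk a b * y) =
    algTensorMapFun f g (AlgTensor.mk a b) * algTensorMapFun f g y) ?_ (fun j c d hc => ?_) y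
  · intro y y' h h'
    rw [mul_add, map_add, map_add, mul_add, h, h']
  rw [AlgTensor.mul_homog a b d hc, algTensorMapFun_mk, algTensorMapFun_mk, algTensorMapFun_mk,
    AlgTensor.mul_homog _ _ _ (f.homog hc), map_mul, map_mul, g.map_gradePow]

theorem algTensorMapFun_star (x : AlgTensor P Q) :
    algTensorMapFun f g (star x) = star (algTensorMapFun f g x) := by
  refine AlgTensor.induction_left (p := fun x => algTensorMapFun f g (star x) =
    star (algTensorMapFun f g x)) ?_ (fun j a b ha => ?_) x
  · intro x x' h h'
    rw [star_add, map_add, map_add, star_add, h, h']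
  rw [AlgTensor.star_homog b ha, algTensorMapFun_mk, algTensorMapFun_mk,
    AlgTensor.star_homog _ (f.homog ha), map_star, g.map_gradePow, map_star]

theorem algTensorMapFun_grade (x : AlgTensor P Q) :
    algTensorMapFun f g ((algTensor P Q).grade x) =
      (algTensor P' Q').grade (algTensorMapFun f g x) := by
  refine AlgTensor.induction (p := fun x => algTensorMapFun f g ((algTensor P Q).grade x) =
    (algTensor P' Q').grade (algTensorMapFun f g x)) ?_ (fun a b => ?_) x
  · intro x x' h h'
    rw [map_add, map_add, map_add, map_add, h, h']
  · exact congrArg₂ AlgTensor.mk (f.map_grade a) (g.map_grade b)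

/-- The algebraic tensor product of two graded `*`-homomorphisms. -/
def algTensorMap : AlgMap (algTensor P Q) (algTensor P' Q') where
  toHom :=
    { toFun := algTensorMapFun f g
      map_smul' := (algTensorMapFun f g).map_smul
      map_zero' := (algTensorMapFun f g).map_zero
      map_add' := (algTensorMapFun f g).map_add
      map_mul' := algTensorMapFun_mul f g
      map_star' := algTensorMapFun_star f g }
  map_grade := algTensorMapFun_grade f g

end AlgTensorMap

/-- The underlying homomorphism of graded `*`-algebras. -/
def GrHom.toAlgMap {A B : GrCStar 𝕜} (f : GrHom A B) : AlgMap A.toAlg B.toAlg where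
  toHom := f.toHom
  map_grade := f.map_grade

section TensorMap

variable {A A' B B' : GrCStar 𝕜}

theorem Rep.ext' {P : GrStarAlg 𝕜} {C : GrCStar 𝕜} {π ρ : Rep P C}
    (h : ∀ x, π.toHom x = ρ.toHom x) : π = ρ := by
  have e : π.toHom = ρ.toHom := NonUnitalStarAlgHom.ext h
  cases π
  cases ρ
  congr

theorem GradedCommute.comp {C : GrCStar 𝕜} {φ : GrHom A' C} {ψ : GrHom B' C}
    (h : GradedCommute φ ψ) (f : GrHom A A') (g : GrHom B B') :
    GradedCommute (φ.comp f) (ψ.comp g) := fun i j a b ha hb =>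
  h i j (f a) (g b) (f.toAlgMap.homog ha) (g.toAlgMap.homog hb)

theorem tensor_pulls (f : GrHom A A') (g : GrHom B B') :
    RepClass.Pulls (tensorClass A B) (tensorClass A' B')
      (algTensorMap f.toAlgMap g.toAlgMap) := by
  rintro C π ⟨φ, ψ, h, rfl⟩
  refine ⟨φ.comp f, ψ.comp g, h.comp f g, Rep.ext' fun x => ?_⟩
  refine AlgTensor.induction (p := fun x =>
    ((pairRep φ ψ h).comp (algTensorMap f.toAlgMap g.toAlgMap)).toHom x =
      (pairRep (φ.comp f) (ψ.comp g) (h.comp f g)).toHom x) ?_ (fun a b => rfl) x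
  intro x y hx hy
  rw [map_add, map_add, hx, hy]

/-- The graded tensor product `f ⊗̂ g` of two graded `*`-homomorphisms. -/
def tensorMap (f : GrHom A A') (g : GrHom B B') : GrHom (A.tensor B) (A'.tensor B') :=
  RepClass.map (algTensorMap f.toAlgMap g.toAlgMap) (tensor_pulls f g)

theorem tensorMap_tmul (f : GrHom A A') (g : GrHom B B') (a : A.carrier) (b : B.carrier) :
    tensorMap f g (tmul a b) = tmul (f a) (g b) :=
  RepClass.map_of (algTensorMap f.toAlgMap g.toAlgMap) (tensor_pulls f g) _

end TensorMap

/-! ### The graded C*-algebras `C₀(ℝ)`, `C[-R, R]`, `C(Y, B)` and `𝒦(H)` -/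

open ZeroAtInfty Filter Topology

theorem rclike_norm_sq_le (z w : 𝕜) : ‖z‖ ^ 2 ≤ ‖star z * z + star w * w‖ := by
  have h : star z * z + star w * w = ((‖z‖ ^ 2 + ‖w‖ ^ 2 : ℝ) : 𝕜) := by
    have e : ∀ u : 𝕜, star u * u = ((‖u‖ ^ 2 : ℝ) : 𝕜) := fun u => by
      rw [RCLike.star_def, RCLike.conj_mul]
      push_cast
      rfl
    rw [e, e]
    push_cast
    rfl
  rw [h, RCLike.norm_ofReal, abs_of_nonneg (by positivity)]
  nlinarith [sq_nonneg ‖w‖]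

/-- The reflection `f ↦ (x ↦ f(-x))` of `C₀(ℝ)`. -/
def flipS : C₀(ℝ, 𝕜) →ₗ[𝕜] C₀(ℝ, 𝕜) where
  toFun f := f.comp ⟨⟨fun x => -x, continuous_neg⟩, (Homeomorph.neg ℝ).isClosedEmbedding.tendsto_cocompact⟩
  map_add' _ _ := rfl
  map_smul' _ _ := rfl

theorem flipS_apply (f : C₀(ℝ, 𝕜)) (x : ℝ) : flipS f x = f (-x) := rfl

theorem c0_norm_le {f : C₀(ℝ, 𝕜)} {M : ℝ} (h0 : 0 ≤ M) (h : ∀ x, ‖f x‖ ≤ M) : ‖f‖ ≤ M := by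
  rw [← ZeroAtInftyContinuousMap.norm_toBCF_eq_norm]
  exact (BoundedContinuousFunction.norm_le h0).2 h

theorem c0_le_norm (f : C₀(ℝ, 𝕜)) (x : ℝ) : ‖f x‖ ≤ ‖f‖ := by
  rw [← ZeroAtInftyContinuousMap.norm_toBCF_eq_norm]
  exact f.toBCF.norm_coe_le_norm x

variable (𝕜) in
/-- `𝒮 = C₀(ℝ)`, with pointwise operations, the supremum norm, and the grading
`δ(f)(x) = f(-x)`. -/
def SAlg : GrCStar 𝕜 where
  carrier := C₀(ℝ, 𝕜)
  norm_sq_le f g := by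
    have h : ‖f‖ ≤ Real.sqrt ‖star f * f + star g * g‖ :=
      c0_norm_le (Real.sqrt_nonneg _) fun x => Real.le_sqrt_of_sq_le
        ((rclike_norm_sq_le (f x) (g x)).trans (c0_le_norm (star f * f + star g * g) x))
    calc ‖f‖ ^ 2 ≤ Real.sqrt ‖star f * f + star g * g‖ ^ 2 :=
          pow_le_pow_left₀ (norm_nonneg _) h 2
      _ = _ := Real.sq_sqrt (norm_nonneg _)
  grade := flipS
  grade_grade f := by
    ext x
    simp [flipS_apply]
  grade_mul _ _ := rfl
  grade_star _ := rfl
  norm_grade f := by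
    refine le_antisymm (c0_norm_le (norm_nonneg _) fun x => c0_le_norm f (-x))
      (c0_norm_le (norm_nonneg _) fun x => ?_)
    have := c0_le_norm (flipS f) (-x)
    rwa [flipS_apply, neg_neg] at this

/-- `C(Y, B)` for a compact Hausdorff space `Y`, with pointwise operations and grading and the
supremum norm. -/
def CAlg (Y : Type) [TopologicalSpace Y] [CompactSpace Y] (B : GrCStar 𝕜) : GrCStar 𝕜 where
  carrier := C(Y, B.carrier)
  norm_sq_le f g := by
    have h : ‖f‖ ≤ Real.sqrt ‖star f * f + star g * g‖ :=
      (ContinuousMap.norm_le _ (Real.sqrt_nonneg _)).2 fun x => Real.le_sqrt_of_sq_le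
        ((B.norm_sq_le (f x) (g x)).trans
          (ContinuousMap.norm_coe_le_norm (star f * f + star g * g) x))
    calc ‖f‖ ^ 2 ≤ Real.sqrt ‖star f * f + star g * g‖ ^ 2 :=
          pow_le_pow_left₀ (norm_nonneg _) h 2
      _ = _ := Real.sq_sqrt (norm_nonneg _)
  grade :=
    { toFun := fun f => ⟨fun y => B.grade (f y),
        (AddMonoidHomClass.continuous_of_bound B.grade 1 fun b => by
          rw [one_mul, B.norm_grade]).comp f.continuous⟩
      map_add' := fun f g => by
        ext y
        exact map_add B.grade _ _
      map_smul' := fun c f => by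
        ext y
        exact map_smul B.grade _ _ }
  grade_grade f := by
    ext y
    exact B.grade_grade (f y)
  grade_mul f g := by
    ext y
    exact B.grade_mul (f y) (g y)
  grade_star f := by
    ext y
    exact B.grade_star (f y)
  norm_grade f := by
    refine le_antisymm ((ContinuousMap.norm_le _ (norm_nonneg _)).2 fun y => ?_)
      ((ContinuousMap.norm_le _ (norm_nonneg _)).2 fun y => ?_)
    · exact (B.norm_grade (f y)).le.trans (f.norm_coe_le_norm y)
    · refine (B.norm_grade (f y)).ge.trans ?_
      exact ContinuousMap.norm_coe_le_norm (⟨fun y => B.grade (f y),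
        (AddMonoidHomClass.continuous_of_bound B.grade 1 fun b => by
          rw [one_mul, B.norm_grade]).comp f.continuous⟩ : C(Y, B.carrier)) y

variable (𝕜) in
/-- `C[-R, R]`, with the grading `δ(f)(x) = f(-x)`. -/
def SRAlg (R : ℝ) : GrCStar 𝕜 where
  carrier := C(Set.Icc (-R) R, 𝕜)
  norm_sq_le f g := by
    have h : ‖f‖ ≤ Real.sqrt ‖star f * f + star g * g‖ :=
      (ContinuousMap.norm_le _ (Real.sqrt_nonneg _)).2 fun x => Real.le_sqrt_of_sq_le
        ((rclike_norm_sq_le (f x) (g x)).trans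
          (ContinuousMap.norm_coe_le_norm (star f * f + star g * g) x))
    calc ‖f‖ ^ 2 ≤ Real.sqrt ‖star f * f + star g * g‖ ^ 2 :=
          pow_le_pow_left₀ (norm_nonneg _) h 2
      _ = _ := Real.sq_sqrt (norm_nonneg _)
  grade :=
    { toFun := fun f => f.comp
        ⟨fun x => ⟨-x.1, neg_le_neg x.2.2, neg_le.1 x.2.1⟩, by fun_prop⟩
      map_add' := fun _ _ => rfl
      map_smul' := fun _ _ => rfl }
  grade_grade f := by
    ext x
    simp
  grade_mul _ _ := rfl
  grade_star _ := rfl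
  norm_grade f := by
    refine le_antisymm ((ContinuousMap.norm_le _ (norm_nonneg _)).2 fun x => ?_)
      ((ContinuousMap.norm_le _ (norm_nonneg _)).2 fun x => ?_)
    · exact f.norm_coe_le_norm _
    · have := ContinuousMap.norm_coe_le_norm (f.comp
        ⟨fun x : Set.Icc (-R) R => (⟨-x.1, neg_le_neg x.2.2, neg_le.1 x.2.1⟩ : Set.Icc (-R) R),
          by fun_prop⟩) ⟨-x.1, neg_le_neg x.2.2, neg_le.1 x.2.1⟩
      simpa using this

/-- The restriction `C₀(ℝ) → C[-R, R]`. -/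
def restrictS (R : ℝ) : GrHom (SAlg 𝕜) (SRAlg 𝕜 R) where
  toHom :=
    { toFun := fun f : C₀(ℝ, 𝕜) =>
        (⟨fun x => f x.1, f.continuous.comp continuous_subtype_val⟩ : C(Set.Icc (-R) R, 𝕜))
      map_smul' := fun _ _ => rfl
      map_zero' := rfl
      map_add' := fun _ _ => rfl
      map_mul' := fun _ _ => rfl
      map_star' := fun _ => rfl }
  map_grade _ := rfl
  norm_le f := (ContinuousMap.norm_le _ (norm_nonneg _)).2 fun x => c0_le_norm f x.1

section Compact

variable (H : Type) [NormedAddCommGroup H] [InnerProductSpace 𝕜 H] [CompleteSpace H]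

/-- The adjoint of a compact operator on a Hilbert space is compact. -/
theorem isCompactOperator_adjoint {T : H →L[𝕜] H} (hT : IsCompactOperator T) :
    IsCompactOperator (ContinuousLinearMap.adjoint T) := by
  have hTT : IsCompactOperator (T ∘L ContinuousLinearMap.adjoint T) := hT.comp_clm _
  have hc : TotallyBounded ((T ∘L ContinuousLinearMap.adjoint T) '' Metric.closedBall 0 1) :=
    (hTT.isCompact_closure_image_closedBall (𝕜₁ := 𝕜) (f := ((T ∘L ContinuousLinearMap.adjoint T :
      H →L[𝕜] H) : H →ₗ[𝕜] H)) 1).totallyBounded.subset subset_closure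
  have key : TotallyBounded (ContinuousLinearMap.adjoint T '' Metric.closedBall 0 1) := by
    rw [Metric.totallyBounded_iff]
    intro ε hε
    obtain ⟨t, hts, htf, hcov⟩ := Metric.finite_approx_of_totallyBounded hc (ε ^ 2 / 2)
      (by positivity)
    have hts' : ∀ y ∈ t, ∃ x, x ∈ Metric.closedBall (0 : H) 1 ∧
        (T ∘L ContinuousLinearMap.adjoint T) x = y := fun y hy => hts hy
    choose! g hg using hts'
    refine ⟨(fun y => ContinuousLinearMap.adjoint T (g y)) '' t, htf.image _, ?_⟩
    rintro _ ⟨x, hx, rfl⟩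
    have hx' : (T ∘L ContinuousLinearMap.adjoint T) x ∈
        (T ∘L ContinuousLinearMap.adjoint T) '' Metric.closedBall 0 1 := ⟨x, hx, rfl⟩
    obtain ⟨y, hy, hxy⟩ := Set.mem_iUnion₂.1 (hcov hx')
    refine Set.mem_iUnion₂.2 ⟨_, ⟨y, hy, rfl⟩, ?_⟩
    obtain ⟨hgy, hgy'⟩ := hg y hy
    rw [Metric.mem_ball, dist_eq_norm] at hxy ⊢
    rw [← map_sub]
    rw [← hgy', ← map_sub] at hxy
    have hn : ‖x - g y‖ ≤ 2 := by
      have h1 : ‖x‖ ≤ 1 := by simpa using hx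
      have h2 : ‖g y‖ ≤ 1 := by simpa using hgy
      exact (norm_sub_le _ _).trans (by linarith)
    have hsq : ‖ContinuousLinearMap.adjoint T (x - g y)‖ ^ 2 < ε ^ 2 := by
      have h3 : ‖ContinuousLinearMap.adjoint T (x - g y)‖ ^ 2 =
          ‖inner 𝕜 ((T ∘L ContinuousLinearMap.adjoint T) (x - g y)) (x - g y)‖ := by
        rw [ContinuousLinearMap.comp_apply, ← ContinuousLinearMap.adjoint_inner_right,
          inner_self_eq_norm_sq_to_K]
        simp
      rw [h3]
      refine (norm_inner_le_norm _ _).trans_lt ?_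
      nlinarith [norm_nonneg ((T ∘L ContinuousLinearMap.adjoint T) (x - g y)),
        norm_nonneg (x - g y)]
    exact lt_of_pow_lt_pow_left₀ 2 hε.le hsq
  have hcl := key.closure.isCompact_of_isClosed isClosed_closure
  exact (isCompactOperator_iff_isCompact_closure_image_closedBall (𝕜₁ := 𝕜)
    ((ContinuousLinearMap.adjoint T : H →L[𝕜] H) : H →ₗ[𝕜] H) one_pos).2 hcl

/-- The compact operators on a Hilbert space, as a non-unital star subalgebra of the algebra of
bounded operators. -/
def compactOps : NonUnitalStarSubalgebra 𝕜 (H →L[𝕜] H) where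
  carrier := {T | IsCompactOperator T}
  add_mem' ha hb := IsCompactOperator.add ha hb
  zero_mem' := isCompactOperator_zero
  mul_mem' {_ b} ha _ := IsCompactOperator.comp_clm ha b
  smul_mem' c _ ha := IsCompactOperator.smul ha c
  star_mem' ha := isCompactOperator_adjoint H ha

theorem isClosed_compactOps : IsClosed (compactOps (𝕜 := 𝕜) H : Set (H →L[𝕜] H)) :=
  isClosed_setOfPred_isCompactOperator

instance : CompleteSpace (compactOps (𝕜 := 𝕜) H) :=
  (isClosed_compactOps H).completeSpace_coe

variable {H}

theorem op_norm_sq_le (S T : H →L[𝕜] H) : ‖S‖ ^ 2 ≤ ‖star S * S + star T * T‖ := by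
  have h : ‖S‖ ≤ Real.sqrt ‖star S * S + star T * T‖ := by
    refine S.opNorm_le_bound (Real.sqrt_nonneg _) fun x => ?_
    have h1 : ‖S x‖ ^ 2 ≤ ‖star S * S + star T * T‖ * ‖x‖ ^ 2 := by
      have h2 : inner 𝕜 ((star S * S + star T * T) x) x =
          ((‖S x‖ ^ 2 + ‖T x‖ ^ 2 : ℝ) : 𝕜) := by
        rw [add_apply, inner_add_left, ContinuousLinearMap.star_eq_adjoint,
          ContinuousLinearMap.star_eq_adjoint]
        change inner 𝕜 (ContinuousLinearMap.adjoint S (S x)) x +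
          inner 𝕜 (ContinuousLinearMap.adjoint T (T x)) x = _
        rw [ContinuousLinearMap.adjoint_inner_left, ContinuousLinearMap.adjoint_inner_left,
          inner_self_eq_norm_sq_to_K, inner_self_eq_norm_sq_to_K]
        push_cast
        rfl
      have h3 := norm_inner_le_norm (𝕜 := 𝕜) ((star S * S + star T * T) x) x
      rw [h2, RCLike.norm_ofReal, abs_of_nonneg (by positivity)] at h3
      have h4 := (star S * S + star T * T).le_opNorm x
      nlinarith [sq_nonneg ‖T x‖, norm_nonneg x]
    have h5 := Real.sqrt_le_sqrt h1
    rwa [Real.sqrt_sq (norm_nonneg _), Real.sqrt_mul (norm_nonneg _),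
      Real.sqrt_sq (norm_nonneg _)] at h5
  calc ‖S‖ ^ 2 ≤ Real.sqrt ‖star S * S + star T * T‖ ^ 2 :=
        pow_le_pow_left₀ (norm_nonneg _) h 2
    _ = _ := Real.sq_sqrt (norm_nonneg _)

variable (H₀ : Submodule 𝕜 H) [H₀.HasOrthogonalProjection]

/-- The operator that is `1` on `H₀` and `-1` on the orthogonal complement of `H₀`. -/
def gradingOp : H →L[𝕜] H := H₀.reflection

theorem gradingOp_mul_self : gradingOp H₀ * gradingOp H₀ = 1 := by
  ext x
  exact H₀.reflection_reflection x

theorem gradingOp_star : star (gradingOp H₀) = gradingOp H₀ := by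
  rw [ContinuousLinearMap.star_eq_adjoint]
  refine (ContinuousLinearMap.eq_adjoint_iff _ _).2 (fun x y => ?_) |>.symm
  have := H₀.reflection.inner_map_map x (H₀.reflection y)
  rw [H₀.reflection_reflection] at this
  exact this

theorem norm_gradingOp_le : ‖gradingOp H₀‖ ≤ 1 :=
  ContinuousLinearMap.opNorm_le_bound _ zero_le_one fun x => by
    rw [one_mul]
    exact (H₀.reflection.norm_map x).le

/-- The grading `T ↦ ε T ε` of the compact operators, where `ε = 1` on `H₀` and `ε = -1` on the
orthogonal complement of `H₀`. -/
def compactGrade : compactOps (𝕜 := 𝕜) H →ₗ[𝕜] compactOps (𝕜 := 𝕜) H where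
  toFun T := ⟨gradingOp H₀ * T.1 * gradingOp H₀,
    (IsCompactOperator.clm_comp T.2 (gradingOp H₀)).comp_clm (gradingOp H₀)⟩
  map_add' S T := by
    ext1
    simp [mul_add, add_mul]
  map_smul' c T := by
    ext1
    simp

theorem compactGrade_coe (T : compactOps (𝕜 := 𝕜) H) :
    (compactGrade H₀ T : H →L[𝕜] H) = gradingOp H₀ * T.1 * gradingOp H₀ := rfl

theorem compactGrade_grade (T : compactOps (𝕜 := 𝕜) H) :
    compactGrade H₀ (compactGrade H₀ T) = T := by
  ext1
  rw [compactGrade_coe, compactGrade_coe, mul_assoc, mul_assoc _ (gradingOp H₀) (gradingOp H₀),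
    gradingOp_mul_self, mul_one, ← mul_assoc, gradingOp_mul_self, one_mul]

theorem norm_compactGrade_le (T : compactOps (𝕜 := 𝕜) H) : ‖compactGrade H₀ T‖ ≤ ‖T‖ := by
  change ‖gradingOp H₀ * T.1 * gradingOp H₀‖ ≤ ‖T.1‖
  have h := norm_gradingOp_le H₀
  calc ‖gradingOp H₀ * T.1 * gradingOp H₀‖
      ≤ ‖gradingOp H₀‖ * ‖T.1‖ * ‖gradingOp H₀‖ :=
        (norm_mul_le _ _).trans (mul_le_mul_of_nonneg_right (norm_mul_le _ _) (norm_nonneg _))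
    _ ≤ 1 * ‖T.1‖ * 1 := by gcongr
    _ = ‖T.1‖ := by ring

theorem norm_compactGrade (T : compactOps (𝕜 := 𝕜) H) : ‖compactGrade H₀ T‖ = ‖T‖ := by
  refine le_antisymm (norm_compactGrade_le H₀ T) ?_
  have := norm_compactGrade_le H₀ (compactGrade H₀ T)
  rwa [compactGrade_grade] at this

/-- The graded C*-algebra `𝒦(H)` of compact operators on the graded Hilbert space
`H = H₀ ⊕ H₁`, where `H₁` is the orthogonal complement of `H₀`: the operators that preserve the
decomposition are even, and those that exchange the two summands are odd. -/
def KAlg : GrCStar 𝕜 where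
  carrier := compactOps (𝕜 := 𝕜) H
  cstar := ⟨fun {T} => CStarRing.norm_mul_self_le (T : H →L[𝕜] H)⟩
  norm_sq_le S T := op_norm_sq_le S.1 T.1
  grade := compactGrade H₀
  grade_grade := compactGrade_grade H₀
  grade_mul S T := by
    ext1
    change gradingOp H₀ * (S.1 * T.1) * gradingOp H₀ =
      gradingOp H₀ * S.1 * gradingOp H₀ * (gradingOp H₀ * T.1 * gradingOp H₀)
    have e := gradingOp_mul_self H₀
    simp only [mul_assoc]
    rw [← mul_assoc (gradingOp H₀) (gradingOp H₀), e, one_mul]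
  grade_star T := by
    ext1
    change gradingOp H₀ * star T.1 * gradingOp H₀ = star (gradingOp H₀ * T.1 * gradingOp H₀)
    rw [star_mul, star_mul, gradingOp_star, mul_assoc]
  norm_grade T := by
    change ‖gradingOp H₀ * T.1 * gradingOp H₀‖ = ‖T.1‖
    exact norm_compactGrade H₀ T

end Compact

/-! ### Clifford algebras -/

/-- The quadratic form `v ↦ ‖v‖²` on `ℝᵐ`. -/
def euclidForm (m : ℕ) : QuadraticForm ℝ (EuclideanSpace ℝ (Fin m)) :=
  LinearMap.BilinMap.toQuadraticMap (innerₗ (EuclideanSpace ℝ (Fin m)))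

theorem euclidForm_apply (m : ℕ) (v : EuclideanSpace ℝ (Fin m)) : euclidForm m v = ‖v‖ ^ 2 :=
  real_inner_self_eq_norm_sq v

/-- The Clifford algebra on `m` generators over `𝕜`: the algebra `𝕜 ⊗_ℝ Cliff(ℝᵐ)`, where
`Cliff(ℝᵐ)` is generated by `ℝᵐ` subject to `v² = ‖v‖²`. -/
def Cliff (𝕜 : Type) [RCLike 𝕜] (m : ℕ) : Type := 𝕜 ⊗[ℝ] CliffordAlgebra (euclidForm m)

namespace Cliff

variable (m : ℕ)

instance : Ring (Cliff 𝕜 m) := inferInstanceAs (Ring (𝕜 ⊗[ℝ] CliffordAlgebra (euclidForm m)))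
instance : Algebra 𝕜 (Cliff 𝕜 m) :=
  inferInstanceAs (Algebra 𝕜 (𝕜 ⊗[ℝ] CliffordAlgebra (euclidForm m)))

variable {m}

/-- The element `c ⊗ x`. -/
def mk (c : 𝕜) (x : CliffordAlgebra (euclidForm m)) : Cliff 𝕜 m := c ⊗ₜ[ℝ] x

theorem mk_mul (c d : 𝕜) (x y : CliffordAlgebra (euclidForm m)) :
    mk c x * mk d y = mk (c * d) (x * y) := Algebra.TensorProduct.tmul_mul_tmul c d x y

theorem smul_mk (a c : 𝕜) (x : CliffordAlgebra (euclidForm m)) : a • mk c x = mk (a * c) x := rfl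

theorem mk_add (c : 𝕜) (x y : CliffordAlgebra (euclidForm m)) :
    mk c (x + y) = mk c x + mk c y := TensorProduct.tmul_add c x y

theorem one_def : (1 : Cliff 𝕜 m) = mk 1 1 := rfl

theorem induction {p : Cliff 𝕜 m → Prop} (hadd : ∀ x y, p x → p y → p (x + y))
    (h : ∀ c x, p (mk c x)) (x : Cliff 𝕜 m) : p x :=
  TensorProduct.induction_on x (by simpa [mk] using h 0 0) h hadd

/-- The `𝕜`-linear extension of a linear map. -/
def ext {n : ℕ} (f : CliffordAlgebra (euclidForm m) →ₗ[ℝ] CliffordAlgebra (euclidForm n)) :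
    Cliff 𝕜 m →ₗ[𝕜] Cliff 𝕜 n :=
  (TensorProduct.AlgebraTensorModule.map LinearMap.id f :
    𝕜 ⊗[ℝ] CliffordAlgebra (euclidForm m) →ₗ[𝕜] 𝕜 ⊗[ℝ] CliffordAlgebra (euclidForm n))

theorem ext_mk {n : ℕ} (f : CliffordAlgebra (euclidForm m) →ₗ[ℝ] CliffordAlgebra (euclidForm n))
    (c : 𝕜) (x : CliffordAlgebra (euclidForm m)) : ext f (mk c x) = mk c (f x) := rfl

/-- The involution of the Clifford algebra: the conjugate-linear anti-automorphism that fixes the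
vectors in `ℝᵐ`. -/
instance : Star (Cliff 𝕜 m) :=
  ⟨(TensorProduct.map ((RCLike.conjAe (K := 𝕜)).toLinearMap)
    (CliffordAlgebra.reverse (Q := euclidForm m)) :
      𝕜 ⊗[ℝ] CliffordAlgebra (euclidForm m) →ₗ[ℝ] 𝕜 ⊗[ℝ] CliffordAlgebra (euclidForm m))⟩

theorem star_mk (c : 𝕜) (x : CliffordAlgebra (euclidForm m)) :
    star (mk c x) = mk (star c) (CliffordAlgebra.reverse x) := rfl

theorem star_add' (x y : Cliff 𝕜 m) : star (x + y) = star x + star y :=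
  map_add (TensorProduct.map ((RCLike.conjAe (K := 𝕜)).toLinearMap)
    (CliffordAlgebra.reverse (Q := euclidForm m)) :
      𝕜 ⊗[ℝ] CliffordAlgebra (euclidForm m) →ₗ[ℝ] 𝕜 ⊗[ℝ] CliffordAlgebra (euclidForm m)) x y

instance : StarRing (Cliff 𝕜 m) where
  star_involutive x := by
    refine induction (p := fun x => star (star x) = x) ?_ (fun c x => ?_) x
    · intro x y hx hy
      rw [star_add', star_add', hx, hy]
    · rw [star_mk, star_mk, star_star, CliffordAlgebra.reverse_reverse]
  star_mul x y := by
    refine induction (p := fun x => star (x * y) = star y * star x) ?_ (fun c x => ?_) x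
    · intro x x' hx hx'
      rw [add_mul, star_add', star_add', mul_add, hx, hx']
    refine induction (p := fun y => star (mk c x * y) = star y * star (mk c x)) ?_
      (fun d y => ?_) y
    · intro y y' hy hy'
      rw [mul_add, star_add', star_add', add_mul, hy, hy']
    · rw [mk_mul, star_mk, star_mk, star_mk, mk_mul, CliffordAlgebra.reverse.map_mul, star_mul]
  star_add := star_add'

instance : StarModule 𝕜 (Cliff 𝕜 m) where
  star_smul a x := by
    refine induction (p := fun x => star (a • x) = star a • star x) ?_ (fun c x => ?_) x
    · intro x y hx hy
      rw [smul_add, star_add', star_add', smul_add, hx, hy]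
    · rw [smul_mk, star_mk, star_mk, smul_mk, star_mul, mul_comm]

theorem ext_mul {n : ℕ} (f : CliffordAlgebra (euclidForm m) →ₐ[ℝ] CliffordAlgebra (euclidForm n))
    (x y : Cliff 𝕜 m) : ext (𝕜 := 𝕜) f.toLinearMap (x * y) =
      ext f.toLinearMap x * ext f.toLinearMap y := by
  refine induction (p := fun x => ext f.toLinearMap (x * y) =
    ext f.toLinearMap x * ext f.toLinearMap y) ?_ (fun c x => ?_) x
  · intro x x' hx hx'
    rw [add_mul, map_add, map_add, add_mul, hx, hx']
  refine induction (p := fun y => ext f.toLinearMap (mk c x * y) =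
    ext f.toLinearMap (mk c x) * ext f.toLinearMap y) ?_ (fun d y => ?_) y
  · intro y y' hy hy'
    rw [mul_add, map_add, map_add, mul_add, hy, hy']
  · rw [mk_mul, ext_mk, ext_mk, ext_mk, mk_mul]
    exact congrArg _ (map_mul f x y)

theorem ext_star {n : ℕ} (f : CliffordAlgebra (euclidForm m) →ₗ[ℝ] CliffordAlgebra (euclidForm n))
    (hf : ∀ x, f (CliffordAlgebra.reverse x) = CliffordAlgebra.reverse (f x))
    (x : Cliff 𝕜 m) : ext (𝕜 := 𝕜) f (star x) = star (ext f x) := by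
  refine induction (p := fun x => ext f (star x) = star (ext f x)) ?_ (fun c x => ?_) x
  · intro x x' hx hx'
    rw [star_add, map_add, map_add, star_add, hx, hx']
  · rw [star_mk, ext_mk, ext_mk, star_mk, hf]

theorem ext_comp {n k : ℕ}
    (f : CliffordAlgebra (euclidForm m) →ₗ[ℝ] CliffordAlgebra (euclidForm n))
    (g : CliffordAlgebra (euclidForm n) →ₗ[ℝ] CliffordAlgebra (euclidForm k)) (x : Cliff 𝕜 m) :
    ext (𝕜 := 𝕜) g (ext f x) = ext (g ∘ₗ f) x := by
  refine induction (p := fun x => ext g (ext f x) = ext (g ∘ₗ f) x) ?_ (fun c x => ?_) x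
  · intro x x' hx hx'
    rw [map_add, map_add, map_add, hx, hx']
  · rw [ext_mk, ext_mk, ext_mk, LinearMap.comp_apply]

end Cliff

variable (𝕜) in
/-- The Clifford algebra as a graded `*`-algebra; vectors are odd and self-adjoint. -/
def cliffPre (m : ℕ) : GrStarAlg 𝕜 where
  carrier := Cliff 𝕜 m
  grade := Cliff.ext (CliffordAlgebra.involute (Q := euclidForm m)).toLinearMap
  grade_grade x := by
    rw [Cliff.ext_comp]
    refine Cliff.induction (p := fun x => Cliff.ext _ x = x) ?_ (fun c x => ?_) x
    · intro x y hx hy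
      rw [map_add, hx, hy]
    · rw [Cliff.ext_mk]
      exact congrArg _ (CliffordAlgebra.involute_involute x)
  grade_mul := Cliff.ext_mul _
  grade_star := Cliff.ext_star _ fun x => (CliffordAlgebra.reverse_involute x).symm

/-- The class of all graded `*`-representations of the Clifford algebra. -/
def cliffClass (m : ℕ) : RepClass (cliffPre 𝕜 m) where
  mem _ := Set.univ
  bdd x := by
    suffices h : ∃ M : ℝ, ∀ (C : GrCStar 𝕜) (π : Rep (cliffPre 𝕜 m) C), ‖π.toHom x‖ ≤ M by
      obtain ⟨M, hM⟩ := h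
      exact ⟨M, fun C π _ => hM C π⟩
    have hone : ∀ (C : GrCStar 𝕜) (π : Rep (cliffPre 𝕜 m) C),
        ‖π.toHom (1 : Cliff 𝕜 m)‖ ≤ 1 := by
      intro C π
      have h : π.toHom (1 : Cliff 𝕜 m) =
          star (π.toHom (1 : Cliff 𝕜 m)) * π.toHom (1 : Cliff 𝕜 m) := by
        have e : (1 : Cliff 𝕜 m) = star (1 : Cliff 𝕜 m) * 1 := by rw [star_one, mul_one]
        refine (congrArg π.toHom e).trans ?_
        refine (map_mul π.toHom (star (1 : Cliff 𝕜 m)) (1 : Cliff 𝕜 m)).trans ?_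
        exact congrArg (· * _) (map_star π.toHom (1 : Cliff 𝕜 m))
      have h2 := CStarRing.norm_star_mul_self (x := π.toHom (1 : Cliff 𝕜 m))
      rw [← h] at h2
      by_contra hc
      nlinarith [norm_nonneg (π.toHom (1 : Cliff 𝕜 m))]
    refine Cliff.induction (p := fun x => ∃ M : ℝ, ∀ (C : GrCStar 𝕜)
      (π : Rep (cliffPre 𝕜 m) C), ‖π.toHom x‖ ≤ M) ?_ (fun c x => ?_) x
    · rintro x y ⟨M, hM⟩ ⟨N, hN⟩
      refine ⟨M + N, fun C π => ?_⟩
      refine (congrArg norm (map_add π.toHom x y)).le.trans ?_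
      exact (norm_add_le _ _).trans (add_le_add (hM C π) (hN C π))
    suffices h : ∃ M : ℝ, ∀ (C : GrCStar 𝕜) (π : Rep (cliffPre 𝕜 m) C),
        ‖π.toHom (Cliff.mk 1 x)‖ ≤ M by
      obtain ⟨M, hM⟩ := h
      refine ⟨‖c‖ * M, fun C π => ?_⟩
      have e : Cliff.mk c x = c • Cliff.mk (1 : 𝕜) x := by rw [Cliff.smul_mk, mul_one]
      refine (congrArg norm ((congrArg π.toHom e).trans (map_smul π.toHom c _))).le.trans ?_
      rw [norm_smul]
      exact mul_le_mul_of_nonneg_left (hM C π) (norm_nonneg c)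
    induction x using CliffordAlgebra.induction with
    | algebraMap r =>
      refine ⟨‖(r : 𝕜)‖ * 1, fun C π => ?_⟩
      have e : Cliff.mk (1 : 𝕜) (algebraMap ℝ (CliffordAlgebra (euclidForm m)) r) =
          (r : 𝕜) • (1 : Cliff 𝕜 m) := by
        rw [Cliff.one_def, Cliff.smul_mk, Algebra.algebraMap_eq_smul_one]
        refine (TensorProduct.tmul_smul r (1 : 𝕜) (1 : CliffordAlgebra (euclidForm m))).trans ?_
        refine (TensorProduct.smul_tmul' r (1 : 𝕜) (1 : CliffordAlgebra (euclidForm m))).trans ?_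
        rw [RCLike.real_smul_eq_coe_mul]
        rfl
      refine (congrArg norm ((congrArg π.toHom e).trans (map_smul π.toHom _ _))).le.trans ?_
      rw [norm_smul]
      exact mul_le_mul_of_nonneg_left (hone C π) (norm_nonneg _)
    | ι v =>
      refine ⟨‖v‖ ^ 2 + 1, fun C π => ?_⟩
      have e : star (Cliff.mk (1 : 𝕜) (CliffordAlgebra.ι (euclidForm m) v)) *
          Cliff.mk (1 : 𝕜) (CliffordAlgebra.ι (euclidForm m) v) =
          ((‖v‖ ^ 2 : ℝ) : 𝕜) • (1 : Cliff 𝕜 m) := by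
        rw [Cliff.star_mk, CliffordAlgebra.reverse_ι, Cliff.mk_mul, CliffordAlgebra.ι_sq_scalar,
          euclidForm_apply, Cliff.one_def, Cliff.smul_mk, Algebra.algebraMap_eq_smul_one, star_one,
          mul_one]
        refine (TensorProduct.tmul_smul (‖v‖ ^ 2) (1 : 𝕜)
          (1 : CliffordAlgebra (euclidForm m))).trans ?_
        refine (TensorProduct.smul_tmul' (‖v‖ ^ 2) (1 : 𝕜)
          (1 : CliffordAlgebra (euclidForm m))).trans ?_
        rw [RCLike.real_smul_eq_coe_mul]
        rfl
      set y := Cliff.mk (1 : 𝕜) (CliffordAlgebra.ι (euclidForm m) v) with hy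
      have e2 : star (π.toHom y) * π.toHom y = ((‖v‖ ^ 2 : ℝ) : 𝕜) • π.toHom (1 : Cliff 𝕜 m) := by
        refine Eq.trans ?_ ((congrArg π.toHom e).trans (map_smul π.toHom _ _))
        refine Eq.trans ?_ (map_mul π.toHom (star y) y).symm
        exact congrArg (· * _) (map_star π.toHom y).symm
      have h2 := CStarRing.norm_star_mul_self (x := π.toHom y)
      rw [e2, norm_smul, RCLike.norm_ofReal, abs_of_nonneg (by positivity)] at h2
      have h3 := hone C π
      nlinarith [norm_nonneg (π.toHom y), sq_nonneg ‖v‖, sq_nonneg (‖π.toHom y‖ - 1)]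
    | mul x y hx hy =>
      obtain ⟨M, hM⟩ := hx
      obtain ⟨N, hN⟩ := hy
      refine ⟨M * N, fun C π => ?_⟩
      have e : Cliff.mk (1 : 𝕜) (x * y) = Cliff.mk 1 x * Cliff.mk 1 y := by
        rw [Cliff.mk_mul, mul_one]
      refine (congrArg norm ((congrArg π.toHom e).trans (map_mul π.toHom _ _))).le.trans ?_
      exact (norm_mul_le _ _).trans (mul_le_mul (hM C π) (hN C π) (norm_nonneg _)
        ((norm_nonneg _).trans (hM C π)))
    | add x y hx hy =>
      obtain ⟨M, hM⟩ := hx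
      obtain ⟨N, hN⟩ := hy
      refine ⟨M + N, fun C π => ?_⟩
      refine (congrArg norm ((congrArg π.toHom (Cliff.mk_add (1 : 𝕜) x y)).trans
        (map_add π.toHom _ _))).le.trans ?_
      exact (norm_add_le _ _).trans (add_le_add (hM C π) (hN C π))

variable (𝕜) in
/-- The Clifford algebra `𝔽_{m,0}` on `m` anticommuting odd self-adjoint generators of square `1`, as
a graded C*-algebra. Its C*-norm, which is unique, is the supremum of `‖π x‖` over the graded
`*`-representations `π`. -/
def CliffAlg (m : ℕ) : GrCStar 𝕜 := (cliffClass (𝕜 := 𝕜) m).envelope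

/-- The image in `𝔽_{m,0}` of an element of the real Clifford algebra. -/
def cliffOf {m : ℕ} (x : CliffordAlgebra (euclidForm m)) : (CliffAlg 𝕜 m).carrier :=
  (cliffClass m).of (Cliff.mk (1 : 𝕜) x)

/-- A linear isometry `ℝᵐ → ℝⁿ`, as an isometry of quadratic forms. -/
def euclidIsometry {m n : ℕ} (f : EuclideanSpace ℝ (Fin m) →ₗᵢ[ℝ] EuclideanSpace ℝ (Fin n)) :
    euclidForm m →qᵢ euclidForm n where
  toLinearMap := f.toLinearMap
  map_app' v := by
    change euclidForm n (f v) = euclidForm m v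
    rw [euclidForm_apply, euclidForm_apply, f.norm_map]

/-- The homomorphism `𝔽_{m,0} → 𝔽_{n,0}` induced by a linear isometry `f : ℝᵐ → ℝⁿ`:
`v₁ ⋯ v_k ↦ f(v₁) ⋯ f(v_k)`. -/
def cliffMap {m n : ℕ} (f : EuclideanSpace ℝ (Fin m) →ₗᵢ[ℝ] EuclideanSpace ℝ (Fin n)) :
    GrHom (CliffAlg 𝕜 m) (CliffAlg 𝕜 n) :=
  let g : Cliff 𝕜 m →ₗ[𝕜] Cliff 𝕜 n :=
    Cliff.ext (CliffordAlgebra.map (euclidIsometry f)).toLinearMap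
  RepClass.map (P := cliffPre 𝕜 m) (Q := cliffPre 𝕜 n)
    { toHom :=
        { toFun := g
          map_smul' := g.map_smul
          map_zero' := g.map_zero
          map_add' := g.map_add
          map_mul' := Cliff.ext_mul _
          map_star' := Cliff.ext_star _ fun x => by
            induction x using CliffordAlgebra.induction with
            | algebraMap r => simp
            | ι v => simp
            | mul x y hx hy =>
              simp only [AlgHom.toLinearMap_apply] at hx hy ⊢
              rw [CliffordAlgebra.reverse.map_mul, map_mul, map_mul,
                CliffordAlgebra.reverse.map_mul, hx, hy]
            | add x y hx hy => rw [map_add, map_add, map_add, map_add, hx, hy] }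
      map_grade := fun x => by
        refine (Cliff.ext_comp _ _ x).trans (Eq.trans ?_ (Cliff.ext_comp _ _ x).symm)
        refine congrArg (fun h => Cliff.ext (𝕜 := 𝕜) h x) ?_
        have e : (CliffordAlgebra.map (euclidIsometry f)).comp CliffordAlgebra.involute =
            CliffordAlgebra.involute.comp (CliffordAlgebra.map (euclidIsometry f)) := by
          ext v
          simp
        exact congrArg AlgHom.toLinearMap e }
    (fun _ _ _ => Set.mem_univ _)

/-! ### The Bott map -/

namespace RepClass

variable {P : GrStarAlg 𝕜} (R : RepClass P)

theorem of_add (x y : P.carrier) : R.of (x + y) = R.of x + R.of y :=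
  UniformSpace.Completion.coe_add (α := R.Pre) x y

theorem of_smul (c : 𝕜) (x : P.carrier) : R.of (c • x) = c • R.of x :=
  UniformSpace.Completion.coe_smul (X := R.Pre) c x

theorem of_mul (x y : P.carrier) : R.of (x * y) = R.of x * R.of y := R.coe_mul x y

theorem of_star (x : P.carrier) : R.of (star x) = star (R.of x) := R.coe_star x

theorem of_grade (x : P.carrier) : R.of (P.grade x) = R.envelope.grade (R.of x) :=
  (R.complGrade_coe x).symm

theorem norm_of (x : P.carrier) : ‖R.of x‖ = R.nrm x :=
  UniformSpace.Completion.norm_coe (E := R.Pre) x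

end RepClass

/-- The generator `e₁` of the real Clifford algebra of `ℝ¹`. -/
def cliffE : CliffordAlgebra (euclidForm 1) :=
  CliffordAlgebra.ι (euclidForm 1) (EuclideanSpace.single 0 1)

theorem cliffE_mul : cliffE * cliffE = 1 := by
  rw [cliffE, CliffordAlgebra.ι_sq_scalar, euclidForm_apply, PiLp.norm_single]
  simp

/-- The element `α + β e₁` of the Clifford algebra on one generator. -/
def cliffOne (α β : 𝕜) : Cliff 𝕜 1 := Cliff.mk α 1 + Cliff.mk β cliffE

theorem cliffMk_add (c d : 𝕜) (x : CliffordAlgebra (euclidForm 1)) :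
    Cliff.mk (c + d) x = Cliff.mk c x + Cliff.mk d x := TensorProduct.add_tmul c d x

theorem cliffOne_add (α β α' β' : 𝕜) :
    cliffOne α β + cliffOne α' β' = cliffOne (α + α') (β + β') := by
  unfold cliffOne
  rw [cliffMk_add, cliffMk_add]
  abel

theorem cliffOne_smul (c α β : 𝕜) : c • cliffOne α β = cliffOne (c * α) (c * β) := by
  unfold cliffOne
  rw [smul_add, Cliff.smul_mk, Cliff.smul_mk]

theorem cliffOne_mul (α β α' β' : 𝕜) :
    cliffOne α β * cliffOne α' β' = cliffOne (α * α' + β * β') (α * β' + β * α') := by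
  unfold cliffOne
  rw [add_mul, mul_add, mul_add, Cliff.mk_mul, Cliff.mk_mul, Cliff.mk_mul, Cliff.mk_mul,
    cliffE_mul, one_mul, one_mul, mul_one, cliffMk_add, cliffMk_add]
  abel

theorem cliffOne_star (α β : 𝕜) : star (cliffOne α β) = cliffOne (star α) (star β) := by
  unfold cliffOne
  rw [star_add, Cliff.star_mk, Cliff.star_mk, cliffE, CliffordAlgebra.reverse_ι,
    CliffordAlgebra.reverse.map_one]

theorem cliffOne_grade (α β : 𝕜) :
    (cliffPre 𝕜 1).grade (cliffOne α β) = cliffOne α (-β) := by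
  have e : (cliffPre 𝕜 1).grade (cliffOne α β) =
      Cliff.mk α (CliffordAlgebra.involute (1 : CliffordAlgebra (euclidForm 1))) +
        Cliff.mk β (CliffordAlgebra.involute cliffE) :=
    (cliffPre 𝕜 1).grade.map_add (Cliff.mk α 1) (Cliff.mk β cliffE)
  rw [e, map_one, cliffE, CliffordAlgebra.involute_ι]
  unfold cliffOne
  congr 1
  exact (TensorProduct.tmul_neg β _).trans (TensorProduct.neg_tmul β _).symm

/-- The functional calculus at the odd element `s e₁`: the element `f(s e₁)` is
`(f(s) + f(-s))/2 + ((f(s) - f(-s))/2) e₁`. -/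
def bottElt (s : ℝ) (f : C₀(ℝ, 𝕜)) : Cliff 𝕜 1 :=
  cliffOne ((f s + f (-s)) / 2) ((f s - f (-s)) / 2)

theorem bottElt_add (s : ℝ) (f g : C₀(ℝ, 𝕜)) : bottElt s (f + g) = bottElt s f + bottElt s g := by
  unfold bottElt
  rw [cliffOne_add]
  congr 1 <;> simp only [ZeroAtInftyContinuousMap.add_apply] <;> ring

theorem bottElt_smul (s : ℝ) (c : 𝕜) (f : C₀(ℝ, 𝕜)) : bottElt s (c • f) = c • bottElt s f := by
  unfold bottElt
  rw [cliffOne_smul]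
  congr 1 <;> simp only [ZeroAtInftyContinuousMap.smul_apply, smul_eq_mul] <;> ring

theorem bottElt_mul (s : ℝ) (f g : C₀(ℝ, 𝕜)) : bottElt s (f * g) = bottElt s f * bottElt s g := by
  unfold bottElt
  rw [cliffOne_mul]
  congr 1 <;> simp only [ZeroAtInftyContinuousMap.mul_apply] <;> ring

theorem bottElt_star (s : ℝ) (f : C₀(ℝ, 𝕜)) : bottElt s (star f) = star (bottElt s f) := by
  unfold bottElt
  rw [cliffOne_star]
  congr 1 <;> simp [ZeroAtInftyContinuousMap.star_apply]

theorem bottElt_grade (s : ℝ) (f : C₀(ℝ, 𝕜)) :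
    bottElt s (flipS f) = (cliffPre 𝕜 1).grade (bottElt s f) := by
  unfold bottElt
  rw [cliffOne_grade]
  congr 1 <;> simp only [flipS_apply, neg_neg] <;> ring

theorem cliff_norm_one_le {m : ℕ} (C : GrCStar 𝕜) (π : Rep (cliffPre 𝕜 m) C) :
    ‖π.toHom (1 : Cliff 𝕜 m)‖ ≤ 1 := by
  have h : π.toHom (1 : Cliff 𝕜 m) =
      star (π.toHom (1 : Cliff 𝕜 m)) * π.toHom (1 : Cliff 𝕜 m) := by
    have e : (1 : Cliff 𝕜 m) = star (1 : Cliff 𝕜 m) * 1 := by rw [star_one, mul_one]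
    refine (congrArg π.toHom e).trans ?_
    refine (map_mul π.toHom (star (1 : Cliff 𝕜 m)) (1 : Cliff 𝕜 m)).trans ?_
    exact congrArg (· * _) (map_star π.toHom (1 : Cliff 𝕜 m))
  have h2 := CStarRing.norm_star_mul_self (x := π.toHom (1 : Cliff 𝕜 m))
  rw [← h] at h2
  by_contra hc
  nlinarith [norm_nonneg (π.toHom (1 : Cliff 𝕜 m))]

theorem bottElt_nrm_le (s : ℝ) (f : C₀(ℝ, 𝕜)) :
    (cliffClass (𝕜 := 𝕜) 1).nrm (bottElt s f) ≤ ‖f‖ := by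
  refine RepClass.nrm_le _ (norm_nonneg f) fun C π _ => ?_
  set M := ‖f‖ with hM
  have key : ∀ x : ℝ, ∃ γ : ℝ, ((γ : 𝕜) * γ = ((M ^ 2 : ℝ) : 𝕜) - star (f x) * f x) := fun x => by
    have h1 : ‖f x‖ ≤ M := c0_le_norm f x
    have h2 : 0 ≤ M ^ 2 - ‖f x‖ ^ 2 := by nlinarith [norm_nonneg (f x)]
    refine ⟨Real.sqrt (M ^ 2 - ‖f x‖ ^ 2), ?_⟩
    rw [← RCLike.ofReal_mul, Real.mul_self_sqrt h2, RCLike.star_def, RCLike.conj_mul]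
    push_cast
    rfl
  obtain ⟨γ, hγ⟩ := key s
  obtain ⟨γ', hγ'⟩ := key (-s)
  set y : Cliff 𝕜 1 := cliffOne (((γ : 𝕜) + γ') / 2) (((γ : 𝕜) - γ') / 2) with hy
  have e : star (bottElt s f) * bottElt s f + star y * y =
      ((M ^ 2 : ℝ) : 𝕜) • (1 : Cliff 𝕜 1) := by
    have h1 : (1 : Cliff 𝕜 1) = cliffOne 1 0 := by
      unfold cliffOne
      rw [show Cliff.mk (0 : 𝕜) cliffE = 0 from TensorProduct.zero_tmul _ _, add_zero,
        Cliff.one_def]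
    rw [h1, cliffOne_smul, hy, bottElt, cliffOne_star, cliffOne_star, cliffOne_mul, cliffOne_mul,
      cliffOne_add]
    have s1 : star (γ : 𝕜) = γ := RCLike.conj_ofReal γ
    have s2 : star (γ' : 𝕜) = γ' := RCLike.conj_ofReal γ'
    have s3 : star (2 : 𝕜) = 2 := by simp
    congr 1
    · rw [star_div₀, star_div₀, star_div₀, star_div₀, star_add, star_sub, star_add, star_sub, s1, s2,
        s3]
      linear_combination (1 / 2 : 𝕜) * hγ + (1 / 2 : 𝕜) * hγ'
    · rw [star_div₀, star_div₀, star_div₀, star_div₀, star_add, star_sub, star_add, star_sub, s1, s2,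
        s3]
      linear_combination (1 / 2 : 𝕜) * hγ - (1 / 2 : 𝕜) * hγ'
  have h3 := C.norm_sq_le (π.toHom (bottElt s f)) (π.toHom y)
  have e2 : star (π.toHom (bottElt s f)) * π.toHom (bottElt s f) + star (π.toHom y) * π.toHom y =
      ((M ^ 2 : ℝ) : 𝕜) • π.toHom (1 : Cliff 𝕜 1) := by
    refine Eq.trans ?_ ((congrArg π.toHom e).trans (map_smul π.toHom _ _))
    refine Eq.trans ?_ (map_add π.toHom (star (bottElt s f) * bottElt s f) (star y * y)).symm
    refine congrArg₂ (· + ·) ?_ ?_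
    · refine Eq.trans ?_ (map_mul π.toHom (star (bottElt s f)) (bottElt s f)).symm
      exact congrArg (· * _) (map_star π.toHom (bottElt s f)).symm
    · refine Eq.trans ?_ (map_mul π.toHom (star y) y).symm
      exact congrArg (· * _) (map_star π.toHom y).symm
  rw [e2, norm_smul, RCLike.norm_ofReal, abs_of_nonneg (by positivity)] at h3
  have h4 := cliff_norm_one_le C π
  have h5 : 0 ≤ M := norm_nonneg f
  refine le_of_sq_le_sq ?_ h5
  nlinarith [sq_nonneg M]

/-- The Bott map `b : 𝒮 → Σ ⊗̂ 𝔽_{1,0}`, `b(f)(s) = f(s e₁)`, where `Σ = C₀(ℝ)`, evaluated at the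
point `s` of the line. -/
def bott (s : ℝ) : GrHom (SAlg 𝕜) (CliffAlg 𝕜 1) where
  toHom :=
    { toFun := fun f : C₀(ℝ, 𝕜) => (cliffClass (𝕜 := 𝕜) 1).of (bottElt s f)
      map_smul' := fun c f =>
        (congrArg _ (bottElt_smul s c f)).trans ((cliffClass (𝕜 := 𝕜) 1).of_smul c _)
      map_zero' := by
        have h := bottElt_smul (𝕜 := 𝕜) s 0 0
        rw [zero_smul] at h
        refine (congrArg _ h).trans (((cliffClass (𝕜 := 𝕜) 1).of_smul 0 _).trans ?_)
        exact zero_smul 𝕜 _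
      map_add' := fun f g =>
        (congrArg _ (bottElt_add s f g)).trans ((cliffClass (𝕜 := 𝕜) 1).of_add _ _)
      map_mul' := fun f g =>
        (congrArg _ (bottElt_mul s f g)).trans ((cliffClass (𝕜 := 𝕜) 1).of_mul _ _)
      map_star' := fun f =>
        (congrArg _ (bottElt_star s f)).trans ((cliffClass (𝕜 := 𝕜) 1).of_star _) }
  map_grade f := (congrArg _ (bottElt_grade s f)).trans ((cliffClass (𝕜 := 𝕜) 1).of_grade _)
  norm_le f := ((cliffClass (𝕜 := 𝕜) 1).norm_of _).le.trans (bottElt_nrm_le s f)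

/-! ### Quasi-topological spaces -/

/-- A quasi-topology on a set `X`: a class `QC` of maps `C → X`, for all compact Hausdorff spaces
`C`, that contains the constant maps, is stable under composition with continuous maps, is
determined on a disjoint union by the restrictions to the two summands, and descends along
continuous surjections. -/
structure QuasiTop (X : Type) where
  QC : ∀ (C : Type) [TopologicalSpace C] [CompactSpace C] [T2Space C], (C → X) → Prop
  const : ∀ (C : Type) [TopologicalSpace C] [CompactSpace C] [T2Space C] (x : X),
    QC C (fun _ => x)
  comp : ∀ (C₁ C₂ : Type) [TopologicalSpace C₁] [CompactSpace C₁] [T2Space C₁]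
    [TopologicalSpace C₂] [CompactSpace C₂] [T2Space C₂] (f : C₁ → C₂) (g : C₂ → X),
    Continuous f → QC C₂ g → QC C₁ (g ∘ f)
  sum : ∀ (C₁ C₂ : Type) [TopologicalSpace C₁] [CompactSpace C₁] [T2Space C₁]
    [TopologicalSpace C₂] [CompactSpace C₂] [T2Space C₂] (g : C₁ ⊕ C₂ → X),
    QC (C₁ ⊕ C₂) g ↔ QC C₁ (g ∘ Sum.inl) ∧ QC C₂ (g ∘ Sum.inr)
  surj : ∀ (C₁ C₂ : Type) [TopologicalSpace C₁] [CompactSpace C₁] [T2Space C₁]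
    [TopologicalSpace C₂] [CompactSpace C₂] [T2Space C₂] (f : C₁ → C₂) (h : C₂ → X),
    Continuous f → Function.Surjective f → QC C₁ (h ∘ f) → QC C₂ h

/-- A map of quasi-topological spaces is quasi-continuous if composition with it preserves
quasi-continuous maps from compact Hausdorff spaces. -/
def QuasiCts {X Y : Type} (S : QuasiTop X) (T : QuasiTop Y) (f : X → Y) : Prop :=
  ∀ (C : Type) [TopologicalSpace C] [CompactSpace C] [T2Space C] (g : C → X),
    S.QC C g → T.QC C (f ∘ g)

/-- The quasi-topology of a topological space: the continuous maps. -/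
def QuasiTop.ofTop (X : Type) [TopologicalSpace X] : QuasiTop X where
  QC _ _ _ _ f := Continuous f
  const _ _ _ _ _ := continuous_const
  comp _ _ _ _ _ _ _ _ _ _ hf hg := hg.comp hf
  sum _ _ _ _ _ _ _ _ _ := continuous_sum_dom
  surj _ _ _ _ _ _ _ _ _ _ hf hs hh := (hf.isClosedMap.isQuotientMap hf hs).continuous_iff.2 hh

/-- The product quasi-topology. -/
def QuasiTop.prod {X Y : Type} (S : QuasiTop X) (T : QuasiTop Y) : QuasiTop (X × Y) where
  QC C _ _ _ f := S.QC C (Prod.fst ∘ f) ∧ T.QC C (Prod.snd ∘ f)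
  const C _ _ _ x := ⟨S.const C x.1, T.const C x.2⟩
  comp C₁ C₂ _ _ _ _ _ _ f _ hf hg := ⟨S.comp C₁ C₂ f _ hf hg.1, T.comp C₁ C₂ f _ hf hg.2⟩
  sum C₁ C₂ _ _ _ _ _ _ g := by
    have h1 := S.sum C₁ C₂ (Prod.fst ∘ g)
    have h2 := T.sum C₁ C₂ (Prod.snd ∘ g)
    rw [h1, h2]
    exact and_and_and_comm
  surj C₁ C₂ _ _ _ _ _ _ f h hf hs hh :=
    ⟨S.surj C₁ C₂ f _ hf hs hh.1, T.surj C₁ C₂ f _ hf hs hh.2⟩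

/-- The quotient quasi-topology, the finest one for which the projection is quasi-continuous: a map
`h : C → X/∼` is quasi-continuous if, after composition with some continuous surjection `C' → C` of
compact Hausdorff spaces, it lifts to a quasi-continuous map `C' → X`. -/
def QuasiTop.quot {X : Type} (S : QuasiTop X) (s : Setoid X) : QuasiTop (Quotient s) where
  QC C _ _ _ h := ∃ (C' : Type) (_ : TopologicalSpace C') (_ : CompactSpace C') (_ : T2Space C')
    (p : C' → C) (g : C' → X), Continuous p ∧ Function.Surjective p ∧ S.QC C' g ∧
      ∀ c, Quotient.mk s (g c) = h (p c)
  const C _ _ _ x := by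
    obtain ⟨y, rfl⟩ := Quotient.exists_rep x
    exact ⟨C, inferInstance, inferInstance, inferInstance, id, fun _ => y, continuous_id,
      Function.surjective_id, S.const C y, fun _ => rfl⟩
  comp C₁ C₂ _ _ _ _ _ _ f h hf hh := by
    obtain ⟨C', _, _, _, p, g, hp, hs, hg, e⟩ := hh
    have hcl : IsClosed {x : C₁ × C' | f x.1 = p x.2} :=
      isClosed_eq (hf.comp continuous_fst) (hp.comp continuous_snd)
    have : CompactSpace {x : C₁ × C' | f x.1 = p x.2} := isCompact_iff_compactSpace.1 hcl.isCompact
    refine ⟨{x : C₁ × C' | f x.1 = p x.2}, inferInstance, inferInstance, inferInstance,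
      fun x => x.1.1, fun x => g x.1.2, by fun_prop, fun c => ?_, ?_, fun x => ?_⟩
    · obtain ⟨c', hc'⟩ := hs (f c)
      exact ⟨⟨(c, c'), hc'.symm⟩, rfl⟩
    · exact S.comp _ C' (fun x : {x : C₁ × C' | f x.1 = p x.2} => x.1.2) g (by fun_prop) hg
    · exact (e x.1.2).trans (congrArg h x.2.symm)
  sum C₁ C₂ _ _ _ _ _ _ h := by
    constructor
    · rintro ⟨C', _, _, _, p, g, hp, hs, hg, e⟩
      constructor
      · have hcl : IsClosed {x : C₁ × C' | Sum.inl x.1 = p x.2} :=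
          isClosed_eq (continuous_inl.comp continuous_fst) (hp.comp continuous_snd)
        have : CompactSpace {x : C₁ × C' | Sum.inl x.1 = p x.2} :=
          isCompact_iff_compactSpace.1 hcl.isCompact
        refine ⟨{x : C₁ × C' | Sum.inl x.1 = p x.2}, inferInstance, inferInstance, inferInstance,
          fun x => x.1.1, fun x => g x.1.2, by fun_prop, fun c => ?_, ?_, fun x => ?_⟩
        · obtain ⟨c', hc'⟩ := hs (Sum.inl c)
          exact ⟨⟨(c, c'), hc'.symm⟩, rfl⟩
        · exact S.comp _ C' (fun x : {x : C₁ × C' | Sum.inl x.1 = p x.2} => x.1.2) g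
            (by fun_prop) hg
        · exact (e x.1.2).trans (congrArg h x.2.symm)
      · have hcl : IsClosed {x : C₂ × C' | Sum.inr x.1 = p x.2} :=
          isClosed_eq (continuous_inr.comp continuous_fst) (hp.comp continuous_snd)
        have : CompactSpace {x : C₂ × C' | Sum.inr x.1 = p x.2} :=
          isCompact_iff_compactSpace.1 hcl.isCompact
        refine ⟨{x : C₂ × C' | Sum.inr x.1 = p x.2}, inferInstance, inferInstance, inferInstance,
          fun x => x.1.1, fun x => g x.1.2, by fun_prop, fun c => ?_, ?_, fun x => ?_⟩
        · obtain ⟨c', hc'⟩ := hs (Sum.inr c)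
          exact ⟨⟨(c, c'), hc'.symm⟩, rfl⟩
        · exact S.comp _ C' (fun x : {x : C₂ × C' | Sum.inr x.1 = p x.2} => x.1.2) g
            (by fun_prop) hg
        · exact (e x.1.2).trans (congrArg h x.2.symm)
    · rintro ⟨⟨D, _, _, _, p, g, hp, hs, hg, e⟩, ⟨D', _, _, _, p', g', hp', hs', hg', e'⟩⟩
      refine ⟨D ⊕ D', inferInstance, inferInstance, inferInstance, Sum.map p p', Sum.elim g g',
        hp.sumMap hp', hs.sumMap hs', (S.sum D D' _).2 ⟨hg, hg'⟩, ?_⟩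
      rintro (c | c)
      · exact e c
      · exact e' c
  surj C₁ C₂ _ _ _ _ _ _ f h hf hs hh := by
    obtain ⟨C', _, _, _, p, g, hp, hs', hg, e⟩ := hh
    exact ⟨C', inferInstance, inferInstance, inferInstance, f ∘ p, g, hf.comp hp, hs.comp hs', hg, e⟩

/-- A based quasi-topological space. -/
structure BQSpace where
  carrier : Type
  top : QuasiTop carrier
  pt : carrier

/-- A morphism of based quasi-topological spaces: a quasi-continuous map that preserves the
basepoint. -/
structure BasedMap (X Y : BQSpace) where
  toFun : X.carrier → Y.carrier
  map_pt : toFun X.pt = Y.pt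
  quasiCts : QuasiCts X.top Y.top toFun

/-- The equivalence relation on `X × Y` that identifies all points of the wedge
`X × {pt} ∪ {pt} × Y`. -/
def smashSetoid (X Y : BQSpace) : Setoid (X.carrier × Y.carrier) where
  r p q := p = q ∨ ((p.1 = X.pt ∨ p.2 = Y.pt) ∧ (q.1 = X.pt ∨ q.2 = Y.pt))
  iseqv :=
    { refl := fun _ => Or.inl rfl
      symm := by
        rintro p q (h | ⟨h, h'⟩)
        · exact Or.inl h.symm
        · exact Or.inr ⟨h', h⟩
      trans := by
        rintro p q r (rfl | ⟨h, h'⟩) (rfl | ⟨k, k'⟩)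
        · exact Or.inl rfl
        · exact Or.inr ⟨k, k'⟩
        · exact Or.inr ⟨h, h'⟩
        · exact Or.inr ⟨h, k'⟩ }

/-- The smash product of based quasi-topological spaces. -/
def Smash (X Y : BQSpace) : BQSpace where
  carrier := Quotient (smashSetoid X Y)
  top := (X.top.prod Y.top).quot (smashSetoid X Y)
  pt := Quotient.mk _ (X.pt, Y.pt)

/-- The point `x ∧ y` of the smash product. -/
def Smash.mk {X Y : BQSpace} (x : X.carrier) (y : Y.carrier) : (Smash X Y).carrier :=
  Quotient.mk (smashSetoid X Y) (x, y)

theorem Smash.mk_pt_left {X Y : BQSpace} (y : Y.carrier) :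
    Smash.mk X.pt y = (Smash X Y).pt := Quotient.sound (Or.inr ⟨Or.inl rfl, Or.inl rfl⟩)

/-- The sphere `Sⁿ`: the one-point compactification of `ℝⁿ`, based at infinity. -/
def Sph (n : ℕ) : BQSpace where
  carrier := OnePoint (EuclideanSpace ℝ (Fin n))
  top := QuasiTop.ofTop _
  pt := OnePoint.infty

/-- The point of `Sⁿ` given by a vector. -/
def Sph.ofVec {n : ℕ} (v : EuclideanSpace ℝ (Fin n)) : (Sph n).carrier :=
  (v : OnePoint (EuclideanSpace ℝ (Fin n)))

/-! ### Orthogonal groups -/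

/-- The orthogonal group `O(n)`, with the topology of a subspace of the space of matrices. -/
abbrev O (n : ℕ) : Type := Matrix.orthogonalGroup (Fin n) ℝ

/-- The isometry `v ↦ H v` of `ℝⁿ`. -/
def orthIso {n : ℕ} (H : O n) : EuclideanSpace ℝ (Fin n) →ₗᵢ[ℝ] EuclideanSpace ℝ (Fin n) where
  toLinearMap := Matrix.toEuclideanLin H.1
  norm_map' v := by
    have h : H.1.transpose * H.1 = 1 := (Matrix.mem_orthogonalGroup_iff' (Fin n) ℝ).1 H.2
    have e : inner ℝ (Matrix.toEuclideanLin H.1 v) (Matrix.toEuclideanLin H.1 v) =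
        inner ℝ v v := by
      rw [← LinearMap.adjoint_inner_right, ← Matrix.toEuclideanLin_conjTranspose_eq_adjoint]
      congr 1
      ext i
      simp [Matrix.mulVec_mulVec, Matrix.conjTranspose_eq_transpose_of_trivial, h]
    rw [← sq_eq_sq₀ (norm_nonneg _) (norm_nonneg _), ← real_inner_self_eq_norm_sq,
      ← real_inner_self_eq_norm_sq, e]

/-- The action of `O(n)` on `Sⁿ`, which fixes the point at infinity. -/
def sphAct {n : ℕ} (K : O n) (s : (Sph n).carrier) : (Sph n).carrier :=
  OnePoint.map (orthIso K) s

/-- The block sum `O(m) × O(n) → O(m + n)`; the first block acts on the first `m` coordinates and the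
second one on the last `n` coordinates. -/
def blockSum {m n : ℕ} (H : O m) (K : O n) : O (m + n) :=
  ⟨Matrix.reindex finSumFinEquiv finSumFinEquiv (Matrix.fromBlocks H.1 0 0 K.1), by
    have h : H.1.transpose * H.1 = 1 := (Matrix.mem_orthogonalGroup_iff' (Fin m) ℝ).1 H.2
    have k : K.1.transpose * K.1 = 1 := (Matrix.mem_orthogonalGroup_iff' (Fin n) ℝ).1 K.2
    rw [Matrix.mem_orthogonalGroup_iff', Matrix.transpose_reindex, Matrix.reindex_apply,
      Matrix.reindex_apply, Matrix.submatrix_mul_equiv, Matrix.fromBlocks_transpose,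
      Matrix.fromBlocks_multiply]
    simp [h, k]⟩

/-! ### Orthogonal quasi-spectra -/

section Spectrum

variable (X : ℕ → BQSpace) (act : ∀ m, O m → (X m).carrier → (X m).carrier)
  (σ : ∀ m, BasedMap (Smash (X m) (Sph 1)) (X (m + 1)))

/-- The first `n` coordinates of a vector in `ℝⁿ⁺¹`. -/
def initVec {n : ℕ} (v : EuclideanSpace ℝ (Fin (n + 1))) : EuclideanSpace ℝ (Fin n) :=
  WithLp.toLp 2 fun i => v i.castSucc

/-- A real number as a vector in `ℝ¹`. -/
def vecOne (s : ℝ) : EuclideanSpace ℝ (Fin 1) := WithLp.toLp 2 fun _ => s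

variable {X}

/-- The iterated structure map on pairs, for vectors:
`(x, (s₁, …, sₙ)) ↦ σ(… σ(σ(x ∧ s₁) ∧ s₂) … ∧ sₙ)`. -/
def iterVec (m : ℕ) (x : (X m).carrier) :
    ∀ n : ℕ, EuclideanSpace ℝ (Fin n) → (X (m + n)).carrier
  | 0, _ => x
  | n + 1, v =>
    (σ (m + n)).toFun (Smash.mk (iterVec m x n (initVec v)) (Sph.ofVec (vecOne (v (Fin.last n)))))

theorem iterVec_pt (m : ℕ) : ∀ (n : ℕ) (v : EuclideanSpace ℝ (Fin n)),
    iterVec σ m (X m).pt n v = (X (m + n)).pt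
  | 0, _ => rfl
  | n + 1, v => by
    rw [iterVec, iterVec_pt m n, Smash.mk_pt_left]
    exact (σ (m + n)).map_pt

/-- The iterated structure map on pairs; the point at infinity of `Sⁿ` goes to the basepoint. -/
def iterFun (m n : ℕ) (x : (X m).carrier) (s : (Sph n).carrier) : (X (m + n)).carrier :=
  OnePoint.elim s (X (m + n)).pt (iterVec σ m x n)

theorem iterFun_pt_left (m n : ℕ) (s : (Sph n).carrier) :
    iterFun σ m n (X m).pt s = (X (m + n)).pt := by
  induction s using OnePoint.rec with
  | infty => rfl
  | coe v => exact iterVec_pt σ m n v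

/-- The iterated structure map `σⁿ : X_m ∧ Sⁿ → X_{m+n}`, where `Sⁿ` is identified with the `n`-fold
smash power of `S¹` by the coordinates of `ℝⁿ`. -/
def iter (m n : ℕ) : (Smash (X m) (Sph n)).carrier → (X (m + n)).carrier :=
  Quotient.lift (s := smashSetoid (X m) (Sph n)) (fun p => iterFun σ m n p.1 p.2) (by
    have key : ∀ p : (X m).carrier × (Sph n).carrier, (p.1 = (X m).pt ∨ p.2 = (Sph n).pt) →
        iterFun σ m n p.1 p.2 = (X (m + n)).pt := by
      rintro ⟨x, s⟩ (h | h)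
      · change x = _ at h
        subst h
        exact iterFun_pt_left σ m n s
      · change s = _ at h
        subst h
        rfl
    rintro p q (h | ⟨h, h'⟩)
    · rw [h]
    · exact (key p h).trans (key q h').symm)

/-- The based quasi-topological spaces `X_m`, with the maps `act : O(m) × X_m → X_m` and the based
quasi-continuous structure maps `σ : X_m ∧ S¹ → X_{m+1}`, form an orthogonal quasi-spectrum. -/
structure IsOrthogonalQuasiSpectrum : Prop where
  act_one : ∀ m x, act m 1 x = x
  act_mul : ∀ m H K x, act m (H * K) x = act m H (act m K x)
  act_pt : ∀ m H, act m H (X m).pt = (X m).pt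
  act_quasiCts : ∀ m, QuasiCts ((QuasiTop.ofTop (O m)).prod (X m).top) (X m).top
    (fun p => act m p.1 p.2)
  iter_quasiCts : ∀ m n, QuasiCts (Smash (X m) (Sph n)).top (X (m + n)).top (iter σ m n)
  iter_equivariant : ∀ m n (H : O m) (K : O n) (x : (X m).carrier) (s : (Sph n).carrier),
    iter σ m n (Smash.mk (act m H x) (sphAct K s)) =
      act (m + n) (blockSum H K) (iter σ m n (Smash.mk x s))

end Spectrum

/-! ### Asymptotic morphisms -/

/-- A graded asymptotic morphism `A ⇢ B`: a family of maps `φ_t : A → B`, `t ∈ [1, ∞)`, such that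
`t ↦ φ_t(a)` is continuous and bounded for each `a`, and which is asymptotically a graded
`*`-homomorphism. -/
structure Asy (A B : GrCStar 𝕜) where
  toFun : Set.Ici (1 : ℝ) → A.carrier → B.carrier
  cont : ∀ a, Continuous fun t => toFun t a
  bdd : ∀ a, ∃ M : ℝ, ∀ t, ‖toFun t a‖ ≤ M
  mul : ∀ a b, Tendsto (fun t => ‖toFun t (a * b) - toFun t a * toFun t b‖) atTop (𝓝 0)
  lin : ∀ (a b) (c : 𝕜),
    Tendsto (fun t => ‖toFun t (a + c • b) - toFun t a - c • toFun t b‖) atTop (𝓝 0)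
  star : ∀ a, Tendsto (fun t => ‖toFun t (star a) - star (toFun t a)‖) atTop (𝓝 0)
  grade : ∀ a, Tendsto (fun t => ‖toFun t (A.grade a) - B.grade (toFun t a)‖) atTop (𝓝 0)

namespace Asy

variable {A A' B B' : GrCStar 𝕜}

/-- The zero asymptotic morphism. -/
def zero (A B : GrCStar 𝕜) : Asy A B where
  toFun _ _ := 0
  cont _ := continuous_const
  bdd _ := ⟨0, fun _ => norm_zero.le⟩
  mul a b := by simp
  lin a b c := by simp
  star a := by simp
  grade a := by simp

/-- Composition with a graded `*`-homomorphism `A' → A`. -/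
def precomp (φ : Asy A B) (f : GrHom A' A) : Asy A' B where
  toFun t a := φ.toFun t (f a)
  cont a := φ.cont (f a)
  bdd a := φ.bdd (f a)
  mul a b := by
    have h := φ.mul (f a) (f b)
    rwa [← map_mul f.toHom] at h
  lin a b c := by
    have h := φ.lin (f a) (f b) c
    rwa [← map_smul f.toHom, ← map_add f.toHom] at h
  star a := by
    have h := φ.star (f a)
    rwa [← map_star f.toHom] at h
  grade a := by
    have h := φ.grade (f a)
    rwa [← f.map_grade] at h

theorem _root_.ETheory.GrHom.continuous (g : GrHom B B') : Continuous g :=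
  AddMonoidHomClass.continuous_of_bound g.toHom 1 fun b => by
    rw [one_mul]
    exact g.norm_le b

theorem tendsto_of_le {u v : Set.Ici (1 : ℝ) → ℝ} (hv : Tendsto v atTop (𝓝 0))
    (h0 : ∀ t, 0 ≤ u t) (h : ∀ t, u t ≤ v t) : Tendsto u atTop (𝓝 0) :=
  squeeze_zero h0 h hv

/-- Composition with a graded `*`-homomorphism `B → B'`. -/
def postcomp (g : GrHom B B') (φ : Asy A B) : Asy A B' where
  toFun t a := g (φ.toFun t a)
  cont a := g.continuous.comp (φ.cont a)
  bdd a := by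
    obtain ⟨M, hM⟩ := φ.bdd a
    exact ⟨M, fun t => (g.norm_le _).trans (hM t)⟩
  mul a b := tendsto_of_le (φ.mul a b) (fun _ => norm_nonneg _) fun t => by
    rw [← map_mul g.toHom, ← map_sub g.toHom]
    exact g.norm_le _
  lin a b c := tendsto_of_le (φ.lin a b c) (fun _ => norm_nonneg _) fun t => by
    rw [← map_smul g.toHom, ← map_sub g.toHom, ← map_sub g.toHom]
    exact g.norm_le _
  star a := tendsto_of_le (φ.star a) (fun _ => norm_nonneg _) fun t => by
    rw [← map_star g.toHom, ← map_sub g.toHom]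
    exact g.norm_le _
  grade a := tendsto_of_le (φ.grade a) (fun _ => norm_nonneg _) fun t => by
    rw [← g.map_grade, ← map_sub g.toHom]
    exact g.norm_le _

/-- Asymptotic equivalence: `φ_t(a) - ψ_t(a) → 0` for each `a`. -/
instance setoid (A B : GrCStar 𝕜) : Setoid (Asy A B) where
  r φ ψ := ∀ a, Tendsto (fun t => ‖φ.toFun t a - ψ.toFun t a‖) atTop (𝓝 0)
  iseqv :=
    { refl := fun φ a => by simp
      symm := fun {φ ψ} h a => by
        refine (h a).congr fun t => ?_
        exact norm_sub_rev _ _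
      trans := fun {φ ψ χ} h h' a => by
        have h2 := (h a).add (h' a)
        rw [add_zero] at h2
        refine tendsto_of_le h2 (fun _ => norm_nonneg _) fun t => ?_
        exact norm_sub_le_norm_sub_add_norm_sub _ _ _ }

variable {Y Y' : Type} [TopologicalSpace Y] [CompactSpace Y] [TopologicalSpace Y'] [CompactSpace Y']

/-- The value at `y` of an element of `C(Y, B)`. -/
def evalC (f : (CAlg Y B).carrier) (y : Y) : B.carrier :=
  DFunLike.coe (F := C(Y, B.carrier)) f y

theorem norm_cAlg_le {f : (CAlg Y B).carrier} {M : ℝ} (h0 : 0 ≤ M) (h : ∀ y, ‖evalC f y‖ ≤ M) :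
    ‖f‖ ≤ M :=
  (ContinuousMap.norm_le (E := B.carrier) f h0).2 h

theorem le_norm_cAlg (f : (CAlg Y B).carrier) (y : Y) : ‖evalC f y‖ ≤ ‖f‖ :=
  ContinuousMap.norm_coe_le_norm (E := B.carrier) f y

/-- Composition with a continuous map `p : Y' → Y`. -/
def pullC (B : GrCStar 𝕜) (p : C(Y', Y)) : GrHom (CAlg Y B) (CAlg Y' B) where
  toHom :=
    { toFun := fun f : C(Y, B.carrier) => (f.comp p : C(Y', B.carrier))
      map_smul' := fun _ _ => rfl
      map_zero' := rfl
      map_add' := fun _ _ => rfl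
      map_mul' := fun _ _ => rfl
      map_star' := fun _ => rfl }
  map_grade _ := rfl
  norm_le f := norm_cAlg_le (norm_nonneg f) fun y => le_norm_cAlg f (p y)

/-- The inclusion of `B` into `C(Y, B)` as the constant functions. -/
def constC (B : GrCStar 𝕜) (Y : Type) [TopologicalSpace Y] [CompactSpace Y] :
    GrHom B (CAlg Y B) where
  toHom :=
    { toFun := fun b => (ContinuousMap.const Y b : C(Y, B.carrier))
      map_smul' := fun _ _ => rfl
      map_zero' := rfl
      map_add' := fun _ _ => rfl
      map_mul' := fun _ _ => rfl
      map_star' := fun _ => rfl }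
  map_grade _ := rfl
  norm_le b := norm_cAlg_le (norm_nonneg b) fun _ => le_rfl

/-- A family of maps is an asymptotic morphism if its images under two homomorphisms that together
control the norm are asymptotic morphisms. -/
def ofImages {C C₁ C₂ : GrCStar 𝕜} (ψ : Set.Ici (1 : ℝ) → A.carrier → C.carrier)
    (r₁ : GrHom C C₁) (r₂ : GrHom C C₂) (hr : ∀ c, ‖c‖ ≤ ‖r₁ c‖ + ‖r₂ c‖)
    (G₁ : Asy A C₁) (G₂ : Asy A C₂) (h₁ : ∀ t a, r₁ (ψ t a) = G₁.toFun t a)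
    (h₂ : ∀ t a, r₂ (ψ t a) = G₂.toFun t a) : Asy A C where
  toFun := ψ
  cont a := by
    rw [continuous_iff_continuousAt]
    intro t₀
    have k₁ := tendsto_iff_norm_sub_tendsto_zero.1 ((G₁.cont a).tendsto t₀)
    have k₂ := tendsto_iff_norm_sub_tendsto_zero.1 ((G₂.cont a).tendsto t₀)
    have k := k₁.add k₂
    rw [add_zero] at k
    refine tendsto_iff_norm_sub_tendsto_zero.2 (squeeze_zero (fun _ => norm_nonneg _)
      (fun t => (hr _).trans ?_) k)
    rw [map_sub r₁.toHom, map_sub r₂.toHom, h₁, h₁, h₂, h₂]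
  bdd a := by
    obtain ⟨M, hM⟩ := G₁.bdd a
    obtain ⟨N, hN⟩ := G₂.bdd a
    refine ⟨M + N, fun t => (hr _).trans ?_⟩
    rw [h₁, h₂]
    exact add_le_add (hM t) (hN t)
  mul a b := by
    have k := (G₁.mul a b).add (G₂.mul a b)
    rw [add_zero] at k
    refine tendsto_of_le k (fun _ => norm_nonneg _) fun t => (hr _).trans ?_
    rw [map_sub r₁.toHom, map_sub r₂.toHom, map_mul r₁.toHom, map_mul r₂.toHom, h₁, h₁, h₁, h₂, h₂,
      h₂]
  lin a b c := by
    have k := (G₁.lin a b c).add (G₂.lin a b c)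
    rw [add_zero] at k
    refine tendsto_of_le k (fun _ => norm_nonneg _) fun t => (hr _).trans ?_
    rw [map_sub r₁.toHom, map_sub r₂.toHom, map_sub r₁.toHom, map_sub r₂.toHom, map_smul r₁.toHom,
      map_smul r₂.toHom, h₁, h₁, h₁, h₂, h₂, h₂]
  star a := by
    have k := (G₁.star a).add (G₂.star a)
    rw [add_zero] at k
    refine tendsto_of_le k (fun _ => norm_nonneg _) fun t => (hr _).trans ?_
    rw [map_sub r₁.toHom, map_sub r₂.toHom, map_star r₁.toHom, map_star r₂.toHom, h₁, h₁, h₂, h₂]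
  grade a := by
    have k := (G₁.grade a).add (G₂.grade a)
    rw [add_zero] at k
    refine tendsto_of_le k (fun _ => norm_nonneg _) fun t => (hr _).trans ?_
    rw [map_sub r₁.toHom, map_sub r₂.toHom, r₁.map_grade, r₂.map_grade, h₁, h₁, h₂, h₂]

/-- The quasi-topology of Dadarlat and Meyer on the set of graded asymptotic morphisms `A ⇢ B`: the
quasi-continuous maps from `Y` are those given by the elements of `Asy(A, C(Y, B))`. -/
def quasiTop (A B : GrCStar 𝕜) : QuasiTop (Asy A B) where
  QC Y _ _ _ h := ∃ G : Asy A (CAlg Y B), ∀ y t a, (h y).toFun t a = evalC (G.toFun t a) y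
  const Y _ _ _ φ := ⟨φ.postcomp (constC B Y), fun _ _ _ => rfl⟩
  comp Y₁ Y₂ _ _ _ _ _ _ f h hf := by
    rintro ⟨G, hG⟩
    exact ⟨G.postcomp (pullC B ⟨f, hf⟩), fun y t a => hG (f y) t a⟩
  sum Y₁ Y₂ _ _ _ _ _ _ h := by
    constructor
    · rintro ⟨G, hG⟩
      exact ⟨⟨G.postcomp (pullC B ⟨Sum.inl, continuous_inl⟩), fun y t a => hG (Sum.inl y) t a⟩,
        ⟨G.postcomp (pullC B ⟨Sum.inr, continuous_inr⟩), fun y t a => hG (Sum.inr y) t a⟩⟩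
    · rintro ⟨⟨G₁, h₁⟩, ⟨G₂, h₂⟩⟩
      let ψ : Set.Ici (1 : ℝ) → A.carrier → C(Y₁ ⊕ Y₂, B.carrier) := fun t a =>
        ⟨fun y => (h y).toFun t a, continuous_sum_dom.2
          ⟨(map_continuous (F := C(Y₁, B.carrier)) (G₁.toFun t a)).congr fun y => (h₁ y t a).symm,
            (map_continuous (F := C(Y₂, B.carrier)) (G₂.toFun t a)).congr fun y => (h₂ y t a).symm⟩⟩
      refine ⟨ofImages (C := CAlg (Y₁ ⊕ Y₂) B) ψ (pullC B ⟨Sum.inl, continuous_inl⟩)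
        (pullC B ⟨Sum.inr, continuous_inr⟩) (fun c => ?_) G₁ G₂ (fun t a => ?_) (fun t a => ?_),
        fun _ _ _ => rfl⟩
      · refine norm_cAlg_le (add_nonneg (norm_nonneg _) (norm_nonneg _)) ?_
        rintro (y | y)
        · exact (le_norm_cAlg (pullC B ⟨Sum.inl, continuous_inl⟩ c) y).trans
            (le_add_of_nonneg_right (norm_nonneg _))
        · exact (le_norm_cAlg (pullC B ⟨Sum.inr, continuous_inr⟩ c) y).trans
            (le_add_of_nonneg_left (norm_nonneg _))
      · exact ContinuousMap.ext fun y => h₁ y t a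
      · exact ContinuousMap.ext fun y => h₂ y t a
  surj Y₁ Y₂ _ _ _ _ _ _ f h hf hs := by
    rintro ⟨G, hG⟩
    let ψ : Set.Ici (1 : ℝ) → A.carrier → C(Y₂, B.carrier) := fun t a =>
      ⟨fun y => (h y).toFun t a, (hf.isClosedMap.isQuotientMap hf hs).continuous_iff.2
        ((map_continuous (F := C(Y₁, B.carrier)) (G.toFun t a)).congr fun y => (hG y t a).symm)⟩
    refine ⟨ofImages (C := CAlg Y₂ B) ψ (pullC B ⟨f, hf⟩) (pullC B ⟨f, hf⟩) (fun c => ?_) G G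
      (fun t a => ContinuousMap.ext fun y => hG y t a)
      (fun t a => ContinuousMap.ext fun y => hG y t a), fun _ _ _ => rfl⟩
    refine norm_cAlg_le (add_nonneg (norm_nonneg _) (norm_nonneg _)) fun y => ?_
    obtain ⟨x, rfl⟩ := hs y
    exact (le_norm_cAlg (pullC B ⟨f, hf⟩ c) x).trans (le_add_of_nonneg_right (norm_nonneg _))

end Asy

/-- The based quasi-topological space of graded asymptotic morphisms `A ⇢ B` up to asymptotic
equivalence, based at the class of the zero morphism. -/
def AsySpace (A B : GrCStar 𝕜) : BQSpace where
  carrier := Quotient (Asy.setoid A B)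
  top := (Asy.quasiTop A B).quot (Asy.setoid A B)
  pt := Quotient.mk _ (Asy.zero A B)

/-- The class of an asymptotic morphism. -/
def Asy.cls {A B : GrCStar 𝕜} (φ : Asy A B) : (AsySpace A B).carrier :=
  Quotient.mk (Asy.setoid A B) φ

/-- Composition of classes of asymptotic morphisms with a graded `*`-homomorphism `B → B'`. -/
def AsySpace.post {A B B' : GrCStar 𝕜} (g : GrHom B B') :
    (AsySpace A B).carrier → (AsySpace A B').carrier :=
  Quotient.map (sa := Asy.setoid A B) (sb := Asy.setoid A B') (Asy.postcomp g) fun φ ψ h a =>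
    Asy.tendsto_of_le (h a) (fun _ => norm_nonneg _) fun t => by
      change ‖g (φ.toFun t a) - g (ψ.toFun t a)‖ ≤ _
      rw [← map_sub g.toHom]
      exact g.norm_le _

/-! ### The spectrum of E-theory -/

section ETheorySpectrum

variable {H : Type} [NormedAddCommGroup H] [InnerProductSpace 𝕜 H] [CompleteSpace H]

/-- The source `𝒮 ⊗̂ A ⊗̂ 𝒦`. -/
abbrev srcAlg (A : GrCStar 𝕜) (H₀ : Submodule 𝕜 H) [H₀.HasOrthogonalProjection] : GrCStar 𝕜 :=
  (SAlg 𝕜).tensor (A.tensor (KAlg H₀))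

/-- The target `B ⊗̂ 𝔽_{m,0} ⊗̂ 𝒦`. -/
abbrev tgtAlg (B : GrCStar 𝕜) (H₀ : Submodule 𝕜 H) [H₀.HasOrthogonalProjection] (m : ℕ) :
    GrCStar 𝕜 :=
  B.tensor ((CliffAlg 𝕜 m).tensor (KAlg H₀))

variable (A B : GrCStar 𝕜) (H₀ : Submodule 𝕜 H) [H₀.HasOrthogonalProjection]

/-- The based quasi-topological space
`X_m = Asy_g(𝒮 ⊗̂ A ⊗̂ 𝒦, B ⊗̂ 𝔽_{m,0} ⊗̂ 𝒦)`. -/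
def XSpace (m : ℕ) : BQSpace := AsySpace (srcAlg A H₀) (tgtAlg B H₀ m)

/-- The action of `O(m)` on `X_m`: composition with the automorphism
`b ⊗ x ⊗ k ↦ b ⊗ H(x) ⊗ k`, where `H(v₁ ⋯ v_k) = H(v₁) ⋯ H(v_k)` on the Clifford algebra. -/
def XAct (m : ℕ) (U : O m) : (XSpace A B H₀ m).carrier → (XSpace A B H₀ m).carrier :=
  AsySpace.post
    (tensorMap (GrHom.id B) (tensorMap (cliffMap (orthIso U)) (GrHom.id (KAlg H₀))))

end ETheorySpectrum

section StructureMaps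

/-- The coordinate function on `[-R, R]`. -/
def coordR (R : ℝ) : (SRAlg 𝕜 R).carrier :=
  (⟨fun x => (x.1 : 𝕜), RCLike.continuous_ofReal.comp continuous_subtype_val⟩ :
    C(Set.Icc (-R) R, 𝕜))

/-- The unit of `C[-R, R]`. -/
def oneR (R : ℝ) : (SRAlg 𝕜 R).carrier := (1 : C(Set.Icc (-R) R, 𝕜))

/-- The element `X_R ⊗ 1 + 1 ⊗ X_R` of `C[-R, R] ⊗̂ C[-R, R]`, where `X_R` is the coordinate
function. -/
def sumR (R : ℝ) : ((SRAlg 𝕜 R).tensor (SRAlg 𝕜 R)).carrier :=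
  tmul (coordR R) (oneR R) + tmul (oneR R) (coordR R)

/-- The powers of `X_R ⊗ 1 + 1 ⊗ X_R`. -/
def sumRPow (R : ℝ) : ℕ → ((SRAlg 𝕜 R).tensor (SRAlg 𝕜 R)).carrier
  | 0 => tmul (oneR R) (oneR R)
  | k + 1 => sumRPow R k * sumR R

/-- The value of a polynomial at `X_R ⊗ 1 + 1 ⊗ X_R`. -/
def sumRPoly (R : ℝ) (p : Polynomial 𝕜) : ((SRAlg 𝕜 R).tensor (SRAlg 𝕜 R)).carrier :=
  p.sum fun k c => c • sumRPow R k

/-- `Δ : 𝒮 → 𝒮 ⊗̂ 𝒮` is given by functional calculus: for every `R > 0`, the image of `Δ(f)` in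
`C[-R, R] ⊗̂ C[-R, R]` is `f(X_R ⊗ 1 + 1 ⊗ X_R)`. The continuous functional calculus is expressed by
uniform approximation of `f` by polynomials on `[-2R, 2R]`, an interval that contains the spectrum of
the self-adjoint element `X_R ⊗ 1 + 1 ⊗ X_R`. -/
def IsComult (Δ : GrHom (SAlg 𝕜) ((SAlg 𝕜).tensor (SAlg 𝕜))) : Prop :=
  ∀ (R : ℝ), 0 < R → ∀ (f : C₀(ℝ, 𝕜)) (p : Polynomial 𝕜) (ε : ℝ),
    (∀ x ∈ Set.Icc (-(2 * R)) (2 * R), ‖f x - p.eval (x : 𝕜)‖ ≤ ε) →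
      ‖tensorMap (restrictS R) (restrictS R) (Δ f) - sumRPoly R p‖ ≤ ε

/-- `α : (A ⊗̂ B) ⊗̂ C → A ⊗̂ (B ⊗̂ C)` is the associativity isomorphism. -/
def IsAssoc {A B C : GrCStar 𝕜} (α : GrHom ((A.tensor B).tensor C) (A.tensor (B.tensor C))) :
    Prop :=
  ∀ a b c, α (tmul (tmul a b) c) = tmul a (tmul b c)

/-- The isometry of `ℝᵐ` onto the span of the first `m` coordinate vectors of `ℝᵐ⁺¹`. -/
def inclFirst (m : ℕ) : EuclideanSpace ℝ (Fin m) →ₗᵢ[ℝ] EuclideanSpace ℝ (Fin (m + 1)) where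
  toFun v := WithLp.toLp 2 (Fin.snoc (α := fun _ => ℝ) v.ofLp 0)
  map_add' v w := by
    ext i
    refine Fin.lastCases ?_ (fun j => ?_) i <;> simp
  map_smul' c v := by
    ext i
    refine Fin.lastCases ?_ (fun j => ?_) i <;> simp
  norm_map' v := by
    simp [EuclideanSpace.norm_eq, Fin.sum_univ_castSucc]

/-- The isometry of `ℝ¹` onto the span of the last coordinate vector of `ℝᵐ⁺¹`. -/
def inclLast (m : ℕ) : EuclideanSpace ℝ (Fin 1) →ₗᵢ[ℝ] EuclideanSpace ℝ (Fin (m + 1)) where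
  toFun v := WithLp.toLp 2 (Fin.snoc (α := fun _ => ℝ) (fun _ => 0) (v 0))
  map_add' v w := by
    ext i
    refine Fin.lastCases ?_ (fun j => ?_) i <;> simp
  map_smul' c v := by
    ext i
    refine Fin.lastCases ?_ (fun j => ?_) i <;> simp
  norm_map' v := by
    simp [EuclideanSpace.norm_eq, Fin.sum_univ_castSucc]

/-- `θ : 𝔽_{1,0} ⊗̂ (B ⊗̂ 𝔽_{m,0} ⊗̂ K) → B ⊗̂ 𝔽_{m+1,0} ⊗̂ K` is the homomorphism that moves the first
factor, with the sign of the graded flip, to the right of `𝔽_{m,0}` and multiplies: the generators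
of `𝔽_{m,0}` become `e₁, …, e_m` and the generator of `𝔽_{1,0}` becomes `e_{m+1}`. -/
def IsShuffle {B K : GrCStar 𝕜} {m : ℕ}
    (θ : GrHom ((CliffAlg 𝕜 1).tensor (B.tensor ((CliffAlg 𝕜 m).tensor K)))
      (B.tensor ((CliffAlg 𝕜 (m + 1)).tensor K))) : Prop :=
  ∀ (i j l : Bool) (c : (CliffAlg 𝕜 1).carrier) (b : B.carrier) (x : (CliffAlg 𝕜 m).carrier)
    (k : K.carrier), (CliffAlg 𝕜 1).toAlg.IsHomog i c → B.toAlg.IsHomog j b →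
    (CliffAlg 𝕜 m).toAlg.IsHomog l x →
      θ (tmul c (tmul b (tmul x k))) =
        (if i && (j ^^ l) then (-1 : 𝕜) else 1) •
          tmul b (tmul (cliffMap (inclFirst m) x * cliffMap (inclLast m) c) k)

/-- `z` represents `id_D ⊗̂ x`: it satisfies `z_t(d ⊗ a) - d ⊗ x_t(a) → 0` for all `d` and `a`. This
determines `z` up to asymptotic equivalence. -/
def IsIdTensor {D A B : GrCStar 𝕜} (x : Asy A B) (z : Asy (D.tensor A) (D.tensor B)) : Prop :=
  ∀ (d : D.carrier) (a : A.carrier),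
    Tendsto (fun t => ‖z.toFun t (tmul d a) - tmul d (x.toFun t a)‖) atTop (𝓝 0)

end StructureMaps

end ETheory

end

open ETheory

/-!
The proof turns asymptotic morphisms into homomorphisms and the structure maps into convolutions with
Bott maps, for which the axioms of an orthogonal spectrum follow from the coassociativity of the
comultiplication of `𝒮` and from the additivity of the Bott maps at orthogonal vectors.

*Asymptotic morphisms.* Let `AsyAlg B` be the algebra of bounded continuous functions `[1, ∞) → B`
modulo those that vanish at infinity. Classes of asymptotic morphisms from `A` to `B` are the same as
graded `*`-homomorphisms `A → AsyAlg B` (`Asy.hat`, `asyLift`, `cls_eq_cls`). The morphism `id ⊗̂ x`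
corresponds to the composition of `id ⊗̂ x.hat` with a homomorphism `tau` from `D ⊗̂ AsyAlg B` to
`AsyAlg (D ⊗̂ B)` (`isIdTensor_iff`).

*Homomorphisms out of tensor products.* With the maximal norm, a homomorphism out of `A ⊗̂ B` is given by
two homomorphisms that commute in the graded sense (`pairHom`). To map into a tensor product, one uses
that its factors act on it by multipliers (`multLeft`, `multRight`) and that products of these
multipliers lie in the tensor product again (`emb_tmul`, `exists_pairLift`). This gives the
associativity homomorphism, the homomorphism `θ` and `tau`. Actions on the algebraic tensor product are
bounded for every C*-norm because `1 - z* z` is a square in the unitization if `‖z‖ < 1`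
(`norm_act_le`).

*The comultiplication.* For real `x` and `y`, the Clifford algebra of the plane, acting on the exterior
algebra, gives a representation `spinHom x y` of `𝒮 ⊗̂ 𝒮` that sends `f ⊗ g` to `f(x e₁) g(y e₂)`. These
representations determine the norm (`norm_le_of_points`). To see this, interpolate an element of the
algebraic tensor product on a grid. The result is a combination of tents, whose coefficients are
bounded by the norms in the representations at the nodes. The tents fall into 64 families of mutually
orthogonal elements, so the norm is at most 64 times the supremum; the C*-identity, applied to high
powers, removes the factor 64 (`norm_le_of_family`). Therefore `Δ(f)` can be prescribed by its images
`f(x e₁ + y e₂)`, and it exists because it does for the generators `exp (-x²)` and `x exp (-x²)`, for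
which `Δ` is `u ⊗ u` and `u ⊗ v + v ⊗ u` (`exists_comult`). The same estimate on `[-R, R]²` shows that the
image of `Δ(f)` in `C[-R, R] ⊗̂ C[-R, R]` is the functional calculus of `X_R ⊗ 1 + 1 ⊗ X_R`
(`isComult_comult`), and the formulas on generators show that `Δ` is coassociative
(`isCoassoc_comult`).

*The spectrum.* For a point `s` of the `n`-sphere let `bottTwist m n s` be the homomorphism from
`𝒮 ⊗̂ B ⊗̂ 𝔽_{m,0} ⊗̂ K` to `B ⊗̂ 𝔽_{m+n,0} ⊗̂ K` given by the Bott map at `s`, which is functional calculus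
`f ↦ f(s)` in `𝔽_{n,0}` and zero at infinity. The structure map is convolution with `bottTwist m 1 s`. An
iterated convolution is a convolution (`conv_conv`), the Bott maps at orthogonal vectors convolve to
the Bott map at their sum (`bottVec_add`), and so the iterated structure map is convolution with
`bottTwist m n s` (`iterVec_structMap`). In this form equivariance is clear, since an isometry `U` of `ℝⁿ`
sends `f(s)` to `f(U s)` (`midMap_bottTwist`). Quasi-continuity holds because a pointwise continuous family
of homomorphisms over a compact space `Y` is a homomorphism to the functions on `Y` (`famHom`,
`quasiCts_of_lift`), and the Bott maps are continuous, also at infinity (`continuous_bottSph`).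
-/


noncomputable section

namespace ETheory

open Filter Topology TensorProduct ZeroAtInfty

variable {𝕜 : Type} [RCLike 𝕜]

section

open MultiplierAlgebra

/-! ### Square roots and contractivity -/

/-- For self-adjoint `h` with `‖h‖ < 1` there is a self-adjoint `s` with `(1 - s)² = 1 - h` in the
unitization. It is the fixed point of the contraction `s ↦ (h + s²) / 2`. -/
theorem exists_one_sub_sq (A : GrCStar 𝕜) {h : A.carrier} (hs : star h = h) (hn : ‖h‖ < 1) :
    ∃ s : A.carrier, star s = s ∧ s + s - s * s = h := by
  set K : Set A.carrier := {x | ‖x‖ ≤ ‖h‖ ∧ star x = x}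
  set f : A.carrier → A.carrier := fun s => (2⁻¹ : 𝕜) • (h + s * s)
  have hK : IsComplete K := by
    refine IsClosed.isComplete ?_
    exact (isClosed_le continuous_norm continuous_const).inter
      (isClosed_eq continuous_star continuous_id)
  have h2 : ‖(2⁻¹ : 𝕜)‖ = 2⁻¹ := by simp
  have hf : Set.MapsTo f K K := by
    rintro x ⟨hx, hx'⟩
    constructor
    · change ‖(2⁻¹ : 𝕜) • (h + x * x)‖ ≤ ‖h‖
      rw [norm_smul, h2]
      have h3 := norm_add_le h (x * x)
      have h4 := norm_mul_le x x
      nlinarith [norm_nonneg x, norm_nonneg h]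
    · change star ((2⁻¹ : 𝕜) • (h + x * x)) = (2⁻¹ : 𝕜) • (h + x * x)
      rw [star_smul, star_add, star_mul, hx', hs]
      simp
  have hc : ContractingWith ‖h‖₊ (hf.restrict f K K) := by
    refine ⟨by exact_mod_cast hn, LipschitzWith.of_dist_le_mul ?_⟩
    rintro ⟨x, hx, _⟩ ⟨y, hy, _⟩
    change dist ((2⁻¹ : 𝕜) • (h + x * x)) ((2⁻¹ : 𝕜) • (h + y * y)) ≤ ‖h‖ * dist x y
    rw [dist_eq_norm, dist_eq_norm, ← smul_sub, norm_smul, h2]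
    have e : h + x * x - (h + y * y) = x * (x - y) + (x - y) * y := by noncomm_ring
    rw [e]
    have h3 := norm_add_le (x * (x - y)) ((x - y) * y)
    have h4 := norm_mul_le x (x - y)
    have h5 := norm_mul_le (x - y) y
    nlinarith [norm_nonneg (x - y), mul_le_mul_of_nonneg_right hx (norm_nonneg (x - y)),
      mul_le_mul_of_nonneg_right hy (norm_nonneg (x - y))]
  obtain ⟨s, ⟨-, h1⟩, h3, -⟩ := hc.exists_fixedPoint' hK hf
    (show (0 : A.carrier) ∈ K from ⟨by simp, star_zero _⟩) (edist_ne_top _ _)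
  refine ⟨s, h1, ?_⟩
  have h4 : (2⁻¹ : 𝕜) • (h + s * s) = s := h3
  have h5 : h + s * s = (2 : 𝕜) • s := by
    rw [← h4, smul_smul, mul_inv_cancel₀ two_ne_zero, one_smul, h4]
  rw [← two_smul 𝕜 s, ← h5]
  abel

/-- An action of a C*-algebra by adjointable operators is contractive in every representation:
if `‖z‖ < 1` and `(1 - s)² = 1 - z* z`, then
`(z w)* (z w) + (w - s w)* (w - s w) = w* w`. -/
theorem norm_act_le {Z C : GrCStar 𝕜} {P : Type} [NonUnitalRing P] [Module 𝕜 P] [StarRing P]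
    (π : P →⋆ₙₐ[𝕜] C.carrier) (act : Z.carrier →ₗ[𝕜] P →ₗ[𝕜] P)
    (hmul : ∀ y z w, act (y * z) w = act y (act z w))
    (hadj : ∀ z w w', star (act z w) * w' = star w * act (star z) w') (z : Z.carrier) (w : P) :
    ‖π (act z w)‖ ≤ ‖z‖ * ‖π w‖ := by
  have key : ∀ z : Z.carrier, ‖z‖ < 1 → ‖π (act z w)‖ ≤ ‖π w‖ := by
    intro z hz
    obtain ⟨s, hs, e⟩ := exists_one_sub_sq Z (h := star z * z) (by simp)
      (by rw [CStarRing.norm_star_mul_self]; nlinarith [norm_nonneg z])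
    have e1 : star (act z w) * act z w + star (w - act s w) * (w - act s w) = star w * w := by
      have a1 : star (act z w) * act z w = star w * act (star z * z) w := by rw [hadj, hmul]
      have a2 : ∀ w', star (act s w) * w' = star w * act s w' := fun w' => by rw [hadj, hs]
      rw [a1, ← e, star_sub, sub_mul, a2]
      simp only [map_sub, map_add, LinearMap.sub_apply, LinearMap.add_apply, hmul, mul_sub, mul_add]
      abel
    have h1 := C.norm_sq_le (π (act z w)) (π (w - act s w))
    -- `norm_sq_le` bounds one summand of `w* w` by the whole
    rw [← map_star π, ← map_star π, ← map_mul π, ← map_mul π, ← map_add π, e1, map_mul, map_star,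
      CStarRing.norm_star_mul_self, ← sq] at h1
    exact le_of_sq_le_sq h1 (norm_nonneg _)
  have key2 : ∀ r : ℝ, ‖z‖ < r → ‖π (act z w)‖ ≤ r * ‖π w‖ := by
    intro r hr
    have hr0 : 0 < r := (norm_nonneg z).trans_lt hr
    have h1 := key (((r⁻¹ : ℝ) : 𝕜) • z) (by
      rw [norm_smul, RCLike.norm_ofReal, abs_of_pos (inv_pos.2 hr0), inv_mul_lt_one₀ hr0]
      exact hr)
    rw [map_smul, LinearMap.smul_apply, map_smul, norm_smul, RCLike.norm_ofReal,
      abs_of_pos (inv_pos.2 hr0), inv_mul_le_iff₀ hr0] at h1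
    exact h1
  refine le_of_forall_gt_imp_ge_of_dense fun c hc => ?_
  by_cases hw : ‖π w‖ = 0
  · have := key2 (‖z‖ + 1) (by linarith)
    rw [hw, mul_zero] at this hc
    exact this.trans hc.le
  · have hw' : 0 < ‖π w‖ := lt_of_le_of_ne (norm_nonneg _) (Ne.symm hw)
    have := key2 (c / ‖π w‖) (by rwa [lt_div_iff₀ hw'])
    rwa [div_mul_cancel₀ _ hw] at this

/-- A `*`-homomorphism between C*-algebras is contractive. -/
theorem norm_starHom_le {A B : GrCStar 𝕜} (f : A.carrier →⋆ₙₐ[𝕜] B.carrier) (a : A.carrier) :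
    ‖f a‖ ≤ ‖a‖ := by
  have h := norm_act_le (Z := A) (C := B) (NonUnitalStarAlgHom.id 𝕜 B.carrier)
    ((LinearMap.mul 𝕜 B.carrier).comp (f : A.carrier →ₗ[𝕜] B.carrier))
    (fun y z w => by simp [mul_assoc]) (fun z w w' => by simp [mul_assoc, map_star]) a (star (f a))
  simp only [LinearMap.comp_apply, LinearMap.mul_apply', NonUnitalStarAlgHom.coe_id, id,
    norm_star] at h
  have h' : ‖f a * star (f a)‖ ≤ ‖a‖ * ‖f a‖ := h
  rw [CStarRing.norm_self_mul_star] at h'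
  by_contra hc
  nlinarith [norm_nonneg (f a), norm_nonneg a]

/-- A graded `*`-homomorphism from an algebraic one. -/
def GrHom.ofHom {A B : GrCStar 𝕜} (f : A.carrier →⋆ₙₐ[𝕜] B.carrier)
    (hf : ∀ a, f (A.grade a) = B.grade (f a)) : GrHom A B := ⟨f, hf, norm_starHom_le f⟩

@[ext]
theorem GrHom.ext {A B : GrCStar 𝕜} {f g : GrHom A B} (h : ∀ a, f a = g a) : f = g := by
  have e : f.toHom = g.toHom := NonUnitalStarAlgHom.ext h
  cases f
  cases g
  congr

@[simp] theorem GrHom.comp_apply {A B C : GrCStar 𝕜} (g : GrHom B C) (f : GrHom A B) (a) :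
    g.comp f a = g (f a) := rfl

@[simp] theorem GrHom.id_apply {A : GrCStar 𝕜} (a) : GrHom.id A a = a := rfl

/-- The grading is continuous. -/
theorem GrCStar.continuous_grade (A : GrCStar 𝕜) : Continuous A.grade :=
  AddMonoidHomClass.continuous_of_bound A.grade 1 fun b => by rw [one_mul, A.norm_grade]

/-! ### Multiplier algebras -/

section Mult

variable (E : GrCStar 𝕜)

theorem DC.adj (a : 𝓜(𝕜, E.carrier)) (x y : E.carrier) :
    star (a.fst x) * y = star x * (star a).fst y := by
  have := (star a).central (star x) y
  rwa [DoubleCentralizer.star_snd, star_star] at this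

variable {E} in
theorem DC.ext_fst {a b : 𝓜(𝕜, E.carrier)} (h : ∀ x, a.fst x = b.fst x) : a = b := by
  have : (a - b).fst = 0 := by
    ext x
    simp [h]
  rw [← sub_eq_zero, ← norm_eq_zero, ← DoubleCentralizer.norm_fst, this, norm_zero]

/-- The grading as a continuous linear map. -/
def GrCStar.gradeL : E.carrier →L[𝕜] E.carrier := ⟨E.grade, E.continuous_grade⟩

/-- The grading of the multiplier algebra: conjugation by the grading. -/
def multGradeFun (a : 𝓜(𝕜, E.carrier)) : 𝓜(𝕜, E.carrier) where
  fst := E.gradeL ∘L a.fst ∘L E.gradeL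
  snd := E.gradeL ∘L a.snd ∘L E.gradeL
  central x y := by
    have := congrArg E.grade (a.central (E.grade x) (E.grade y))
    rw [E.grade_mul, E.grade_mul, E.grade_grade, E.grade_grade] at this
    exact this

theorem norm_multGradeFun_le (a : 𝓜(𝕜, E.carrier)) : ‖multGradeFun E a‖ ≤ ‖a‖ := by
  rw [← DoubleCentralizer.norm_fst, ← DoubleCentralizer.norm_fst]
  refine ContinuousLinearMap.opNorm_le_bound _ (norm_nonneg _) fun x => ?_
  change ‖E.grade (a.fst (E.grade x))‖ ≤ _
  rw [E.norm_grade, ← E.norm_grade x]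
  exact a.fst.le_opNorm _

theorem multGradeFun_grade (a : 𝓜(𝕜, E.carrier)) : multGradeFun E (multGradeFun E a) = a :=
  DC.ext_fst fun x => by
    change E.grade (E.grade (a.fst (E.grade (E.grade x)))) = _
    rw [E.grade_grade, E.grade_grade]

/-- The multiplier algebra of a graded C*-algebra. -/
def Mult : GrCStar 𝕜 where
  carrier := 𝓜(𝕜, E.carrier)
  norm_sq_le a b := by
    have h : ‖a‖ ≤ Real.sqrt ‖star a * a + star b * b‖ := by
      rw [← DoubleCentralizer.norm_fst]
      refine ContinuousLinearMap.opNorm_le_bound _ (Real.sqrt_nonneg _) fun x => ?_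
      have h1 := E.norm_sq_le (a.fst x) (b.fst x)
      rw [DC.adj, DC.adj, ← mul_add] at h1
      have h2 := norm_mul_le (star x) ((star a).fst (a.fst x) + (star b).fst (b.fst x))
      have h3 := (star a * a + star b * b).fst.le_opNorm x
      rw [DoubleCentralizer.norm_fst] at h3
      have h4 : (star a * a + star b * b).fst x =
        (star a).fst (a.fst x) + (star b).fst (b.fst x) := rfl
      rw [h4] at h3
      rw [norm_star] at h2
      refine le_of_sq_le_sq ?_ (by positivity)
      rw [mul_pow, Real.sq_sqrt (norm_nonneg _)]
      nlinarith [norm_nonneg x]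
    calc ‖a‖ ^ 2 ≤ Real.sqrt ‖star a * a + star b * b‖ ^ 2 :=
          pow_le_pow_left₀ (norm_nonneg _) h 2
      _ = _ := Real.sq_sqrt (norm_nonneg _)
  grade :=
    { toFun := multGradeFun E
      map_add' := fun a b => DC.ext_fst fun x => map_add E.grade _ _
      map_smul' := fun c a => DC.ext_fst fun x => map_smul E.grade _ _ }
  grade_grade := multGradeFun_grade E
  grade_mul a b := DC.ext_fst fun x => by
    change E.grade (a.fst (b.fst (E.grade x))) =
      E.grade (a.fst (E.grade (E.grade (b.fst (E.grade x)))))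
    rw [E.grade_grade]
  grade_star a := DC.ext_fst fun x => by
    change E.grade (star (a.snd (star (E.grade x)))) = star (E.grade (a.snd (E.grade (star x))))
    rw [E.grade_star, E.grade_star]
  norm_grade a := by
    refine le_antisymm (norm_multGradeFun_le E a) ?_
    have := norm_multGradeFun_le E (multGradeFun E a)
    rwa [multGradeFun_grade] at this

variable {E}

/-- The action of a multiplier on `E` from the left. -/
def Mult.app (a : (Mult E).carrier) : E.carrier →L[𝕜] E.carrier :=
  (show 𝓜(𝕜, E.carrier) from a).fst

theorem Mult.ext {a b : (Mult E).carrier} (h : ∀ x, Mult.app a x = Mult.app b x) : a = b :=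
  DC.ext_fst h

@[simp] theorem Mult.app_add (a b : (Mult E).carrier) (x) :
    Mult.app (a + b) x = Mult.app a x + Mult.app b x := rfl
@[simp] theorem Mult.app_mul (a b : (Mult E).carrier) (x) :
    Mult.app (a * b) x = Mult.app a (Mult.app b x) := rfl
@[simp] theorem Mult.app_smul (c : 𝕜) (a : (Mult E).carrier) (x) :
    Mult.app (c • a) x = c • Mult.app a x := rfl
theorem Mult.app_grade (a : (Mult E).carrier) (x) :
    Mult.app ((Mult E).grade a) x = E.grade (Mult.app a (E.grade x)) := rfl
theorem Mult.adj (a : (Mult E).carrier) (x y : E.carrier) :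
    star (Mult.app a x) * y = star x * Mult.app (star a) y := DC.adj E a x y
theorem Mult.app_mul_right (a : (Mult E).carrier) (x y : E.carrier) :
    Mult.app a (x * y) = Mult.app a x * y := by
  have h1 : ∀ z, star z * Mult.app a (x * y) = star z * (Mult.app a x * y) := fun z => by
    have h := Mult.adj (star a) z (x * y)
    have h' := Mult.adj (star a) z x
    rw [star_star] at h h'
    rw [← h, ← mul_assoc, h', mul_assoc]
  have h2 := h1 (Mult.app a (x * y) - Mult.app a x * y)
  rw [← sub_eq_zero, ← mul_sub, CStarRing.star_mul_self_eq_zero_iff, sub_eq_zero] at h2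
  exact h2

/-- A pair of mutually adjoint operators defines a multiplier. -/
def Mult.mk (T T' : E.carrier →L[𝕜] E.carrier) (h : ∀ x y, star (T x) * y = star x * T' y) :
    (Mult E).carrier :=
  ({ fst := T
     snd := (((starₗᵢ 𝕜 : E.carrier ≃ₗᵢ⋆[𝕜] E.carrier) : E.carrier →L⋆[𝕜] E.carrier).comp T').comp
          ((starₗᵢ 𝕜 : E.carrier ≃ₗᵢ⋆[𝕜] E.carrier) : E.carrier →L⋆[𝕜] E.carrier)
     central := fun x y => by
      have := congrArg star (h y (star x))
      rw [star_mul, star_mul, star_star, star_star, star_star] at this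
      exact this.symm } : 𝓜(𝕜, E.carrier))

@[simp] theorem Mult.app_mk (T T' : E.carrier →L[𝕜] E.carrier) (h) (x) :
    Mult.app (Mult.mk T T' h) x = T x := rfl

variable (E) in
/-- The inclusion of a graded C*-algebra in its multiplier algebra. -/
def emb : GrHom E (Mult E) :=
  GrHom.ofHom (B := Mult E) (DoubleCentralizer.coeHom (𝕜 := 𝕜) (A := E.carrier)) fun a =>
    Mult.ext fun x => by
      change E.grade a * x = E.grade (a * E.grade x)
      rw [E.grade_mul, E.grade_grade]

@[simp] theorem emb_app (a x : E.carrier) : Mult.app (emb E a) x = a * x := rfl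

theorem norm_emb (a : E.carrier) : ‖emb E a‖ = ‖a‖ := by
  refine le_antisymm ((emb E).norm_le a) ?_
  have h : ‖Mult.app (emb E a) (star a)‖ ≤ ‖emb E a‖ * ‖star a‖ := by
    refine (ContinuousLinearMap.le_opNorm _ _).trans_eq ?_
    congr 1
    exact DoubleCentralizer.norm_fst (𝕜 := 𝕜) (A := E.carrier) _
  rw [emb_app, CStarRing.norm_self_mul_star, norm_star] at h
  by_contra hc
  nlinarith [norm_nonneg a, norm_nonneg (emb E a)]

/-- Multiplication by a multiplier from the left stays in `E`. -/
theorem mult_mul_emb (a : (Mult E).carrier) (x : E.carrier) : a * emb E x = emb E (Mult.app a x) :=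
  Mult.ext fun y => by simp [Mult.app_mul_right]

end Mult

/-! ### Actions on a graded `*`-algebra as multipliers of its completions -/

/-- An action of the graded C*-algebra `Z` on the graded `*`-algebra `P` by adjointable operators. -/
structure Action (Z : GrCStar 𝕜) (P : GrStarAlg 𝕜) where
  act : Z.carrier →ₗ[𝕜] P.carrier →ₗ[𝕜] P.carrier
  mul : ∀ y z w, act (y * z) w = act y (act z w)
  adj : ∀ z w w', star (act z w) * w' = star w * act (star z) w'
  grade : ∀ z w, P.grade (act z w) = act (Z.grade z) (P.grade w)

namespace Action

variable {Z : GrCStar 𝕜} {P : GrStarAlg 𝕜} (ρ : Action Z P) (R : RepClass P)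

theorem nrm_le (z : Z.carrier) (w : P.carrier) : R.nrm (ρ.act z w) ≤ ‖z‖ * R.nrm w :=
  R.nrm_le (mul_nonneg (norm_nonneg _) (R.nrm_nonneg _)) fun _ π h =>
    (norm_act_le π.toHom ρ.act ρ.mul ρ.adj z w).trans
      (mul_le_mul_of_nonneg_left (R.le_nrm h w) (norm_nonneg _))

/-- The operator of an element of `Z` on `P`, as a bounded operator. -/
def pre (z : Z.carrier) : R.Pre →L[𝕜] R.Pre :=
  LinearMap.mkContinuous (E := R.Pre) (F := R.Pre) (ρ.act z) ‖z‖ (fun w => ρ.nrm_le R z w)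

/-- The operator of an element of `Z` on the completion of `P`. -/
def op (z : Z.carrier) : R.envelope.carrier →L[𝕜] R.envelope.carrier :=
  (ρ.pre R z).completion

theorem op_of (z : Z.carrier) (w : P.carrier) : ρ.op R z (R.of w) = R.of (ρ.act z w) :=
  ContinuousLinearMap.completion_apply_coe (ρ.pre R z) w

theorem induction_of {p : R.envelope.carrier → Prop} (hc : IsClosed {x | p x})
    (h : ∀ w, p (R.of w)) (x) : p x :=
  UniformSpace.Completion.induction_on (α := R.Pre) x hc h

theorem op_adj (z : Z.carrier) (x y : R.envelope.carrier) :
    star (ρ.op R z x) * y = star x * ρ.op R (star z) y := by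
  refine induction_of R (p := fun x => star (ρ.op R z x) * y = star x * ρ.op R (star z) y)
    (isClosed_eq (by fun_prop) (by fun_prop)) (fun w => ?_) x
  refine induction_of R (p := fun y => star (ρ.op R z (R.of w)) * y =
    star (R.of w) * ρ.op R (star z) y)
    (isClosed_eq (by fun_prop) (by fun_prop)) (fun w' => ?_) y
  rw [op_of, op_of, ← R.of_star, ← R.of_star]
  exact (R.of_mul _ _).symm.trans ((congrArg R.of (ρ.adj z w w')).trans (R.of_mul _ _))

/-- The multiplier of the completion of `P` given by an element of `Z`. -/
def mult (z : Z.carrier) : (Mult R.envelope).carrier := Mult.mk _ _ (ρ.op_adj R z)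

theorem mult_of (z : Z.carrier) (w : P.carrier) :
    Mult.app (ρ.mult R z) (R.of w) = R.of (ρ.act z w) := ρ.op_of R z w

theorem ext_of {a b : (Mult R.envelope).carrier}
    (h : ∀ w, Mult.app a (R.of w) = Mult.app b (R.of w)) : a = b :=
  Mult.ext fun x => induction_of R (p := fun x => Mult.app a x = Mult.app b x)
    (isClosed_eq (by fun_prop) (by fun_prop)) h x

/-- The homomorphism to the multiplier algebra given by an action. -/
def hom : GrHom Z (Mult R.envelope) := GrHom.ofHom
  { toFun := ρ.mult R
    map_smul' := fun c z => ext_of R fun w => by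
      rw [mult_of, MonoidHom.id_apply, Mult.app_smul, mult_of, map_smul, LinearMap.smul_apply]
      exact R.of_smul _ _
    map_zero' := ext_of R fun w => by
      rw [mult_of, map_zero, LinearMap.zero_apply, ← zero_smul 𝕜 (0 : P.carrier)]
      refine (R.of_smul _ _).trans ?_
      rw [zero_smul]
      rfl
    map_add' := fun y z => ext_of R fun w => by
      rw [mult_of, Mult.app_add, mult_of, mult_of, map_add, LinearMap.add_apply]
      exact R.of_add _ _
    map_mul' := fun y z => ext_of R fun w => by
      rw [mult_of, Mult.app_mul, mult_of, mult_of, ρ.mul]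
    map_star' := fun z => Mult.ext fun x => by
      have h1 : ∀ y, star y * Mult.app (ρ.mult R (star z)) x =
          star y * Mult.app (star (ρ.mult R z)) x := fun y => by
        rw [← Mult.adj, mult, mult, Mult.app_mk, Mult.app_mk, op_adj]
      have h2 := h1 (Mult.app (ρ.mult R (star z)) x - Mult.app (star (ρ.mult R z)) x)
      rw [← sub_eq_zero, ← mul_sub, CStarRing.star_mul_self_eq_zero_iff, sub_eq_zero] at h2
      exact h2 }
  fun z => ext_of R fun w => by
    change Mult.app (ρ.mult R _) _ = _
    rw [mult_of, Mult.app_grade, ← R.of_grade]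
    change _ = R.envelope.grade (Mult.app (ρ.mult R _) _)
    rw [mult_of, ← R.of_grade, ρ.grade, P.grade_grade]

theorem hom_of (z : Z.carrier) (w : P.carrier) :
    Mult.app (ρ.hom R z) (R.of w) = R.of (ρ.act z w) := ρ.op_of R z w

end Action

end

/-! ### Homomorphisms out of a graded tensor product -/

section Extend

variable {P : GrStarAlg 𝕜} {R : RepClass P} {C : GrCStar 𝕜}

/-- The extension to the completion of the linear map underlying a representation of the class. -/
def RepClass.extendL (π : Rep P C) (h : π ∈ R.mem C) : R.envelope.carrier →L[𝕜] C.carrier :=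
  (LinearMap.mkContinuous (E := R.Pre) (F := C.carrier) (π.toHom : P.carrier →ₗ[𝕜] C.carrier) 1
    (fun x => by rw [one_mul]; exact R.le_nrm h x)).fromCompletion

theorem RepClass.extendL_of (π : Rep P C) (h : π ∈ R.mem C) (x : P.carrier) :
    RepClass.extendL π h (R.of x) = π.toHom x :=
  ContinuousLinearMap.fromCompletion_apply_coe _ _

/-- A representation of the class extends to the completion. -/
def RepClass.extend (π : Rep P C) (h : π ∈ R.mem C) : GrHom R.envelope C := GrHom.ofHom
  { toFun := RepClass.extendL π h
    map_smul' := (RepClass.extendL π h).map_smul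
    map_zero' := map_zero _
    map_add' := map_add _
    map_mul' := fun x y => by
      refine Action.induction_of R (p := fun x => RepClass.extendL π h (x * y) =
        RepClass.extendL π h x * RepClass.extendL π h y)
        (isClosed_eq (by fun_prop) (by fun_prop)) (fun w => ?_) x
      refine Action.induction_of R (p := fun y => RepClass.extendL π h (R.of w * y) =
        RepClass.extendL π h (R.of w) * RepClass.extendL π h y)
        (isClosed_eq (by fun_prop) (by fun_prop)) (fun w' => ?_) y
      rw [extendL_of, extendL_of]
      exact (congrArg _ (R.of_mul w w').symm).trans ((extendL_of π h _).trans (map_mul _ _ _))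
    map_star' := fun x => by
      refine Action.induction_of R (p := fun x => RepClass.extendL π h (star x) =
        star (RepClass.extendL π h x))
        (isClosed_eq (by fun_prop) (by fun_prop)) (fun w => ?_) x
      rw [extendL_of, ← R.of_star]
      exact (extendL_of π h _).trans (map_star _ _) }
  fun x => by
    refine Action.induction_of R (p := fun x => RepClass.extendL π h (R.envelope.grade x) =
        C.grade (RepClass.extendL π h x))
        (isClosed_eq ((RepClass.extendL π h).continuous.comp R.envelope.continuous_grade)
          (C.continuous_grade.comp (RepClass.extendL π h).continuous)) (fun w => ?_) x
    rw [extendL_of, ← R.of_grade, extendL_of, π.map_grade]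

theorem RepClass.extend_of (π : Rep P C) (h : π ∈ R.mem C) (x : P.carrier) :
    RepClass.extend π h (R.of x) = π.toHom x := RepClass.extendL_of π h x

end Extend

section Tensor

variable {A B C D : GrCStar 𝕜}

theorem of_induction {p : (A.tensor B).carrier → Prop} (hc : IsClosed {x | p x})
    (h : ∀ w, p ((tensorClass A B).of w)) (x) : p x := Action.induction_of (tensorClass A B) hc h x

theorem tensor_induction {p : (A.tensor B).carrier → Prop} (hc : IsClosed {x | p x})
    (hadd : ∀ x y, p x → p y → p (x + y)) (h : ∀ a b, p (tmul a b)) (x) : p x := by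
  refine of_induction hc (fun w => ?_) x
  refine AlgTensor.induction (p := fun w => p ((tensorClass A B).of w)) (fun x y hx hy => ?_) h w
  rw [(tensorClass A B).of_add]
  exact hadd _ _ hx hy

theorem tmul_add (a : A.carrier) (b b' : B.carrier) : tmul a (b + b') = tmul a b + tmul a b' :=
  (congrArg _ (AlgTensor.mk_add (P := A.toAlg) (Q := B.toAlg) a b b')).trans
    ((tensorClass A B).of_add _ _)

theorem add_tmul (a a' : A.carrier) (b : B.carrier) : tmul (a + a') b = tmul a b + tmul a' b :=
  (congrArg _ (AlgTensor.add_mk (P := A.toAlg) (Q := B.toAlg) a a' b)).trans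
    ((tensorClass A B).of_add _ _)

theorem smul_tmul (c : 𝕜) (a : A.carrier) (b : B.carrier) : tmul (c • a) b = c • tmul a b :=
  (congrArg _ (TensorProduct.smul_tmul' c a b).symm).trans ((tensorClass A B).of_smul c _)

theorem tmul_smul (c : 𝕜) (a : A.carrier) (b : B.carrier) : tmul a (c • b) = c • tmul a b :=
  (congrArg _ (TensorProduct.tmul_smul c a b)).trans ((tensorClass A B).of_smul c _)

theorem norm_tmul_le (a : A.carrier) (b : B.carrier) : ‖tmul a b‖ ≤ ‖a‖ * ‖b‖ := by
  refine ((tensorClass A B).norm_of _).le.trans ?_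
  refine (tensorClass A B).nrm_le (mul_nonneg (norm_nonneg _) (norm_nonneg _)) ?_
  rintro C π ⟨φ, ψ, h, rfl⟩
  rw [pairRep_mk]
  exact (norm_mul_le _ _).trans
    (mul_le_mul (φ.norm_le a) (ψ.norm_le b) (norm_nonneg _) (norm_nonneg _))

/-- Elementary tensors, as a bounded bilinear map. -/
def tmulL (A B : GrCStar 𝕜) : A.carrier →L[𝕜] B.carrier →L[𝕜] (A.tensor B).carrier :=
  LinearMap.mkContinuous₂ (LinearMap.mk₂ 𝕜 tmul add_tmul smul_tmul tmul_add tmul_smul) 1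
    fun a b => by rw [one_mul]; exact norm_tmul_le a b

@[simp] theorem tmulL_apply (a : A.carrier) (b : B.carrier) : tmulL A B a b = tmul a b := rfl

theorem continuous_tmul_left (b : B.carrier) : Continuous fun a : A.carrier => tmul a b :=
  ((tmulL A B).flip b).continuous

theorem continuous_tmul_right (a : A.carrier) : Continuous fun b : B.carrier => tmul a b :=
  (tmulL A B a).continuous

theorem tensor_induction_homog {p : (A.tensor B).carrier → Prop} (hc : IsClosed {x | p x})
    (hadd : ∀ x y, p x → p y → p (x + y))
    (h : ∀ i j a b, A.toAlg.IsHomog i a → B.toAlg.IsHomog j b → p (tmul a b)) (x) : p x := by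
  refine tensor_induction hc hadd (fun a b => ?_) x
  refine A.toAlg.homog_induction (p := fun a => p (tmul a b)) (fun a a' h h' => ?_)
    (fun i a ha => ?_) a
  · exact (congrArg p (add_tmul (A := A) (B := B) a a' b)).mpr (hadd _ _ h h')
  refine B.toAlg.homog_induction (p := fun b => p (tmul a b)) (fun b b' h h' => ?_)
    (fun j b hb => h i j a b ha hb) b
  exact (congrArg p (tmul_add (A := A) (B := B) a b b')).mpr (hadd _ _ h h')

theorem tmul_mul_homog {i : Bool} (a c : A.carrier) (b d : B.carrier) (hc : A.toAlg.IsHomog i c) :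
    tmul a b * tmul c d = tmul (a * c) (B.toAlg.gradePow i b * d) :=
  ((tensorClass A B).of_mul _ _).symm.trans
    (congrArg _ (AlgTensor.mul_homog (P := A.toAlg) (Q := B.toAlg) a b d hc))

theorem grade_tmul (a : A.carrier) (b : B.carrier) :
    (A.tensor B).grade (tmul a b) = tmul (A.grade a) (B.grade b) :=
  ((tensorClass A B).of_grade _).symm

theorem GrHom.tensor_ext {f g : GrHom (A.tensor B) C} (h : ∀ a b, f (tmul a b) = g (tmul a b)) :
    f = g := by
  refine GrHom.ext fun x => tensor_induction (p := fun x => f x = g x)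
    (isClosed_eq f.continuous g.continuous) (fun x y hx hy => ?_) h x
  rw [map_add, map_add, hx, hy]

theorem GrHom.tensor_ext₃ {f g : GrHom ((A.tensor B).tensor C) D}
    (h : ∀ a b c, f (tmul (tmul a b) c) = g (tmul (tmul a b) c)) : f = g := by
  refine GrHom.tensor_ext fun x c => ?_
  refine tensor_induction (p := fun x => f (tmul x c) = g (tmul x c))
    (isClosed_eq (f.continuous.comp (continuous_tmul_left c))
      (g.continuous.comp (continuous_tmul_left c))) (fun x y hx hy => ?_) (fun a b => h a b c) x
  rw [add_tmul, map_add, map_add, hx, hy]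

/-- Graded commutation, without reference to homogeneous elements. -/
theorem GradedCommute.of_forall {φ : GrHom A C} {ψ : GrHom B C}
    (h : ∀ i a b, A.toAlg.IsHomog i a → ψ b * φ a = φ a * ψ (B.toAlg.gradePow i b)) :
    GradedCommute φ ψ := by
  intro i j a b ha hb
  have h1 := h i a b ha
  have hb' : B.grade b = if j then -b else b := hb
  have e : ψ (B.toAlg.gradePow i b) = if i && j then -ψ b else ψ b := by
    cases i
    · rfl
    · change ψ (B.grade b) = _
      rw [hb']
      cases j
      · rfl
      · exact map_neg ψ.toHom b
  rw [e] at h1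
  have h1' : ψ b * φ a = φ a * (if i && j then -ψ b else ψ b) := h1
  cases hij : (i && j)
  · simp only [hij, Bool.false_eq_true, if_false] at h1' ⊢
    exact h1'.symm
  · simp only [hij, if_true] at h1' ⊢
    rw [h1', mul_neg, neg_neg]

theorem GradedCommute.symm {φ : GrHom A C} {ψ : GrHom B C} (h : GradedCommute φ ψ) :
    GradedCommute ψ φ := by
  intro i j b a hb ha
  have h1 := h j i a b ha hb
  rw [Bool.and_comm] at h1
  cases hij : (i && j)
  · simp only [hij, Bool.false_eq_true, if_false] at h1 ⊢
    exact h1.symm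
  · simp only [hij, if_true] at h1 ⊢
    rw [h1, neg_neg]

/-- The homomorphism `a ⊗ b ↦ φ(a) ψ(b)`. -/
def pairHom (φ : GrHom A C) (ψ : GrHom B C) (h : GradedCommute φ ψ) : GrHom (A.tensor B) C :=
  RepClass.extend (R := tensorClass A B) (pairRep φ ψ h) ⟨φ, ψ, h, rfl⟩

@[simp] theorem pairHom_tmul (φ : GrHom A C) (ψ : GrHom B C) (h : GradedCommute φ ψ) (a b) :
    pairHom φ ψ h (tmul a b) = φ a * ψ b := RepClass.extend_of _ _ _

/-- The products `φ(a) ψ(b)` commute in the graded sense with whatever `φ` and `ψ` commute with, so that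
homomorphisms out of iterated tensor products can be built from several commuting homomorphisms. -/
theorem pairHom_commute (φ : GrHom A D) (ψ : GrHom B D) (h : GradedCommute φ ψ) (χ : GrHom C D)
    (h₁ : GradedCommute φ χ) (h₂ : GradedCommute ψ χ) : GradedCommute (pairHom φ ψ h) χ := by
  refine GradedCommute.symm (GradedCommute.of_forall fun i c z hc => ?_)
  refine tensor_induction (p := fun z => pairHom φ ψ h z * χ c =
    χ c * pairHom φ ψ h ((A.tensor B).toAlg.gradePow i z)) ?_ (fun x y hx hy => ?_)
    (fun a b => ?_) z
  · have hg : Continuous fun z => (A.tensor B).toAlg.gradePow i z := by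
      cases i
      · exact continuous_id
      · exact (A.tensor B).continuous_grade
    exact isClosed_eq ((pairHom φ ψ h).continuous.mul continuous_const)
      (continuous_const.mul ((pairHom φ ψ h).continuous.comp hg))
  · rw [map_add, map_add, map_add, add_mul, mul_add, hx, hy]
  · have e : (A.tensor B).toAlg.gradePow i (tmul a b) =
        tmul (A.toAlg.gradePow i a) (B.toAlg.gradePow i b) := by
      cases i
      · rfl
      · exact grade_tmul a b
    rw [e, pairHom_tmul, pairHom_tmul, mul_assoc, h₂.symm.swap b hc, ← mul_assoc,
      h₁.symm.swap a hc, mul_assoc]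

/-- A homomorphism whose values lie in the range of an isometric homomorphism factors through it. -/
theorem GrHom.exists_factor {E M : GrCStar 𝕜} (j : GrHom E M) (hj : ∀ e, ‖j e‖ = ‖e‖)
    (f : GrHom A M) (hf : ∀ a, ∃ e, j e = f a) : ∃ g : GrHom A E, ∀ a, j (g a) = f a := by
  have inj : ∀ x y, j x = j y → x = y := fun x y h => by
    rw [← sub_eq_zero, ← norm_eq_zero, ← hj, map_sub, h, sub_self, norm_zero]
  choose g hg using hf
  exact ⟨GrHom.ofHom
    { toFun := g
      map_smul' := fun c a => inj _ _ (by simp only [hg, map_smul, MonoidHom.id_apply])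
      map_zero' := inj _ _ (by simp only [hg, map_zero])
      map_add' := fun a b => inj _ _ (by simp only [hg, map_add])
      map_mul' := fun a b => inj _ _ (by simp only [hg, map_mul])
      map_star' := fun a => inj _ _ (by simp only [hg, map_star]) }
    (fun a => inj _ _ (by
      rw [j.map_grade]
      exact (hg _).trans ((f.map_grade a).trans (congrArg M.grade (hg a).symm)))), hg⟩

theorem isClosed_range_of_isometric {E M : GrCStar 𝕜} (j : GrHom E M) (hj : ∀ e, ‖j e‖ = ‖e‖) :
    IsClosed (Set.range j.toHom) :=
  (AddMonoidHomClass.isometry_of_norm j.toHom hj).isClosedEmbedding.isClosed_range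

/-- A pair of graded-commuting homomorphisms to `M` for which the products `φ(a) ψ(b)` lie in a
subalgebra `E` defines a homomorphism from the tensor product to `E`. -/
theorem exists_pairLift {E M : GrCStar 𝕜} (j : GrHom E M) (hj : ∀ e, ‖j e‖ = ‖e‖)
    (φ : GrHom A M) (ψ : GrHom B M) (h : GradedCommute φ ψ)
    (hr : ∀ a b, ∃ e, j e = φ a * ψ b) :
    ∃ g : GrHom (A.tensor B) E, ∀ a b, j (g (tmul a b)) = φ a * ψ b := by
  obtain ⟨g, hg⟩ := GrHom.exists_factor j hj (pairHom φ ψ h) fun x => by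
    refine tensor_induction (p := fun x => pairHom φ ψ h x ∈ Set.range j.toHom)
      ((isClosed_range_of_isometric j hj).preimage (pairHom φ ψ h).continuous)
      (fun x y hx hy => ?_) (fun a b => ?_) x
    · obtain ⟨e, he⟩ := hx
      obtain ⟨e', he'⟩ := hy
      exact ⟨e + e', by rw [map_add, map_add, he, he']⟩
    · rw [pairHom_tmul]
      exact hr a b
  exact ⟨g, fun a b => (hg _).trans (pairHom_tmul _ _ _ _ _)⟩

/-! ### The multipliers of a tensor product given by its factors -/

/-- Left multiplication on the first factor. -/
def leftAction (A B : GrCStar 𝕜) : Action A (algTensor A.toAlg B.toAlg) where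
  act := ((LinearMap.rTensorHom B.carrier).comp (LinearMap.mul 𝕜 A.carrier) :
    A.carrier →ₗ[𝕜] (A.carrier ⊗[𝕜] B.carrier) →ₗ[𝕜] (A.carrier ⊗[𝕜] B.carrier))
  mul y z w := by
    let F : A.carrier → AlgTensor A.toAlg B.toAlg →ₗ[𝕜] AlgTensor A.toAlg B.toAlg :=
      fun z => LinearMap.rTensor B.carrier (LinearMap.mul 𝕜 A.carrier z)
    change F (y * z) w = F y (F z w)
    refine AlgTensor.induction (p := fun w => F (y * z) w = F y (F z w))
      (fun x x' h h' => ?_) (fun a b => ?_) w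
    · simp only [map_add, h, h']
    · change AlgTensor.mk (P := A.toAlg) (Q := B.toAlg) (y * z * a) b =
        AlgTensor.mk (P := A.toAlg) (Q := B.toAlg) (y * (z * a)) b
      rw [mul_assoc]
  adj z w w' := by
    let F : A.carrier → AlgTensor A.toAlg B.toAlg →ₗ[𝕜] AlgTensor A.toAlg B.toAlg :=
      fun z => LinearMap.rTensor B.carrier (LinearMap.mul 𝕜 A.carrier z)
    have hF : ∀ z a b, F z (AlgTensor.mk a b) = AlgTensor.mk (z * a) b := fun _ _ _ => rfl
    change star (F z w) * w' = star w * F (star z) w'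
    refine A.toAlg.homog_induction (p := fun z => star (F z w) * w' = star w * F (star z) w')
      (fun z z' h h' => ?_) (fun k z hz => ?_) z
    · have e : ∀ w, F (z + z') w = F z w + F z' w := fun w => by
        change LinearMap.rTensor B.carrier (LinearMap.mul 𝕜 A.carrier (z + z')) w = _
        rw [map_add, LinearMap.rTensor_add]
        rfl
      have e' : ∀ w, F (star (z + z')) w = F (star z) w + F (star z') w := fun w => by
        change LinearMap.rTensor B.carrier (LinearMap.mul 𝕜 A.carrier (star (z + z'))) w = _
        rw [star_add, map_add, LinearMap.rTensor_add]
        rfl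
      rw [e, e', star_add, add_mul, mul_add, h, h']
    refine AlgTensor.induction_left (p := fun w => star (F z w) * w' = star w * F (star z) w')
      (fun x x' h h' => ?_) (fun i a b ha => ?_) w
    · rw [map_add, star_add, star_add, add_mul, add_mul, h, h']
    refine AlgTensor.induction_left (p := fun w' => star (F z (AlgTensor.mk a b)) * w' =
      star (AlgTensor.mk a b) * F (star z) w') (fun x x' h h' => ?_) (fun j c d hc => ?_) w'
    · rw [map_add, mul_add, mul_add, h, h']
    have hza := hz.mul ha
    have hzc := hz.star.mul hc
    rw [hF, hF, AlgTensor.star_homog _ ha, AlgTensor.star_homog _ hza, AlgTensor.mul_homog _ _ _ hc,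
      AlgTensor.mul_homog _ _ _ hzc, star_mul, mul_assoc, GrStarAlg.gradePow_gradePow,
      GrStarAlg.gradePow_gradePow]
    congr 3
    cases i <;> cases j <;> cases k <;> rfl
  grade z w := by
    let F : A.carrier → AlgTensor A.toAlg B.toAlg →ₗ[𝕜] AlgTensor A.toAlg B.toAlg :=
      fun z => LinearMap.rTensor B.carrier (LinearMap.mul 𝕜 A.carrier z)
    let G : AlgTensor A.toAlg B.toAlg →ₗ[𝕜] AlgTensor A.toAlg B.toAlg :=
      (algTensor A.toAlg B.toAlg).grade
    change G (F z w) = F (A.grade z) (G w)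
    refine AlgTensor.induction (p := fun w => G (F z w) = F (A.grade z) (G w))
      (fun x x' h h' => ?_) (fun a b => ?_) w
    · simp only [map_add, h, h']
    · change AlgTensor.mk (P := A.toAlg) (Q := B.toAlg) (A.grade (z * a)) (B.grade b) =
        AlgTensor.mk (P := A.toAlg) (Q := B.toAlg) (A.grade z * A.grade a) (B.grade b)
      rw [A.grade_mul]

/-- The homomorphism from the first factor to the multiplier algebra of a tensor product. -/
def multLeft (A B : GrCStar 𝕜) : GrHom A (Mult (A.tensor B)) :=
  (leftAction A B).hom (tensorClass A B)

@[simp] theorem multLeft_tmul (x : A.carrier) (a : A.carrier) (b : B.carrier) :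
    Mult.app (multLeft A B x) (tmul a b) = tmul (x * a) b :=
  (leftAction A B).hom_of (tensorClass A B) x _

/-- The operator `1 ⊗̂ T` on the algebraic tensor product for a multiplier `T = κ(z)` of the second
factor: `a ⊗ b ↦ a ⊗ δ^i(T) b` for `a` homogeneous of degree `i`. -/
def rightFun (A : GrCStar 𝕜) {Z B : GrCStar 𝕜} (κ : GrHom Z (Mult B)) :
    Z.carrier →ₗ[𝕜] AlgTensor A.toAlg B.toAlg →ₗ[𝕜] AlgTensor A.toAlg B.toAlg :=
  let L : Z.carrier →ₗ[𝕜] B.carrier →ₗ[𝕜] B.carrier :=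
    LinearMap.mk₂ 𝕜 (fun z b => Mult.app (κ z) b)
      (fun z z' b => by rw [map_add, Mult.app_add]) (fun c z b => by rw [map_smul, Mult.app_smul])
      (fun z b b' => map_add _ _ _) (fun c z b => map_smul _ _ _)
  (LinearMap.mk₂ 𝕜 (fun (z : Z.carrier) (w : A.carrier ⊗[𝕜] B.carrier) =>
      TensorProduct.map A.toAlg.even (L z) w + TensorProduct.map A.toAlg.odd (L (Z.grade z)) w)
    (fun z z' w => by
      simp only [map_add, TensorProduct.map_add_right, LinearMap.add_apply]
      exact add_add_add_comm _ _ _ _)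
    (fun c z w => by
      simp only [map_smul, TensorProduct.map_smul_right, LinearMap.smul_apply, smul_add])
    (fun z w w' => by simp only [map_add]; exact add_add_add_comm _ _ _ _)
    (fun c z w => by simp only [map_smul, smul_add]) :
    Z.carrier →ₗ[𝕜] (A.carrier ⊗[𝕜] B.carrier) →ₗ[𝕜] (A.carrier ⊗[𝕜] B.carrier))

theorem Mult.app_grade_apply (T : (Mult B).carrier) (b : B.carrier) :
    B.grade (Mult.app T b) = Mult.app ((Mult B).grade T) (B.grade b) := by
  rw [Mult.app_grade, B.grade_grade]

/-- The operator `1 ⊗̂ T` passes `a` at the cost of the sign of the graded tensor product. -/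
theorem rightFun_mk {Z : GrCStar 𝕜} (κ : GrHom Z (Mult B)) (z : Z.carrier) {i : Bool}
    {a : A.carrier} (ha : A.toAlg.IsHomog i a) (b : B.carrier) :
    rightFun A κ z (AlgTensor.mk (P := A.toAlg) (Q := B.toAlg) a b) =
      AlgTensor.mk (P := A.toAlg) (Q := B.toAlg) a (Mult.app (κ (Z.toAlg.gradePow i z)) b) := by
  have h : rightFun A κ z (AlgTensor.mk (P := A.toAlg) (Q := B.toAlg) a b) =
    AlgTensor.mk (P := A.toAlg) (Q := B.toAlg) (A.toAlg.even a) (Mult.app (κ z) b) +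
    AlgTensor.mk (P := A.toAlg) (Q := B.toAlg) (A.toAlg.odd a) (Mult.app (κ (Z.grade z)) b) := rfl
  rw [h]
  cases i
  · have h1 : A.toAlg.grade a = a := ha
    rw [A.toAlg.even_of_even h1, A.toAlg.odd_of_even h1, AlgTensor.zero_mk, add_zero]
    rfl
  · have h1 : A.toAlg.grade a = -a := ha
    rw [A.toAlg.even_of_odd h1, A.toAlg.odd_of_odd h1, AlgTensor.zero_mk, zero_add]
    rfl

theorem Mult.app_gradePow (i : Bool) (T : (Mult B).carrier) (b : B.carrier) :
    B.toAlg.gradePow i (Mult.app T b) =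
      Mult.app ((Mult B).toAlg.gradePow i T) (B.toAlg.gradePow i b) := by
  cases i
  · rfl
  · exact Mult.app_grade_apply T b

theorem GrHom.map_gradePow (f : GrHom A B) (i : Bool) (a : A.carrier) :
    f (A.toAlg.gradePow i a) = B.toAlg.gradePow i (f a) := f.toAlgMap.map_gradePow i a

/-- The action on a tensor product of an algebra that acts on the second factor by multipliers. -/
def rightAction (A : GrCStar 𝕜) {Z B : GrCStar 𝕜} (κ : GrHom Z (Mult B)) :
    Action Z (algTensor A.toAlg B.toAlg) where
  act := rightFun A κ
  mul y z w := by
    refine AlgTensor.induction_left (p := fun w => rightFun A κ (y * z) w =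
      rightFun A κ y (rightFun A κ z w)) (fun x x' h h' => ?_) (fun i a b ha => ?_) w
    · simp only [map_add, h, h']
    · rw [rightFun_mk κ _ ha, rightFun_mk κ _ ha, rightFun_mk κ _ ha]
      congr 1
      exact (congrArg (fun T => Mult.app (κ T) b) (GrStarAlg.gradePow_mul (P := Z.toAlg) i y z)).trans
        (by rw [map_mul, Mult.app_mul])
  adj z w w' := by
    refine AlgTensor.induction_left (p := fun w => star (rightFun A κ z w) * w' =
      star w * rightFun A κ (star z) w') (fun x x' h h' => ?_) (fun i a b ha => ?_) w
    · rw [map_add, star_add, star_add, add_mul, add_mul, h, h']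
    refine AlgTensor.induction_left (p := fun w' =>
      star (rightFun A κ z (AlgTensor.mk (P := A.toAlg) (Q := B.toAlg) a b)) * w' =
      star (AlgTensor.mk (P := A.toAlg) (Q := B.toAlg) a b) * rightFun A κ (star z) w')
      (fun x x' h h' => ?_) (fun j c d hc => ?_) w'
    · rw [map_add, mul_add, mul_add, h, h']
    rw [rightFun_mk κ _ ha, rightFun_mk κ _ hc, AlgTensor.star_homog _ ha,
      AlgTensor.star_homog _ ha, AlgTensor.mul_homog _ _ _ hc, AlgTensor.mul_homog _ _ _ hc,
      GrStarAlg.gradePow_gradePow, GrStarAlg.gradePow_gradePow, GrStarAlg.gradePow_star,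
      GrStarAlg.gradePow_star, Mult.app_gradePow]
    congr 1
    refine (Mult.adj _ _ _).trans ?_
    have e : (Mult B).toAlg.gradePow (j ^^ i) (κ (Z.toAlg.gradePow i z)) =
        κ (Z.toAlg.gradePow j z) := by
      rw [← κ.map_gradePow, GrStarAlg.gradePow_gradePow]
      cases i <;> cases j <;> rfl
    rw [e, ← map_star κ.toHom]
    exact congrArg (fun y => _ * Mult.app (κ y) d) (GrStarAlg.gradePow_star (P := Z.toAlg) j z).symm
  grade z w := by
    let G : AlgTensor A.toAlg B.toAlg →ₗ[𝕜] AlgTensor A.toAlg B.toAlg :=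
      (algTensor A.toAlg B.toAlg).grade
    have hG : ∀ a b, G (AlgTensor.mk a b) = AlgTensor.mk (A.grade a) (B.grade b) := fun _ _ => rfl
    change G (rightFun A κ z w) = rightFun A κ (Z.grade z) (G w)
    refine AlgTensor.induction_left (p := fun w => G (rightFun A κ z w) =
      rightFun A κ (Z.grade z) (G w)) (fun x x' h h' => ?_) (fun i a b ha => ?_) w
    · simp only [map_add, h, h']
    · have ha' : A.toAlg.IsHomog i (A.grade a) := by
        have h1 : A.grade a = if i then -a else a := ha
        change A.grade (A.grade a) = if i then -A.grade a else A.grade a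
        rw [h1]
        cases i <;> simp [h1]
      rw [rightFun_mk κ _ ha, hG, hG, rightFun_mk κ _ ha', Mult.app_grade_apply, ← κ.map_grade]
      refine congrArg (fun y => AlgTensor.mk (P := A.toAlg) (Q := B.toAlg) (A.grade a)
        (Mult.app (κ y) (B.grade b))) ?_
      exact (GrStarAlg.gradePow_grade (P := Z.toAlg) i z).symm

/-- The homomorphism `z ↦ 1 ⊗̂ κ(z)` to the multiplier algebra of a tensor product. -/
def multRight (A : GrCStar 𝕜) {Z B : GrCStar 𝕜} (κ : GrHom Z (Mult B)) :
    GrHom Z (Mult (A.tensor B)) := (rightAction A κ).hom (tensorClass A B)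

theorem multRight_tmul {Z : GrCStar 𝕜} (κ : GrHom Z (Mult B)) (z : Z.carrier) {i : Bool}
    {a : A.carrier} (ha : A.toAlg.IsHomog i a) (b : B.carrier) :
    Mult.app (multRight A κ z) (tmul a b) = tmul a (Mult.app (κ (Z.toAlg.gradePow i z)) b) :=
  ((rightAction A κ).hom_of (tensorClass A B) z _).trans (congrArg _ (rightFun_mk κ z ha b))

end Tensor

/-! ### Associativity and the shuffle homomorphism -/

section Assoc

variable {A B C D F F₁ F₂ K Z Z' Z'' : GrCStar 𝕜}

theorem GrCStar.homog_gradePow {i : Bool} {a : A.carrier} (h : A.toAlg.IsHomog i a) (j : Bool) :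
    A.toAlg.IsHomog i (A.toAlg.gradePow j a) := by
  cases j
  · exact h
  · have h1 : A.grade a = if i then -a else a := h
    change A.grade (A.grade a) = if i then -A.grade a else A.grade a
    rw [h1]
    cases i <;> simp [h1]

theorem gradePow_comm' (i j : Bool) (a : A.carrier) :
    A.toAlg.gradePow i (A.toAlg.gradePow j a) = A.toAlg.gradePow j (A.toAlg.gradePow i a) := by
  rw [GrStarAlg.gradePow_gradePow, GrStarAlg.gradePow_gradePow, Bool.xor_comm]

theorem GrHom.map_homog (f : GrHom A B) {i : Bool} {a : A.carrier} (h : A.toAlg.IsHomog i a) :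
    B.toAlg.IsHomog i (f a) := f.toAlgMap.homog h

/-- Multipliers of a tensor product agree if they agree on elementary tensors with homogeneous
factors. -/
theorem Mult.tensor_ext {S T : (Mult (A.tensor B)).carrier}
    (h : ∀ i j a b, A.toAlg.IsHomog i a → B.toAlg.IsHomog j b →
      Mult.app S (tmul a b) = Mult.app T (tmul a b)) : S = T :=
  Mult.ext fun x => tensor_induction_homog (p := fun x => Mult.app S x = Mult.app T x)
    (isClosed_eq (by fun_prop) (by fun_prop)) (fun x y hx hy => by rw [map_add, map_add, hx, hy])
    h x

theorem multLeft_commute (κ : GrHom Z (Mult B)) :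
    GradedCommute (multLeft A B) (multRight A κ) := by
  refine GradedCommute.of_forall fun i a z ha => Mult.tensor_ext fun j _ a' b ha' _ => ?_
  rw [Mult.app_mul, Mult.app_mul, multLeft_tmul, multRight_tmul κ z (ha.mul ha'),
    multRight_tmul κ _ ha', multLeft_tmul, GrStarAlg.gradePow_gradePow, Bool.xor_comm]

theorem multRight_commute {κ : GrHom Z (Mult B)} {κ' : GrHom Z' (Mult B)}
    (h : GradedCommute κ κ') : GradedCommute (multRight A κ) (multRight A κ') := by
  refine GradedCommute.of_forall fun i z z' hz => Mult.tensor_ext fun j _ a b ha _ => ?_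
  rw [Mult.app_mul, Mult.app_mul, multRight_tmul κ _ ha, multRight_tmul κ' _ ha,
    multRight_tmul κ' _ ha, multRight_tmul κ _ ha, ← Mult.app_mul, ← Mult.app_mul,
    h.swap _ (GrCStar.homog_gradePow hz j), gradePow_comm']

/-- `1 ⊗̂ -` is multiplicative, also for factors that come from different algebras. -/
theorem multRight_mul {κ : GrHom Z (Mult B)} {κ' : GrHom Z' (Mult B)} {κ'' : GrHom Z'' (Mult B)}
    {z : Z.carrier} {z' : Z'.carrier} {z'' : Z''.carrier} (h : κ'' z'' = κ z * κ' z') :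
    multRight A κ'' z'' = multRight A κ z * multRight A κ' z' := by
  refine Mult.tensor_ext fun j _ a b ha _ => ?_
  rw [Mult.app_mul, multRight_tmul κ'' _ ha, multRight_tmul κ' _ ha, multRight_tmul κ _ ha,
    ← Mult.app_mul, GrHom.map_gradePow, GrHom.map_gradePow, GrHom.map_gradePow, h,
    ← GrStarAlg.gradePow_mul]

/-- In the multiplier algebra, `a ⊗ b` is the product of `a ⊗ 1` and `1 ⊗ b`. This reduces the
construction of homomorphisms into tensor products to that of commuting homomorphisms to multiplier
algebras. -/
theorem emb_tmul (a : A.carrier) (b : B.carrier) :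
    emb (A.tensor B) (tmul a b) = multLeft A B a * multRight A (emb B) b :=
  Mult.tensor_ext fun j _ a' b' ha' _ => by
    rw [emb_app, Mult.app_mul, multRight_tmul _ _ ha', multLeft_tmul, emb_app,
      tmul_mul_homog _ _ _ _ ha']

theorem GradedCommute.postcomp {φ : GrHom A C} {ψ : GrHom B C} (h : GradedCommute φ ψ)
    (f : GrHom C D) : GradedCommute (f.comp φ) (f.comp ψ) :=
  GradedCommute.of_forall fun i a b ha => by
    rw [GrHom.comp_apply, GrHom.comp_apply, GrHom.comp_apply, ← map_mul, ← map_mul, h.swap b ha]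

/-- In the multiplier algebra of `A ⊗̂ (B ⊗̂ C)`, the three factors commute in the graded sense, so they
define a homomorphism on `(A ⊗̂ B) ⊗̂ C`, with values in `A ⊗̂ (B ⊗̂ C)`. -/
theorem exists_assoc (A B C : GrCStar 𝕜) :
    ∃ α : GrHom ((A.tensor B).tensor C) (A.tensor (B.tensor C)), IsAssoc α := by
  have h₁ := multLeft_commute (A := A) (multLeft B C)
  have h₂ := multLeft_commute (A := A) (multRight B (emb C))
  have h₃ := multRight_commute (A := A) (multLeft_commute (A := B) (emb C))
  have e : ∀ a b c, emb (A.tensor (B.tensor C)) (tmul a (tmul b c)) =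
      multLeft A (B.tensor C) a * multRight A (multLeft B C) b *
        multRight A (multRight B (emb C)) c := fun a b c => by
    rw [emb_tmul, mul_assoc, multRight_mul (emb_tmul b c)]
  obtain ⟨g, hg⟩ := exists_pairLift (emb (A.tensor (B.tensor C))) norm_emb (pairHom _ _ h₁) _
    (pairHom_commute _ _ h₁ _ h₂ h₃) fun z c => by
      refine tensor_induction (p := fun z => pairHom _ _ h₁ z * multRight A (multRight B (emb C)) c ∈
        Set.range (emb (A.tensor (B.tensor C))).toHom)
        ((isClosed_range_of_isometric _ norm_emb).preimage
          ((pairHom _ _ h₁).continuous.mul continuous_const)) (fun x y hx hy => ?_)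
        (fun a b => ⟨tmul a (tmul b c), by rw [e, pairHom_tmul]⟩) z
      obtain ⟨x', hx⟩ := hx
      obtain ⟨y', hy⟩ := hy
      exact ⟨x' + y', by rw [map_add, map_add, add_mul, hx, hy]⟩
  refine ⟨g, fun a b c => ?_⟩
  have h := hg (tmul a b) c
  rw [pairHom_tmul, ← e, ← sub_eq_zero, ← map_sub, ← norm_eq_zero, norm_emb, norm_eq_zero,
    sub_eq_zero] at h
  exact h

/-- The associativity homomorphism. -/
def assocHom (A B C : GrCStar 𝕜) : GrHom ((A.tensor B).tensor C) (A.tensor (B.tensor C)) :=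
  (exists_assoc A B C).choose

@[simp] theorem assocHom_tmul (a : A.carrier) (b : B.carrier) (c : C.carrier) :
    assocHom A B C (tmul (tmul a b) c) = tmul a (tmul b c) :=
  (exists_assoc A B C).choose_spec a b c

attribute [simp] tensorMap_tmul

theorem emb_injective : Function.Injective (emb A).toHom := fun x y h => by
  rw [← sub_eq_zero, ← norm_eq_zero, ← norm_emb, map_sub, h, sub_self, norm_zero]

/-- The homomorphism `1 ⊗̂ q ⊗̂ 1`. -/
abbrev midMap (B K : GrCStar 𝕜) (q : GrHom F₂ F) :
    GrHom (B.tensor (F₂.tensor K)) (B.tensor (F.tensor K)) :=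
  tensorMap (GrHom.id B) (tensorMap q (GrHom.id K))

/-- The action of `F₁` on `B ⊗̂ F ⊗̂ K` by left multiplication on the middle factor, along `p`. -/
def midMult (B K : GrCStar 𝕜) (p : GrHom F₁ F) : GrHom F₁ (Mult (B.tensor (F.tensor K))) :=
  multRight B ((multLeft F K).comp p)

theorem midMult_tmul (p : GrHom F₁ F) (c : F₁.carrier) {i : Bool} {b : B.carrier}
    (hb : B.toAlg.IsHomog i b) (y : F.carrier) (k : K.carrier) :
    Mult.app (midMult B K p c) (tmul b (tmul y k)) =
      tmul b (tmul (p (F₁.toAlg.gradePow i c) * y) k) := by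
  rw [midMult, multRight_tmul _ _ hb, GrHom.comp_apply, multLeft_tmul]

/-- In the multiplier algebra of `B ⊗̂ F ⊗̂ K`, the action of `F₁` on the middle factor along `p` commutes
in the graded sense with the images of `B`, of `F₂` along `q`, and of `K`, hence with that of
`B ⊗̂ F₂ ⊗̂ K`. -/
theorem exists_shuffle (B K : GrCStar 𝕜) (p : GrHom F₁ F) (q : GrHom F₂ F)
    (h : GradedCommute p q) :
    ∃ θ : GrHom (F₁.tensor (B.tensor (F₂.tensor K))) (B.tensor (F.tensor K)),
      ∀ c e, θ (tmul c e) = Mult.app (midMult B K p c) (midMap B K q e) := by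
  set φ₁ := multLeft B (F.tensor K)
  set φ₂ := multRight B ((multLeft F K).comp q)
  set φ₃ := multRight B (multRight F (emb K))
  have hK := multLeft_commute (A := F) (emb K)
  have hq : GradedCommute ((multLeft F K).comp q) (multRight F (emb K)) := by
    exact hK.comp q (GrHom.id K)
  have hp : GradedCommute ((multLeft F K).comp p) (multRight F (emb K)) := by
    exact hK.comp p (GrHom.id K)
  have h₁₂ : GradedCommute φ₁ φ₂ := multLeft_commute _
  have h₁₃ : GradedCommute φ₁ φ₃ := multLeft_commute _
  have h₂₃ : GradedCommute φ₂ φ₃ := multRight_commute hq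
  have k₁ : GradedCommute φ₁ (midMult B K p) := multLeft_commute _
  have k₂ : GradedCommute φ₂ (midMult B K p) := multRight_commute (h.symm.postcomp _)
  have k₃ : GradedCommute φ₃ (midMult B K p) := multRight_commute hp.symm
  have l : GradedCommute φ₁ (pairHom φ₂ φ₃ h₂₃) :=
    (pairHom_commute _ _ _ _ h₁₂.symm h₁₃.symm).symm
  set ψ := pairHom φ₁ (pairHom φ₂ φ₃ h₂₃) l
  -- `ψ` is `1 ⊗̂ q ⊗̂ 1`, followed by the inclusion in the multiplier algebra
  have hψ : ψ = (emb _).comp (midMap B K q) := by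
    refine GrHom.tensor_ext fun b w => ?_
    rw [pairHom_tmul, GrHom.comp_apply, tensorMap_tmul, emb_tmul]
    congr 1
    refine tensor_induction (p := fun w => pairHom φ₂ φ₃ h₂₃ w =
      multRight B (emb (F.tensor K)) (tensorMap q (GrHom.id K) w))
      (isClosed_eq (GrHom.continuous _) ((GrHom.continuous _).comp (GrHom.continuous _)))
      (fun x y hx hy => ?_) (fun y k => ?_) w
    · simp only [map_add, hx, hy]
    · rw [pairHom_tmul, tensorMap_tmul, multRight_mul (emb_tmul (q y) (GrHom.id K k))]
      congr 1
      refine Mult.tensor_ext fun j _ a b ha _ => ?_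
      rw [multRight_tmul _ _ ha, multRight_tmul _ _ ha, GrHom.comp_apply, GrHom.map_gradePow]
  have hc : GradedCommute (midMult B K p) ψ :=
    (pairHom_commute _ _ _ _ k₁ (pairHom_commute _ _ _ _ k₂ k₃)).symm
  have key : ∀ c e, midMult B K p c * ψ e =
      emb _ (Mult.app (midMult B K p c) (midMap B K q e)) := fun c e => by
    rw [hψ, GrHom.comp_apply, mult_mul_emb]
  obtain ⟨θ, hθ⟩ := exists_pairLift (emb (B.tensor (F.tensor K))) norm_emb (midMult B K p) ψ hc
    fun c e => ⟨_, (key c e).symm⟩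
  exact ⟨θ, fun c e => emb_injective ((hθ c e).trans (key c e))⟩

/-- The shuffle homomorphism `c ⊗ b ⊗ y ⊗ k ↦ ± b ⊗ p(c) q(y) ⊗ k`. -/
def shuffle (B K : GrCStar 𝕜) (p : GrHom F₁ F) (q : GrHom F₂ F) (h : GradedCommute p q) :
    GrHom (F₁.tensor (B.tensor (F₂.tensor K))) (B.tensor (F.tensor K)) :=
  (exists_shuffle B K p q h).choose

theorem shuffle_tmul (p : GrHom F₁ F) (q : GrHom F₂ F) (h : GradedCommute p q) (c e) :
    shuffle B K p q h (tmul c e) = Mult.app (midMult B K p c) (midMap B K q e) :=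
  (exists_shuffle B K p q h).choose_spec c e

/-- Closed additive properties on `B ⊗̂ F ⊗̂ K` can be checked on elementary tensors with homogeneous
factors. -/
theorem mid_induction {p : (B.tensor (F.tensor K)).carrier → Prop} (hc : IsClosed {x | p x})
    (hadd : ∀ x y, p x → p y → p (x + y))
    (h : ∀ i j b y k, B.toAlg.IsHomog i b → F.toAlg.IsHomog j y → p (tmul b (tmul y k))) (x) :
    p x := by
  refine tensor_induction_homog hc hadd (fun i _ b w hb _ => ?_) x
  refine tensor_induction_homog (p := fun w => p (tmul b w))
    (hc.preimage (continuous_tmul_right b)) (fun x y hx hy => ?_) (fun j _ y k hy _ => ?_) w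
  · exact (congrArg p (tmul_add (A := B) b x y)).mpr (hadd _ _ hx hy)
  · exact h i j b y k hb hy

theorem midMap_midMult {F' : GrCStar 𝕜} (p : GrHom F₁ F) (q : GrHom F F') (c : F₁.carrier)
    (x : (B.tensor (F.tensor K)).carrier) :
    midMap B K q (Mult.app (midMult B K p c) x) =
      Mult.app (midMult B K (q.comp p) c) (midMap B K q x) := by
  refine mid_induction (p := fun x => midMap B K q (Mult.app (midMult B K p c) x) =
      Mult.app (midMult B K (q.comp p) c) (midMap B K q x))
    (isClosed_eq ((GrHom.continuous _).comp (ContinuousLinearMap.continuous _))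
      ((ContinuousLinearMap.continuous _).comp (GrHom.continuous _)))
    (fun x y hx hy => by simp only [map_add, hx, hy]) (fun i j b y k hb _ => ?_) x
  rw [midMult_tmul _ _ hb, tensorMap_tmul, tensorMap_tmul, tensorMap_tmul, tensorMap_tmul,
    midMult_tmul _ _ ((GrHom.id B).map_homog hb), map_mul]
  rfl

theorem midMult_comp_apply {F₀ : GrCStar 𝕜} (p : GrHom F₁ F) (r : GrHom F₀ F₁) (c : F₀.carrier) :
    midMult B K (p.comp r) c = midMult B K p (r c) :=
  Mult.ext fun x => mid_induction (p := fun x => Mult.app (midMult B K (p.comp r) c) x =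
      Mult.app (midMult B K p (r c)) x)
    (isClosed_eq (ContinuousLinearMap.continuous _) (ContinuousLinearMap.continuous _))
    (fun x y hx hy => by simp only [map_add, hx, hy]) (fun i j b y k hb _ => by
      rw [midMult_tmul _ _ hb, midMult_tmul _ _ hb, GrHom.comp_apply, GrHom.map_gradePow]) x

/-- The new generator is multiplied from the left in the definition of `shuffle`; moving it to the right
of `y` gives the sign `(-1)^(deg c deg y)`, and moving it past `b` the sign `(-1)^(deg c deg b)`. -/
theorem isShuffle_shuffle {m : ℕ}
    (h : GradedCommute (cliffMap (𝕜 := 𝕜) (inclLast m)) (cliffMap (inclFirst m))) :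
    IsShuffle (shuffle B K (cliffMap (𝕜 := 𝕜) (inclLast m)) (cliffMap (inclFirst m)) h) := by
  intro i j l c b x k hc hb hx
  rw [shuffle_tmul, tensorMap_tmul, tensorMap_tmul, GrHom.id_apply, GrHom.id_apply,
    midMult_tmul _ _ hb]
  have h1 := h.swap x hc
  have hc' : (CliffAlg 𝕜 1).grade c = if i then -c else c := hc
  have hx' : (CliffAlg 𝕜 m).grade x = if l then -x else x := hx
  have e1 : (CliffAlg 𝕜 1).toAlg.gradePow j c = (if i && j then (-1 : 𝕜) else 1) • c := by
    cases j
    · simp [GrStarAlg.gradePow]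
    · change (CliffAlg 𝕜 1).grade c = _
      rw [hc']
      cases i <;> simp
  have e2 : (CliffAlg 𝕜 m).toAlg.gradePow i x = (if i && l then (-1 : 𝕜) else 1) • x := by
    cases i
    · simp [GrStarAlg.gradePow]
    · change (CliffAlg 𝕜 m).grade x = _
      rw [hx']
      cases l <;> simp
  rw [e2, map_smul, mul_smul_comm] at h1
  rw [e1, map_smul, smul_mul_assoc]
  have h2 : cliffMap (𝕜 := 𝕜) (inclLast m) c * cliffMap (inclFirst m) x =
      (if i && l then (-1 : 𝕜) else 1) •
        (cliffMap (inclFirst m) x * cliffMap (inclLast m) c) := by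
    rw [h1, smul_smul]
    cases i <;> cases l <;> simp
  change tmul b (tmul ((if i && j then (-1 : 𝕜) else 1) •
    (cliffMap (inclLast m) c * cliffMap (inclFirst m) x)) k) = _
  rw [h2, smul_smul, smul_tmul, tmul_smul]
  congr 1
  cases i <;> cases j <;> cases l <;> simp

end Assoc

/-! ### Clifford algebras -/

section Clifford

variable {m n N : ℕ}

/-- The element of the Clifford algebra given by a vector. -/
def cliffVec (v : EuclideanSpace ℝ (Fin m)) : (CliffAlg 𝕜 m).carrier :=
  cliffOf (CliffordAlgebra.ι (euclidForm m) v)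

variable (𝕜 m) in
/-- The unit of the Clifford algebra. -/
def cliffUnit : (CliffAlg 𝕜 m).carrier := cliffOf 1

theorem cliffOf_mul (x y : CliffordAlgebra (euclidForm m)) :
    cliffOf (𝕜 := 𝕜) (x * y) = cliffOf x * cliffOf y := by
  refine Eq.trans ?_ ((cliffClass (𝕜 := 𝕜) m).of_mul (Cliff.mk 1 x) (Cliff.mk 1 y))
  refine congrArg (cliffClass (𝕜 := 𝕜) m).of ?_
  refine Eq.trans ?_ (Cliff.mk_mul 1 1 x y).symm
  rw [mul_one]

theorem cliffOf_add (x y : CliffordAlgebra (euclidForm m)) :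
    cliffOf (𝕜 := 𝕜) (x + y) = cliffOf x + cliffOf y :=
  (congrArg _ (Cliff.mk_add 1 x y)).trans
    ((cliffClass (𝕜 := 𝕜) m).of_add (Cliff.mk 1 x) (Cliff.mk 1 y))

theorem cliff_of_mk (c : 𝕜) (x : CliffordAlgebra (euclidForm m)) :
    (cliffClass (𝕜 := 𝕜) m).of (Cliff.mk c x) = c • cliffOf x := by
  have e : Cliff.mk c x = c • Cliff.mk (1 : 𝕜) x := by rw [Cliff.smul_mk, mul_one]
  exact (congrArg (cliffClass (𝕜 := 𝕜) m).of e).trans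
    ((cliffClass (𝕜 := 𝕜) m).of_smul c (Cliff.mk 1 x))

theorem cliffOf_smul (r : ℝ) (x : CliffordAlgebra (euclidForm m)) :
    cliffOf (𝕜 := 𝕜) (r • x) = (r : 𝕜) • cliffOf x := by
  refine Eq.trans (congrArg (cliffClass (𝕜 := 𝕜) m).of ?_) (cliff_of_mk (r : 𝕜) x)
  refine (TensorProduct.tmul_smul r (1 : 𝕜) x).trans ?_
  refine (TensorProduct.smul_tmul' r (1 : 𝕜) x).trans ?_
  rw [RCLike.real_smul_eq_coe_mul, mul_one]
  rfl

/-- The unit and the vectors generate the Clifford algebra as a C*-algebra. -/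
theorem cliff_induction {p : (CliffAlg 𝕜 m).carrier → Prop} (hc : IsClosed {x | p x})
    (hadd : ∀ x y, p x → p y → p (x + y)) (hsmul : ∀ (c : 𝕜) x, p x → p (c • x))
    (hone : p (cliffUnit 𝕜 m)) (hvec : ∀ v, p (cliffVec v))
    (hmul : ∀ x y, p x → p y → p (x * y)) (x) : p x := by
  refine Action.induction_of (cliffClass (𝕜 := 𝕜) m) hc (fun w => ?_) x
  refine Cliff.induction (p := fun w => p ((cliffClass (𝕜 := 𝕜) m).of w)) (fun x y hx hy => ?_)
    (fun c x => ?_) w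
  · exact (congrArg p ((cliffClass (𝕜 := 𝕜) m).of_add x y)).mpr (hadd _ _ hx hy)
  refine (congrArg p (cliff_of_mk c x)).mpr (hsmul c _ ?_)
  induction x using CliffordAlgebra.induction with
  | algebraMap r =>
    rw [Algebra.algebraMap_eq_smul_one, cliffOf_smul]
    exact hsmul _ _ hone
  | ι v => exact hvec v
  | mul x y hx hy =>
    rw [cliffOf_mul]
    exact hmul _ _ hx hy
  | add x y hx hy =>
    rw [cliffOf_add]
    exact hadd _ _ hx hy

theorem cliffUnit_mul (x : (CliffAlg 𝕜 m).carrier) : cliffUnit 𝕜 m * x = x := by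
  have hc : IsClosed {x : (CliffAlg 𝕜 m).carrier | cliffUnit 𝕜 m * x = x} :=
    isClosed_eq (continuous_const.mul continuous_id) continuous_id
  refine Action.induction_of (cliffClass (𝕜 := 𝕜) m)
    (p := fun x : (CliffAlg 𝕜 m).carrier => cliffUnit 𝕜 m * x = x) hc (fun w => ?_) x
  refine ((cliffClass (𝕜 := 𝕜) m).of_mul (1 : Cliff 𝕜 m) w).symm.trans ?_
  exact congrArg _ (one_mul (M := Cliff 𝕜 m) w)

theorem mul_cliffUnit (x : (CliffAlg 𝕜 m).carrier) : x * cliffUnit 𝕜 m = x := by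
  have hc : IsClosed {x : (CliffAlg 𝕜 m).carrier | x * cliffUnit 𝕜 m = x} :=
    isClosed_eq (continuous_id.mul continuous_const) continuous_id
  refine Action.induction_of (cliffClass (𝕜 := 𝕜) m)
    (p := fun x : (CliffAlg 𝕜 m).carrier => x * cliffUnit 𝕜 m = x) hc (fun w => ?_) x
  refine ((cliffClass (𝕜 := 𝕜) m).of_mul w (1 : Cliff 𝕜 m)).symm.trans ?_
  exact congrArg _ (mul_one (M := Cliff 𝕜 m) w)

theorem cliffMap_cliffOf (f : EuclideanSpace ℝ (Fin m) →ₗᵢ[ℝ] EuclideanSpace ℝ (Fin n))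
    (x : CliffordAlgebra (euclidForm m)) :
    cliffMap (𝕜 := 𝕜) f (cliffOf x) = cliffOf (CliffordAlgebra.map (euclidIsometry f) x) :=
  RepClass.map_of _ _ _

@[simp] theorem cliffMap_vec (f : EuclideanSpace ℝ (Fin m) →ₗᵢ[ℝ] EuclideanSpace ℝ (Fin n)) (v) :
    cliffMap (𝕜 := 𝕜) f (cliffVec v) = cliffVec (f v) := by
  rw [cliffVec, cliffMap_cliffOf, CliffordAlgebra.map_apply_ι]
  rfl

@[simp] theorem cliffMap_unit (f : EuclideanSpace ℝ (Fin m) →ₗᵢ[ℝ] EuclideanSpace ℝ (Fin n)) :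
    cliffMap (𝕜 := 𝕜) f (cliffUnit 𝕜 m) = cliffUnit 𝕜 n := by
  rw [cliffUnit, cliffMap_cliffOf, map_one]
  rfl

theorem cliffVec_add (v w : EuclideanSpace ℝ (Fin m)) :
    cliffVec (𝕜 := 𝕜) (v + w) = cliffVec v + cliffVec w := by
  rw [cliffVec, map_add, cliffOf_add]
  rfl

theorem cliffVec_smul (r : ℝ) (v : EuclideanSpace ℝ (Fin m)) :
    cliffVec (𝕜 := 𝕜) (r • v) = (r : 𝕜) • cliffVec v := by
  rw [cliffVec, map_smul, cliffOf_smul]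
  rfl

theorem grade_cliffVec (v : EuclideanSpace ℝ (Fin m)) :
    (CliffAlg 𝕜 m).grade (cliffVec v) = -cliffVec v := by
  refine ((cliffClass (𝕜 := 𝕜) m).of_grade _).symm.trans ?_
  have e : (cliffPre 𝕜 m).grade (Cliff.mk 1 (CliffordAlgebra.ι (euclidForm m) v)) =
      (Cliff.mk (1 : 𝕜) (CliffordAlgebra.ι (euclidForm m) (-v))) :=
    (Cliff.ext_mk _ _ _).trans (by rw [map_neg]; simp)
  refine (congrArg (cliffClass (𝕜 := 𝕜) m).of e).trans ?_
  change cliffVec (-v) = _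
  rw [← neg_one_smul ℝ v, cliffVec_smul]
  simp

theorem grade_cliffUnit : (CliffAlg 𝕜 m).grade (cliffUnit 𝕜 m) = cliffUnit 𝕜 m := by
  refine ((cliffClass (𝕜 := 𝕜) m).of_grade _).symm.trans ?_
  have e : (cliffPre 𝕜 m).grade (Cliff.mk 1 (1 : CliffordAlgebra (euclidForm m))) =
      (Cliff.mk (1 : 𝕜) 1) := (Cliff.ext_mk _ _ _).trans (by simp)
  exact congrArg (cliffClass (𝕜 := 𝕜) m).of e

theorem cliffVec_mul_add {v w : EuclideanSpace ℝ (Fin m)} (h : inner ℝ v w = 0) :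
    cliffVec (𝕜 := 𝕜) v * cliffVec w = -(cliffVec w * cliffVec v) := by
  rw [eq_neg_iff_add_eq_zero, cliffVec, cliffVec, ← cliffOf_mul, ← cliffOf_mul, ← cliffOf_add,
    CliffordAlgebra.ι_mul_ι_add_swap]
  have e : QuadraticMap.polar (euclidForm m) v w = 0 := by
    rw [QuadraticMap.polar, euclidForm_apply, euclidForm_apply, euclidForm_apply,
      norm_add_sq_real, h]
    ring
  rw [e, Algebra.algebraMap_eq_smul_one, cliffOf_smul]
  simp

theorem norm_cliffUnit_le : ‖cliffUnit 𝕜 m‖ ≤ 1 := by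
  refine ((cliffClass (𝕜 := 𝕜) m).norm_of _).le.trans ?_
  exact (cliffClass (𝕜 := 𝕜) m).nrm_le zero_le_one fun C π _ => cliff_norm_one_le C π

theorem star_cliffVec (v : EuclideanSpace ℝ (Fin m)) :
    star (cliffVec (𝕜 := 𝕜) v) = cliffVec v := by
  refine ((cliffClass (𝕜 := 𝕜) m).of_star _).symm.trans (congrArg _ ?_)
  exact (Cliff.star_mk _ _).trans (by rw [CliffordAlgebra.reverse_ι, star_one])

theorem norm_cliffVec_le (v : EuclideanSpace ℝ (Fin m)) : ‖cliffVec (𝕜 := 𝕜) v‖ ≤ ‖v‖ := by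
  have h := CStarRing.norm_star_mul_self (x := cliffVec (𝕜 := 𝕜) v)
  have e : star (cliffVec (𝕜 := 𝕜) v) * cliffVec v = ((‖v‖ ^ 2 : ℝ) : 𝕜) • cliffUnit 𝕜 m := by
    rw [star_cliffVec, cliffVec, ← cliffOf_mul, CliffordAlgebra.ι_sq_scalar, euclidForm_apply,
      Algebra.algebraMap_eq_smul_one, cliffOf_smul]
    rfl
  rw [e, norm_smul, RCLike.norm_ofReal, abs_of_nonneg (by positivity)] at h
  have h1 := norm_cliffUnit_le (𝕜 := 𝕜) (m := m)
  refine le_of_sq_le_sq ?_ (norm_nonneg v)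
  nlinarith [sq_nonneg ‖v‖]

theorem GrHom.cliff_ext {C : GrCStar 𝕜} {f g : GrHom (CliffAlg 𝕜 m) C}
    (h1 : f (cliffUnit 𝕜 m) = g (cliffUnit 𝕜 m)) (hv : ∀ v, f (cliffVec v) = g (cliffVec v)) :
    f = g :=
  GrHom.ext fun x => cliff_induction (p := fun x => f x = g x)
    (isClosed_eq f.continuous g.continuous) (fun x y hx hy => by rw [map_add, map_add, hx, hy])
    (fun c x hx => by rw [map_smul, map_smul, hx]) h1 hv
    (fun x y hx hy => by rw [map_mul, map_mul, hx, hy]) x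

theorem GrStarAlg.even_mul (P : GrStarAlg 𝕜) (a b : P.carrier) :
    P.even (a * b) = P.even a * P.even b + P.odd a * P.odd b := by
  have h1 : P.even (a * b) = P.even ((P.even a + P.odd a) * (P.even b + P.odd b)) := by
    rw [P.even_add_odd, P.even_add_odd]
  rw [h1, add_mul, mul_add, mul_add, map_add, map_add, map_add,
    P.even_of_even (a := P.even a * P.even b) (by rw [P.grade_mul, P.grade_even, P.grade_even]),
    P.even_of_odd (a := P.even a * P.odd b) (by rw [P.grade_mul, P.grade_even, P.grade_odd, mul_neg]),
    P.even_of_odd (a := P.odd a * P.even b) (by rw [P.grade_mul, P.grade_even, P.grade_odd, neg_mul]),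
    P.even_of_even (a := P.odd a * P.odd b) (by rw [P.grade_mul, P.grade_odd, P.grade_odd, neg_mul_neg])]
  abel

theorem GrStarAlg.odd_mul (P : GrStarAlg 𝕜) (a b : P.carrier) :
    P.odd (a * b) = P.even a * P.odd b + P.odd a * P.even b := by
  have h1 := P.even_add_odd (a * b)
  rw [P.even_mul] at h1
  have h2 : a * b = (P.even a + P.odd a) * (P.even b + P.odd b) := by
    rw [P.even_add_odd, P.even_add_odd]
  rw [← sub_eq_iff_eq_add'.2 h1.symm, h2]
  noncomm_ring

theorem GrCStar.continuous_even (A : GrCStar 𝕜) : Continuous A.toAlg.even :=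
  (continuous_id.add A.continuous_grade).const_smul (2⁻¹ : 𝕜)

theorem GrCStar.continuous_odd (A : GrCStar 𝕜) : Continuous A.toAlg.odd :=
  (continuous_id.sub A.continuous_grade).const_smul (2⁻¹ : 𝕜)

/-- A homomorphism out of a Clifford algebra commutes in the graded sense with another one as soon
as the unit and the vectors do. -/
theorem GradedCommute.of_cliff {C Z : GrCStar 𝕜} {φ : GrHom (CliffAlg 𝕜 m) C} {ψ : GrHom Z C}
    (hu : ∀ y, ψ y * φ (cliffUnit 𝕜 m) = φ (cliffUnit 𝕜 m) * ψ y)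
    (hv : ∀ v y, ψ y * φ (cliffVec v) = φ (cliffVec v) * ψ (Z.grade y)) :
    GradedCommute φ ψ := by
  have h2 : ∀ c, (∀ y, ψ y * φ ((CliffAlg 𝕜 m).toAlg.even c) =
        φ ((CliffAlg 𝕜 m).toAlg.even c) * ψ y) ∧
      ∀ y, ψ y * φ ((CliffAlg 𝕜 m).toAlg.odd c) =
        φ ((CliffAlg 𝕜 m).toAlg.odd c) * ψ (Z.grade y) := by
    intro c
    refine cliff_induction (p := fun c => (∀ y, ψ y * φ ((CliffAlg 𝕜 m).toAlg.even c) =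
        φ ((CliffAlg 𝕜 m).toAlg.even c) * ψ y) ∧
      ∀ y, ψ y * φ ((CliffAlg 𝕜 m).toAlg.odd c) =
        φ ((CliffAlg 𝕜 m).toAlg.odd c) * ψ (Z.grade y)) ?_
      (fun x y hx hy => ?_) (fun r x hx => ?_) ?_ (fun v => ?_) (fun x y hx hy => ?_) c
    · have ce := φ.continuous.comp (CliffAlg 𝕜 m).continuous_even
      have co := φ.continuous.comp (CliffAlg 𝕜 m).continuous_odd
      refine IsClosed.and ?_ ?_
      · simp only [Set.ofPred_forall]
        exact isClosed_iInter fun y => isClosed_eq (continuous_const.mul ce)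
          (ce.mul continuous_const)
      · simp only [Set.ofPred_forall]
        exact isClosed_iInter fun y => isClosed_eq (continuous_const.mul co)
          (co.mul continuous_const)
    · refine ⟨fun z => ?_, fun z => ?_⟩
      · rw [map_add, map_add, mul_add, add_mul, hx.1, hy.1]
      · rw [map_add, map_add, mul_add, add_mul, hx.2, hy.2]
    · refine ⟨fun z => ?_, fun z => ?_⟩
      · rw [map_smul, map_smul, mul_smul_comm, smul_mul_assoc, hx.1]
      · rw [map_smul, map_smul, mul_smul_comm, smul_mul_assoc, hx.2]
    · refine ⟨fun z => ?_, fun z => ?_⟩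
      · rw [GrStarAlg.even_of_even _ grade_cliffUnit, hu]
      · rw [GrStarAlg.odd_of_even _ grade_cliffUnit, map_zero, mul_zero, zero_mul]
    · refine ⟨fun z => ?_, fun z => ?_⟩
      · rw [GrStarAlg.even_of_odd _ (grade_cliffVec v), map_zero, mul_zero, zero_mul]
      · rw [GrStarAlg.odd_of_odd _ (grade_cliffVec v), hv]
    · refine ⟨fun z => ?_, fun z => ?_⟩
      · rw [GrStarAlg.even_mul, map_add, map_mul, map_mul, mul_add, add_mul, ← mul_assoc, hx.1,
          mul_assoc, hy.1, ← mul_assoc, ← mul_assoc, hx.2, mul_assoc _ _ (φ _), hy.2, Z.grade_grade,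
          ← mul_assoc]
      · rw [GrStarAlg.odd_mul, map_add, map_mul, map_mul, mul_add, add_mul, ← mul_assoc, hx.1,
          mul_assoc, hy.2, ← mul_assoc, ← mul_assoc, hx.2, mul_assoc _ _ (φ _), hy.1,
          ← mul_assoc]
  -- a homogeneous element is its own even or odd part
  refine GradedCommute.of_forall fun i c y hc => ?_
  cases i
  · have := (h2 c).1 y
    rwa [GrStarAlg.even_of_even _ hc] at this
  · have := (h2 c).2 y
    rwa [GrStarAlg.odd_of_odd _ hc] at this

/-- Isometries with orthogonal ranges induce graded-commuting homomorphisms of Clifford algebras. -/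
theorem cliffMap_commute {f : EuclideanSpace ℝ (Fin m) →ₗᵢ[ℝ] EuclideanSpace ℝ (Fin N)}
    {g : EuclideanSpace ℝ (Fin n) →ₗᵢ[ℝ] EuclideanSpace ℝ (Fin N)}
    (h : ∀ v w, inner ℝ (f v) (g w) = 0) :
    GradedCommute (cliffMap (𝕜 := 𝕜) f) (cliffMap g) := by
  refine GradedCommute.of_cliff (fun y => ?_) (fun v => ?_)
  · rw [cliffMap_unit, cliffUnit_mul, mul_cliffUnit]
  intro y
  refine cliff_induction (p := fun y => cliffMap g y * cliffMap f (cliffVec v) =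
      cliffMap f (cliffVec v) * cliffMap g ((CliffAlg 𝕜 n).grade y))
    (isClosed_eq ((GrHom.continuous _).mul continuous_const)
      (continuous_const.mul ((GrHom.continuous (cliffMap g)).comp
        (CliffAlg 𝕜 n).continuous_grade)))
    (fun x y hx hy => ?_) (fun c x hx => ?_) ?_ (fun w => ?_) (fun x y hx hy => ?_) y
  · rw [map_add, map_add, map_add, add_mul, mul_add, hx, hy]
  · rw [map_smul, map_smul, map_smul, smul_mul_assoc, mul_smul_comm, hx]
  · rw [grade_cliffUnit, cliffMap_unit, cliffUnit_mul, mul_cliffUnit]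
  · rw [grade_cliffVec, map_neg, cliffMap_vec, cliffMap_vec, mul_neg, cliffVec_mul_add]
    rw [real_inner_comm]
    exact h v w
  · rw [map_mul, mul_assoc, hy, ← mul_assoc, hx, mul_assoc, ← map_mul, (CliffAlg 𝕜 n).grade_mul]

end Clifford

section

open BoundedContinuousFunction

/-! ### The asymptotic algebra of a graded C*-algebra -/

section AsyAlg

variable (E : GrCStar 𝕜)

/-- Bounded continuous functions `[1, ∞) → E`. -/
abbrev BC : Type := Set.Ici (1 : ℝ) →ᵇ E.carrier

variable {E} {E' : GrCStar 𝕜}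

/-- The function that is frozen before time `s`: `t ↦ f (max t s)`. -/
def BC.tail (s : Set.Ici (1 : ℝ)) (f : BC E) : BC E :=
  f.compContinuous ⟨fun t => t ⊔ s, by fun_prop⟩

theorem BC.tail_apply (s : Set.Ici (1 : ℝ)) (f : BC E) (t) : BC.tail s f t = f (t ⊔ s) := rfl

theorem BC.norm_tail_le {s s' : Set.Ici (1 : ℝ)} (h : s ≤ s') (f : BC E) :
    ‖BC.tail s' f‖ ≤ ‖BC.tail s f‖ :=
  (norm_le (norm_nonneg _)).2 fun t => by
    have := (BC.tail s f).norm_coe_le_norm (t ⊔ s')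
    rwa [BC.tail_apply, sup_assoc, sup_eq_left.2 h] at this

/-- The upper limit of `‖f t‖` for `t → ∞`, as the limit of the norms of the tails. -/
def BC.limNorm (f : BC E) : ℝ := ⨅ s, ‖BC.tail s f‖

theorem BC.tendsto_limNorm (f : BC E) :
    Tendsto (fun s => ‖BC.tail s f‖) atTop (𝓝 (BC.limNorm f)) :=
  tendsto_atTop_ciInf (fun _ _ h => BC.norm_tail_le h f) ⟨0, by rintro _ ⟨s, rfl⟩; exact norm_nonneg _⟩

theorem BC.limNorm_nonneg (f : BC E) : 0 ≤ BC.limNorm f :=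
  le_ciInf fun _ => norm_nonneg _

theorem BC.limNorm_le_tail (f : BC E) (s) : BC.limNorm f ≤ ‖BC.tail s f‖ :=
  ciInf_le ⟨0, by rintro _ ⟨s, rfl⟩; exact norm_nonneg _⟩ s

theorem BC.limNorm_le (f : BC E) : BC.limNorm f ≤ ‖f‖ :=
  (BC.limNorm_le_tail f ⟨1, Set.self_mem_Ici⟩).trans ((norm_le (norm_nonneg _)).2 fun _ => f.norm_coe_le_norm _)

theorem BC.limNorm_add (f g : BC E) : BC.limNorm (f + g) ≤ BC.limNorm f + BC.limNorm g :=
  le_of_tendsto_of_tendsto' (BC.tendsto_limNorm _)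
    ((BC.tendsto_limNorm f).add (BC.tendsto_limNorm g)) fun s =>
      norm_add_le (BC.tail s f) (BC.tail s g)

theorem BC.limNorm_mul (f g : BC E) : BC.limNorm (f * g) ≤ BC.limNorm f * BC.limNorm g :=
  le_of_tendsto_of_tendsto' (BC.tendsto_limNorm _)
    ((BC.tendsto_limNorm f).mul (BC.tendsto_limNorm g)) fun s =>
      norm_mul_le (BC.tail s f) (BC.tail s g)

theorem BC.limNorm_smul (c : 𝕜) (f : BC E) : BC.limNorm (c • f) = ‖c‖ * BC.limNorm f :=
  tendsto_nhds_unique (BC.tendsto_limNorm _) (((BC.tendsto_limNorm f).const_mul ‖c‖).congr fun s =>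
    (norm_smul c (BC.tail s f)).symm)

theorem BC.limNorm_star (f : BC E) : BC.limNorm (star f) = BC.limNorm f :=
  tendsto_nhds_unique (BC.tendsto_limNorm _) ((BC.tendsto_limNorm f).congr fun s =>
    (norm_star (BC.tail s f)).symm)

theorem BC.limNorm_star_mul (f : BC E) :
    BC.limNorm (star f * f) = BC.limNorm f * BC.limNorm f :=
  tendsto_nhds_unique (BC.tendsto_limNorm _)
    (((BC.tendsto_limNorm f).mul (BC.tendsto_limNorm f)).congr fun s =>
      (CStarRing.norm_star_mul_self (x := BC.tail s f)).symm)

theorem BC.norm_sq_le (f g : BC E) : ‖f‖ ^ 2 ≤ ‖star f * f + star g * g‖ := by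
  have h : ‖f‖ ≤ Real.sqrt ‖star f * f + star g * g‖ :=
    (norm_le (Real.sqrt_nonneg _)).2 fun x => Real.le_sqrt_of_sq_le
      ((E.norm_sq_le (f x) (g x)).trans ((star f * f + star g * g).norm_coe_le_norm x))
  calc ‖f‖ ^ 2 ≤ Real.sqrt ‖star f * f + star g * g‖ ^ 2 :=
        pow_le_pow_left₀ (norm_nonneg _) h 2
    _ = _ := Real.sq_sqrt (norm_nonneg _)

theorem BC.limNorm_sq_le (f g : BC E) :
    BC.limNorm f ^ 2 ≤ BC.limNorm (star f * f + star g * g) :=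
  le_of_tendsto_of_tendsto' ((BC.tendsto_limNorm f).pow 2) (BC.tendsto_limNorm _) fun s =>
    BC.norm_sq_le (BC.tail s f) (BC.tail s g)

theorem BC.limNorm_eq_zero_iff (f : BC E) :
    BC.limNorm f = 0 ↔ Tendsto (fun t => ‖f t‖) atTop (𝓝 0) := by
  constructor
  · intro h
    have h1 := BC.tendsto_limNorm f
    rw [h] at h1
    refine squeeze_zero (fun _ => norm_nonneg _) (fun t => ?_) h1
    have := (BC.tail t f).norm_coe_le_norm t
    rwa [BC.tail_apply, sup_idem] at this
  · intro h
    refine le_antisymm (le_of_forall_pos_le_add fun ε hε => ?_) (BC.limNorm_nonneg f)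
    obtain ⟨s, hs⟩ := eventually_atTop.1 (h.eventually (ge_mem_nhds hε))
    rw [zero_add]
    exact (BC.limNorm_le_tail f s).trans ((norm_le hε.le).2 fun t => hs _ le_sup_right)

/-- The pointwise image under a bounded linear map. -/
def BC.map (g : E.carrier →L[𝕜] E'.carrier) (f : BC E) : BC E' :=
  g.compLeftContinuousBounded (Set.Ici (1 : ℝ)) f

theorem BC.limNorm_map_le (g : E.carrier →L[𝕜] E'.carrier) (h : ∀ x, ‖g x‖ ≤ ‖x‖) (f : BC E) :
    BC.limNorm (BC.map g f) ≤ BC.limNorm f :=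
  le_of_tendsto_of_tendsto' (BC.tendsto_limNorm _) (BC.tendsto_limNorm f) fun s =>
    (norm_le (norm_nonneg _)).2 fun t => (h _).trans ((BC.tail s f).norm_coe_le_norm t)

theorem BC.limNorm_map (g : E.carrier →L[𝕜] E'.carrier) (h : ∀ x, ‖g x‖ = ‖x‖) (f : BC E) :
    BC.limNorm (BC.map g f) = BC.limNorm f := by
  refine le_antisymm (BC.limNorm_map_le g (fun x => (h x).le) f) ?_
  refine le_of_tendsto_of_tendsto' (BC.tendsto_limNorm f) (BC.tendsto_limNorm _) fun s =>
    (norm_le (norm_nonneg _)).2 fun t => ?_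
  exact (h _).ge.trans ((BC.tail s (BC.map g f)).norm_coe_le_norm t)

variable (E) in
/-- Bounded continuous functions with the seminorm `limsup ‖f t‖`. -/
def AsyPre : Type := BC E

/-- The identity, as a map to the type with the other seminorm. -/
def AsyPre.of (f : BC E) : AsyPre E := f

instance : NonUnitalRing (AsyPre E) := inferInstanceAs (NonUnitalRing (BC E))
instance : Module 𝕜 (AsyPre E) := inferInstanceAs (Module 𝕜 (BC E))

variable (E) in
/-- The seminorm `limsup ‖f t‖`. -/
def asySeminorm : Seminorm 𝕜 (AsyPre E) :=
  Seminorm.of BC.limNorm BC.limNorm_add BC.limNorm_smul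

instance : NonUnitalSeminormedRing (AsyPre E) :=
  { (asySeminorm E).toSeminormedAddCommGroup, (inferInstance : NonUnitalRing (AsyPre E)) with
    norm_mul_le := BC.limNorm_mul }

instance : NormedSpace 𝕜 (AsyPre E) where
  norm_smul_le c f := (BC.limNorm_smul c f).le

variable (E) in
/-- The underlying space of the asymptotic algebra. -/
abbrev AsyQuot : Type := SeparationQuotient (AsyPre E)

namespace AsyQuot

/-- The class of a bounded continuous function. -/
def mk (f : BC E) : AsyQuot E := SeparationQuotient.mk (AsyPre.of f)

theorem mk_surjective : Function.Surjective (mk (E := E)) := fun x => by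
  obtain ⟨f, rfl⟩ := SeparationQuotient.surjective_mk x
  exact ⟨f, rfl⟩

theorem norm_mk (f : BC E) : ‖mk f‖ = BC.limNorm f := SeparationQuotient.norm_mk (E := AsyPre E) f

theorem mk_add (f g : BC E) : mk (f + g) = mk f + mk g := rfl
theorem mk_sub (f g : BC E) : mk (f - g) = mk f - mk g := rfl
theorem mk_mul (f g : BC E) : mk (f * g) = mk f * mk g := rfl
theorem mk_smul (c : 𝕜) (f : BC E) : mk (c • f) = c • mk f := rfl

theorem mk_eq_mk {f g : BC E} : mk f = mk g ↔ Tendsto (fun t => ‖f t - g t‖) atTop (𝓝 0) := by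
  rw [← sub_eq_zero, ← mk_sub, ← norm_eq_zero, norm_mk, BC.limNorm_eq_zero_iff]
  rfl

/-- The map on classes induced by an additive map that does not increase the seminorm. -/
def lift {F : GrCStar 𝕜} (T : BC E → BC F) (hT : ∀ f g, T (f - g) = T f - T g)
    (hn : ∀ f, BC.limNorm (T f) ≤ BC.limNorm f) : AsyQuot E → AsyQuot F :=
  have key : ∀ f g : BC E, mk f = mk g → mk (T f) = mk (T g) := fun f g h => by
    rw [← sub_eq_zero, ← mk_sub, ← norm_eq_zero, norm_mk] at h ⊢
    refine le_antisymm ?_ (BC.limNorm_nonneg _)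
    rw [← h, ← hT]
    exact hn _
  SeparationQuotient.lift (fun f : AsyPre E => mk (T f)) fun f g h =>
    key f g (SeparationQuotient.mk_eq_mk.2 h)

instance : Star (AsyQuot E) := ⟨lift star star_sub fun f => (BC.limNorm_star f).le⟩

theorem mk_star (f : BC E) : mk (star f) = star (mk f) := rfl

instance : StarRing (AsyQuot E) where
  star_involutive x := by
    obtain ⟨f, rfl⟩ := mk_surjective x
    rw [← mk_star, ← mk_star, star_star]
  star_mul x y := by
    obtain ⟨f, rfl⟩ := mk_surjective x
    obtain ⟨g, rfl⟩ := mk_surjective y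
    rw [← mk_star, ← mk_star, ← mk_mul, ← mk_star, star_mul, mk_mul]
  star_add x y := by
    obtain ⟨f, rfl⟩ := mk_surjective x
    obtain ⟨g, rfl⟩ := mk_surjective y
    rw [← mk_star, ← mk_star, ← mk_add, ← mk_star, star_add, mk_add]

instance : StarModule 𝕜 (AsyQuot E) where
  star_smul c x := by
    obtain ⟨f, rfl⟩ := mk_surjective x
    rw [← mk_star, ← mk_smul, ← mk_star, star_smul, mk_smul]

instance : IsScalarTower 𝕜 (AsyQuot E) (AsyQuot E) where
  smul_assoc c x y := by
    obtain ⟨f, rfl⟩ := mk_surjective x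
    obtain ⟨g, rfl⟩ := mk_surjective y
    rw [smul_eq_mul, smul_eq_mul, ← mk_smul, ← mk_mul, ← mk_mul, ← mk_smul, smul_mul_assoc]

instance : SMulCommClass 𝕜 (AsyQuot E) (AsyQuot E) where
  smul_comm c x y := by
    obtain ⟨f, rfl⟩ := mk_surjective x
    obtain ⟨g, rfl⟩ := mk_surjective y
    rw [smul_eq_mul, smul_eq_mul, ← mk_smul, ← mk_mul, ← mk_mul, ← mk_smul, mul_smul_comm]

instance : CStarRing (AsyQuot E) where
  norm_mul_self_le x := by
    obtain ⟨f, rfl⟩ := mk_surjective x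
    rw [← mk_star, ← mk_mul, norm_mk, norm_mk, BC.limNorm_star_mul]

/-- A class has representatives whose supremum norm is close to the norm of the class: pass to a
tail. -/
theorem exists_rep (x : AsyQuot E) {ε : ℝ} (hε : 0 < ε) : ∃ f : BC E, mk f = x ∧ ‖f‖ ≤ ‖x‖ + ε := by
  obtain ⟨f, rfl⟩ := mk_surjective x
  rw [norm_mk]
  obtain ⟨s, hs⟩ := ((BC.tendsto_limNorm f).eventually
    (ge_mem_nhds (lt_add_of_pos_right _ hε))).exists
  refine ⟨BC.tail s f, mk_eq_mk.2 (tendsto_const_nhds.congr' ?_), hs⟩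
  filter_upwards [eventually_ge_atTop s] with t ht
  rw [BC.tail_apply, sup_eq_left.2 ht, sub_self, norm_zero]

theorem continuous_mk : Continuous (mk (E := E)) :=
  (LipschitzWith.of_dist_le_mul (K := 1) fun f g => by
    rw [NNReal.coe_one, one_mul, dist_eq_norm, dist_eq_norm, ← mk_sub, norm_mk]
    exact BC.limNorm_le _).continuous

instance : CompleteSpace (AsyQuot E) :=
  NormedAddCommGroup.completeSpace_of_summable_imp_tendsto fun u hu => by
    choose f hf hn using fun n => exists_rep (u n) (ε := (1 / 2) ^ n) (by positivity)
    have h1 : Summable f := Summable.of_norm_bounded (hu.add summable_geometric_two) hn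
    -- the representatives are chosen with summable norms, so their sum represents the sum
    refine ⟨mk (∑' n, f n), ?_⟩
    refine ((continuous_mk.tendsto _).comp h1.hasSum.tendsto_sum_nat).congr fun n => ?_
    change mk (∑ i ∈ Finset.range n, f i) = _
    induction n with
    | zero => rfl
    | succ n ih => rw [Finset.sum_range_succ, Finset.sum_range_succ, mk_add, ih, hf]

end AsyQuot

variable (E) in
/-- The asymptotic algebra of `E`: bounded continuous functions `[1, ∞) → E` modulo those that vanish
at infinity. -/
def AsyAlg : GrCStar 𝕜 where
  carrier := AsyQuot E
  norm_sq_le x y := by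
    obtain ⟨f, rfl⟩ := AsyQuot.mk_surjective x
    obtain ⟨g, rfl⟩ := AsyQuot.mk_surjective y
    rw [← AsyQuot.mk_star, ← AsyQuot.mk_star, ← AsyQuot.mk_mul, ← AsyQuot.mk_mul, ← AsyQuot.mk_add,
      AsyQuot.norm_mk, AsyQuot.norm_mk]
    exact BC.limNorm_sq_le f g
  grade :=
    { toFun := AsyQuot.lift (BC.map E.gradeL) (fun f g => map_sub _ _ _)
        fun f => BC.limNorm_map_le _ (fun x => (E.norm_grade x).le) f
      map_add' := fun x y => by
        obtain ⟨f, rfl⟩ := AsyQuot.mk_surjective x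
        obtain ⟨g, rfl⟩ := AsyQuot.mk_surjective y
        exact congrArg AsyQuot.mk (BoundedContinuousFunction.ext fun t => map_add E.grade _ _)
      map_smul' := fun c x => by
        obtain ⟨f, rfl⟩ := AsyQuot.mk_surjective x
        exact congrArg AsyQuot.mk (BoundedContinuousFunction.ext fun t => map_smul E.grade _ _) }
  grade_grade x := by
    obtain ⟨f, rfl⟩ := AsyQuot.mk_surjective x
    exact congrArg AsyQuot.mk (BoundedContinuousFunction.ext fun t => E.grade_grade (f t))
  grade_mul x y := by
    obtain ⟨f, rfl⟩ := AsyQuot.mk_surjective x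
    obtain ⟨g, rfl⟩ := AsyQuot.mk_surjective y
    exact congrArg AsyQuot.mk (BoundedContinuousFunction.ext fun t => E.grade_mul (f t) (g t))
  grade_star x := by
    obtain ⟨f, rfl⟩ := AsyQuot.mk_surjective x
    exact congrArg AsyQuot.mk (BoundedContinuousFunction.ext fun t => E.grade_star (f t))
  norm_grade x := by
    obtain ⟨f, rfl⟩ := AsyQuot.mk_surjective x
    exact (AsyQuot.norm_mk _).trans ((BC.limNorm_map _ E.norm_grade f).trans
      (AsyQuot.norm_mk f).symm)

/-- The class of a bounded continuous function in the asymptotic algebra. -/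
def AsyAlg.mk (f : BC E) : (AsyAlg E).carrier := AsyQuot.mk f

theorem AsyAlg.mk_surjective : Function.Surjective (AsyAlg.mk (E := E)) := AsyQuot.mk_surjective

/-- Two paths have the same class if and only if they are asymptotically equal. -/
theorem AsyAlg.mk_eq_mk {f g : BC E} :
    AsyAlg.mk f = AsyAlg.mk g ↔ Tendsto (fun t => ‖f t - g t‖) atTop (𝓝 0) := AsyQuot.mk_eq_mk

theorem AsyAlg.mk_mul (f g : BC E) : AsyAlg.mk (f * g) = AsyAlg.mk f * AsyAlg.mk g := rfl
theorem AsyAlg.mk_grade (f : BC E) :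
    (AsyAlg E).grade (AsyAlg.mk f) = AsyAlg.mk (BC.map E.gradeL f) := rfl

/-- A graded `*`-homomorphism as a continuous linear map. -/
def GrHom.toCLM (g : GrHom E E') : E.carrier →L[𝕜] E'.carrier :=
  ⟨(g.toHom : E.carrier →ₗ[𝕜] E'.carrier), g.continuous⟩

/-- The homomorphism of asymptotic algebras induced by a homomorphism. -/
def asyMap (g : GrHom E E') : GrHom (AsyAlg E) (AsyAlg E') := GrHom.ofHom
  { toFun := AsyQuot.lift (BC.map g.toCLM) (fun f g => map_sub _ _ _)
        fun f => BC.limNorm_map_le _ g.norm_le f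
    map_zero' := congrArg AsyQuot.mk (BoundedContinuousFunction.ext fun t => map_zero g.toHom)
    map_add' := fun x y => by
      obtain ⟨f, rfl⟩ := AsyQuot.mk_surjective x
      obtain ⟨f', rfl⟩ := AsyQuot.mk_surjective y
      exact congrArg AsyQuot.mk (BoundedContinuousFunction.ext fun t => map_add g.toHom _ _)
    map_smul' := fun c x => by
      obtain ⟨f, rfl⟩ := AsyQuot.mk_surjective x
      exact congrArg AsyQuot.mk (BoundedContinuousFunction.ext fun t => map_smul g.toHom _ _)
    map_mul' := fun x y => by
      obtain ⟨f, rfl⟩ := AsyQuot.mk_surjective x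
      obtain ⟨f', rfl⟩ := AsyQuot.mk_surjective y
      exact congrArg AsyQuot.mk (BoundedContinuousFunction.ext fun t => map_mul g.toHom _ _)
    map_star' := fun x => by
      obtain ⟨f, rfl⟩ := AsyQuot.mk_surjective x
      exact congrArg AsyQuot.mk (BoundedContinuousFunction.ext fun t => map_star g.toHom _) }
  fun x => by
    obtain ⟨f, rfl⟩ := AsyQuot.mk_surjective x
    exact congrArg AsyQuot.mk (BoundedContinuousFunction.ext fun t => g.map_grade _)

theorem asyMap_mk (g : GrHom E E') (f : BC E) :
    asyMap g (AsyAlg.mk f) = AsyAlg.mk (BC.map g.toCLM f) := rfl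

theorem norm_asyMap (g : GrHom E E') (hg : ∀ x, ‖g x‖ = ‖x‖) (x) : ‖asyMap g x‖ = ‖x‖ := by
  obtain ⟨f, rfl⟩ := AsyAlg.mk_surjective x
  exact (AsyQuot.norm_mk _).trans ((BC.limNorm_map _ hg f).trans (AsyQuot.norm_mk f).symm)

theorem asyMap_comp {E'' : GrCStar 𝕜} (g : GrHom E' E'') (f : GrHom E E') (x) :
    asyMap (g.comp f) x = asyMap g (asyMap f x) := by
  obtain ⟨f, rfl⟩ := AsyAlg.mk_surjective x
  rfl

theorem asyMap_id (x : (AsyAlg E).carrier) : asyMap (GrHom.id E) x = x := by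
  obtain ⟨f, rfl⟩ := AsyAlg.mk_surjective x
  rfl

variable (E) in
/-- The inclusion of `E` in its asymptotic algebra by constant functions. -/
def asyConst : GrHom E (AsyAlg E) := GrHom.ofHom
  { toFun := fun x => AsyAlg.mk (BoundedContinuousFunction.const _ x)
    map_zero' := rfl
    map_add' := fun _ _ => rfl
    map_smul' := fun _ _ => rfl
    map_mul' := fun _ _ => rfl
    map_star' := fun _ => rfl }
  fun _ => rfl

theorem asyConst_apply (x : E.carrier) :
    asyConst E x = AsyAlg.mk (BoundedContinuousFunction.const _ x) := rfl

end AsyAlg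

/-! ### Asymptotic morphisms as homomorphisms to the asymptotic algebra -/

section Hat

variable {A A' B B' : GrCStar 𝕜}

/-- The path `t ↦ φ_t(a)`. -/
def Asy.path (φ : Asy A B) (a : A.carrier) : BC B :=
  BoundedContinuousFunction.ofNormedAddCommGroup (fun t => φ.toFun t a) (φ.cont a)
    (φ.bdd a).choose (φ.bdd a).choose_spec

theorem Asy.path_apply (φ : Asy A B) (a : A.carrier) (t) : φ.path a t = φ.toFun t a := rfl

/-- The homomorphism to the asymptotic algebra given by an asymptotic morphism. -/
def Asy.hat (φ : Asy A B) : GrHom A (AsyAlg B) :=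
  have hlin : ∀ a b (c : 𝕜), AsyQuot.mk (φ.path (a + c • b)) =
      AsyQuot.mk (φ.path a) + c • AsyQuot.mk (φ.path b) := fun a b c => by
    rw [← AsyQuot.mk_smul, ← AsyQuot.mk_add, AsyQuot.mk_eq_mk]
    refine (φ.lin a b c).congr fun t => ?_
    rw [BoundedContinuousFunction.add_apply, BoundedContinuousFunction.smul_apply, φ.path_apply,
      φ.path_apply, φ.path_apply, sub_sub]
  have h0 : AsyQuot.mk (φ.path 0) = 0 := by
    have := hlin 0 0 1
    rw [smul_zero, add_zero, one_smul] at this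
    exact left_eq_add.1 this
  GrHom.ofHom (B := AsyAlg B)
  { toFun := fun a => AsyQuot.mk (φ.path a)
    map_zero' := h0
    map_add' := fun a b => by
      have := hlin a b 1
      rwa [one_smul, one_smul] at this
    map_smul' := fun c a => by
      have := hlin 0 a c
      rwa [zero_add, h0, zero_add] at this
    map_mul' := fun a b => AsyQuot.mk_eq_mk.2 (φ.mul a b)
    map_star' := fun a => AsyQuot.mk_eq_mk.2 (φ.star a) }
  fun a => AsyQuot.mk_eq_mk.2 (φ.grade a)

theorem Asy.hat_apply (φ : Asy A B) (a : A.carrier) : φ.hat a = AsyAlg.mk (φ.path a) := rfl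

/-- An asymptotic morphism that lifts a homomorphism to the asymptotic algebra, by a choice of
representatives. -/
def asyLift (F : GrHom A (AsyAlg B)) : Asy A B :=
  have h : ∀ a, ∃ f : BC B, AsyAlg.mk f = F a := fun a => AsyAlg.mk_surjective (F a)
  { toFun := fun t a => (h a).choose t
    cont := fun a => (h a).choose.continuous
    bdd := fun a => ⟨_, (h a).choose.norm_coe_le_norm⟩
    mul := fun a b => AsyAlg.mk_eq_mk (f := (h (a * b)).choose)
      (g := (h a).choose * (h b).choose).1 (by
        rw [AsyAlg.mk_mul, (h a).choose_spec, (h b).choose_spec, (h (a * b)).choose_spec, map_mul])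
    lin := fun a b c => by
      have e : AsyAlg.mk (h (a + c • b)).choose =
          AsyAlg.mk ((h a).choose + c • (h b).choose) := by
        have e1 : AsyAlg.mk ((h a).choose + c • (h b).choose) =
          AsyAlg.mk (h a).choose + c • AsyAlg.mk (h b).choose := rfl
        rw [e1, (h a).choose_spec, (h b).choose_spec, (h (a + c • b)).choose_spec, map_add,
          map_smul]
      refine (AsyAlg.mk_eq_mk.1 e).congr fun t => ?_
      rw [sub_sub]
      rfl
    star := fun a => AsyAlg.mk_eq_mk (f := (h (star a)).choose) (g := star (h a).choose).1 (by
      have e1 : AsyAlg.mk (star (h a).choose) = star (AsyAlg.mk (h a).choose) := rfl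
      rw [e1, (h a).choose_spec, (h (star a)).choose_spec, map_star])
    grade := fun a => AsyAlg.mk_eq_mk (f := (h (A.grade a)).choose)
      (g := BC.map B.gradeL (h a).choose).1 (by
        rw [← AsyAlg.mk_grade, (h a).choose_spec, (h (A.grade a)).choose_spec, F.map_grade]) }

@[simp] theorem hat_asyLift (F : GrHom A (AsyAlg B)) : (asyLift F).hat = F :=
  GrHom.ext fun a => (AsyAlg.mk_surjective (F a)).choose_spec

/-- Asymptotic equivalence is equality of the homomorphisms to the asymptotic algebra. -/
theorem cls_eq_cls {φ ψ : Asy A B} : φ.cls = ψ.cls ↔ φ.hat = ψ.hat := by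
  constructor
  · intro h
    exact GrHom.ext fun a => AsyAlg.mk_eq_mk.2 (Quotient.exact h a)
  · intro h
    exact Quotient.sound fun a => AsyAlg.mk_eq_mk (f := φ.path a) (g := ψ.path a).1
      (congrArg (fun F : GrHom A (AsyAlg B) => F a) h)

theorem hat_precomp (φ : Asy A B) (f : GrHom A' A) : (φ.precomp f).hat = φ.hat.comp f := rfl

theorem hat_postcomp (φ : Asy A B) (g : GrHom B B') :
    (φ.postcomp g).hat = (asyMap g).comp φ.hat := rfl

/-- The class of a homomorphism to the asymptotic algebra. -/
def asyCls (F : GrHom A (AsyAlg B)) : (AsySpace A B).carrier := (asyLift F).cls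

theorem asyCls_hat (φ : Asy A B) : asyCls φ.hat = φ.cls := cls_eq_cls.2 (hat_asyLift _)

theorem asyCls_surjective : Function.Surjective (asyCls (A := A) (B := B)) := fun x => by
  obtain ⟨φ, rfl⟩ := Quotient.exists_rep x
  exact ⟨φ.hat, asyCls_hat φ⟩

theorem mk_mul_const_eq {M : GrCStar 𝕜} {χ : GrHom B M} {f g : BC B} {u : M.carrier}
    (h : ∀ t, χ (f t) * u = u * χ (g t)) :
    asyMap χ (AsyAlg.mk f) * asyConst M u = asyConst M u * asyMap χ (AsyAlg.mk g) := by
  rw [asyMap_mk, asyMap_mk, asyConst_apply, ← AsyAlg.mk_mul, ← AsyAlg.mk_mul]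
  exact congrArg AsyAlg.mk (BoundedContinuousFunction.ext h)

theorem const_mul_mk_eq {M E : GrCStar 𝕜} {χ : GrHom B M} {j : GrHom E M} {f : BC B} {g : BC E}
    {u : M.carrier} (h : ∀ t, j (g t) = u * χ (f t)) :
    asyMap j (AsyAlg.mk g) = asyConst M u * asyMap χ (AsyAlg.mk f) := by
  rw [asyMap_mk, asyMap_mk, asyConst_apply, ← AsyAlg.mk_mul]
  exact congrArg AsyAlg.mk (BoundedContinuousFunction.ext h)

/-- Constants in `D` and paths in `B` commute in the graded sense in the asymptotic algebra of the
multiplier algebra of `D ⊗̂ B`, and their products lie in the asymptotic algebra of `D ⊗̂ B`, which is a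
subalgebra because the functor `asyMap` preserves isometries. -/
theorem exists_tau (D B : GrCStar 𝕜) :
    ∃ τ : GrHom (D.tensor (AsyAlg B)) (AsyAlg (D.tensor B)),
      ∀ d (f : BC B), τ (tmul d (AsyAlg.mk f)) = AsyAlg.mk (BC.map (tmulL D B d) f) := by
  have hs : ∀ i d, D.toAlg.IsHomog i d → ∀ b, multRight D (emb B) b * multLeft D B d =
      multLeft D B d * multRight D (emb B) (B.toAlg.gradePow i b) := fun i d hd b =>
    (multLeft_commute (A := D) (emb B)).swap b hd
  have hc : GradedCommute ((asyConst _).comp (multLeft D B)) (asyMap (multRight D (emb B))) := by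
    refine GradedCommute.of_forall fun i d y hd => ?_
    obtain ⟨f, rfl⟩ := AsyAlg.mk_surjective y
    cases i
    · have e : ∀ t, multRight D (emb B) (f t) * multLeft D B d =
        multLeft D B d * multRight D (emb B) (f t) := fun t => hs _ _ hd (f t)
      exact mk_mul_const_eq e
    · have e : ∀ t, multRight D (emb B) (f t) * multLeft D B d =
        multLeft D B d * multRight D (emb B) (BC.map B.gradeL f t) := fun t => hs _ _ hd (f t)
      exact mk_mul_const_eq e
  have key : ∀ d (f : BC B), asyMap (emb (D.tensor B)) (AsyAlg.mk (BC.map (tmulL D B d) f)) =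
      asyConst _ (multLeft D B d) * asyMap (multRight D (emb B)) (AsyAlg.mk f) := fun d f =>
    const_mul_mk_eq fun t => emb_tmul d (f t)
  have hn := norm_asyMap _ (norm_emb (E := D.tensor B))
  obtain ⟨g, hg⟩ := exists_pairLift _ hn _ _ hc fun d y => by
    obtain ⟨f, rfl⟩ := AsyAlg.mk_surjective y
    exact ⟨_, key d f⟩
  refine ⟨g, fun d f => ?_⟩
  have h1 := (hg d (AsyAlg.mk f)).trans (key d f).symm
  rw [← sub_eq_zero, ← map_sub, ← norm_eq_zero, hn, norm_eq_zero, sub_eq_zero] at h1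
  exact h1

/-- The homomorphism `D ⊗̂ 𝔄(B) → 𝔄(D ⊗̂ B)` that multiplies a path by a constant. -/
def tau (D B : GrCStar 𝕜) : GrHom (D.tensor (AsyAlg B)) (AsyAlg (D.tensor B)) :=
  (exists_tau D B).choose

theorem tau_tmul {D B : GrCStar 𝕜} (d : D.carrier) (f : BC B) :
    tau D B (tmul d (AsyAlg.mk f)) = AsyAlg.mk (BC.map (tmulL D B d) f) :=
  (exists_tau D B).choose_spec d f

theorem tau_natural {D D' : GrCStar 𝕜} (g : GrHom D D') (h : GrHom B B') :
    (asyMap (tensorMap g h)).comp (tau D B) = (tau D' B').comp (tensorMap g (asyMap h)) := by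
  refine GrHom.tensor_ext fun d y => ?_
  obtain ⟨f, rfl⟩ := AsyAlg.mk_surjective y
  rw [GrHom.comp_apply, GrHom.comp_apply, tau_tmul, tensorMap_tmul, asyMap_mk, asyMap_mk, tau_tmul]
  exact congrArg AsyAlg.mk (BoundedContinuousFunction.ext fun t => tensorMap_tmul g h d (f t))

/-- The homomorphism to the asymptotic algebra that represents `id ⊗̂ x`. -/
def idTensor (D : GrCStar 𝕜) (F : GrHom A (AsyAlg B)) : GrHom (D.tensor A) (AsyAlg (D.tensor B)) :=
  (tau D B).comp (tensorMap (GrHom.id D) F)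

/-- The asymptotic condition that characterizes `id ⊗̂ x` says that `id ⊗̂ x` represents the composition of
`id ⊗̂ x.hat` with `tau`. -/
theorem isIdTensor_iff {D : GrCStar 𝕜} (x : Asy A B) (z : Asy (D.tensor A) (D.tensor B)) :
    IsIdTensor x z ↔ z.hat = idTensor D x.hat := by
  have key : ∀ d a, idTensor D x.hat (tmul d a) = AsyAlg.mk (BC.map (tmulL D B d) (x.path a)) :=
    fun d a => by
      rw [idTensor, GrHom.comp_apply, tensorMap_tmul, x.hat_apply, tau_tmul, GrHom.id_apply]
  constructor
  · intro h
    refine GrHom.tensor_ext fun d a => ?_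
    rw [key, z.hat_apply]
    exact AsyAlg.mk_eq_mk.2 (h d a)
  · intro h d a
    have h1 := congrArg (fun F : GrHom (D.tensor A) (AsyAlg (D.tensor B)) => F (tmul d a)) h
    change z.hat (tmul d a) = idTensor D x.hat (tmul d a) at h1
    rw [key, z.hat_apply] at h1
    exact AsyAlg.mk_eq_mk.1 h1

end Hat

end

/-! ### Sharpening norm estimates by powers -/

/-- A bound up to a constant for all `2ⁿ`-th powers is a bound without the constant. Together with the
C*-identity this removes constants from norm estimates. -/
theorem le_of_pow_two_pow_le {a M K : ℝ} (hM : 0 ≤ M) (h : ∀ n : ℕ, a ^ 2 ^ n ≤ K * M ^ 2 ^ n) :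
    a ≤ M := by
  by_contra! hc
  rcases hM.eq_or_lt with rfl | hM
  · have := h 0
    simp at this
    linarith
  obtain ⟨m, hm⟩ := pow_unbounded_of_one_lt K ((one_lt_div hM).2 hc)
  have h1 : (a / M) ^ m ≤ (a / M) ^ 2 ^ m :=
    pow_le_pow_right₀ ((one_lt_div hM).2 hc).le Nat.lt_two_pow_self.le
  have h2 := h m
  rw [← div_le_iff₀ (by positivity), ← div_pow] at h2
  linarith

/-- The norm of a sum of elements with orthogonal ranges and orthogonal supports is at most the maximum
of their norms. The C*-identity passes from the `Q i` to the elements `(Q i)* Q i`, which are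
orthogonal again, and the trivial bound by the number of summands suffices for
`le_of_pow_two_pow_le`. -/
theorem norm_sum_le_of_orthogonal {E : GrCStar 𝕜} {ι : Type*} (s : Finset ι) (Q : ι → E.carrier)
    (h₁ : ∀ i ∈ s, ∀ j ∈ s, i ≠ j → star (Q i) * Q j = 0)
    (h₂ : ∀ i ∈ s, ∀ j ∈ s, i ≠ j → Q i * star (Q j) = 0) {M : ℝ} (hM : 0 ≤ M)
    (hQ : ∀ i ∈ s, ‖Q i‖ ≤ M) : ‖∑ i ∈ s, Q i‖ ≤ M := by
  refine le_of_pow_two_pow_le (K := s.card) hM fun n => ?_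
  induction n generalizing Q M with
  | zero =>
    rw [pow_zero, pow_one, pow_one, ← nsmul_eq_mul]
    exact (norm_sum_le _ _).trans (Finset.sum_le_card_nsmul _ _ _ hQ)
  | succ n ih =>
    have e : star (∑ i ∈ s, Q i) * ∑ i ∈ s, Q i = ∑ i ∈ s, star (Q i) * Q i := by
      rw [star_sum, Finset.sum_mul_sum]
      refine Finset.sum_congr rfl fun i hi => ?_
      rw [Finset.sum_eq_single i (fun j hj hij => h₁ i hi j hj hij.symm) fun h => absurd hi h]
    have h := ih (fun i => star (Q i) * Q i) (M := M ^ 2) (fun i hi j hj hij => ?_)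
      (fun i hi j hj hij => ?_) (by positivity) fun i hi => ?_
    · rw [← e, CStarRing.norm_star_mul_self, ← sq, ← pow_mul, ← pow_mul, ← pow_succ'] at h
      exact h
    · rw [star_mul, star_star, mul_assoc, ← mul_assoc (Q i), h₂ i hi j hj hij, zero_mul, mul_zero]
    · rw [star_mul, star_star, mul_assoc, ← mul_assoc (Q i), h₂ i hi j hj hij, zero_mul, mul_zero]
    · rw [CStarRing.norm_star_mul_self, ← sq]
      exact pow_le_pow_left₀ (norm_nonneg _) (hQ i hi) 2

/-- If the homomorphisms `Φ i` control the norm of `T z` up to a constant for all `z`, then they control it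
without the constant: apply the estimate to `z* z`, `(z* z)²`, and so on. -/
theorem norm_le_of_family {A E : GrCStar 𝕜} {ι : Type*} {F : ι → GrCStar 𝕜} (T : GrHom A E)
    (Φ : ∀ i, GrHom A (F i)) (K : ℝ)
    (h : ∀ (z : A.carrier) (M : ℝ), 0 ≤ M → (∀ i, ‖Φ i z‖ ≤ M) → ‖T z‖ ≤ K * M)
    {z : A.carrier} {M : ℝ} (hM : 0 ≤ M) (hz : ∀ i, ‖Φ i z‖ ≤ M) : ‖T z‖ ≤ M := by
  refine le_of_pow_two_pow_le (K := K) hM fun n => ?_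
  induction n generalizing z M with
  | zero =>
    rw [pow_zero, pow_one, pow_one]
    exact h z M hM hz
  | succ n ih =>
    have h := ih (z := star z * z) (M := M ^ 2) (by positivity) fun i => by
      rw [map_mul, map_star, CStarRing.norm_star_mul_self, ← sq]
      exact pow_le_pow_left₀ (norm_nonneg _) (hz i) 2
    rwa [map_mul, map_star, CStarRing.norm_star_mul_self, ← sq, ← pow_mul, ← pow_mul,
      ← pow_succ'] at h

/-! ### Generators of `𝒮` -/

section Generators

/-- A continuous real function that vanishes at infinity as an element of `𝒮`. -/
def ofRealS (f : ℝ → ℝ) (hf : Continuous f) (h : Tendsto f (cocompact ℝ) (𝓝 0)) : C₀(ℝ, 𝕜) where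
  toFun x := (f x : 𝕜)
  continuous_toFun := RCLike.continuous_ofReal.comp hf
  zero_at_infty' := by
    have h1 := (RCLike.continuous_ofReal (K := 𝕜)).tendsto 0
    rw [RCLike.ofReal_zero] at h1
    exact h1.comp h

theorem tendsto_mul_gauss : Tendsto (fun x : ℝ => x * Real.exp (-x ^ 2)) (cocompact ℝ) (𝓝 0) := by
  have h := tendsto_rpow_abs_mul_exp_neg_mul_sq_cocompact (a := 1) one_pos 1
  refine squeeze_zero_norm (fun x => ?_) h
  rw [norm_mul, Real.norm_eq_abs, Real.norm_eq_abs, Real.abs_exp, Real.rpow_one, neg_one_mul]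

theorem tendsto_gauss : Tendsto (fun x : ℝ => Real.exp (-x ^ 2)) (cocompact ℝ) (𝓝 0) := by
  have h := tendsto_rpow_abs_mul_exp_neg_mul_sq_cocompact (a := 1) one_pos 0
  refine squeeze_zero_norm (fun x => ?_) h
  rw [Real.norm_eq_abs, Real.abs_exp, Real.rpow_zero, one_mul, neg_one_mul]

variable (𝕜) in
/-- The generator `exp (-x²)` of `𝒮`. -/
def gaussS : C₀(ℝ, 𝕜) := ofRealS (fun x => Real.exp (-x ^ 2)) (by fun_prop) tendsto_gauss

variable (𝕜) in
/-- The generator `x exp (-x²)` of `𝒮`. -/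
def xgaussS : C₀(ℝ, 𝕜) := ofRealS (fun x => x * Real.exp (-x ^ 2)) (by fun_prop) tendsto_mul_gauss

theorem gaussS_apply (x : ℝ) : gaussS 𝕜 x = (Real.exp (-x ^ 2) : 𝕜) := rfl
theorem xgaussS_apply (x : ℝ) : xgaussS 𝕜 x = ((x * Real.exp (-x ^ 2) : ℝ) : 𝕜) := rfl

/-- The extension of a function in `𝒮` by zero to the one-point compactification. -/
def extendS (f : C₀(ℝ, 𝕜)) : C(OnePoint ℝ, 𝕜) where
  toFun x := OnePoint.elim x 0 f
  continuous_toFun := by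
    rw [OnePoint.continuous_iff]
    refine ⟨?_, f.continuous⟩
    rw [Filter.coclosedCompact_eq_cocompact]
    exact f.zero_at_infty'

theorem extendS_coe (f : C₀(ℝ, 𝕜)) (x : ℝ) : extendS f x = f x := rfl
theorem extendS_infty (f : C₀(ℝ, 𝕜)) : extendS f OnePoint.infty = 0 := rfl

/-- `exp (-x²)` and `x exp (-x²)` generate `𝒮`, by the Stone–Weierstrass theorem on the one-point
compactification of `ℝ`. -/
theorem s_induction {p : C₀(ℝ, 𝕜) → Prop} (hc : IsClosed {f | p f})
    (hadd : ∀ f g, p f → p g → p (f + g)) (hsmul : ∀ (c : 𝕜) f, p f → p (c • f))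
    (hmul : ∀ f g, p f → p g → p (f * g)) (hu : p (gaussS 𝕜)) (hv : p (xgaussS 𝕜)) (f) : p f := by
  -- closing the property under the adjoint is harmless, as the two generators are self-adjoint
  let N : NonUnitalStarSubalgebra 𝕜 C₀(ℝ, 𝕜) :=
    { carrier := {f | p f ∧ p (star f)}
      add_mem' := fun {f g} hf hg => ⟨hadd _ _ hf.1 hg.1, by
        rw [star_add]; exact hadd _ _ hf.2 hg.2⟩
      zero_mem' := by
        have h0 : p 0 := by simpa using hsmul 0 _ hu
        exact ⟨h0, by rwa [star_zero]⟩
      mul_mem' := fun {f g} hf hg => ⟨hmul _ _ hf.1 hg.1, by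
        rw [star_mul]; exact hmul _ _ hg.2 hf.2⟩
      smul_mem' := fun c f hf => ⟨hsmul _ _ hf.1, by rw [star_smul]; exact hsmul _ _ hf.2⟩
      star_mem' := fun {f} hf => ⟨hf.2, by rw [star_star]; exact hf.1⟩ }
  have hu' : gaussS 𝕜 ∈ N := ⟨hu, by
    have : star (gaussS 𝕜) = gaussS 𝕜 := by
      ext x
      exact RCLike.conj_ofReal _
    rwa [this]⟩
  have hv' : xgaussS 𝕜 ∈ N := ⟨hv, by
    have : star (xgaussS 𝕜) = xgaussS 𝕜 := by
      ext x
      exact RCLike.conj_ofReal _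
    rwa [this]⟩
  -- adjoin the constants
  let A : StarSubalgebra 𝕜 C(OnePoint ℝ, 𝕜) :=
    { carrier := {g | ∃ c : 𝕜, ∃ f ∈ N, g = algebraMap 𝕜 _ c + extendS f}
      add_mem' := by
        rintro _ _ ⟨c, f, hf, rfl⟩ ⟨d, g, hg, rfl⟩
        refine ⟨c + d, f + g, add_mem hf hg, ?_⟩
        ext x
        induction x using OnePoint.rec <;> simp [extendS_coe, extendS_infty]
        ring
      mul_mem' := by
        rintro _ _ ⟨c, f, hf, rfl⟩ ⟨d, g, hg, rfl⟩
        refine ⟨c * d, c • g + d • f + f * g, add_mem (add_mem (SMulMemClass.smul_mem c hg)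
          (SMulMemClass.smul_mem d hf)) (mul_mem hf hg), ?_⟩
        ext x
        induction x using OnePoint.rec <;> simp [extendS_coe, extendS_infty]
        ring
      algebraMap_mem' := fun c => ⟨c, 0, zero_mem _, by
        ext x
        induction x using OnePoint.rec <;> simp [extendS_coe, extendS_infty]⟩
      star_mem' := by
        rintro _ ⟨c, f, hf, rfl⟩
        refine ⟨star c, star f, star_mem hf, ?_⟩
        ext x
        induction x using OnePoint.rec <;> simp [extendS_coe, extendS_infty] }
  have hA : A.topologicalClosure = ⊤ := by
    refine ContinuousMap.starSubalgebra_topologicalClosure_eq_top_of_separatesPoints A ?_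
    intro x y hxy
    have hun : extendS (gaussS 𝕜) ∈ A := ⟨0, _, hu', by simp⟩
    have hvn : extendS (xgaussS 𝕜) ∈ A := ⟨0, _, hv', by simp⟩
    -- if `exp (-x²)` takes the same value at both points, then `x exp (-x²)` separates them
    by_cases h : extendS (gaussS 𝕜) x = extendS (gaussS 𝕜) y
    · have hp : ∀ x : ℝ, (Real.exp (-x ^ 2) : 𝕜) ≠ 0 := fun x =>
        RCLike.ofReal_ne_zero.2 (Real.exp_ne_zero _)
      refine ⟨_, ⟨_, hvn, rfl⟩, fun h' => ?_⟩
      induction x using OnePoint.rec with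
      | infty =>
        induction y using OnePoint.rec with
        | infty => exact hxy rfl
        | coe y => exact hp y h.symm
      | coe x =>
        induction y using OnePoint.rec with
        | infty => exact hp x h
        | coe y =>
          rw [extendS_coe, extendS_coe, gaussS_apply, gaussS_apply, RCLike.ofReal_inj] at h
          change xgaussS 𝕜 x = xgaussS 𝕜 y at h'
          rw [xgaussS_apply, xgaussS_apply, RCLike.ofReal_inj, h] at h'
          exact hxy (congrArg _ (mul_right_cancel₀ (Real.exp_ne_zero _) h'))
    · exact ⟨_, ⟨_, hun, rfl⟩, h⟩
  have hf : extendS f ∈ closure (A : Set C(OnePoint ℝ, 𝕜)) := by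
    have : extendS f ∈ A.topologicalClosure := by rw [hA]; trivial
    exact this
  refine hc.closure_subset (Metric.mem_closure_iff.2 fun ε hε => ?_)
  obtain ⟨_, ⟨c, g, hg, rfl⟩, hd⟩ := Metric.mem_closure_iff.1 hf (ε / 3) (by positivity)
  refine ⟨g, hg.1, ?_⟩
  rw [dist_eq_norm] at hd ⊢
  have h1 : ∀ x, ‖extendS f x - (c + extendS g x)‖ ≤ ε / 3 := fun x =>
    (ContinuousMap.norm_coe_le_norm (extendS f - (algebraMap 𝕜 _ c + extendS g)) x).trans hd.le
  -- the value at infinity shows that the constant is small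
  have h2 := h1 OnePoint.infty
  rw [extendS_infty, extendS_infty] at h2
  have h2' : ‖c‖ ≤ ε / 3 := by simpa using h2
  refine (c0_norm_le (f := f - g) (M := 2 * ε / 3) (by positivity) fun x => ?_).trans_lt
    (by linarith)
  have h3 := h1 x
  rw [extendS_coe, extendS_coe] at h3
  calc ‖(f - g) x‖ = ‖(f x - (c + g x)) + c‖ := by
        rw [ZeroAtInftyContinuousMap.sub_apply]
        congr 1
        ring
    _ ≤ _ := (norm_add_le _ _).trans (by linarith)

theorem GrHom.s_ext {E : GrCStar 𝕜} {f g : GrHom (SAlg 𝕜) E} (hu : f (gaussS 𝕜) = g (gaussS 𝕜))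
    (hv : f (xgaussS 𝕜) = g (xgaussS 𝕜)) : f = g :=
  GrHom.ext fun x => s_induction (p := fun x => f x = g x) (isClosed_eq f.continuous g.continuous)
    (fun x y hx hy => by
      change f.toHom _ = g.toHom _ at hx hy ⊢
      exact (map_add f.toHom x y).trans ((congrArg₂ _ hx hy).trans (map_add g.toHom x y).symm))
    (fun c x hx => (map_smul f.toHom c x).trans ((congrArg _ hx).trans (map_smul g.toHom c x).symm))
    (fun x y hx hy => (map_mul f.toHom x y).trans
      ((congrArg₂ _ hx hy).trans (map_mul g.toHom x y).symm)) hu hv x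

end Generators

/-! ### Homomorphisms from `𝒮` by functional calculus at a point -/

section Point

variable {E : GrCStar 𝕜}

/-- The value of the even part. -/
def evS (x : ℝ) (f : C₀(ℝ, 𝕜)) : 𝕜 := (f x + f (-x)) / 2
/-- The value of the odd part. -/
def odS (x : ℝ) (f : C₀(ℝ, 𝕜)) : 𝕜 := (f x - f (-x)) / 2

theorem evS_add (x : ℝ) (f g : C₀(ℝ, 𝕜)) : evS x (f + g) = evS x f + evS x g := by
  simp [evS]; ring
theorem odS_add (x : ℝ) (f g : C₀(ℝ, 𝕜)) : odS x (f + g) = odS x f + odS x g := by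
  simp [odS]; ring
theorem evS_smul (x : ℝ) (c : 𝕜) (f : C₀(ℝ, 𝕜)) : evS x (c • f) = c * evS x f := by
  simp [evS]; ring
theorem odS_smul (x : ℝ) (c : 𝕜) (f : C₀(ℝ, 𝕜)) : odS x (c • f) = c * odS x f := by
  simp [odS]; ring
theorem evS_mul (x : ℝ) (f g : C₀(ℝ, 𝕜)) :
    evS x (f * g) = evS x f * evS x g + odS x f * odS x g := by
  simp [evS, odS]; ring
theorem odS_mul (x : ℝ) (f g : C₀(ℝ, 𝕜)) :
    odS x (f * g) = evS x f * odS x g + odS x f * evS x g := by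
  simp [evS, odS]; ring
theorem evS_star (x : ℝ) (f : C₀(ℝ, 𝕜)) : evS x (star f) = star (evS x f) := by simp [evS]
theorem odS_star (x : ℝ) (f : C₀(ℝ, 𝕜)) : odS x (star f) = star (odS x f) := by simp [odS]
theorem evS_flip (x : ℝ) (f : C₀(ℝ, 𝕜)) : evS x (flipS f) = evS x f := by
  rw [evS, evS, flipS_apply, flipS_apply, neg_neg, add_comm]
theorem odS_flip (x : ℝ) (f : C₀(ℝ, 𝕜)) : odS x (flipS f) = -odS x f := by
  rw [odS, odS, flipS_apply, flipS_apply, neg_neg]; ring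
theorem odS_zero (f : C₀(ℝ, 𝕜)) : odS 0 f = 0 := by simp [odS]

/-- A self-adjoint odd element `d` with `d² = x² p`, where `p` is a unit for `d`, has a functional
calculus `f ↦ f(d)`. -/
structure IsPoint (x : ℝ) (p d : E.carrier) : Prop where
  pp : p * p = p
  pd : p * d = d
  dp : d * p = d
  dd : d * d = ((x ^ 2 : ℝ) : 𝕜) • p
  sp : star p = p
  sd : star d = d
  gp : E.grade p = p
  gd : E.grade d = -d

theorem IsPoint.mul {x : ℝ} {p d : E.carrier} (h : IsPoint x p d) (a b a' b' : 𝕜) :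
    (a • p + b • d) * (a' • p + b' • d) =
      (a * a' + b * b' * ((x ^ 2 : ℝ) : 𝕜)) • p + (a * b' + b * a') • d := by
  simp only [add_mul, mul_add, smul_mul_assoc, mul_smul_comm, h.pp, h.pd, h.dp, h.dd]
  module

/-- The homomorphism `f ↦ f(d) = f_even(x) p + (f_odd(x) / x) d`. The quotient by `x = 0` is harmless:
an odd function vanishes at `0`. -/
def pointHom {x : ℝ} {p d : E.carrier} (h : IsPoint x p d) : GrHom (SAlg 𝕜) E := GrHom.ofHom
  (A := SAlg 𝕜)
  { toFun := fun f : C₀(ℝ, 𝕜) => evS x f • p + (odS x f / (x : 𝕜)) • d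
    map_zero' := by
      have h1 : evS x (0 : C₀(ℝ, 𝕜)) = 0 := by simp [evS]
      have h2 : odS x (0 : C₀(ℝ, 𝕜)) = 0 := by simp [odS]
      exact (congrArg₂ (fun a b : 𝕜 => a • p + (b / (x : 𝕜)) • d) h1 h2).trans (by simp)
    map_add' := fun f g => by
      refine (congrArg₂ (fun a b : 𝕜 => a • p + (b / (x : 𝕜)) • d) (evS_add x f g)
        (odS_add x f g)).trans ?_
      simp only [add_div]
      module
    map_smul' := fun c f => by
      refine (congrArg₂ (fun a b : 𝕜 => a • p + (b / (x : 𝕜)) • d) (evS_smul x c f)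
        (odS_smul x c f)).trans ?_
      simp only [mul_div_assoc, mul_smul, smul_add, MonoidHom.id_apply]
    map_mul' := fun f g => by
      refine (congrArg₂ (fun a b : 𝕜 => a • p + (b / (x : 𝕜)) • d) (evS_mul x f g)
        (odS_mul x f g)).trans (Eq.trans ?_ (h.mul _ _ _ _).symm)
      have e : odS x f / (x : 𝕜) * (odS x g / (x : 𝕜)) * ((x ^ 2 : ℝ) : 𝕜) =
          odS x f * odS x g := by
        by_cases hx : x = 0
        · have : odS x f = 0 := by rw [hx]; exact odS_zero f
          rw [this]
          simp
        · have hx' : (x : 𝕜) ≠ 0 := RCLike.ofReal_ne_zero.2 hx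
          push_cast
          field_simp
      rw [e]
      congr 2
      ring
    map_star' := fun f => by
      refine (congrArg₂ (fun a b : 𝕜 => a • p + (b / (x : 𝕜)) • d) (evS_star x f)
        (odS_star x f)).trans ?_
      rw [star_add, star_smul, star_smul, h.sp, h.sd, star_div₀]
      simp }
  fun f => by
    refine (congrArg₂ (fun a b : 𝕜 => a • p + (b / (x : 𝕜)) • d) (evS_flip x f)
      (odS_flip x f)).trans ?_
    refine Eq.trans ?_ (map_add E.grade _ _).symm
    rw [map_smul, map_smul, h.gp, h.gd, neg_div, neg_smul, smul_neg]

theorem pointHom_apply {x : ℝ} {p d : E.carrier} (h : IsPoint x p d) (f : C₀(ℝ, 𝕜)) :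
    pointHom h f = evS x f • p + (odS x f / (x : 𝕜)) • d := rfl

theorem pointHom_gauss {x : ℝ} {p d : E.carrier} (h : IsPoint x p d) :
    pointHom h (gaussS 𝕜) = (Real.exp (-x ^ 2) : 𝕜) • p := by
  have h1 : evS x (gaussS 𝕜) = (Real.exp (-x ^ 2) : 𝕜) := by simp [evS, gaussS_apply]
  have h2 : odS x (gaussS 𝕜) = 0 := by simp [odS, gaussS_apply]
  rw [pointHom_apply, h1, h2, zero_div, zero_smul, add_zero]

/-- At `x = 0` the C*-identity gives `d = 0`. -/
theorem IsPoint.eq_zero {p d : E.carrier} (h : IsPoint (𝕜 := 𝕜) 0 p d) : d = 0 := by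
  have := h.dd
  nth_rewrite 1 [← h.sd] at this
  rw [← CStarRing.star_mul_self_eq_zero_iff, this]
  simp

theorem pointHom_xgauss {x : ℝ} {p d : E.carrier} (h : IsPoint x p d) :
    pointHom h (xgaussS 𝕜) = (Real.exp (-x ^ 2) : 𝕜) • d := by
  have h1 : evS x (xgaussS 𝕜) = 0 := by simp [evS, xgaussS_apply]
  have h2 : odS x (xgaussS 𝕜) = (x : 𝕜) * (Real.exp (-x ^ 2) : 𝕜) := by
    simp [odS, xgaussS_apply]
  rw [pointHom_apply, h1, h2, zero_smul, zero_add]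
  by_cases hx : x = 0
  · subst hx
    rw [h.eq_zero, smul_zero, smul_zero]
  · have hx' : (x : 𝕜) ≠ 0 := RCLike.ofReal_ne_zero.2 hx
    rw [mul_div_cancel_left₀ _ hx']

end Point

/-! ### The spin representation of the tensor square of `𝒮` -/

section Spin

/-- The bounded operators on a Hilbert space, graded by conjugation with a self-adjoint unitary. -/
def opAlg {H : Type} [NormedAddCommGroup H] [InnerProductSpace 𝕜 H] [CompleteSpace H]
    (J : H →L[𝕜] H) (hJ : J * J = 1) (hs : star J = J) : GrCStar 𝕜 :=
  have e : ∀ a : H →L[𝕜] H, J * (J * a * J) * J = a := fun a => by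
    rw [mul_assoc J a J, ← mul_assoc J J, hJ, one_mul, mul_assoc, hJ, mul_one]
  have hn : ‖J‖ ≤ 1 := by
    have h1 := CStarRing.norm_star_mul_self (x := J)
    rw [hs, hJ] at h1
    have h2 : ‖(1 : H →L[𝕜] H)‖ ≤ 1 := ContinuousLinearMap.norm_id_le
    nlinarith [norm_nonneg J]
  have hle : ∀ a : H →L[𝕜] H, ‖J * a * J‖ ≤ ‖a‖ := fun a => by
    have h1 := norm_mul_le (J * a) J
    have h2 := norm_mul_le J a
    nlinarith [norm_nonneg J, norm_nonneg a, norm_nonneg (J * a)]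
  { carrier := H →L[𝕜] H
    norm_sq_le := op_norm_sq_le
    grade :=
      { toFun := fun a => J * a * J
        map_add' := fun a b => by rw [mul_add, add_mul]
        map_smul' := fun c a => by rw [mul_smul_comm, smul_mul_assoc, RingHom.id_apply] }
    grade_grade := e
    grade_mul := fun a b => by
      change J * (a * b) * J = J * a * J * (J * b * J)
      have h1 : J * a * J * (J * b * J) = J * a * (J * J) * (b * J) := by simp only [mul_assoc]
      rw [h1, hJ, mul_one]
      simp only [mul_assoc]
    grade_star := fun a => by
      change J * star a * J = star (J * a * J)
      rw [star_mul, star_mul, hs, mul_assoc]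
    norm_grade := fun a => le_antisymm (hle a) (by
      have := hle (J * a * J)
      rwa [e] at this) }

variable (𝕜) in
/-- The operator on `𝕜⁴` given by a matrix. -/
def op4 : Matrix (Fin 4) (Fin 4) 𝕜 ≃⋆ₐ[𝕜]
    (EuclideanSpace 𝕜 (Fin 4) →L[𝕜] EuclideanSpace 𝕜 (Fin 4)) := Matrix.toEuclideanCLM

/-- The grading of the exterior algebra of the plane, in the basis `1, e₁, e₂, e₁ e₂`. -/
def spinJ : Matrix (Fin 4) (Fin 4) 𝕜 := !![1, 0, 0, 0; 0, -1, 0, 0; 0, 0, -1, 0; 0, 0, 0, 1]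
/-- Left Clifford multiplication by the first basis vector. -/
def spinE₁ : Matrix (Fin 4) (Fin 4) 𝕜 := !![0, 1, 0, 0; 1, 0, 0, 0; 0, 0, 0, 1; 0, 0, 1, 0]
/-- Left Clifford multiplication by the second basis vector. -/
def spinE₂ : Matrix (Fin 4) (Fin 4) 𝕜 := !![0, 0, 1, 0; 0, 0, 0, -1; 1, 0, 0, 0; 0, -1, 0, 0]

variable (𝕜) in
/-- The operators on the exterior algebra of the plane. -/
def spinAlg : GrCStar 𝕜 := opAlg (op4 𝕜 spinJ)
  (by
    rw [← map_mul, ← map_one (op4 𝕜)]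
    congr 1
    ext i j
    fin_cases i <;> fin_cases j <;> simp [spinJ, Matrix.mul_apply, Fin.sum_univ_four])
  (by
    rw [← map_star]
    congr 1
    ext i j
    fin_cases i <;> fin_cases j <;> simp [spinJ, Matrix.star_apply])

/-- The element of the graded algebra of operators given by a matrix. -/
def spinOp (a : Matrix (Fin 4) (Fin 4) 𝕜) : (spinAlg 𝕜).carrier := op4 𝕜 a

theorem spinOp_mul (a b : Matrix (Fin 4) (Fin 4) 𝕜) : spinOp (a * b) = spinOp a * spinOp b :=
  map_mul (op4 𝕜) a b
theorem spinOp_add (a b : Matrix (Fin 4) (Fin 4) 𝕜) : spinOp (a + b) = spinOp a + spinOp b :=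
  map_add (op4 𝕜) a b
theorem spinOp_smul (c : 𝕜) (a : Matrix (Fin 4) (Fin 4) 𝕜) : spinOp (c • a) = c • spinOp a :=
  map_smul (op4 𝕜) c a
theorem spinOp_star (a : Matrix (Fin 4) (Fin 4) 𝕜) : spinOp (star a) = star (spinOp a) :=
  map_star (op4 𝕜) a
theorem spinOp_grade (a : Matrix (Fin 4) (Fin 4) 𝕜) :
    (spinAlg 𝕜).grade (spinOp a) = spinOp (spinJ * a * spinJ) := by
  rw [spinOp_mul, spinOp_mul]
  rfl

/-- The entries of the first column are bounded by the operator norm. -/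
theorem norm_entry_le (a : Matrix (Fin 4) (Fin 4) 𝕜) (i : Fin 4) : ‖a i 0‖ ≤ ‖spinOp a‖ := by
  have h1 := (op4 𝕜 a).le_opNorm (EuclideanSpace.single 0 1)
  have h2 := PiLp.norm_apply_le (op4 𝕜 a (EuclideanSpace.single 0 1)) i
  have h3 : op4 𝕜 a (EuclideanSpace.single 0 1) i = a i 0 := by
    simp [op4]
  rw [h3] at h2
  have h4 : ‖EuclideanSpace.single (0 : Fin 4) (1 : 𝕜)‖ = 1 := by simp
  rw [h4, mul_one] at h1
  exact h2.trans h1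

theorem spinE₁_sq : spinE₁ * spinE₁ = (1 : Matrix (Fin 4) (Fin 4) 𝕜) := by
  ext i j
  fin_cases i <;> fin_cases j <;> simp [spinE₁, Matrix.mul_apply, Fin.sum_univ_four]
theorem spinE₂_sq : spinE₂ * spinE₂ = (1 : Matrix (Fin 4) (Fin 4) 𝕜) := by
  ext i j
  fin_cases i <;> fin_cases j <;> simp [spinE₂, Matrix.mul_apply, Fin.sum_univ_four]
theorem spinJ_sq : spinJ * spinJ = (1 : Matrix (Fin 4) (Fin 4) 𝕜) := by
  ext i j
  fin_cases i <;> fin_cases j <;> simp [spinJ, Matrix.mul_apply, Fin.sum_univ_four]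
theorem spinE₁₂ : spinE₂ * spinE₁ = -(spinE₁ * spinE₂ : Matrix (Fin 4) (Fin 4) 𝕜) := by
  ext i j
  fin_cases i <;> fin_cases j <;> simp [spinE₁, spinE₂, Matrix.mul_apply, Fin.sum_univ_four]
theorem spinE₁_star : star spinE₁ = (spinE₁ : Matrix (Fin 4) (Fin 4) 𝕜) := by
  ext i j
  fin_cases i <;> fin_cases j <;> simp [spinE₁, Matrix.star_apply]
theorem spinE₂_star : star spinE₂ = (spinE₂ : Matrix (Fin 4) (Fin 4) 𝕜) := by
  ext i j
  fin_cases i <;> fin_cases j <;> simp [spinE₂, Matrix.star_apply]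
theorem spinJ_E₁ : spinJ * spinE₁ * spinJ = -(spinE₁ : Matrix (Fin 4) (Fin 4) 𝕜) := by
  ext i j
  fin_cases i <;> fin_cases j <;>
    simp [spinE₁, spinJ, Matrix.mul_apply, Fin.sum_univ_four]
theorem spinJ_E₂ : spinJ * spinE₂ * spinJ = -(spinE₂ : Matrix (Fin 4) (Fin 4) 𝕜) := by
  ext i j
  fin_cases i <;> fin_cases j <;>
    simp [spinE₂, spinJ, Matrix.mul_apply, Fin.sum_univ_four]

/-- The Clifford vector `x e₁ + y e₂` as an operator. -/
def spinVec (x y : ℝ) : Matrix (Fin 4) (Fin 4) 𝕜 := (x : 𝕜) • spinE₁ + (y : 𝕜) • spinE₂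

/-- The Clifford vector `x e₁ + y e₂` is odd and self-adjoint with square `x² + y²`. -/
theorem isPoint_spin {r x y : ℝ} (h : r ^ 2 = x ^ 2 + y ^ 2) :
    IsPoint (E := spinAlg 𝕜) r (spinOp 1) (spinOp (spinVec x y)) where
  pp := by rw [← spinOp_mul, mul_one]
  pd := by rw [← spinOp_mul, one_mul]
  dp := by rw [← spinOp_mul, mul_one]
  dd := by
    rw [← spinOp_mul, ← spinOp_smul, h]
    congr 1
    simp only [spinVec, add_mul, mul_add, smul_mul_assoc, mul_smul_comm, spinE₁_sq, spinE₂_sq,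
      spinE₁₂]
    push_cast
    module
  sp := by rw [← spinOp_star, star_one]
  sd := by
    rw [← spinOp_star, spinVec, star_add, star_smul, star_smul, spinE₁_star, spinE₂_star]
    simp
  gp := by rw [spinOp_grade, mul_one, spinJ_sq]
  gd := by
    rw [spinOp_grade, ← neg_one_smul 𝕜 (spinOp _), ← spinOp_smul]
    congr 1
    simp only [spinVec, add_mul, mul_add, smul_mul_assoc, mul_smul_comm, spinJ_E₁, spinJ_E₂]
    module

/-- The homomorphism `f ↦ f(x e₁)`. -/
def spinLeft (x : ℝ) : GrHom (SAlg 𝕜) (spinAlg 𝕜) :=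
  pointHom (isPoint_spin (r := x) (x := x) (y := 0) (by ring))
/-- The homomorphism `f ↦ f(y e₂)`. -/
def spinRight (y : ℝ) : GrHom (SAlg 𝕜) (spinAlg 𝕜) :=
  pointHom (isPoint_spin (r := y) (x := 0) (y := y) (by ring))

theorem spinLeft_apply (x : ℝ) (f : C₀(ℝ, 𝕜)) :
    spinLeft x f = spinOp (evS x f • 1 + odS x f • spinE₁) := by
  have h : (odS x f / (x : 𝕜)) * (x : 𝕜) = odS x f := by
    by_cases hx : x = 0
    · subst hx
      rw [odS_zero]
      simp
    · exact div_mul_cancel₀ _ (RCLike.ofReal_ne_zero.2 hx)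
  rw [spinLeft, pointHom_apply, spinVec, ← spinOp_smul, ← spinOp_smul, ← spinOp_add, smul_add,
    smul_smul, h, RCLike.ofReal_zero, zero_smul, smul_zero, add_zero]

theorem spinRight_apply (y : ℝ) (f : C₀(ℝ, 𝕜)) :
    spinRight y f = spinOp (evS y f • 1 + odS y f • spinE₂) := by
  have h : (odS y f / (y : 𝕜)) * (y : 𝕜) = odS y f := by
    by_cases hx : y = 0
    · subst hx
      rw [odS_zero]
      simp
    · exact div_mul_cancel₀ _ (RCLike.ofReal_ne_zero.2 hx)
  rw [spinRight, pointHom_apply, spinVec, ← spinOp_smul, ← spinOp_smul, ← spinOp_add, smul_add,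
    smul_smul, smul_smul, h, RCLike.ofReal_zero, mul_zero, zero_smul, zero_add]

theorem spin_commute (x y : ℝ) : GradedCommute (spinLeft (𝕜 := 𝕜) x) (spinRight y) := by
  have h₁ : ∀ f g : C₀(ℝ, 𝕜), flipS f = f →
      spinRight y g * spinLeft x f = spinLeft x f * spinRight y g := fun f g hf => by
    have h := odS_flip x f
    rw [hf] at h
    rw [spinLeft_apply, spinRight_apply, self_eq_neg.1 h, ← spinOp_mul, ← spinOp_mul]
    simp
  have h₂ : ∀ f g : C₀(ℝ, 𝕜), flipS f = -f →
      spinRight y g * spinLeft x f = spinLeft x f * spinRight y (flipS g) := fun f g hf => by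
    have h := evS_flip x f
    rw [hf, ← neg_one_smul 𝕜 f, evS_smul, neg_one_mul] at h
    rw [spinLeft_apply, spinRight_apply, spinRight_apply, self_eq_neg.1 h.symm, evS_flip, odS_flip,
      ← spinOp_mul, ← spinOp_mul]
    congr 1
    simp only [add_mul, mul_add, smul_mul_assoc, mul_smul_comm, spinE₁₂, one_mul, mul_one]
    module
  refine GradedCommute.of_forall fun i f g hf => ?_
  cases i
  · exact h₁ f g hf
  · exact h₂ f g hf

/-- The representation of the tensor square of `𝒮` at the point `(x, y)`. -/
def spinHom (x y : ℝ) : GrHom ((SAlg 𝕜).tensor (SAlg 𝕜)) (spinAlg 𝕜) :=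
  pairHom (spinLeft x) (spinRight y) (spin_commute x y)

/-- The even or odd part of a function. -/
def partS (a : Bool) : C₀(ℝ, 𝕜) →ₗ[𝕜] C₀(ℝ, 𝕜) :=
  if a then (SAlg 𝕜).toAlg.odd else (SAlg 𝕜).toAlg.even

theorem partS_true_apply (f : C₀(ℝ, 𝕜)) (x : ℝ) : partS true f x = odS x f := by
  change (2⁻¹ : 𝕜) * (f x - f (-x)) = _
  rw [odS]
  ring

theorem partS_false_apply (f : C₀(ℝ, 𝕜)) (x : ℝ) : partS false f x = evS x f := by
  change (2⁻¹ : 𝕜) * (f x + f (-x)) = _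
  rw [evS]
  ring

/-- Evaluation at a point. -/
def evalL (x : ℝ) : C₀(ℝ, 𝕜) →ₗ[𝕜] 𝕜 where
  toFun f := f x
  map_add' _ _ := rfl
  map_smul' _ _ := rfl

/-- The value at `(x, y)` of the component of parity `(a, b)` of an element of the algebraic tensor
square. -/
def coefS (a b : Bool) (x y : ℝ) : C₀(ℝ, 𝕜) ⊗[𝕜] C₀(ℝ, 𝕜) →ₗ[𝕜] 𝕜 :=
  LinearMap.mul' 𝕜 𝕜 ∘ₗ
    TensorProduct.map (evalL x ∘ₗ partS a) (evalL y ∘ₗ partS b)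

theorem coefS_tmul (a b : Bool) (x y : ℝ) (f g : C₀(ℝ, 𝕜)) :
    coefS a b x y (f ⊗ₜ g) = partS a f x * partS b g y := rfl

variable (𝕜) in
/-- An element of the algebraic tensor square of `𝒮` as an element of the completion. -/
def ofSS (w : C₀(ℝ, 𝕜) ⊗[𝕜] C₀(ℝ, 𝕜)) : ((SAlg 𝕜).tensor (SAlg 𝕜)).carrier :=
  (tensorClass (SAlg 𝕜) (SAlg 𝕜)).of w

theorem ofSS_add (w w' : C₀(ℝ, 𝕜) ⊗[𝕜] C₀(ℝ, 𝕜)) : ofSS 𝕜 (w + w') = ofSS 𝕜 w + ofSS 𝕜 w' :=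
  (tensorClass (SAlg 𝕜) (SAlg 𝕜)).of_add w w'

/-- In terms of the basis `1, e₁, e₂, e₁ e₂` of the Clifford algebra of the plane, the representation at
`(x, y)` consists of the values at `(x, y)` of the four components of an element. -/
theorem spinHom_ofSS (x y : ℝ) (w : C₀(ℝ, 𝕜) ⊗[𝕜] C₀(ℝ, 𝕜)) :
    spinHom x y (ofSS 𝕜 w) = spinOp (coefS false false x y w • 1 + coefS true false x y w • spinE₁ +
      coefS false true x y w • spinE₂ + coefS true true x y w • (spinE₁ * spinE₂)) := by
  induction w using TensorProduct.induction_on with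
  | zero =>
    have h : ofSS 𝕜 (0 : C₀(ℝ, 𝕜) ⊗[𝕜] C₀(ℝ, 𝕜)) = 0 := by
      have := ofSS_add (𝕜 := 𝕜) 0 0
      rwa [add_zero, left_eq_add] at this
    rw [h, map_zero]
    simp only [map_zero, zero_smul, add_zero]
    exact (map_zero (op4 𝕜)).symm
  | tmul f g =>
    refine (pairHom_tmul (A := SAlg 𝕜) (B := SAlg 𝕜) _ _ _ f g).trans ?_
    rw [spinLeft_apply, spinRight_apply, ← spinOp_mul]
    congr 1
    simp only [coefS_tmul, partS_true_apply, partS_false_apply, add_mul, mul_add, smul_mul_assoc,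
      mul_smul_comm, one_mul, mul_one]
    module
  | add w w' h h' =>
    rw [ofSS_add, map_add, h, h', ← spinOp_add]
    congr 1
    simp only [map_add]
    module

/-- The first column of the matrix of an element of the Clifford algebra, acting on the exterior algebra,
contains its four coefficients, so each of them is bounded by the norm. -/
theorem norm_coefS_le (a b : Bool) (x y : ℝ) (w : C₀(ℝ, 𝕜) ⊗[𝕜] C₀(ℝ, 𝕜)) :
    ‖coefS a b x y w‖ ≤ ‖spinHom x y (ofSS 𝕜 w)‖ := by
  rw [spinHom_ofSS]
  cases a <;> cases b
  · refine le_trans (le_of_eq ?_) (norm_entry_le _ 0)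
    simp [spinE₁, spinE₂]
  · refine le_trans (le_of_eq ?_) (norm_entry_le _ 2)
    simp [spinE₁, spinE₂]
  · refine le_trans (le_of_eq ?_) (norm_entry_le _ 1)
    simp [spinE₁, spinE₂]
  · refine le_trans (le_of_eq ?_) (norm_entry_le _ 3)
    simp [spinE₁, spinE₂]

end Spin

/-! ### Approximation by piecewise linear functions -/

section Tent

/-- The hat function of height one around the integer `k`. -/
def hat (k : ℤ) (s : ℝ) : ℝ := max 0 (1 - |s - k|)

theorem hat_nonneg (k : ℤ) (s : ℝ) : 0 ≤ hat k s := le_max_left _ _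

theorem hat_le_one (k : ℤ) (s : ℝ) : hat k s ≤ 1 :=
  max_le zero_le_one (by linarith [abs_nonneg (s - k)])

theorem hat_eq_zero {k : ℤ} {s : ℝ} (h : 1 ≤ |s - k|) : hat k s = 0 := max_eq_left (by linarith)

theorem hat_neg (k : ℤ) (s : ℝ) : hat k (-s) = hat (-k) s := by
  rw [hat, hat, ← abs_neg]
  congr 3
  push_cast
  ring

theorem sum_hat_pair (s : ℝ) : hat ⌊s⌋ s + hat (⌊s⌋ + 1) s = 1 := by
  have h1 := Int.floor_le s
  have h2 := Int.lt_floor_add_one s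
  rw [hat, hat, abs_of_nonneg (by linarith), abs_of_nonpos (by push_cast; linarith),
    max_eq_right (by linarith), max_eq_right (by push_cast; linarith)]
  push_cast
  ring

theorem hat_eq_zero_of_ne {k : ℤ} {s : ℝ} (h0 : k ≠ ⌊s⌋) (h1 : k ≠ ⌊s⌋ + 1) : hat k s = 0 := by
  refine hat_eq_zero ?_
  have h3 := Int.floor_le s
  have h4 := Int.lt_floor_add_one s
  rcases lt_trichotomy k ⌊s⌋ with h | h | h
  · have : (k : ℝ) + 1 ≤ ⌊s⌋ := by exact_mod_cast h
    rw [abs_of_nonneg (by linarith)]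
    linarith
  · exact absurd h h0
  · have h5 : ⌊s⌋ + 2 ≤ k := by omega
    have : (⌊s⌋ : ℝ) + 2 ≤ k := by exact_mod_cast h5
    rw [abs_of_nonpos (by linarith)]
    linarith

/-- The hat functions are a partition of unity: at `s` only those around `⌊s⌋` and `⌊s⌋ + 1` do not
vanish. -/
theorem sum_hat_eq (I : Finset ℤ) {s : ℝ} (h0 : ⌊s⌋ ∈ I) (h1 : ⌊s⌋ + 1 ∈ I) :
    ∑ k ∈ I, hat k s = 1 := by
  rw [← sum_hat_pair s, ← Finset.sum_pair (f := fun k => hat k s) (by omega : ⌊s⌋ ≠ ⌊s⌋ + 1)]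
  refine (Finset.sum_subset (fun k hk => ?_) fun k _ hk => ?_).symm
  · rcases Finset.mem_insert.1 hk with rfl | hk
    · exact h0
    · rw [Finset.mem_singleton.1 hk]
      exact h1
  · rw [Finset.mem_insert, Finset.mem_singleton, not_or] at hk
    exact hat_eq_zero_of_ne hk.1 hk.2

theorem sum_hat_le (I : Finset ℤ) (s : ℝ) : ∑ k ∈ I, hat k s ≤ 1 := by
  rw [← sum_hat_eq (I ∪ {⌊s⌋, ⌊s⌋ + 1}) (s := s) (by simp) (by simp)]
  exact Finset.sum_le_sum_of_subset_of_nonneg Finset.subset_union_left fun _ _ _ => hat_nonneg _ _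

variable (𝕜) in
/-- The hat function around the node `k h` as an element of `𝒮`. -/
def hatS (h : ℝ) (k : ℤ) (hh : 0 < h) : C₀(ℝ, 𝕜) :=
  ofRealS (fun x => hat k (x / h)) (by unfold hat; fun_prop) (by
    refine tendsto_nhds_of_eventually_eq ?_
    have : ∀ᶠ x : ℝ in cocompact ℝ, (|(k : ℝ)| + 1) * h ≤ ‖x‖ :=
      (tendsto_norm_cocompact_atTop (E := ℝ)).eventually_ge_atTop _
    filter_upwards [this] with x hx
    refine hat_eq_zero ?_
    rw [Real.norm_eq_abs, ← le_div_iff₀ hh, ← abs_of_pos hh, ← abs_div] at hx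
    have := abs_sub_abs_le_abs_sub (x / h) k
    linarith)

theorem hatS_apply (h : ℝ) (k : ℤ) (hh : 0 < h) (x : ℝ) :
    hatS 𝕜 h k hh x = (hat k (x / h) : 𝕜) := rfl

/-- The mesh of the `n`-th approximation. -/
def mesh (R : ℝ) (n : ℕ) : ℝ := R / (n + 1)

theorem mesh_pos {R : ℝ} (hR : 0 < R) (n : ℕ) : 0 < mesh R n := by unfold mesh; positivity

/-- The nodes of the `n`-th approximation. -/
def nodes (n : ℕ) : Finset ℤ := Finset.Icc (-((n + 1) ^ 2 : ℕ) : ℤ) ((n + 1) ^ 2 : ℕ)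

/-- Piecewise linear interpolation. -/
def interp {R : ℝ} (hR : 0 < R) (n : ℕ) : C₀(ℝ, 𝕜) →ₗ[𝕜] C₀(ℝ, 𝕜) :=
  ∑ k ∈ nodes n, (evalL (k * mesh R n)).smulRight (hatS 𝕜 (mesh R n) k (mesh_pos hR n))

theorem interp_apply {R : ℝ} (hR : 0 < R) (n : ℕ) (f : C₀(ℝ, 𝕜)) :
    interp hR n f =
      ∑ k ∈ nodes n, f (k * mesh R n) • hatS 𝕜 (mesh R n) k (mesh_pos hR n) := by
  simp [interp, LinearMap.sum_apply, LinearMap.smulRight_apply, evalL]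

theorem c0_sum_apply {ι : Type*} (I : Finset ι) (F : ι → C₀(ℝ, 𝕜)) (x : ℝ) :
    (∑ i ∈ I, F i) x = ∑ i ∈ I, F i x := map_sum (evalL x) F I

/-- Interpolation at the nodes in `[-(n + 1) R, (n + 1) R]` is close to `f` if `f` varies little on the
scale of the mesh and is small outside this interval. -/
theorem norm_interp_sub_le {R : ℝ} (hR : 0 < R) (n : ℕ) (f : C₀(ℝ, 𝕜)) {ε : ℝ} (hε : 0 ≤ ε)
    (h₁ : ∀ x y, |x - y| < mesh R n → ‖f x - f y‖ ≤ ε)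
    (h₂ : ∀ x, (n + 1) * R ≤ |x| → ‖f x‖ ≤ ε) : ‖f - interp hR n f‖ ≤ 2 * ε := by
  have hh := mesh_pos hR n
  set h := mesh R n with hdef
  refine c0_norm_le (by positivity) fun x => ?_
  have e : (f - interp hR n f) x = ((1 - ∑ k ∈ nodes n, hat k (x / h) : ℝ) : 𝕜) * f x +
      ∑ k ∈ nodes n, (hat k (x / h) : 𝕜) * (f x - f (k * h)) := by
    rw [ZeroAtInftyContinuousMap.sub_apply, interp_apply, c0_sum_apply]
    simp only [ZeroAtInftyContinuousMap.smul_apply, hatS_apply, smul_eq_mul, mul_sub,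
      Finset.sum_sub_distrib, ← hdef]
    push_cast
    rw [sub_mul, one_mul, Finset.sum_mul]
    simp only [mul_comm]
    ring
  rw [e, two_mul]
  refine (norm_add_le _ _).trans (add_le_add ?_ ?_)
  · rw [norm_mul, RCLike.norm_ofReal]
    by_cases hx : (n + 1) * R ≤ |x|
    · have h3 := sum_hat_le (nodes n) (x / h)
      have h4 : 0 ≤ ∑ k ∈ nodes n, hat k (x / h) := Finset.sum_nonneg fun _ _ => hat_nonneg _ _
      rw [abs_of_nonneg (by linarith)]
      have := h₂ x hx
      nlinarith [norm_nonneg (f x)]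
    -- inside the interval the hats sum to one and the first term vanishes
    · have hs : |x / h| < ((n + 1) ^ 2 : ℕ) := by
        rw [abs_div, abs_of_pos hh, div_lt_iff₀ hh, hdef, mesh]
        push_cast
        have : ((n : ℝ) + 1) ^ 2 * (R / (n + 1)) = (n + 1) * R := by
          field_simp
        rw [this]
        exact not_le.1 hx
      obtain ⟨h5, h6⟩ := abs_lt.1 hs
      have h7 : (-((n + 1) ^ 2 : ℕ) : ℤ) ≤ ⌊x / h⌋ := Int.le_floor.2 (by push_cast at h5 ⊢; linarith)
      have h8 : ⌊x / h⌋ < ((n + 1) ^ 2 : ℕ) := Int.floor_lt.2 (by exact_mod_cast h6)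
      rw [sum_hat_eq (nodes n) (Finset.mem_Icc.2 ⟨h7, h8.le⟩)
        (Finset.mem_Icc.2 ⟨by omega, by omega⟩)]
      simpa using hε
  · calc ‖∑ k ∈ nodes n, (hat k (x / h) : 𝕜) * (f x - f (k * h))‖
        ≤ ∑ k ∈ nodes n, hat k (x / h) * ε := by
          refine norm_sum_le_of_le _ fun k _ => ?_
          rw [norm_mul, RCLike.norm_ofReal, abs_of_nonneg (hat_nonneg _ _)]
          by_cases hk : |x - k * h| < h
          · exact mul_le_mul_of_nonneg_left (h₁ _ _ hk) (hat_nonneg _ _)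
          · have : hat k (x / h) = 0 := by
              refine hat_eq_zero ?_
              have e2 : x / h - k = (x - k * h) / h := by field_simp
              rw [e2, abs_div, abs_of_pos hh, le_div_iff₀ hh, one_mul]
              exact not_lt.1 hk
            rw [this, zero_mul, zero_mul]
      _ ≤ ε := by
          rw [← Finset.sum_mul]
          have := sum_hat_le (nodes n) (x / h)
          nlinarith

theorem tendsto_interp {R : ℝ} (hR : 0 < R) (f : C₀(ℝ, 𝕜)) :
    Tendsto (fun n => interp hR n f) atTop (𝓝 f) := by
  refine Metric.tendsto_nhds.2 fun ε hε => ?_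
  have hu : UniformContinuous f := ZeroAtInftyContinuousMap.uniformContinuous f
  obtain ⟨δ, hδ, h1⟩ := Metric.uniformContinuous_iff.1 hu (ε / 3) (by positivity)
  have h2 : ∀ᶠ x in cocompact ℝ, ‖f x‖ < ε / 3 := by
    have := f.zero_at_infty'
    have := this.norm
    rw [norm_zero] at this
    exact this.eventually (gt_mem_nhds (by positivity))
  rw [← Metric.cobounded_eq_cocompact, ← comap_norm_atTop, eventually_comap] at h2
  obtain ⟨L, hL⟩ := eventually_atTop.1 h2
  have h3 : Tendsto (fun n : ℕ => mesh R n) atTop (𝓝 0) := by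
    have := tendsto_one_div_add_atTop_nhds_zero_nat (𝕜 := ℝ)
    have := this.const_mul R
    rw [mul_zero] at this
    refine this.congr fun n => ?_
    rw [mesh, mul_one_div]
  have h4 : Tendsto (fun n : ℕ => ((n : ℝ) + 1) * R) atTop atTop :=
    (tendsto_atTop_add_const_right _ _ tendsto_natCast_atTop_atTop).atTop_mul_const hR
  filter_upwards [h3.eventually (gt_mem_nhds hδ), h4.eventually_ge_atTop L] with n hn hn'
  have h5 := norm_interp_sub_le hR n f (ε := ε / 3) (by positivity)
    (fun x y hxy => by
      have := h1 (a := x) (b := y) (by rw [Real.dist_eq]; exact hxy.trans hn)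
      rw [dist_eq_norm] at this
      exact this.le) (fun x hx => (hL _ (hn'.trans hx) x rfl).le)
  rw [dist_comm, dist_eq_norm]
  linarith

end Tent

/-! ### The norm of the tensor square of `𝒮` -/

section TentSquare

theorem hat_mul_eq_zero {k l : ℤ} (h : 2 ≤ |k - l|) (s : ℝ) : hat k s * hat l s = 0 := by
  by_contra hc
  obtain ⟨h1, h2⟩ := mul_ne_zero_iff.1 hc
  have h3 : |s - k| < 1 := not_le.1 fun h => h1 (hat_eq_zero h)
  have h4 : |s - l| < 1 := not_le.1 fun h => h2 (hat_eq_zero h)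
  have h5 : (2 : ℝ) ≤ |(k : ℝ) - l| := by exact_mod_cast h
  have h6 := abs_sub_le (k : ℝ) s l
  rw [abs_sub_comm (k : ℝ) s] at h6
  linarith

/-- The sign `±1` of a parity. -/
def sgn (a : Bool) : ℝ := if a then -1 else 1

variable (𝕜) in
/-- The even or odd part of a hat function. -/
def halfHat {R : ℝ} (hR : 0 < R) (n : ℕ) (a : Bool) (k : ℤ) : C₀(ℝ, 𝕜) :=
  partS a (hatS 𝕜 (mesh R n) k (mesh_pos hR n))

variable {R : ℝ} (hR : 0 < R) (n : ℕ)

theorem halfHat_apply (a : Bool) (k : ℤ) (x : ℝ) : halfHat 𝕜 hR n a k x =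
    (((hat k (x / mesh R n) + sgn a * hat (-k) (x / mesh R n)) / 2 : ℝ) : 𝕜) := by
  have h : hatS 𝕜 (mesh R n) k (mesh_pos hR n) (-x) = (hat (-k) (x / mesh R n) : 𝕜) := by
    rw [hatS_apply, neg_div, hat_neg]
  cases a
  · refine (partS_false_apply _ x).trans ?_
    rw [evS, h, hatS_apply]
    simp only [sgn]
    push_cast
    simp
  · refine (partS_true_apply _ x).trans ?_
    rw [odS, h, hatS_apply]
    simp only [sgn]
    push_cast
    simp [sub_eq_add_neg]

theorem norm_halfHat_le (a : Bool) (k : ℤ) : ‖halfHat 𝕜 hR n a k‖ ≤ 1 := by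
  refine c0_norm_le zero_le_one fun x => ?_
  rw [halfHat_apply, RCLike.norm_ofReal]
  have h1 := hat_nonneg k (x / mesh R n)
  have h2 := hat_le_one k (x / mesh R n)
  have h3 := hat_nonneg (-k) (x / mesh R n)
  have h4 := hat_le_one (-k) (x / mesh R n)
  rw [abs_le]
  cases a <;> simp only [sgn] <;> constructor <;> norm_num <;> linarith

theorem star_halfHat (a : Bool) (k : ℤ) : star (halfHat 𝕜 hR n a k) = halfHat 𝕜 hR n a k := by
  ext x
  change star (halfHat 𝕜 hR n a k x) = _
  rw [halfHat_apply]
  exact RCLike.conj_ofReal _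

theorem isHomog_partS (a : Bool) (f : C₀(ℝ, 𝕜)) : (SAlg 𝕜).toAlg.IsHomog a (partS a f) := by
  cases a
  · exact (SAlg 𝕜).toAlg.grade_even f
  · exact (SAlg 𝕜).toAlg.grade_odd f

theorem continuous_partS (a : Bool) : Continuous (partS (𝕜 := 𝕜) a) := by
  cases a
  · exact (SAlg 𝕜).continuous_even
  · exact (SAlg 𝕜).continuous_odd

theorem partS_partS (a : Bool) (f : C₀(ℝ, 𝕜)) : partS a (partS a f) = partS a f := by
  cases a
  · exact (SAlg 𝕜).toAlg.even_of_even ((SAlg 𝕜).toAlg.grade_even f)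
  · exact (SAlg 𝕜).toAlg.odd_of_odd ((SAlg 𝕜).toAlg.grade_odd f)

theorem sum_partS (f : C₀(ℝ, 𝕜)) : ∑ a : Bool, partS a f = f := by
  rw [Fintype.sum_bool, add_comm]
  exact (SAlg 𝕜).toAlg.even_add_odd f

/-- Nodes of the same class have disjoint hats, also after reflection. -/
def nodeClass (k : ℤ) : Bool × Bool := (decide (0 < k), decide (k % 2 = 0))

/-- Distinct indices `k`, `l` of the same class have the same parity and the same sign, so `±k` and
`±l` differ by at least two and the hats around them have disjoint supports. -/
theorem halfHat_mul (a : Bool) {k l : ℤ} (hc : nodeClass k = nodeClass l) (hkl : k ≠ l) :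
    halfHat 𝕜 hR n a k * halfHat 𝕜 hR n a l = 0 := by
  obtain ⟨h1, h2⟩ := Prod.ext_iff.1 hc
  simp only [nodeClass, decide_eq_decide] at h1 h2
  have e1 : 2 ≤ |k - l| := by rcases abs_cases (k - l) with h | h <;> omega
  have e2 : 2 ≤ |k - -l| := by rcases abs_cases (k - -l) with h | h <;> omega
  have e3 : 2 ≤ |-k - l| := by rcases abs_cases (-k - l) with h | h <;> omega
  have e4 : 2 ≤ |-k - -l| := by rcases abs_cases (-k - -l) with h | h <;> omega
  ext x
  rw [ZeroAtInftyContinuousMap.mul_apply, halfHat_apply, halfHat_apply, ← RCLike.ofReal_mul]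
  refine (congrArg _ ?_).trans RCLike.ofReal_zero
  have f1 := hat_mul_eq_zero e1 (x / mesh R n)
  have f2 := hat_mul_eq_zero e2 (x / mesh R n)
  have f3 := hat_mul_eq_zero e3 (x / mesh R n)
  have f4 := hat_mul_eq_zero e4 (x / mesh R n)
  linear_combination (1 / 4) * f1 + (sgn a / 4) * f2 + (sgn a / 4) * f3 + (sgn a ^ 2 / 4) * f4

/-- The elementary tensor of two half hats. -/
def tent (a b : Bool) (p : ℤ × ℤ) : ((SAlg 𝕜).tensor (SAlg 𝕜)).carrier :=
  tmul (A := SAlg 𝕜) (B := SAlg 𝕜) (halfHat 𝕜 hR n a p.1) (halfHat 𝕜 hR n b p.2)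

theorem norm_tent_le (a b : Bool) (p : ℤ × ℤ) : ‖tent (𝕜 := 𝕜) hR n a b p‖ ≤ 1 := by
  refine (norm_tmul_le (A := SAlg 𝕜) (B := SAlg 𝕜) _ _).trans ?_
  exact mul_le_one₀ (norm_halfHat_le hR n a p.1) (norm_nonneg _) (norm_halfHat_le hR n b p.2)

theorem star_tmul_homog {A B : GrCStar 𝕜} {i j : Bool} {a : A.carrier} {b : B.carrier}
    (ha : A.toAlg.IsHomog i a) (hb : B.toAlg.IsHomog j b) :
    ∃ c : 𝕜, star (tmul a b) = c • tmul (star a) (star b) := by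
  have h : star (tmul a b) = tmul (star a) (B.toAlg.gradePow i (star b)) :=
    ((tensorClass A B).of_star _).symm.trans
      (congrArg _ (AlgTensor.star_homog (P := A.toAlg) (Q := B.toAlg) b ha))
  obtain ⟨c, hc⟩ : ∃ c : 𝕜, B.toAlg.gradePow i (star b) = c • star b := by
    cases i
    · exact ⟨1, (one_smul _ _).symm⟩
    · have h2 : B.toAlg.gradePow true (star b) = if j then -star b else star b := hb.star
      cases j
      · exact ⟨1, h2.trans (one_smul _ _).symm⟩
      · exact ⟨-1, h2.trans (by simp)⟩
  exact ⟨c, by rw [h, hc, tmul_smul]⟩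

theorem tmul_mul_eq_zero {A B : GrCStar 𝕜} {i j : Bool} {a c : A.carrier} {b d : B.carrier}
    (hc : A.toAlg.IsHomog i c) (hb : B.toAlg.IsHomog j b) (h : a * c = 0 ∨ b * d = 0) :
    tmul a b * tmul c d = 0 := by
  rw [tmul_mul_homog a c b d hc]
  rcases h with h | h
  · rw [h]
    exact ((tmulL A B).map_zero₂ _)
  · have h2 : B.toAlg.gradePow i b * d = 0 := by
      cases i
      · exact h
      · have h2 : B.toAlg.gradePow true b = if j then -b else b := hb
        rw [h2]
        cases j
        · exact h
        · exact (neg_mul b d).trans (by rw [h, neg_zero])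
    rw [h2]
    exact (tmulL A B _).map_zero

/-- Tents for different nodes of the same class are orthogonal. They are products of self-adjoint
homogeneous elements, so the adjoint of a tent is a multiple of it. -/
theorem tent_orthogonal (a b : Bool) {p q : ℤ × ℤ} (h₁ : nodeClass p.1 = nodeClass q.1)
    (h₂ : nodeClass p.2 = nodeClass q.2) (hpq : p ≠ q) :
    star (tent (𝕜 := 𝕜) hR n a b p) * tent hR n a b q = 0 ∧
      tent (𝕜 := 𝕜) hR n a b p * star (tent hR n a b q) = 0 := by
  have hst : ∀ p, ∃ c : 𝕜, star (tent (𝕜 := 𝕜) hR n a b p) = c • tent hR n a b p := fun p => by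
    obtain ⟨c, hc⟩ := star_tmul_homog (A := SAlg 𝕜) (B := SAlg 𝕜)
      (isHomog_partS a (hatS 𝕜 (mesh R n) p.1 (mesh_pos hR n)))
      (isHomog_partS b (hatS 𝕜 (mesh R n) p.2 (mesh_pos hR n)))
    refine ⟨c, hc.trans (congrArg (c • ·) ?_)⟩
    exact congrArg₂ (tmul (A := SAlg 𝕜) (B := SAlg 𝕜)) (star_halfHat hR n a p.1)
      (star_halfHat hR n b p.2)
  have h : tent (𝕜 := 𝕜) hR n a b p * tent hR n a b q = 0 := by
    refine tmul_mul_eq_zero (A := SAlg 𝕜) (B := SAlg 𝕜) (isHomog_partS a _) (isHomog_partS b _) ?_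
    by_cases h1 : p.1 = q.1
    · exact Or.inr (halfHat_mul hR n b h₂ fun h2 => hpq (Prod.ext h1 h2))
    · exact Or.inl (halfHat_mul hR n a h₁ h1)
  obtain ⟨c, hc⟩ := hst p
  obtain ⟨d, hd⟩ := hst q
  rw [hc, hd, smul_mul_assoc, mul_smul_comm, h, smul_zero, smul_zero]
  exact ⟨rfl, rfl⟩

/-- Interpolation of an element of the algebraic tensor square of `𝒮`. -/
def approxSS (w : C₀(ℝ, 𝕜) ⊗[𝕜] C₀(ℝ, 𝕜)) : ((SAlg 𝕜).tensor (SAlg 𝕜)).carrier :=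
  ∑ a : Bool, ∑ b : Bool, ∑ p ∈ nodes n ×ˢ nodes n,
    coefS a b (p.1 * mesh R n) (p.2 * mesh R n) w • tent hR n a b p

/-- Interpolation that preserves the grading. -/
def interp₂ (f : C₀(ℝ, 𝕜)) : C₀(ℝ, 𝕜) := ∑ a : Bool, partS a (interp hR n (partS a f))

theorem tendsto_interp₂ (f : C₀(ℝ, 𝕜)) : Tendsto (fun n => interp₂ hR n f) atTop (𝓝 f) := by
  have h : Tendsto (fun n => interp₂ hR n f) atTop (𝓝 (∑ a : Bool, partS a (partS a f))) :=
    tendsto_finsetSum _ fun a _ => ((continuous_partS a).tendsto _).comp (tendsto_interp hR _)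
  simpa only [partS_partS, sum_partS] using h

theorem interp₂_eq (f : C₀(ℝ, 𝕜)) : interp₂ hR n f =
    ∑ a : Bool, ∑ k ∈ nodes n, partS a f (k * mesh R n) • halfHat 𝕜 hR n a k := by
  refine Finset.sum_congr rfl fun a _ => ?_
  rw [interp_apply, map_sum]
  exact Finset.sum_congr rfl fun k _ => map_smul _ _ _

theorem tmul_sum_sum {A B : GrCStar 𝕜} {ι κ : Type*} (s : Finset ι) (t : Finset κ)
    (F : ι → A.carrier) (G : κ → B.carrier) :
    tmul (∑ i ∈ s, F i) (∑ j ∈ t, G j) = ∑ i ∈ s, ∑ j ∈ t, tmul (F i) (G j) := by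
  rw [← tmulL_apply, map_sum, Finset.sum_comm]
  refine Finset.sum_congr rfl fun j _ => ?_
  rw [map_sum, sum_apply]
  rfl

theorem tendsto_apply₂ {A B C : Type} [SeminormedAddCommGroup A] [NormedSpace 𝕜 A]
    [SeminormedAddCommGroup B] [NormedSpace 𝕜 B] [SeminormedAddCommGroup C] [NormedSpace 𝕜 C]
    (t : A →L[𝕜] B →L[𝕜] C) {ι : Type*} {l : Filter ι} {F : ι → A} {G : ι → B} {a : A} {b : B}
    (hF : Tendsto F l (𝓝 a)) (hG : Tendsto G l (𝓝 b)) :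
    Tendsto (fun i => t (F i) (G i)) l (𝓝 (t a b)) :=
  (t.continuous₂.tendsto (a, b)).comp (hF.prodMk_nhds hG)

theorem tendsto_tmul {A B : GrCStar 𝕜} {ι : Type*} {l : Filter ι} {F : ι → A.carrier}
    {G : ι → B.carrier} {a : A.carrier} {b : B.carrier} (hF : Tendsto F l (𝓝 a))
    (hG : Tendsto G l (𝓝 b)) : Tendsto (fun i => tmul (F i) (G i)) l (𝓝 (tmul a b)) :=
  tendsto_apply₂ (tmulL A B) hF hG

/-- The interpolation of an element of the algebraic tensor square, defined by its values at pairs of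
nodes, is on elementary tensors the tensor product of the interpolations of the factors. -/
theorem approxSS_tmul (f g : C₀(ℝ, 𝕜)) : approxSS hR n (f ⊗ₜ g) =
    tmul (A := SAlg 𝕜) (B := SAlg 𝕜) (interp₂ hR n f) (interp₂ hR n g) := by
  rw [interp₂_eq, interp₂_eq, approxSS]
  refine Eq.symm ((tmul_sum_sum (A := SAlg 𝕜) (B := SAlg 𝕜) Finset.univ Finset.univ _ _).trans ?_)
  refine Finset.sum_congr rfl fun a _ => Finset.sum_congr rfl fun b _ => ?_
  refine (tmul_sum_sum (A := SAlg 𝕜) (B := SAlg 𝕜) (nodes n) (nodes n) _ _).trans ?_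
  rw [Finset.sum_product]
  refine Finset.sum_congr rfl fun k _ => Finset.sum_congr rfl fun l _ => ?_
  rw [coefS_tmul, mul_smul]
  exact (smul_tmul (A := SAlg 𝕜) (B := SAlg 𝕜) _ _ _).trans
    (congrArg _ (tmul_smul (A := SAlg 𝕜) (B := SAlg 𝕜) _ _ _))

theorem approxSS_add (w w' : C₀(ℝ, 𝕜) ⊗[𝕜] C₀(ℝ, 𝕜)) :
    approxSS hR n (w + w') = approxSS hR n w + approxSS hR n w' := by
  simp only [approxSS, map_add, add_smul, Finset.sum_add_distrib]

theorem tendsto_approxSS (w : C₀(ℝ, 𝕜) ⊗[𝕜] C₀(ℝ, 𝕜)) :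
    Tendsto (fun n => approxSS hR n w) atTop (𝓝 (ofSS 𝕜 w)) := by
  induction w using TensorProduct.induction_on with
  | zero =>
    have h : ofSS 𝕜 (0 : C₀(ℝ, 𝕜) ⊗[𝕜] C₀(ℝ, 𝕜)) = 0 := by
      have := ofSS_add (𝕜 := 𝕜) 0 0
      rwa [add_zero, left_eq_add] at this
    rw [h]
    simp only [approxSS, map_zero, zero_smul, Finset.sum_const_zero]
    exact tendsto_const_nhds
  | tmul f g =>
    simp only [approxSS_tmul]
    exact tendsto_tmul (A := SAlg 𝕜) (B := SAlg 𝕜) (tendsto_interp₂ hR f) (tendsto_interp₂ hR g)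
  | add w w' h h' =>
    simp only [approxSS_add, ofSS_add]
    exact h.add h'

/-- The homomorphisms `spinHom x y`, for `x` and `y` in a suitable symmetric set `X`, determine the
norm of the image of an element under a homomorphism out of `𝒮 ⊗̂ 𝒮` that only depends on
restrictions to `X`. -/
theorem norm_le_of_points {E : GrCStar 𝕜} (T : GrHom ((SAlg 𝕜).tensor (SAlg 𝕜)) E) {R : ℝ}
    (hR : 0 < R) (X : Set ℝ) (hneg : ∀ x ∈ X, -x ∈ X)
    (hX : ∀ (n : ℕ) (k : ℤ), k * mesh R n ∉ X → ∀ x ∈ X, mesh R n ≤ |x - k * mesh R n|)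
    (hT : ∀ f g : C₀(ℝ, 𝕜), ((∀ x ∈ X, f x = 0) ∨ ∀ x ∈ X, g x = 0) →
      T (tmul (A := SAlg 𝕜) (B := SAlg 𝕜) f g) = 0)
    {z : ((SAlg 𝕜).tensor (SAlg 𝕜)).carrier} {M : ℝ} (hM : 0 ≤ M)
    (hz : ∀ x ∈ X, ∀ y ∈ X, ‖spinHom x y z‖ ≤ M) : ‖T z‖ ≤ M := by
  -- hats around nodes outside `X` vanish on `X`
  have hhat : ∀ (n : ℕ) (a : Bool) (k : ℤ), k * mesh R n ∉ X →
      ∀ x ∈ X, halfHat 𝕜 hR n a k x = 0 := fun n a k hk x hx => by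
    have hm := mesh_pos hR n
    have h1 : ∀ x ∈ X, hat k (x / mesh R n) = 0 := fun x hx => by
      refine hat_eq_zero ?_
      have e : x / mesh R n - k = (x - k * mesh R n) / mesh R n := by field_simp
      rw [e, abs_div, abs_of_pos hm, le_div_iff₀ hm, one_mul]
      exact hX n k hk x hx
    have h2 := h1 _ (hneg x hx)
    rw [neg_div, hat_neg] at h2
    rw [halfHat_apply, h1 x hx, h2]
    simp
  -- on the algebraic tensor product the norm of `T` is bounded up to the constant 64: there are four
  -- pairs of parities and sixteen pairs of classes of nodes, and the tents of each kind are orthogonal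
  have hw : ∀ (w : C₀(ℝ, 𝕜) ⊗[𝕜] C₀(ℝ, 𝕜)) (M : ℝ), 0 ≤ M →
      (∀ x ∈ X, ∀ y ∈ X, ‖spinHom x y (ofSS 𝕜 w)‖ ≤ M) → ‖T (ofSS 𝕜 w)‖ ≤ 64 * M := by
    intro w M hM hw
    have hlim : Tendsto (fun n => ‖T (approxSS hR n w)‖) atTop (𝓝 ‖T (ofSS 𝕜 w)‖) :=
      ((T.continuous.tendsto _).comp (tendsto_approxSS hR w)).norm
    refine le_of_tendsto hlim (Eventually.of_forall fun n => ?_)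
    have hab : ∀ a b : Bool, ‖∑ p ∈ nodes n ×ˢ nodes n,
        T (coefS a b (p.1 * mesh R n) (p.2 * mesh R n) w • tent hR n a b p)‖ ≤ 16 * M := by
      intro a b
      have hcl : ∀ p ∈ nodes n ×ˢ nodes n, (nodeClass p.1, nodeClass p.2) ∈
        (Finset.univ : Finset ((Bool × Bool) × (Bool × Bool))) := fun _ _ => Finset.mem_univ _
      rw [← Finset.sum_fiberwise_of_maps_to hcl]
      have hcard : ((Finset.univ : Finset ((Bool × Bool) × (Bool × Bool))).card : ℝ) = 16 := by
        have : (Finset.univ : Finset ((Bool × Bool) × (Bool × Bool))).card = 16 := rfl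
        rw [this]
        norm_num
      refine (norm_sum_le _ _).trans ((Finset.sum_le_card_nsmul _ _ M fun c _ => ?_).trans
        (by rw [nsmul_eq_mul, hcard]))
      refine norm_sum_le_of_orthogonal _ _ (fun p hp q hq hpq => ?_) (fun p hp q hq hpq => ?_) hM
        fun p _ => ?_
      · have e := ((Finset.mem_filter.1 hp).2).trans ((Finset.mem_filter.1 hq).2).symm
        obtain ⟨e1, e2⟩ := Prod.ext_iff.1 e
        rw [← map_star, ← map_mul, star_smul, smul_mul_assoc, mul_smul_comm,
          (tent_orthogonal hR n a b e1 e2 hpq).1, smul_zero, smul_zero, map_zero]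
      · have e := ((Finset.mem_filter.1 hp).2).trans ((Finset.mem_filter.1 hq).2).symm
        obtain ⟨e1, e2⟩ := Prod.ext_iff.1 e
        rw [← map_star, ← map_mul, star_smul, smul_mul_assoc, mul_smul_comm,
          (tent_orthogonal hR n a b e1 e2 hpq).2, smul_zero, smul_zero, map_zero]
      · by_cases h1 : p.1 * mesh R n ∈ X ∧ p.2 * mesh R n ∈ X
        · refine (norm_starHom_le _ _).trans ?_
          rw [norm_smul]
          have h3 := (norm_coefS_le a b _ _ w).trans (hw _ h1.1 _ h1.2)
          exact (mul_le_mul h3 (norm_tent_le hR n a b p) (norm_nonneg _) hM).trans (mul_one M).le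
        · have h0 : T (tent hR n a b p) = 0 := by
            refine hT _ _ ?_
            rcases not_and_or.1 h1 with h1 | h1
            · exact Or.inl (hhat n a _ h1)
            · exact Or.inr (hhat n b _ h1)
          rw [map_smul, h0, smul_zero, norm_zero]
          exact hM
    rw [approxSS]
    simp only [map_sum]
    rw [Fintype.sum_bool, Fintype.sum_bool, Fintype.sum_bool]
    refine (norm_add_le_of_le (norm_add_le_of_le (hab _ _) (hab _ _))
      (norm_add_le_of_le (hab _ _) (hab _ _))).trans (le_of_eq (by ring))
  -- by the C*-identity the constant can be dropped
  refine norm_le_of_family (ι := X × X) T (fun p => spinHom p.1 p.2) 64 (fun z M hM hz => ?_) hM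
    fun p => hz _ p.1.2 _ p.2.2
  -- `z` is approximated by an element of the algebraic tensor product
  have key : ∀ ε : ℝ, 0 < ε → ‖T z‖ ≤ 64 * (M + ε) + ε := fun ε hε => by
    obtain ⟨w, hw'⟩ : ∃ w, ‖z - ofSS 𝕜 w‖ < ε := by
      have hd : ∀ z, z ∈ closure (Set.range (ofSS 𝕜)) := fun z =>
        of_induction (A := SAlg 𝕜) (B := SAlg 𝕜) (p := fun z => z ∈ closure (Set.range (ofSS 𝕜)))
          isClosed_closure (fun w => subset_closure ⟨w, rfl⟩) z
      obtain ⟨_, ⟨w, rfl⟩, h⟩ := Metric.mem_closure_iff.1 (hd z) ε hε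
      exact ⟨w, by rwa [← dist_eq_norm]⟩
    have h1 := hw w (M + ε) (by positivity) fun x hx y hy => by
      have e : ofSS 𝕜 w = z - (z - ofSS 𝕜 w) := by abel
      rw [e, map_sub]
      exact (norm_sub_le _ _).trans (add_le_add (hz (⟨x, hx⟩, ⟨y, hy⟩))
        ((norm_starHom_le _ _).trans hw'.le))
    have e : z = ofSS 𝕜 w + (z - ofSS 𝕜 w) := by abel
    rw [e, map_add]
    exact (norm_add_le _ _).trans (add_le_add h1 ((norm_starHom_le _ _).trans hw'.le))
  refine le_of_forall_pos_le_add fun ε hε => ?_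
  have := key (ε / 65) (by positivity)
  linarith

end TentSquare

/-! ### Norm bounds and cut-offs for the functional calculus at a point -/

section PointBounds

variable {E : GrCStar 𝕜} {x : ℝ} {p d : E.carrier}

/-- The norm of `f(d)` is at most the maximum of `|f|` at `± x`. The bound with a constant is clear from
the formula for `f(d)`, and the C*-identity removes the constant. -/
theorem norm_pointHom_le (h : IsPoint x p d) {f : C₀(ℝ, 𝕜)} {M : ℝ} (hM : 0 ≤ M)
    (h₁ : ‖f x‖ ≤ M) (h₂ : ‖f (-x)‖ ≤ M) : ‖pointHom h f‖ ≤ M := by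
  refine le_of_pow_two_pow_le (K := ‖p‖ + |x|⁻¹ * ‖d‖) hM fun n => ?_
  induction n generalizing f M with
  | zero =>
    have e1 : ‖evS x f‖ ≤ M := by
      rw [evS, norm_div, RCLike.norm_ofNat, div_le_iff₀ two_pos]
      exact (norm_add_le _ _).trans (by linarith)
    have e2 : ‖odS x f‖ ≤ M := by
      rw [odS, norm_div, RCLike.norm_ofNat, div_le_iff₀ two_pos]
      exact (norm_sub_le _ _).trans (by linarith)
    rw [pow_zero, pow_one, pow_one, pointHom_apply, add_mul]
    refine (norm_add_le _ _).trans (add_le_add ?_ ?_)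
    · rw [norm_smul, mul_comm]
      exact mul_le_mul_of_nonneg_left e1 (norm_nonneg _)
    · rw [norm_smul, norm_div, RCLike.norm_ofReal, div_eq_mul_inv]
      calc ‖odS x f‖ * |x|⁻¹ * ‖d‖ ≤ M * |x|⁻¹ * ‖d‖ := by gcongr
        _ = _ := by ring
  | succ n ih =>
    have hb : ∀ y, ‖f y‖ ≤ M → ‖(star f * f) y‖ ≤ M ^ 2 := fun y hy => by
      change ‖star (f y) * f y‖ ≤ _
      rw [norm_mul, norm_star, ← sq]
      exact pow_le_pow_left₀ (norm_nonneg _) hy 2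
    have h3 := ih (f := star f * f) (M := M ^ 2) (by positivity) (hb _ h₁) (hb _ h₂)
    have e : pointHom h (star f * f) = star (pointHom h f) * pointHom h f :=
      (map_mul (pointHom h).toHom (star f) f).trans
        (congrArg (· * _) (map_star (pointHom h).toHom f))
    rwa [e, CStarRing.norm_star_mul_self, ← sq, ← pow_mul, ← pow_mul, ← pow_succ'] at h3

theorem pointHom_of_one (h : IsPoint x p d) {f : C₀(ℝ, 𝕜)} (h₁ : f x = 1) (h₂ : f (-x) = 1) :
    pointHom h f = p := by
  have e1 : evS x f = 1 := by rw [evS, h₁, h₂]; norm_num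
  have e2 : odS x f = 0 := by rw [odS, h₁, h₂]; norm_num
  rw [pointHom_apply, e1, e2, zero_div, zero_smul, one_smul, add_zero]

theorem pointHom_of_coord (h : IsPoint x p d) {f : C₀(ℝ, 𝕜)} (h₁ : f x = (x : 𝕜))
    (h₂ : f (-x) = -(x : 𝕜)) : pointHom h f = d := by
  have e1 : evS x f = 0 := by rw [evS, h₁, h₂]; simp
  have e2 : odS x f = (x : 𝕜) := by rw [odS, h₁, h₂]; ring
  rw [pointHom_apply, e1, e2, zero_smul, zero_add]
  by_cases hx : x = 0
  · subst hx
    rw [h.eq_zero, smul_zero]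
  · rw [div_self (RCLike.ofReal_ne_zero.2 hx), one_smul]

/-- A cut-off function that is `1` on `[-L, L]`. -/
def cut (L x : ℝ) : ℝ := max 0 (min 1 (L + 1 - |x|))

theorem cut_eq_one {L x : ℝ} (h : x ∈ Set.Icc (-L) L) : cut L x = 1 := by
  have : |x| ≤ L := abs_le.2 h
  rw [cut, min_eq_left (by linarith), max_eq_right zero_le_one]

theorem eventually_cut (L : ℝ) : ∀ᶠ x in cocompact ℝ, cut L x = 0 := by
  filter_upwards [(tendsto_norm_cocompact_atTop (E := ℝ)).eventually_ge_atTop (L + 1)] with x hx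
  rw [Real.norm_eq_abs] at hx
  exact max_eq_left ((min_le_right _ _).trans (by linarith))

variable (𝕜) in
/-- The cut-off function as an element of `𝒮`. -/
def cutS (L : ℝ) : C₀(ℝ, 𝕜) := ofRealS (cut L) (by unfold cut; fun_prop)
  (tendsto_nhds_of_eventually_eq (eventually_cut L))

variable (𝕜) in
/-- The truncated coordinate function. -/
def xcutS (L : ℝ) : C₀(ℝ, 𝕜) := ofRealS (fun x => x * cut L x) (by unfold cut; fun_prop)
  (tendsto_nhds_of_eventually_eq ((eventually_cut L).mono fun x hx => by rw [hx, mul_zero]))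

theorem cutS_apply {L x : ℝ} (h : x ∈ Set.Icc (-L) L) : cutS 𝕜 L x = 1 := by
  change ((cut L x : ℝ) : 𝕜) = 1
  rw [cut_eq_one h, RCLike.ofReal_one]

theorem xcutS_apply {L x : ℝ} (h : x ∈ Set.Icc (-L) L) : xcutS 𝕜 L x = (x : 𝕜) := by
  change ((x * cut L x : ℝ) : 𝕜) = x
  rw [cut_eq_one h, mul_one]

theorem neg_mem_Icc {L x : ℝ} (h : x ∈ Set.Icc (-L) L) : -x ∈ Set.Icc (-L) L :=
  ⟨neg_le_neg h.2, neg_le.1 h.1⟩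

theorem pointHom_cutS (h : IsPoint x p d) {L : ℝ} (hx : x ∈ Set.Icc (-L) L) :
    pointHom h (cutS 𝕜 L) = p := pointHom_of_one h (cutS_apply hx) (cutS_apply (neg_mem_Icc hx))

theorem pointHom_xcutS (h : IsPoint x p d) {L : ℝ} (hx : x ∈ Set.Icc (-L) L) :
    pointHom h (xcutS 𝕜 L) = d := pointHom_of_coord h (xcutS_apply hx) (by
  rw [xcutS_apply (neg_mem_Icc hx), RCLike.ofReal_neg])

end PointBounds

/-! ### The comultiplication of `𝒮` -/

section Comult

/-- The homomorphisms `spinHom x y` determine the norm of `𝒮 ⊗̂ 𝒮`. -/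
theorem norm_le_of_spin {z : ((SAlg 𝕜).tensor (SAlg 𝕜)).carrier} {M : ℝ} (hM : 0 ≤ M)
    (h : ∀ x y, ‖spinHom x y z‖ ≤ M) : ‖z‖ ≤ M :=
  norm_le_of_points (GrHom.id _) one_pos Set.univ (fun _ _ => trivial)
    (fun _ _ hk => absurd trivial hk) (fun f g h => by
      have hz : ∀ f : C₀(ℝ, 𝕜), (∀ x ∈ (Set.univ : Set ℝ), f x = 0) → f = 0 := fun f hf =>
        ZeroAtInftyContinuousMap.ext fun x => hf x trivial
      rcases h with h | h
      · rw [hz f h]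
        exact (tmulL (SAlg 𝕜) (SAlg 𝕜)).map_zero₂ _
      · rw [hz g h]
        exact (tmulL (SAlg 𝕜) (SAlg 𝕜) _).map_zero) hM fun x _ y _ => h x y

theorem spin_ext {z z' : ((SAlg 𝕜).tensor (SAlg 𝕜)).carrier}
    (h : ∀ x y, spinHom x y z = spinHom x y z') : z = z' := by
  rw [← sub_eq_zero, ← norm_le_zero_iff]
  exact norm_le_of_spin le_rfl fun x y => by rw [map_sub, h, sub_self, norm_zero]

/-- Functional calculus for the Clifford vector `x e₁ + y e₂`. -/
def spinDiag (x y : ℝ) : GrHom (SAlg 𝕜) (spinAlg 𝕜) :=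
  pointHom (isPoint_spin (Real.sq_sqrt (add_nonneg (sq_nonneg x) (sq_nonneg y))))

theorem spinHom_tmul (x y : ℝ) (f g : C₀(ℝ, 𝕜)) :
    spinHom x y (tmul (A := SAlg 𝕜) (B := SAlg 𝕜) f g) = spinLeft x f * spinRight y g :=
  pairHom_tmul (A := SAlg 𝕜) (B := SAlg 𝕜) _ _ _ f g

theorem spinVec_add (x y : ℝ) : spinOp (spinVec x 0) + spinOp (spinVec 0 y) =
    spinOp (spinVec x y : Matrix (Fin 4) (Fin 4) 𝕜) := by
  rw [← spinOp_add]
  simp [spinVec]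

theorem spinOp_one_mul (a : Matrix (Fin 4) (Fin 4) 𝕜) : spinOp 1 * spinOp a = spinOp a := by
  rw [← spinOp_mul, one_mul]

theorem spinOp_mul_one (a : Matrix (Fin 4) (Fin 4) 𝕜) : spinOp a * spinOp 1 = spinOp a := by
  rw [← spinOp_mul, mul_one]

theorem exp_neg_sqrt_sq (x y : ℝ) : (Real.exp (-√(x ^ 2 + y ^ 2) ^ 2) : 𝕜) =
    (Real.exp (-x ^ 2) : 𝕜) * (Real.exp (-y ^ 2) : 𝕜) := by
  rw [← RCLike.ofReal_mul, ← Real.exp_add, Real.sq_sqrt (by positivity)]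
  congr 3
  ring

/-- `exp(-x²) exp(-y²) = exp(-(x² + y²))`. -/
theorem spinHom_gauss (x y : ℝ) :
    spinHom x y (tmul (A := SAlg 𝕜) (B := SAlg 𝕜) (gaussS 𝕜) (gaussS 𝕜)) =
      spinDiag x y (gaussS 𝕜) := by
  rw [spinHom_tmul, spinLeft, spinRight, spinDiag, pointHom_gauss, pointHom_gauss, pointHom_gauss,
    smul_mul_assoc, mul_smul_comm, spinOp_one_mul, smul_smul, exp_neg_sqrt_sq]

theorem spinHom_xgauss (x y : ℝ) :
    spinHom x y (tmul (A := SAlg 𝕜) (B := SAlg 𝕜) (gaussS 𝕜) (xgaussS 𝕜) +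
      tmul (A := SAlg 𝕜) (B := SAlg 𝕜) (xgaussS 𝕜) (gaussS 𝕜)) = spinDiag x y (xgaussS 𝕜) := by
  rw [map_add, spinHom_tmul, spinHom_tmul, spinLeft, spinRight, spinDiag, pointHom_gauss,
    pointHom_gauss, pointHom_xgauss, pointHom_xgauss, pointHom_xgauss, smul_mul_assoc,
    mul_smul_comm, spinOp_one_mul, smul_mul_assoc, mul_smul_comm, spinOp_mul_one, smul_smul,
    smul_smul, exp_neg_sqrt_sq, ← smul_add, add_comm (spinOp (spinVec 0 y)), spinVec_add]

/-- The family `f(x e₁ + y e₂)` comes from an element of `𝒮 ⊗̂ 𝒮`. The set of such `f` is a subalgebra, it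
is closed because the norm of `𝒮 ⊗̂ 𝒮` is determined by the family, and it contains the generators
`exp (-x²)` and `x exp (-x²)`. -/
theorem exists_comult (f : C₀(ℝ, 𝕜)) : ∃ z : ((SAlg 𝕜).tensor (SAlg 𝕜)).carrier,
    ∀ x y, spinHom x y z = spinDiag x y f := by
  refine s_induction (p := fun f => ∃ z : ((SAlg 𝕜).tensor (SAlg 𝕜)).carrier,
    ∀ x y, spinHom x y z = spinDiag x y f) ?_ ?_ ?_ ?_ ⟨_, spinHom_gauss⟩ ⟨_, spinHom_xgauss⟩ f
  -- the lifts of a convergent sequence form a Cauchy sequence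
  · refine isSeqClosed_iff_isClosed.1 fun u f hu hf => ?_
    choose z hz using hu
    have hd : ∀ i j, ‖z i - z j‖ ≤ ‖u i - u j‖ := fun i j => norm_le_of_spin (norm_nonneg _)
      fun x y => by
        rw [map_sub, hz, hz]
        exact (congrArg norm (map_sub (spinDiag x y).toHom (u i) (u j))).symm.le.trans
          (norm_starHom_le (A := SAlg 𝕜) (spinDiag x y).toHom (u i - u j))
    have hc : CauchySeq z := by
      refine Metric.cauchySeq_iff'.2 fun ε hε => ?_
      obtain ⟨N, hN⟩ := Metric.cauchySeq_iff'.1 hf.cauchySeq ε hε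
      refine ⟨N, fun n hn => ?_⟩
      rw [dist_eq_norm]
      refine (hd n N).trans_lt ?_
      rw [← dist_eq_norm]
      exact hN n hn
    obtain ⟨w, hw⟩ := cauchySeq_tendsto_of_complete hc
    refine ⟨w, fun x y => ?_⟩
    refine tendsto_nhds_unique (((spinHom x y).continuous.tendsto w).comp hw) ?_
    have h2 := ((spinDiag (𝕜 := 𝕜) x y).continuous.tendsto f).comp hf
    exact h2.congr fun n => (hz n x y).symm
  · rintro f g ⟨z, hz⟩ ⟨w, hw⟩
    exact ⟨z + w, fun x y => by
      rw [map_add, hz, hw]; exact (map_add (spinDiag x y).toHom f g).symm⟩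
  · rintro c f ⟨z, hz⟩
    exact ⟨c • z, fun x y => by
      rw [map_smul, hz]; exact (map_smul (spinDiag x y).toHom c f).symm⟩
  · rintro f g ⟨z, hz⟩ ⟨w, hw⟩
    exact ⟨z * w, fun x y => by
      rw [map_mul, hz, hw]; exact (map_mul (spinDiag x y).toHom f g).symm⟩

/-- The value of the comultiplication at `f`. -/
def comultFun (f : (SAlg 𝕜).carrier) : ((SAlg 𝕜).tensor (SAlg 𝕜)).carrier :=
  (exists_comult f).choose

theorem spinHom_comultFun (x y : ℝ) (f : (SAlg 𝕜).carrier) :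
    spinHom x y (comultFun f) = spinDiag x y f := (exists_comult f).choose_spec x y

variable (𝕜) in
/-- The comultiplication `Δ : 𝒮 → 𝒮 ⊗̂ 𝒮`. -/
def comult : GrHom (SAlg 𝕜) ((SAlg 𝕜).tensor (SAlg 𝕜)) := GrHom.ofHom
  { toFun := comultFun
    map_zero' := spin_ext fun x y => by rw [spinHom_comultFun, map_zero, map_zero]
    map_add' := fun f g => spin_ext fun x y => by
      rw [spinHom_comultFun, map_add, map_add, spinHom_comultFun, spinHom_comultFun]
    map_smul' := fun c f => spin_ext fun x y => by
      rw [spinHom_comultFun, map_smul, MonoidHom.id_apply, map_smul, spinHom_comultFun]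
    map_mul' := fun f g => spin_ext fun x y => by
      rw [spinHom_comultFun, map_mul, map_mul, spinHom_comultFun, spinHom_comultFun]
    map_star' := fun f => spin_ext fun x y => by
      rw [spinHom_comultFun, map_star, map_star, spinHom_comultFun] }
  fun f => spin_ext fun x y => by
    refine (spinHom_comultFun x y _).trans (((spinDiag x y).map_grade f).trans ?_)
    exact ((congrArg _ (spinHom_comultFun x y f)).symm).trans ((spinHom x y).map_grade _).symm

theorem spinHom_comult (x y : ℝ) (f : C₀(ℝ, 𝕜)) :
    spinHom x y (comult 𝕜 f) = spinDiag x y f := spinHom_comultFun x y f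

theorem comult_gauss : comult 𝕜 (gaussS 𝕜) =
    tmul (A := SAlg 𝕜) (B := SAlg 𝕜) (gaussS 𝕜) (gaussS 𝕜) :=
  spin_ext fun x y => by rw [spinHom_comult, spinHom_gauss]

theorem comult_xgauss : comult 𝕜 (xgaussS 𝕜) =
    tmul (A := SAlg 𝕜) (B := SAlg 𝕜) (gaussS 𝕜) (xgaussS 𝕜) +
      tmul (A := SAlg 𝕜) (B := SAlg 𝕜) (xgaussS 𝕜) (gaussS 𝕜) :=
  spin_ext fun x y => by rw [spinHom_comult, spinHom_xgauss]

variable (𝕜) in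
/-- Powers of the truncated coordinate function. -/
def cutPow (L : ℝ) : ℕ → C₀(ℝ, 𝕜)
  | 0 => cutS 𝕜 L
  | k + 1 => cutPow L k * xcutS 𝕜 L

theorem cutPow_apply {L x : ℝ} (h : x ∈ Set.Icc (-L) L) (k : ℕ) :
    cutPow 𝕜 L k x = (x : 𝕜) ^ k := by
  induction k with
  | zero => rw [cutPow, cutS_apply h, pow_zero]
  | succ k ih => rw [cutPow, ZeroAtInftyContinuousMap.mul_apply, ih, xcutS_apply h, pow_succ]

theorem pointHom_cutPow {E : GrCStar 𝕜} {p d : E.carrier} {x : ℝ} (h : IsPoint x p d) {L : ℝ}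
    (hx : x ∈ Set.Icc (-L) L) (k : ℕ) : pointHom h (cutPow 𝕜 L (k + 1)) =
      pointHom h (cutPow 𝕜 L k) * d := by
  rw [cutPow]
  exact (map_mul (pointHom h).toHom _ _).trans (congrArg _ (pointHom_xcutS h hx))

variable (𝕜) in
/-- A lift of `X_R ⊗ 1 + 1 ⊗ X_R` to `𝒮 ⊗̂ 𝒮`. -/
def cutSum (R : ℝ) : ((SAlg 𝕜).tensor (SAlg 𝕜)).carrier :=
  tmul (A := SAlg 𝕜) (B := SAlg 𝕜) (xcutS 𝕜 R) (cutS 𝕜 R) +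
    tmul (A := SAlg 𝕜) (B := SAlg 𝕜) (cutS 𝕜 R) (xcutS 𝕜 R)

variable (𝕜) in
/-- Lifts of the powers of `X_R ⊗ 1 + 1 ⊗ X_R` to `𝒮 ⊗̂ 𝒮`. -/
def cutSumPow (R : ℝ) : ℕ → ((SAlg 𝕜).tensor (SAlg 𝕜)).carrier
  | 0 => tmul (A := SAlg 𝕜) (B := SAlg 𝕜) (cutS 𝕜 R) (cutS 𝕜 R)
  | k + 1 => cutSumPow R k * cutSum 𝕜 R

theorem restrictS_cutS (R : ℝ) : restrictS R (cutS 𝕜 R) = oneR R :=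
  ContinuousMap.ext fun x => cutS_apply x.2

theorem restrictS_xcutS (R : ℝ) : restrictS R (xcutS 𝕜 R) = coordR R :=
  ContinuousMap.ext fun x => xcutS_apply x.2

theorem restrict_tmul (R : ℝ) (f g : C₀(ℝ, 𝕜)) : tensorMap (restrictS R) (restrictS R)
    (tmul (A := SAlg 𝕜) (B := SAlg 𝕜) f g) = tmul (restrictS R f) (restrictS R g) :=
  tensorMap_tmul (A := SAlg 𝕜) (B := SAlg 𝕜) _ _ f g

theorem restrict_cutSumPow (R : ℝ) (k : ℕ) :
    tensorMap (restrictS R) (restrictS R) (cutSumPow 𝕜 R k) = sumRPow R k := by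
  induction k with
  | zero => rw [cutSumPow, restrict_tmul, restrictS_cutS]; rfl
  | succ k ih =>
    rw [cutSumPow, map_mul, ih, cutSum, map_add, restrict_tmul, restrict_tmul, restrictS_cutS,
      restrictS_xcutS]
    rfl

theorem spinHom_cutSumPow {R x y : ℝ} (hx : x ∈ Set.Icc (-R) R) (hy : y ∈ Set.Icc (-R) R)
    {L : ℝ} (hL : √(x ^ 2 + y ^ 2) ∈ Set.Icc (-L) L) (k : ℕ) :
    spinHom x y (cutSumPow 𝕜 R k) = spinDiag x y (cutPow 𝕜 L k) := by
  induction k with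
  | zero =>
    rw [cutSumPow, spinHom_tmul, spinLeft, spinRight, spinDiag, pointHom_cutS _ hx,
      pointHom_cutS _ hy, cutPow, pointHom_cutS _ hL, spinOp_one_mul]
  | succ k ih =>
    rw [spinDiag, pointHom_cutPow _ hL, cutSumPow, map_mul, ih, cutSum, map_add, spinHom_tmul,
      spinHom_tmul, spinLeft, spinRight, pointHom_cutS _ hx, pointHom_cutS _ hy,
      pointHom_xcutS _ hx, pointHom_xcutS _ hy, spinOp_one_mul, spinOp_mul_one, spinVec_add]
    rfl

/-- The representations at points of `[-R, R]²` determine the norm of the image in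
`C[-R, R] ⊗̂ C[-R, R]`. The endpoints `± R` are nodes of every mesh, so a node outside the interval is
at least one mesh away from it. -/
theorem norm_restrict_le {R : ℝ} (hR : 0 < R) {z : ((SAlg 𝕜).tensor (SAlg 𝕜)).carrier} {M : ℝ}
    (hM : 0 ≤ M) (h : ∀ x ∈ Set.Icc (-R) R, ∀ y ∈ Set.Icc (-R) R, ‖spinHom x y z‖ ≤ M) :
    ‖tensorMap (restrictS R) (restrictS R) z‖ ≤ M := by
  refine norm_le_of_points (tensorMap (restrictS R) (restrictS R)) hR (Set.Icc (-R) R)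
    (fun _ => neg_mem_Icc) (fun n k hk x hx => ?_) (fun f g hfg => ?_) hM h
  · have hm := mesh_pos hR n
    have e : R = (n + 1) * mesh R n := by
      rw [mesh]
      field_simp
    obtain ⟨h1, h2⟩ := hx
    -- the interval contains the nodes with `-(n + 1) ≤ k ≤ n + 1`
    rcases le_or_gt k 0 with h0 | h0
    · have hk2 : k + n + 2 ≤ 0 := by
        by_contra hc
        refine hk ⟨?_, ?_⟩
        · have : -((n : ℝ) + 1) ≤ k := by
            have : -((n : ℤ) + 1) ≤ k := by omega
            exact_mod_cast this
          nlinarith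
        · have : (k : ℝ) ≤ 0 := by exact_mod_cast h0
          nlinarith
      have : (k : ℝ) + n + 2 ≤ 0 := by exact_mod_cast hk2
      refine le_trans ?_ (le_abs_self _)
      nlinarith
    · have hk2 : (n : ℤ) + 2 ≤ k := by
        by_contra hc
        refine hk ⟨?_, ?_⟩
        · have : (0 : ℝ) < k := by exact_mod_cast h0
          nlinarith
        · have : (k : ℝ) ≤ n + 1 := by
            have : k ≤ (n : ℤ) + 1 := by omega
            exact_mod_cast this
          nlinarith
      have : (n : ℝ) + 2 ≤ k := by exact_mod_cast hk2
      refine le_trans ?_ (neg_le_abs _)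
      nlinarith
  · rw [restrict_tmul]
    have hz : ∀ f : C₀(ℝ, 𝕜), (∀ x ∈ Set.Icc (-R) R, f x = 0) → restrictS R f = 0 := fun f hf =>
      ContinuousMap.ext fun x => hf x x.2
    rcases hfg with h | h
    · rw [hz f h]
      exact (tmulL (SRAlg 𝕜 R) (SRAlg 𝕜 R)).map_zero₂ _
    · rw [hz g h]
      exact (tmulL (SRAlg 𝕜 R) (SRAlg 𝕜 R) _).map_zero

/-- If the polynomial `p` is within `ε` of `f` on `[-2R, 2R]`, then `p(X_R ⊗ 1 + 1 ⊗ X_R)` is within `ε` of the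
image of `Δ(f)`: at each point of `[-R, R]²` both come from functional calculus for the same Clifford
vector, whose norm is at most `2R`. -/
theorem isComult_comult : IsComult (comult 𝕜) := by
  intro R hR f p ε h
  have hε : 0 ≤ ε := (norm_nonneg _).trans (h 0 ⟨by linarith, by linarith⟩)
  set z : ((SAlg 𝕜).tensor (SAlg 𝕜)).carrier := p.sum fun k c => c • cutSumPow 𝕜 R k with hz
  set g : C₀(ℝ, 𝕜) := p.sum fun k c => c • cutPow 𝕜 (2 * R) k with hg
  have e : sumRPoly R p = tensorMap (restrictS R) (restrictS R) z := by
    rw [hz, Polynomial.sum_def, map_sum, sumRPoly, Polynomial.sum_def]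
    refine Finset.sum_congr rfl fun k _ => ?_
    rw [map_smul, restrict_cutSumPow]
  rw [e, ← map_sub]
  refine norm_restrict_le hR hε fun x hx y hy => ?_
  have hr : √(x ^ 2 + y ^ 2) ∈ Set.Icc (-(2 * R)) (2 * R) := by
    refine ⟨by linarith [Real.sqrt_nonneg (x ^ 2 + y ^ 2)], ?_⟩
    refine Real.sqrt_le_iff.2 ⟨by linarith, ?_⟩
    have h1 := sq_le_sq' hx.1 hx.2
    have h2 := sq_le_sq' hy.1 hy.2
    nlinarith
  have e2 : spinHom x y z = spinDiag x y g := by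
    rw [hz, hg, Polynomial.sum_def, Polynomial.sum_def, map_sum]
    refine Eq.trans ?_ (map_sum (spinDiag x y).toHom _ _).symm
    refine Finset.sum_congr rfl fun k _ => ?_
    rw [map_smul, spinHom_cutSumPow hx hy hr]
    exact (map_smul (spinDiag x y).toHom _ _).symm
  have e3 : spinDiag x y f - spinDiag x y g = spinDiag x y (f - g) :=
    (map_sub (spinDiag x y).toHom f g).symm
  have hfg : ∀ t ∈ Set.Icc (-(2 * R)) (2 * R), ‖(f - g) t‖ ≤ ε := fun t ht => by
    have : g t = p.eval (t : 𝕜) := by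
      rw [hg, Polynomial.sum_def, c0_sum_apply, Polynomial.eval_eq_sum, Polynomial.sum_def]
      refine Finset.sum_congr rfl fun k _ => ?_
      rw [ZeroAtInftyContinuousMap.smul_apply, cutPow_apply ht, smul_eq_mul]
    rw [ZeroAtInftyContinuousMap.sub_apply, this]
    exact h t ht
  rw [map_sub, spinHom_comult, e2, e3]
  exact norm_pointHom_le _ hε (hfg _ hr) (hfg _ (neg_mem_Icc hr))

end Comult

/-! ### Convolution of asymptotic morphisms with homomorphisms out of `𝒮` -/

section Convolution

variable {S A B C D D' E E' E'' Q A' B' C' : GrCStar 𝕜}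

theorem GrHom.comp_assoc (f : GrHom C D) (g : GrHom B C) (h : GrHom A B) :
    (f.comp g).comp h = f.comp (g.comp h) := rfl

theorem GrHom.id_comp (f : GrHom A B) : (GrHom.id B).comp f = f := rfl

theorem tensorMap_comp (f : GrHom A' C) (g : GrHom B' D) (f' : GrHom A A') (g' : GrHom B B') :
    (tensorMap f g).comp (tensorMap f' g') = tensorMap (f.comp f') (g.comp g') :=
  GrHom.tensor_ext fun a b => by simp

theorem tensorMap_id : tensorMap (GrHom.id A) (GrHom.id B) = GrHom.id (A.tensor B) :=
  GrHom.tensor_ext fun a b => by simp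

theorem assoc_natural (f : GrHom A A') (g : GrHom B B') (h : GrHom C C') :
    (assocHom A' B' C').comp (tensorMap (tensorMap f g) h) =
      (tensorMap f (tensorMap g h)).comp (assocHom A B C) :=
  GrHom.tensor_ext₃ fun a b c => by simp

theorem asyMap_comp' (g : GrHom E' E'') (f : GrHom E E') :
    asyMap (g.comp f) = (asyMap g).comp (asyMap f) := GrHom.ext fun x => asyMap_comp g f x

theorem asyMap_id' : asyMap (GrHom.id E) = GrHom.id (AsyAlg E) := GrHom.ext asyMap_id

theorem tau_assoc (D D' B : GrCStar 𝕜) :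
    (asyMap (assocHom D D' B)).comp (tau (D.tensor D') B) =
      (tau D (D'.tensor B)).comp
        ((tensorMap (GrHom.id D) (tau D' B)).comp (assocHom D D' (AsyAlg B))) := by
  refine GrHom.tensor_ext₃ fun d d' y => ?_
  obtain ⟨f, rfl⟩ := AsyAlg.mk_surjective y
  simp only [GrHom.comp_apply, tau_tmul, asyMap_mk, assocHom_tmul, tensorMap_tmul, GrHom.id_apply]
  exact congrArg AsyAlg.mk (BoundedContinuousFunction.ext fun t => assocHom_tmul d d' (f t))

theorem idTensor_comp (F : GrHom A (AsyAlg B)) (f : GrHom Q A) :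
    idTensor D (F.comp f) = (idTensor D F).comp (tensorMap (GrHom.id D) f) := by
  rw [idTensor, idTensor, GrHom.comp_assoc, tensorMap_comp]
  rfl

theorem idTensor_asyMap (F : GrHom A (AsyAlg B)) (h : GrHom B C) :
    idTensor D ((asyMap h).comp F) = (asyMap (tensorMap (GrHom.id D) h)).comp (idTensor D F) := by
  rw [idTensor, idTensor, ← GrHom.comp_assoc, tau_natural, GrHom.comp_assoc, tensorMap_comp]
  rfl

/-- The homomorphism `S ⊗̂ Q → S ⊗̂ (S ⊗̂ Q)` given by a comultiplication. -/
def coact (Δ : GrHom S (S.tensor S)) (Q : GrCStar 𝕜) :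
    GrHom (S.tensor Q) (S.tensor (S.tensor Q)) :=
  (assocHom S S Q).comp (tensorMap Δ (GrHom.id Q))

/-- The convolution of `F` with `l`: the composition `l ∘ (id ⊗̂ F) ∘ (Δ ⊗̂ id)`. -/
def conv (Δ : GrHom S (S.tensor S)) (l : GrHom (S.tensor E) E')
    (F : GrHom (S.tensor Q) (AsyAlg E)) : GrHom (S.tensor Q) (AsyAlg E') :=
  (asyMap l).comp ((idTensor S F).comp (coact Δ Q))

variable (Δ : GrHom S (S.tensor S))

theorem asyMap_conv (h : GrHom E' E'') (l : GrHom (S.tensor E) E')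
    (F : GrHom (S.tensor Q) (AsyAlg E)) :
    (asyMap h).comp (conv Δ l F) = conv Δ (h.comp l) F := by
  rw [conv, conv, asyMap_comp', GrHom.comp_assoc]

theorem conv_asyMap (l : GrHom (S.tensor E') E'') (h : GrHom E E')
    (F : GrHom (S.tensor Q) (AsyAlg E)) :
    conv Δ l ((asyMap h).comp F) = conv Δ (l.comp (tensorMap (GrHom.id S) h)) F := by
  rw [conv, conv, idTensor_asyMap, asyMap_comp', GrHom.comp_assoc, GrHom.comp_assoc]

/-- A coassociative comultiplication. -/
def IsCoassoc : Prop :=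
  (assocHom S S S).comp ((tensorMap Δ (GrHom.id S)).comp Δ) = (tensorMap (GrHom.id S) Δ).comp Δ

variable {Δ}

/-- Coassociativity for `S ⊗̂ Q`; besides that of `Δ` it needs the pentagon identity for `assocHom`. -/
theorem coact_coact (h : IsCoassoc Δ) :
    (coact Δ (S.tensor Q)).comp (coact Δ Q) =
      (tensorMap (GrHom.id S) (coact Δ Q)).comp (coact Δ Q) := by
  have pent : (assocHom S S (S.tensor Q)).comp (assocHom (S.tensor S) S Q) =
      (tensorMap (GrHom.id S) (assocHom S S Q)).comp ((assocHom S (S.tensor S) Q).comp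
        (tensorMap (assocHom S S S) (GrHom.id Q))) := by
    refine GrHom.tensor_ext fun z c => ?_
    refine tensor_induction (p := fun z => (assocHom S S (S.tensor Q)).comp
      (assocHom (S.tensor S) S Q) (tmul z c) =
      (tensorMap (GrHom.id S) (assocHom S S Q)).comp ((assocHom S (S.tensor S) Q).comp
        (tensorMap (assocHom S S S) (GrHom.id Q))) (tmul z c))
      (isClosed_eq ((GrHom.continuous _).comp (continuous_tmul_left c))
        ((GrHom.continuous _).comp (continuous_tmul_left c)))
      (fun x y hx hy => by rw [add_tmul, map_add, map_add, hx, hy]) (fun z s => ?_) z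
    refine tensor_induction (p := fun z => (assocHom S S (S.tensor Q)).comp
      (assocHom (S.tensor S) S Q) (tmul (tmul z s) c) =
      (tensorMap (GrHom.id S) (assocHom S S Q)).comp ((assocHom S (S.tensor S) Q).comp
        (tensorMap (assocHom S S S) (GrHom.id Q))) (tmul (tmul z s) c))
      (isClosed_eq
        ((GrHom.continuous _).comp ((continuous_tmul_left c).comp (continuous_tmul_left s)))
        ((GrHom.continuous _).comp ((continuous_tmul_left c).comp (continuous_tmul_left s))))
      (fun x y hx hy => by rw [add_tmul, add_tmul, map_add, map_add, hx, hy]) (fun f g => ?_) z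
    simp only [GrHom.comp_apply, assocHom_tmul, tensorMap_tmul, GrHom.id_apply]
  have e1 : (tensorMap Δ (GrHom.id (S.tensor Q))).comp (assocHom S S Q) =
      (assocHom (S.tensor S) S Q).comp (tensorMap (tensorMap Δ (GrHom.id S)) (GrHom.id Q)) := by
    rw [assoc_natural, tensorMap_id]
  have e2 : (assocHom S (S.tensor S) Q).comp (tensorMap (tensorMap (GrHom.id S) Δ) (GrHom.id Q)) =
      (tensorMap (GrHom.id S) (tensorMap Δ (GrHom.id Q))).comp (assocHom S S Q) := assoc_natural _ _ _
  have e3 : tensorMap (GrHom.id S) (coact Δ Q) =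
      (tensorMap (GrHom.id S) (assocHom S S Q)).comp
        (tensorMap (GrHom.id S) (tensorMap Δ (GrHom.id Q))) := by
    rw [tensorMap_comp]
    rfl
  calc (coact Δ (S.tensor Q)).comp (coact Δ Q)
      = (assocHom S S (S.tensor Q)).comp (((tensorMap Δ (GrHom.id (S.tensor Q))).comp
          (assocHom S S Q)).comp (tensorMap Δ (GrHom.id Q))) := rfl
    _ = ((assocHom S S (S.tensor Q)).comp (assocHom (S.tensor S) S Q)).comp
          ((tensorMap (tensorMap Δ (GrHom.id S)) (GrHom.id Q)).comp
            (tensorMap Δ (GrHom.id Q))) := by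
        rw [e1]
        rfl
    _ = (tensorMap (GrHom.id S) (assocHom S S Q)).comp ((assocHom S (S.tensor S) Q).comp
          ((tensorMap (assocHom S S S) (GrHom.id Q)).comp
            ((tensorMap (tensorMap Δ (GrHom.id S)) (GrHom.id Q)).comp
              (tensorMap Δ (GrHom.id Q))))) := by
        rw [pent]
        rfl
    _ = (tensorMap (GrHom.id S) (assocHom S S Q)).comp (((assocHom S (S.tensor S) Q).comp
          (tensorMap (tensorMap (GrHom.id S) Δ) (GrHom.id Q))).comp
            (tensorMap Δ (GrHom.id Q))) := by
        rw [GrHom.comp_assoc (assocHom S (S.tensor S) Q), tensorMap_comp, tensorMap_comp,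
          tensorMap_comp]
        exact congrArg (fun f => (tensorMap (GrHom.id S) (assocHom S S Q)).comp
          ((assocHom S (S.tensor S) Q).comp (tensorMap f (GrHom.id Q)))) h
    _ = _ := by
        rw [e2, e3]
        rfl

/-- By coassociativity, an iterated convolution is a convolution with a single homomorphism. -/
theorem conv_conv (h : IsCoassoc Δ) (l' : GrHom (S.tensor E') E'') (l : GrHom (S.tensor E) E')
    (F : GrHom (S.tensor Q) (AsyAlg E)) : conv Δ l' (conv Δ l F) =
      conv Δ ((l'.comp (tensorMap (GrHom.id S) l)).comp (coact Δ E)) F := by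
  have key : (asyMap (coact Δ E)).comp (idTensor S F) =
      (idTensor S (idTensor S F)).comp (coact Δ (S.tensor Q)) := by
    have e1 : (tensorMap (GrHom.id S) (tensorMap (GrHom.id S) F)).comp
        (assocHom S S (S.tensor Q)) = (assocHom S S (AsyAlg E)).comp
          (tensorMap (tensorMap (GrHom.id S) (GrHom.id S)) F) := (assoc_natural _ _ _).symm
    calc (asyMap (coact Δ E)).comp (idTensor S F)
        = (asyMap (assocHom S S E)).comp (((asyMap (tensorMap Δ (GrHom.id E))).comp
            (tau S E)).comp (tensorMap (GrHom.id S) F)) := by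
          rw [coact, asyMap_comp']
          rfl
      _ = ((asyMap (assocHom S S E)).comp (tau (S.tensor S) E)).comp (tensorMap Δ F) := by
          rw [tau_natural, asyMap_id', GrHom.comp_assoc (tau (S.tensor S) E), tensorMap_comp]
          rfl
      _ = (tau S (S.tensor E)).comp ((tensorMap (GrHom.id S) (tau S E)).comp
            ((assocHom S S (AsyAlg E)).comp (tensorMap Δ F))) := by
          rw [tau_assoc]
          rfl
      _ = (tau S (S.tensor E)).comp ((tensorMap (GrHom.id S) (tau S E)).comp
            ((tensorMap (GrHom.id S) (tensorMap (GrHom.id S) F)).comp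
              (coact Δ (S.tensor Q)))) := by
          rw [coact, ← GrHom.comp_assoc (tensorMap (GrHom.id S) (tensorMap (GrHom.id S) F)), e1,
            GrHom.comp_assoc (assocHom S S (AsyAlg E)), tensorMap_comp, tensorMap_id]
          rfl
      _ = _ := by
          rw [← GrHom.comp_assoc (tensorMap (GrHom.id S) (tau S E)), tensorMap_comp]
          rfl
  calc conv Δ l' (conv Δ l F)
      = (asyMap (l'.comp (tensorMap (GrHom.id S) l))).comp
          ((idTensor S ((idTensor S F).comp (coact Δ Q))).comp (coact Δ Q)) := by
        rw [conv, conv, idTensor_asyMap, asyMap_comp']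
        rfl
    _ = (asyMap (l'.comp (tensorMap (GrHom.id S) l))).comp
          ((idTensor S (idTensor S F)).comp ((coact Δ (S.tensor Q)).comp (coact Δ Q))) := by
        rw [idTensor_comp, GrHom.comp_assoc (idTensor S (idTensor S F)), coact_coact h]
    _ = (asyMap (l'.comp (tensorMap (GrHom.id S) l))).comp
          (((asyMap (coact Δ E)).comp (idTensor S F)).comp (coact Δ Q)) := by
        rw [key]
        rfl
    _ = _ := by
        rw [conv, asyMap_comp' _ (coact Δ E)]
        rfl

/-- If `ε` is a counit, with values in an algebra `C` that acts on `E` by `l` in such a way that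
`e₀` acts as the identity, then convolution with `l ∘ (ε ⊗̂ id)` does nothing. -/
theorem conv_counit {ε : GrHom S C} {e₀ : C.carrier} (l : GrHom (C.tensor E) E)
    (hε : ∀ f, tensorMap ε (GrHom.id S) (Δ f) = tmul e₀ f) (hl : ∀ x, l (tmul e₀ x) = x)
    (F : GrHom (S.tensor Q) (AsyAlg E)) :
    conv Δ (l.comp (tensorMap ε (GrHom.id E))) F = F := by
  have e1 : (tensorMap ε F).comp (assocHom S S Q) = (tensorMap (GrHom.id C) F).comp
      ((assocHom C S Q).comp (tensorMap (tensorMap ε (GrHom.id S)) (GrHom.id Q))) := by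
    rw [assoc_natural, ← GrHom.comp_assoc, tensorMap_comp, tensorMap_id]
    rfl
  have e2 : conv Δ (l.comp (tensorMap ε (GrHom.id E))) F = (asyMap l).comp ((tau C E).comp
      ((tensorMap (GrHom.id C) F).comp ((assocHom C S Q).comp
        (tensorMap ((tensorMap ε (GrHom.id S)).comp Δ) (GrHom.id Q))))) := by
    calc conv Δ (l.comp (tensorMap ε (GrHom.id E))) F
        = (asyMap l).comp (((asyMap (tensorMap ε (GrHom.id E))).comp (tau S E)).comp
            ((tensorMap (GrHom.id S) F).comp (coact Δ Q))) := by
          rw [conv, asyMap_comp']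
          rfl
      _ = (asyMap l).comp ((tau C E).comp (((tensorMap ε F).comp (assocHom S S Q)).comp
            (tensorMap Δ (GrHom.id Q)))) := by
          rw [tau_natural, asyMap_id', GrHom.comp_assoc (tau C E),
            ← GrHom.comp_assoc (tensorMap ε (GrHom.id (AsyAlg E))), tensorMap_comp]
          rfl
      _ = _ := by
          rw [e1, GrHom.comp_assoc, GrHom.comp_assoc, tensorMap_comp]
          rfl
  rw [e2]
  refine GrHom.tensor_ext fun f a => ?_
  simp only [GrHom.comp_apply, tensorMap_tmul, hε, assocHom_tmul, GrHom.id_apply]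
  obtain ⟨y, hy⟩ := AsyAlg.mk_surjective (F (tmul f a))
  rw [← hy, tau_tmul, asyMap_mk]
  exact congrArg AsyAlg.mk (BoundedContinuousFunction.ext fun t => hl (y t))

theorem conv_zero_right (l : GrHom (S.tensor E) E') {F : GrHom (S.tensor Q) (AsyAlg E)}
    (hF : ∀ x, F x = 0) (x) : conv Δ l F x = 0 := by
  have e : ∀ z, idTensor S F z = 0 := fun z => by
    refine tensor_induction (p := fun z => idTensor S F z = 0)
      (isClosed_eq (GrHom.continuous _) continuous_const)
      (fun x y hx hy => by rw [map_add, hx, hy, add_zero]) (fun d a => ?_) z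
    have h0 : tmul d (F a) = 0 := by
      rw [hF]
      exact (tmulL _ _ d).map_zero
    rw [idTensor, GrHom.comp_apply, tensorMap_tmul, GrHom.id_apply, h0, map_zero]
  rw [conv, GrHom.comp_apply, GrHom.comp_apply, e, map_zero]

theorem conv_zero_left {l : GrHom (S.tensor E) E'} (hl : ∀ x, l x = 0)
    (F : GrHom (S.tensor Q) (AsyAlg E)) (x) : conv Δ l F x = 0 := by
  rw [conv, GrHom.comp_apply]
  obtain ⟨y, hy⟩ := AsyAlg.mk_surjective (((idTensor S F).comp (coact Δ Q)) x)
  rw [← hy, asyMap_mk]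
  exact congrArg AsyAlg.mk (BoundedContinuousFunction.ext fun t => hl (y t))

end Convolution

/-! ### Twisting by commuting homomorphisms to the middle factor -/

section Twist

variable {S F₁ F₂ F F' B K : GrCStar 𝕜}

theorem shuffle_comp (p : GrHom F₁ F) (q : GrHom F₂ F) (h : GradedCommute p q) (γ : GrHom S F₁)
    (h' : GradedCommute (p.comp γ) q) : (shuffle B K p q h).comp (tensorMap γ (GrHom.id _)) =
      shuffle B K (p.comp γ) q h' :=
  GrHom.tensor_ext fun c e => by
    rw [GrHom.comp_apply, tensorMap_tmul, shuffle_tmul, shuffle_tmul, midMult_comp_apply]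
    rfl

theorem shuffle_congr {p p' : GrHom F₁ F} {q q' : GrHom F₂ F} (h : GradedCommute p q)
    (h' : GradedCommute p' q') (e₁ : p = p') (e₂ : q = q') :
    shuffle B K p q h = shuffle B K p' q' h' := by
  subst e₁ e₂
  rfl

theorem midMap_shuffle (p : GrHom F₁ F) (q : GrHom F₂ F) (h : GradedCommute p q) (r : GrHom F F')
    (h' : GradedCommute (r.comp p) (r.comp q)) :
    (midMap B K r).comp (shuffle B K p q h) = shuffle B K (r.comp p) (r.comp q) h' :=
  GrHom.tensor_ext fun c e => by
    rw [GrHom.comp_apply, shuffle_tmul, shuffle_tmul, midMap_midMult, ← GrHom.comp_apply,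
      tensorMap_comp, tensorMap_comp]
    rfl

theorem shuffle_midMap {F₀ : GrCStar 𝕜} (p : GrHom F₁ F) (q : GrHom F₂ F) (h : GradedCommute p q)
    (r : GrHom F₀ F₂) (h' : GradedCommute p (q.comp r)) :
    (shuffle B K p q h).comp (tensorMap (GrHom.id F₁) (midMap B K r)) =
      shuffle B K p (q.comp r) h' :=
  GrHom.tensor_ext fun c e => by
    rw [GrHom.comp_apply, tensorMap_tmul, shuffle_tmul, shuffle_tmul, ← GrHom.comp_apply (midMap B K q),
      tensorMap_comp, tensorMap_comp]
    rfl

theorem GradedCommute.precomp_left {A A' C D : GrCStar 𝕜} {φ : GrHom A C} {ψ : GrHom D C}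
    (h : GradedCommute φ ψ) (f : GrHom A' A) : GradedCommute (φ.comp f) ψ :=
  h.comp f (GrHom.id D)

theorem GradedCommute.precomp_right {A D' C D : GrCStar 𝕜} {φ : GrHom A C} {ψ : GrHom D C}
    (h : GradedCommute φ ψ) (f : GrHom D' D) : GradedCommute φ (ψ.comp f) :=
  h.comp (GrHom.id A) f

/-- The composition of two shuffles along a comultiplication is a shuffle. -/
theorem shuffle_shuffle (Δ : GrHom S (S.tensor S)) {p : GrHom S F} {q : GrHom F₂ F}
    (h : GradedCommute p q) {p' : GrHom S F'} {q' : GrHom F F'} (h' : GradedCommute p' q')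
    (k : GradedCommute p' (q'.comp p))
    (k' : GradedCommute ((pairHom p' (q'.comp p) k).comp Δ) (q'.comp q)) :
    ((shuffle B K p' q' h').comp (tensorMap (GrHom.id S) (shuffle B K p q h))).comp (coact Δ _) =
      shuffle B K ((pairHom p' (q'.comp p) k).comp Δ) (q'.comp q) k' := by
  have k'' : GradedCommute (pairHom p' (q'.comp p) k) (q'.comp q) :=
    pairHom_commute _ _ _ _ (h'.precomp_right q) (h.postcomp q')
  rw [← shuffle_comp (pairHom p' (q'.comp p) k) (q'.comp q) k'' Δ, coact, ← GrHom.comp_assoc]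
  congr 1
  refine GrHom.tensor_ext₃ fun f g e => ?_
  have e1 : midMult B K (pairHom p' (q'.comp p) k) (tmul f g) =
      midMult B K p' f * midMult B K (q'.comp p) g := by
    have a1 := midMult_comp_apply (B := B) (K := K) (GrHom.id F') (pairHom p' (q'.comp p) k)
      (tmul f g)
    have a2 := midMult_comp_apply (B := B) (K := K) (GrHom.id F') p' f
    have a3 := midMult_comp_apply (B := B) (K := K) (GrHom.id F') (q'.comp p) g
    rw [GrHom.id_comp] at a1 a2 a3
    rw [a1, a2, a3, pairHom_tmul, map_mul]
  rw [GrHom.comp_apply, GrHom.comp_apply, assocHom_tmul, tensorMap_tmul, shuffle_tmul,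
    shuffle_tmul, shuffle_tmul, midMap_midMult, e1, Mult.app_mul, GrHom.id_apply,
    ← GrHom.comp_apply (midMap B K q'), tensorMap_comp, tensorMap_comp]
  rfl

end Twist

/-! ### Coassociativity -/

section Generators

variable (𝕜) in
/-- The generator `exp (-x²)`, as an element of the graded algebra `𝒮`. -/
def genU : (SAlg 𝕜).carrier := gaussS 𝕜

variable (𝕜) in
/-- The generator `x exp (-x²)`, as an element of the graded algebra `𝒮`. -/
def genV : (SAlg 𝕜).carrier := xgaussS 𝕜

theorem comult_genU : comult 𝕜 (genU 𝕜) = tmul (genU 𝕜) (genU 𝕜) := comult_gauss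

theorem comult_genV : comult 𝕜 (genV 𝕜) = tmul (genU 𝕜) (genV 𝕜) + tmul (genV 𝕜) (genU 𝕜) :=
  comult_xgauss

theorem GrHom.gen_ext {E : GrCStar 𝕜} {f g : GrHom (SAlg 𝕜) E} (hu : f (genU 𝕜) = g (genU 𝕜))
    (hv : f (genV 𝕜) = g (genV 𝕜)) : f = g := GrHom.s_ext hu hv

/-- It suffices to compare both sides on the generators, where `Δ` has a simple form. -/
theorem isCoassoc_comult : IsCoassoc (comult 𝕜) := by
  refine GrHom.gen_ext ?_ ?_
  · simp only [GrHom.comp_apply, comult_genU, tensorMap_tmul, assocHom_tmul, GrHom.id_apply]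
  · simp only [GrHom.comp_apply, comult_genU, comult_genV, map_add, tensorMap_tmul, GrHom.id_apply,
      add_tmul, tmul_add, assocHom_tmul]
    abel

end Generators

/-! ### Bott maps at vectors -/

section Bott

variable {m n N : ℕ}

theorem cliffVec_mul_self (v : EuclideanSpace ℝ (Fin m)) :
    cliffVec (𝕜 := 𝕜) v * cliffVec v = ((‖v‖ ^ 2 : ℝ) : 𝕜) • cliffUnit 𝕜 m := by
  rw [cliffVec, ← cliffOf_mul, CliffordAlgebra.ι_sq_scalar, euclidForm_apply,
    Algebra.algebraMap_eq_smul_one, cliffOf_smul]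
  rfl

theorem star_cliffUnit : star (cliffUnit 𝕜 m) = cliffUnit 𝕜 m := by
  rw [← cliffUnit_mul (star (cliffUnit 𝕜 m))]
  nth_rewrite 1 [← star_star (cliffUnit 𝕜 m)]
  rw [← star_mul, cliffUnit_mul, star_star]

theorem isPoint_cliff (v : EuclideanSpace ℝ (Fin m)) :
    IsPoint (E := CliffAlg 𝕜 m) ‖v‖ (cliffUnit 𝕜 m) (cliffVec v) where
  pp := cliffUnit_mul _
  pd := cliffUnit_mul _
  dp := mul_cliffUnit _
  dd := cliffVec_mul_self v
  sp := star_cliffUnit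
  sd := star_cliffVec v
  gp := grade_cliffUnit
  gd := grade_cliffVec v

/-- The Bott map `f ↦ f(v)` at a vector `v`, by functional calculus in the Clifford algebra. -/
def bottVec (v : EuclideanSpace ℝ (Fin m)) : GrHom (SAlg 𝕜) (CliffAlg 𝕜 m) :=
  pointHom (isPoint_cliff v)

theorem bottVec_genU (v : EuclideanSpace ℝ (Fin m)) :
    bottVec v (genU 𝕜) = (Real.exp (-‖v‖ ^ 2) : 𝕜) • cliffUnit 𝕜 m := pointHom_gauss _

theorem bottVec_genV (v : EuclideanSpace ℝ (Fin m)) :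
    bottVec v (genV 𝕜) = (Real.exp (-‖v‖ ^ 2) : 𝕜) • cliffVec v := pointHom_xgauss _

theorem cliffMap_bottVec (f : EuclideanSpace ℝ (Fin m) →ₗᵢ[ℝ] EuclideanSpace ℝ (Fin n))
    (v : EuclideanSpace ℝ (Fin m)) : (cliffMap f).comp (bottVec v) = bottVec (𝕜 := 𝕜) (f v) := by
  refine GrHom.gen_ext ?_ ?_
  · rw [GrHom.comp_apply, bottVec_genU, map_smul, cliffMap_unit, bottVec_genU, f.norm_map]
  · rw [GrHom.comp_apply, bottVec_genV, map_smul, cliffMap_vec, bottVec_genV, f.norm_map]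

theorem cliffMap_comp (f : EuclideanSpace ℝ (Fin n) →ₗᵢ[ℝ] EuclideanSpace ℝ (Fin N))
    (g : EuclideanSpace ℝ (Fin m) →ₗᵢ[ℝ] EuclideanSpace ℝ (Fin n)) :
    cliffMap (𝕜 := 𝕜) (f.comp g) = (cliffMap f).comp (cliffMap g) := by
  refine GrHom.cliff_ext ?_ fun v => ?_
  · simp
  · simp

theorem cliffMap_id : cliffMap (𝕜 := 𝕜) (LinearIsometry.id (E := EuclideanSpace ℝ (Fin m))) =
    GrHom.id (CliffAlg 𝕜 m) := by
  refine GrHom.cliff_ext ?_ fun v => ?_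
  · simp
  · simp

/-- The Bott maps at orthogonal vectors convolve to the Bott map at their sum. -/
theorem bottVec_add {v w : EuclideanSpace ℝ (Fin m)} (h : inner ℝ v w = 0)
    (k : GradedCommute (bottVec (𝕜 := 𝕜) v) (bottVec w)) :
    (pairHom (bottVec v) (bottVec w) k).comp (comult 𝕜) = bottVec (v + w) := by
  have e : (Real.exp (-‖v + w‖ ^ 2) : 𝕜) =
      (Real.exp (-‖v‖ ^ 2) : 𝕜) * (Real.exp (-‖w‖ ^ 2) : 𝕜) := by
    rw [← RCLike.ofReal_mul, ← Real.exp_add, norm_add_sq_real, h]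
    congr 3
    ring
  refine GrHom.gen_ext ?_ ?_
  · rw [GrHom.comp_apply, comult_genU, pairHom_tmul, bottVec_genU, bottVec_genU, bottVec_genU,
      smul_mul_assoc, mul_smul_comm, cliffUnit_mul, smul_smul, e]
  · rw [GrHom.comp_apply, comult_genV, map_add, pairHom_tmul, pairHom_tmul, bottVec_genU,
      bottVec_genU, bottVec_genV, bottVec_genV, bottVec_genV, smul_mul_assoc, mul_smul_comm,
      smul_mul_assoc, mul_smul_comm, cliffUnit_mul, mul_cliffUnit, smul_smul, smul_smul, e,
      cliffVec_add, smul_add, add_comm]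

/-- The Bott map `b_s` is the Bott map at the vector `s e₁`. -/
theorem bott_eq_bottVec (s : ℝ) : bott (𝕜 := 𝕜) s = bottVec (vecOne s) := by
  have hn : ‖vecOne s‖ ^ 2 = s ^ 2 := by
    rw [EuclideanSpace.norm_sq_eq]
    simp [vecOne]
  have hb : ∀ f : C₀(ℝ, 𝕜), bott (𝕜 := 𝕜) s f = ((f s + f (-s)) / 2) • cliffUnit 𝕜 1 +
      ((f s - f (-s)) / 2) • cliffOf cliffE := fun f =>
    ((cliffClass (𝕜 := 𝕜) 1).of_add (Cliff.mk _ 1) (Cliff.mk _ cliffE)).trans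
      (congrArg₂ (· + ·) (cliff_of_mk _ _) (cliff_of_mk _ _))
  have hv : cliffVec (𝕜 := 𝕜) (vecOne s) = (s : 𝕜) • cliffOf cliffE := by
    rw [cliffE]
    refine Eq.trans ?_ (cliffVec_smul s _)
    congr 1
    ext i
    fin_cases i
    simp [vecOne]
  refine GrHom.gen_ext ?_ ?_
  · rw [bottVec_genU, hn]
    refine (hb (gaussS 𝕜)).trans ?_
    rw [gaussS_apply, gaussS_apply, neg_sq, sub_self, zero_div, zero_smul, add_zero, add_self_div_two]
  · rw [bottVec_genV, hn, hv]
    refine (hb (xgaussS 𝕜)).trans ?_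
    rw [xgaussS_apply, xgaussS_apply, neg_sq, neg_mul, RCLike.ofReal_neg, add_neg_cancel, zero_div,
      zero_smul, zero_add, sub_neg_eq_add, add_self_div_two, smul_smul, RCLike.ofReal_mul, mul_comm]

/-- The zero homomorphism. -/
def GrHom.zero (A B : GrCStar 𝕜) : GrHom A B := GrHom.ofHom
  { toFun := fun _ => 0
    map_smul' := fun c _ => (smul_zero c).symm
    map_zero' := rfl
    map_add' := fun _ _ => (add_zero 0).symm
    map_mul' := fun _ _ => (mul_zero 0).symm
    map_star' := fun _ => (star_zero _).symm }
  fun _ => (map_zero B.grade).symm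

theorem GrHom.zero_apply {A B : GrCStar 𝕜} (a) : GrHom.zero A B a = 0 := rfl

/-- The Bott maps parametrized by the sphere: zero at the point at infinity. -/
def bottSph (s : (Sph n).carrier) : GrHom (SAlg 𝕜) (CliffAlg 𝕜 n) :=
  OnePoint.elim s (GrHom.zero _ _) bottVec

theorem bottSph_coe (v : EuclideanSpace ℝ (Fin n)) :
    bottSph (𝕜 := 𝕜) (Sph.ofVec v) = bottVec v := rfl

theorem bottSph_pt : bottSph (𝕜 := 𝕜) (Sph n).pt = GrHom.zero _ _ := rfl

theorem cliffMap_bottSph (K : O n) (s : (Sph n).carrier) :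
    (cliffMap (orthIso K)).comp (bottSph s) = bottSph (𝕜 := 𝕜) (sphAct K s) := by
  induction s using OnePoint.rec with
  | infty => exact GrHom.ext fun x => map_zero (cliffMap (orthIso K)).toHom
  | coe v => exact cliffMap_bottVec _ v

end Bott

/-! ### Continuous families of homomorphisms -/

section Families

variable {Y : Type} [TopologicalSpace Y] {P E E' : GrCStar 𝕜}

/-- Homomorphisms are contractive, so continuity of a family of homomorphisms at an element passes to
limits of elements. -/
theorem isClosed_continuous_family (U : Y → GrHom P E) :
    IsClosed {x : P.carrier | Continuous fun y => U y x} := by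
  refine isClosed_of_closure_subset fun x hx => ?_
  refine continuous_of_uniform_approx_of_continuous fun u hu => ?_
  obtain ⟨ε, hε, h⟩ := Metric.mem_uniformity_dist.1 hu
  obtain ⟨x', hx', hd⟩ := Metric.mem_closure_iff.1 hx ε hε
  refine ⟨fun y => U y x', hx', fun y => h ?_⟩
  rw [dist_eq_norm, ← map_sub]
  refine (norm_starHom_le _ _).trans_lt ?_
  rwa [← dist_eq_norm]

theorem continuous_family_apply {U : Y → GrHom P E} (hU : ∀ x, Continuous fun y => U y x)
    {f : Y → P.carrier} (hf : Continuous f) : Continuous fun y => U y (f y) := by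
  rw [continuous_iff_continuousAt]
  intro y₀
  have h1 := (hU (f y₀)).tendsto y₀
  have h2 : Tendsto (fun y => U y (f y - f y₀)) (𝓝 y₀) (𝓝 0) := by
    refine squeeze_zero_norm (fun y => norm_starHom_le (U y).toHom (f y - f y₀)) ?_
    have h3 : Tendsto (fun y => f y - f y₀) (𝓝 y₀) (𝓝 (f y₀ - f y₀)) :=
      (hf.tendsto y₀).sub tendsto_const_nhds
    rw [sub_self] at h3
    simpa using h3.norm
  have h4 := h2.add h1
  rw [zero_add] at h4
  refine h4.congr fun y => ?_
  rw [← map_add, sub_add_cancel]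

theorem continuous_family_tensor {A B : GrCStar 𝕜} {U : Y → GrHom (A.tensor B) E}
    (h : ∀ a b, Continuous fun y => U y (tmul a b)) (z) : Continuous fun y => U y z :=
  tensor_induction (p := fun z => Continuous fun y => U y z) (isClosed_continuous_family U)
    (fun x x' hx hx' => (hx.add hx').congr fun y => (map_add (U y).toHom x x').symm) h z

theorem continuous_family_gen {U : Y → GrHom (SAlg 𝕜) E}
    (hu : Continuous fun y => U y (genU 𝕜)) (hv : Continuous fun y => U y (genV 𝕜))
    (f : (SAlg 𝕜).carrier) : Continuous fun y => U y f :=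
  s_induction (p := fun f => Continuous fun y => U y f) (isClosed_continuous_family U)
    (fun f g hf hg => (hf.add hg).congr fun y => (map_add (U y).toHom f g).symm)
    (fun c f hf => (hf.const_smul c).congr fun y => (map_smul (U y).toHom c f).symm)
    (fun f g hf hg => (hf.mul hg).congr fun y => (map_mul (U y).toHom f g).symm) hu hv f

variable [CompactSpace Y]

/-- A family of homomorphisms that is continuous pointwise, as a homomorphism to the algebra of
continuous functions. -/
def famHom (U : Y → GrHom P E) (hU : ∀ x, Continuous fun y => U y x) : GrHom P (CAlg Y E) :=
  GrHom.ofHom (B := CAlg Y E)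
  { toFun := fun x => (⟨fun y => U y x, hU x⟩ : C(Y, E.carrier))
    map_smul' := fun c x => ContinuousMap.ext fun y => map_smul (U y).toHom c x
    map_zero' := ContinuousMap.ext fun y => map_zero (U y).toHom
    map_add' := fun x x' => ContinuousMap.ext fun y => map_add (U y).toHom x x'
    map_mul' := fun x x' => ContinuousMap.ext fun y => map_mul (U y).toHom x x'
    map_star' := fun x => ContinuousMap.ext fun y => map_star (U y).toHom x }
  fun x => ContinuousMap.ext fun y => (U y).map_grade x

/-- Evaluation at a point. -/
def evalHom (E : GrCStar 𝕜) (y : Y) : GrHom (CAlg Y E) E := GrHom.ofHom (A := CAlg Y E)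
  { toFun := fun f => Asy.evalC f y
    map_smul' := fun _ _ => rfl
    map_zero' := rfl
    map_add' := fun _ _ => rfl
    map_mul' := fun _ _ => rfl
    map_star' := fun _ => rfl }
  fun _ => rfl

theorem evalHom_famHom (U : Y → GrHom P E) (hU : ∀ x, Continuous fun y => U y x) (y : Y) :
    (evalHom E y).comp (famHom U hU) = U y := rfl

theorem continuous_evalHom (f : (CAlg Y E).carrier) : Continuous fun y => evalHom E y f :=
  map_continuous (F := C(Y, E.carrier)) f

end Families

/-! ### Continuity of the Bott maps and of the orthogonal action -/

section BottContinuous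

variable {n m : ℕ}

theorem continuous_cliffVec :
    Continuous fun v : EuclideanSpace ℝ (Fin m) => cliffVec (𝕜 := 𝕜) v := by
  have h := AddMonoidHomClass.continuous_of_bound
    (AddMonoidHom.mk' (cliffVec (𝕜 := 𝕜) (m := m)) cliffVec_add) 1 fun v => by
      rw [one_mul]
      exact norm_cliffVec_le v
  exact h

/-- The Bott maps are continuous at infinity because elements of `𝒮` vanish there. On generators this is
the decay of `exp (-‖v‖²)` and `‖v‖ exp (-‖v‖²)`. -/
theorem continuous_bottSph (f : (SAlg 𝕜).carrier) :
    Continuous fun s : OnePoint (EuclideanSpace ℝ (Fin n)) => bottSph (𝕜 := 𝕜) (n := n) s f := by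
  have hn : Tendsto (fun v : EuclideanSpace ℝ (Fin n) => ‖v‖) (cocompact _) (cocompact ℝ) :=
    (tendsto_norm_cocompact_atTop).mono_right atTop_le_cocompact
  have h0 := tendsto_gauss.comp hn
  have h1 := tendsto_mul_gauss.comp hn
  have hexp : Continuous fun v : EuclideanSpace ℝ (Fin n) => (Real.exp (-‖v‖ ^ 2) : 𝕜) := by
    have h2 : Continuous fun v : EuclideanSpace ℝ (Fin n) => Real.exp (-‖v‖ ^ 2) := by fun_prop
    exact RCLike.continuous_ofReal.comp h2
  refine continuous_family_gen ?_ ?_ f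
  · rw [OnePoint.continuous_iff, Filter.coclosedCompact_eq_cocompact]
    refine ⟨?_, ?_⟩
    · change Tendsto (fun v => bottVec v (genU 𝕜)) _ (𝓝 0)
      simp only [bottVec_genU]
      have h2 := ((RCLike.continuous_ofReal (K := 𝕜)).tendsto 0).comp h0
      rw [RCLike.ofReal_zero] at h2
      have h3 := h2.smul_const (cliffUnit 𝕜 n)
      rwa [zero_smul] at h3
    · change Continuous fun v => bottVec v (genU 𝕜)
      simp only [bottVec_genU]
      exact hexp.smul continuous_const
  · have hv := continuous_cliffVec (𝕜 := 𝕜) (m := n)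
    rw [OnePoint.continuous_iff, Filter.coclosedCompact_eq_cocompact]
    refine ⟨?_, ?_⟩
    · change Tendsto (fun v => bottVec v (genV 𝕜)) _ (𝓝 0)
      simp only [bottVec_genV]
      refine squeeze_zero_norm (fun v => ?_) h1
      rw [norm_smul, RCLike.norm_ofReal, Real.abs_exp, mul_comm]
      exact mul_le_mul_of_nonneg_right (norm_cliffVec_le v) (Real.exp_nonneg _)
    · change Continuous fun v => bottVec v (genV 𝕜)
      simp only [bottVec_genV]
      exact hexp.smul hv

theorem continuous_cliffMap (x : (CliffAlg 𝕜 m).carrier) :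
    Continuous fun U : O m => cliffMap (𝕜 := 𝕜) (orthIso U) x := by
  have hv := continuous_cliffVec (𝕜 := 𝕜) (m := m)
  refine cliff_induction (p := fun x => Continuous fun U : O m => cliffMap (𝕜 := 𝕜) (orthIso U) x)
    (isClosed_continuous_family _) (fun x y hx hy => ?_) (fun c x hx => ?_) ?_ (fun v => ?_)
    (fun x y hx hy => ?_) x
  · exact (hx.add hy).congr fun U => (map_add (cliffMap (orthIso U)).toHom x y).symm
  · exact (hx.const_smul c).congr fun U => (map_smul (cliffMap (orthIso U)).toHom c x).symm
  · simp only [cliffMap_unit]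
    exact continuous_const
  · simp only [cliffMap_vec]
    refine hv.comp ?_
    have e : ∀ U : O m, orthIso U v = WithLp.toLp 2 (U.1.mulVec v.ofLp) := fun U => rfl
    simp only [e]
    exact (PiLp.continuous_toLp 2 _).comp (continuous_subtype_val.matrix_mulVec continuous_const)
  · exact (hx.mul hy).congr fun U => (map_mul (cliffMap (orthIso U)).toHom x y).symm

end BottContinuous

/-! ### Decompositions of Euclidean space -/

section Incl

variable {m n : ℕ}

/-- The isometry of `ℝᵐ` onto the span of the first `m` coordinate vectors of `ℝᵐ⁺ⁿ`. -/
def inclLeft (m n : ℕ) : EuclideanSpace ℝ (Fin m) →ₗᵢ[ℝ] EuclideanSpace ℝ (Fin (m + n)) where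
  toFun v := WithLp.toLp 2 (Fin.append v.ofLp fun _ => 0)
  map_add' v w := by
    ext i
    refine Fin.addCases (fun i => ?_) (fun j => ?_) i <;> simp
  map_smul' c v := by
    ext i
    refine Fin.addCases (fun i => ?_) (fun j => ?_) i <;> simp
  norm_map' v := by simp [EuclideanSpace.norm_eq, Fin.sum_univ_add]

/-- The isometry of `ℝⁿ` onto the span of the last `n` coordinate vectors of `ℝᵐ⁺ⁿ`. -/
def inclRight (m n : ℕ) : EuclideanSpace ℝ (Fin n) →ₗᵢ[ℝ] EuclideanSpace ℝ (Fin (m + n)) where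
  toFun w := WithLp.toLp 2 (Fin.append (fun _ => 0) w.ofLp)
  map_add' v w := by
    ext i
    refine Fin.addCases (fun i => ?_) (fun j => ?_) i <;> simp
  map_smul' c v := by
    ext i
    refine Fin.addCases (fun i => ?_) (fun j => ?_) i <;> simp
  norm_map' v := by simp [EuclideanSpace.norm_eq, Fin.sum_univ_add]

@[simp] theorem inclLeft_castAdd (v : EuclideanSpace ℝ (Fin m)) (i : Fin m) :
    inclLeft m n v (Fin.castAdd n i) = v i :=
  Fin.append_left v.ofLp (fun _ => 0) i
@[simp] theorem inclLeft_natAdd (v : EuclideanSpace ℝ (Fin m)) (j : Fin n) :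
    inclLeft m n v (Fin.natAdd m j) = 0 :=
  Fin.append_right v.ofLp (fun _ => 0) j
@[simp] theorem inclRight_castAdd (w : EuclideanSpace ℝ (Fin n)) (i : Fin m) :
    inclRight m n w (Fin.castAdd n i) = 0 :=
  Fin.append_left (fun _ => 0) w.ofLp i
@[simp] theorem inclRight_natAdd (w : EuclideanSpace ℝ (Fin n)) (j : Fin n) :
    inclRight m n w (Fin.natAdd m j) = w j :=
  Fin.append_right (fun _ => 0) w.ofLp j

theorem inner_inclRight_inclLeft (w : EuclideanSpace ℝ (Fin n)) (v : EuclideanSpace ℝ (Fin m)) :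
    inner ℝ (inclRight m n w) (inclLeft m n v) = 0 := by
  simp [PiLp.inner_apply, Fin.sum_univ_add]

theorem inclFirst_castSucc (v : EuclideanSpace ℝ (Fin m)) (i : Fin m) :
    inclFirst m v i.castSucc = v i := Fin.snoc_castSucc (α := fun _ => ℝ) _ _ i
theorem inclFirst_last (v : EuclideanSpace ℝ (Fin m)) : inclFirst m v (Fin.last m) = 0 :=
  Fin.snoc_last (α := fun _ => ℝ) _ _
theorem inclLast_castSucc (v : EuclideanSpace ℝ (Fin 1)) (i : Fin m) :
    inclLast m v i.castSucc = 0 :=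
  Fin.snoc_castSucc (α := fun _ => ℝ) (v 0) (fun _ => 0) i
theorem inclLast_last (v : EuclideanSpace ℝ (Fin 1)) : inclLast m v (Fin.last m) = v 0 :=
  Fin.snoc_last (α := fun _ => ℝ) (v 0) (fun _ => 0)

theorem inner_inclLast_inclFirst (w : EuclideanSpace ℝ (Fin 1)) (v : EuclideanSpace ℝ (Fin m)) :
    inner ℝ (inclLast m w) (inclFirst m v) = 0 := by
  simp [PiLp.inner_apply, Fin.sum_univ_castSucc, inclFirst_last, inclLast_castSucc]

theorem inclLeft_zero (v : EuclideanSpace ℝ (Fin m)) : inclLeft m 0 v = v := by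
  ext i
  exact inclLeft_castAdd (n := 0) v i

theorem inclLeft_succ (v : EuclideanSpace ℝ (Fin m)) :
    inclLeft m (n + 1) v = inclFirst (m + n) (inclLeft m n v) := by
  ext i
  refine Fin.addCases (fun i => ?_) (fun j => ?_) i
  · rw [inclLeft_castAdd]
    exact ((inclFirst_castSucc _ (Fin.castAdd n i)).trans (inclLeft_castAdd v i)).symm
  · rw [inclLeft_natAdd]
    refine Fin.lastCases ?_ (fun j => ?_) j
    · exact (inclFirst_last _).symm
    · exact ((inclFirst_castSucc _ (Fin.natAdd m j)).trans (inclLeft_natAdd v j)).symm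

/-- The last `n + 1` coordinates of `ℝᵐ⁺ⁿ⁺¹` consist of the last one and of the last `n` coordinates of
`ℝᵐ⁺ⁿ`. -/
theorem inclRight_succ (w : EuclideanSpace ℝ (Fin (n + 1))) : inclRight m (n + 1) w =
    inclLast (m + n) (vecOne (w (Fin.last n))) +
      inclFirst (m + n) (inclRight m n (initVec w)) := by
  ext i
  rw [PiLp.add_apply]
  refine Fin.addCases (fun i => ?_) (fun j => ?_) i
  · rw [inclRight_castAdd]
    refine Eq.symm ((congrArg₂ (· + ·) (inclLast_castSucc _ (Fin.castAdd n i))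
      ((inclFirst_castSucc _ (Fin.castAdd n i)).trans (inclRight_castAdd _ i))).trans ?_)
    exact add_zero 0
  · rw [inclRight_natAdd]
    refine Fin.lastCases ?_ (fun j => ?_) j
    · exact ((congrArg₂ (· + ·) (inclLast_last (m := m + n) (vecOne (w (Fin.last n))))
        (inclFirst_last (m := m + n) (inclRight m n (initVec w)))).trans (add_zero _)).symm
    · refine Eq.symm ((congrArg₂ (· + ·) (inclLast_castSucc _ (Fin.natAdd m j))
        ((inclFirst_castSucc _ (Fin.natAdd m j)).trans (inclRight_natAdd _ j))).trans ?_)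
      exact zero_add _

theorem inclLeft_one : inclLeft m 1 = inclFirst m := by
  ext v : 1
  rw [inclLeft_succ, inclLeft_zero]
  rfl

theorem inclRight_one : inclRight m 1 = inclLast m := by
  ext w : 1
  have h : inclRight m 0 (initVec w) = 0 := by
    have : initVec w = 0 := by
      ext i
      exact i.elim0
    rw [this, map_zero]
  rw [inclRight_succ, h, map_zero, add_zero]
  congr 1
  ext i
  fin_cases i
  rfl

theorem orthIso_apply (H : O m) (v : EuclideanSpace ℝ (Fin m)) (i : Fin m) :
    orthIso H v i = ∑ j, H.1 i j * v j := rfl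

theorem orthIso_one : orthIso (1 : O m) = LinearIsometry.id := by
  ext v i
  rw [orthIso_apply]
  simp [Matrix.one_apply]

theorem orthIso_mul (H K : O m) : orthIso (H * K) = (orthIso H).comp (orthIso K) := by
  ext v i
  change orthIso (H * K) v i = orthIso H (orthIso K v) i
  simp only [orthIso_apply, Submonoid.coe_mul, Matrix.mul_apply, Finset.sum_mul, Finset.mul_sum]
  rw [Finset.sum_comm]
  exact Finset.sum_congr rfl fun j _ => Finset.sum_congr rfl fun k _ => mul_assoc _ _ _

theorem orthIso_blockSum_inclLeft (H : O m) (K : O n) :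
    (orthIso (blockSum H K)).comp (inclLeft m n) = (inclLeft m n).comp (orthIso H) := by
  ext v i
  change orthIso (blockSum H K) (inclLeft m n v) i = inclLeft m n (orthIso H v) i
  rw [orthIso_apply, Fin.sum_univ_add]
  refine Fin.addCases (fun i => ?_) (fun j => ?_) i
  · simp [blockSum, orthIso_apply]
  · simp [blockSum]

theorem orthIso_blockSum_inclRight (H : O m) (K : O n) :
    (orthIso (blockSum H K)).comp (inclRight m n) = (inclRight m n).comp (orthIso K) := by
  ext v i
  change orthIso (blockSum H K) (inclRight m n v) i = inclRight m n (orthIso K v) i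
  rw [orthIso_apply, Fin.sum_univ_add]
  refine Fin.addCases (fun i => ?_) (fun j => ?_) i
  · simp [blockSum]
  · simp [blockSum, orthIso_apply]

end Incl

/-! ### Classes of asymptotic morphisms and their quasi-topology -/

section Classes

variable {P P' E E' : GrCStar 𝕜}

/-- The homomorphism to the asymptotic algebra given by a class of asymptotic morphisms. -/
def clsHat (x : (AsySpace P E).carrier) : GrHom P (AsyAlg E) :=
  Quotient.lift (s := Asy.setoid P E) Asy.hat (fun _ _ h => cls_eq_cls.1 (Quotient.sound h)) x

theorem clsHat_cls (φ : Asy P E) : clsHat φ.cls = φ.hat := rfl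

theorem clsHat_asyCls (F : GrHom P (AsyAlg E)) : clsHat (asyCls F) = F := hat_asyLift F

theorem asyCls_clsHat (x : (AsySpace P E).carrier) : asyCls (clsHat x) = x := by
  obtain ⟨F, rfl⟩ := asyCls_surjective x
  rw [clsHat_asyCls]

theorem clsHat_pt (x) : clsHat (AsySpace P E).pt x = 0 :=
  congrArg AsyAlg.mk (BoundedContinuousFunction.ext fun _ => rfl)

theorem asyCls_eq_pt {F : GrHom P (AsyAlg E)} (h : ∀ x, F x = 0) :
    asyCls F = (AsySpace P E).pt := by
  rw [← asyCls_clsHat (AsySpace P E).pt]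
  congr 1
  exact GrHom.ext fun x => (h x).trans (clsHat_pt x).symm

theorem post_asyCls (g : GrHom E E') (F : GrHom P (AsyAlg E)) :
    AsySpace.post g (asyCls F) = asyCls ((asyMap g).comp F) := by
  refine Eq.trans ?_ ((asyCls_hat ((asyLift F).postcomp g)).symm.trans ?_)
  · rfl
  · rw [hat_postcomp, hat_asyLift]

/-- A parametrized map of spaces of asymptotic morphisms is quasi-continuous if it lifts to the level
of asymptotic morphisms with values in algebras of continuous functions. -/
theorem quasiCts_of_lift {Z : Type} [TopologicalSpace Z]
    (T : Z → (AsySpace P E).carrier → (AsySpace P' E').carrier)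
    (h : ∀ (Y : Type) [TopologicalSpace Y] [CompactSpace Y] (k : Y → Z), Continuous k →
      ∀ G : GrHom P (AsyAlg (CAlg Y E)), ∃ G' : GrHom P' (AsyAlg (CAlg Y E')),
        ∀ y, T (k y) (asyCls ((asyMap (evalHom E y)).comp G)) =
          asyCls ((asyMap (evalHom E' y)).comp G')) :
    QuasiCts ((AsySpace P E).top.prod (QuasiTop.ofTop Z)) (AsySpace P' E').top
      (fun p => T p.2 p.1) := by
  intro C _ _ _ g hg
  obtain ⟨⟨C', _, _, _, p, g', hp, hs, ⟨G, hG⟩, e⟩, hk⟩ := hg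
  obtain ⟨G', hG'⟩ := h C' (fun y => (g (p y)).2)
    (Continuous.comp (g := fun c => (g c).2) hk hp) G.hat
  refine ⟨C', inferInstance, inferInstance, inferInstance, p,
    fun y => (asyLift G').postcomp (evalHom E' y), hp, hs, ⟨asyLift G', fun _ _ _ => rfl⟩,
    fun y => ?_⟩
  have h1 : (g (p y)).1 = asyCls ((asyMap (evalHom E y)).comp G.hat) := by
    rw [← hat_postcomp, asyCls_hat]
    refine (e y).symm.trans (Quotient.sound fun a => ?_)
    have h2 : ∀ t, ‖(g' y).toFun t a - (G.postcomp (evalHom E y)).toFun t a‖ = 0 := fun t => by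
      rw [hG]
      exact (congrArg norm (sub_self _)).trans norm_zero
    simp only [h2]
    exact tendsto_const_nhds
  change ((asyLift G').postcomp (evalHom E' y)).cls = T (g (p y)).2 (g (p y)).1
  rw [h1, hG', ← asyCls_hat, hat_postcomp, hat_asyLift]

end Classes

/-! ### The structure maps -/

section Structure

variable {B K : GrCStar 𝕜} {m n : ℕ}

theorem incl_commute (m n : ℕ) :
    GradedCommute (cliffMap (𝕜 := 𝕜) (inclRight m n)) (cliffMap (inclLeft m n)) :=
  cliffMap_commute inner_inclRight_inclLeft

theorem inclLast_commute (m : ℕ) :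
    GradedCommute (cliffMap (𝕜 := 𝕜) (inclLast m)) (cliffMap (inclFirst m)) :=
  cliffMap_commute inner_inclLast_inclFirst

variable (B K) in
/-- The middle factor `𝔽_{m,0}` is replaced by `𝔽_{m+n,0}`; the factor `𝒮` acts through the Bott map at
the point `s` of the sphere and the last `n` basis vectors. -/
def bottTwist (m n : ℕ) (s : (Sph n).carrier) :
    GrHom ((SAlg 𝕜).tensor (B.tensor ((CliffAlg 𝕜 m).tensor K)))
      (B.tensor ((CliffAlg 𝕜 (m + n)).tensor K)) :=
  shuffle B K ((cliffMap (inclRight m n)).comp (bottSph s)) (cliffMap (inclLeft m n))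
    ((incl_commute m n).precomp_left _)

theorem Mult.continuous_app {E Z : GrCStar 𝕜} (κ : GrHom Z (Mult E)) (x : E.carrier) :
    Continuous fun z => Mult.app (κ z) x := by
  refine AddMonoidHomClass.continuous_of_bound
    (AddMonoidHom.mk' (fun z => Mult.app (κ z) x) fun z z' => by rw [map_add, Mult.app_add]) ‖x‖
    fun z => ?_
  refine (ContinuousLinearMap.le_opNorm _ _).trans ?_
  rw [mul_comm]
  refine mul_le_mul_of_nonneg_left ?_ (norm_nonneg x)
  exact (DoubleCentralizer.norm_fst (𝕜 := 𝕜) (A := E.carrier) _).le.trans (norm_starHom_le κ.toHom z)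

theorem continuous_bottTwist (z) : Continuous fun s : OnePoint (EuclideanSpace ℝ (Fin n)) =>
    bottTwist B K m n s z := by
  refine continuous_family_tensor (fun f e => ?_) z
  have h : ∀ s, bottTwist B K m n s (tmul f e) = Mult.app (midMult B K (cliffMap (inclRight m n))
      (bottSph s f)) (midMap B K (cliffMap (inclLeft m n)) e) := fun s => by
    rw [bottTwist, shuffle_tmul, midMult_comp_apply]
  exact ((Mult.continuous_app _ _).comp (continuous_bottSph f)).congr fun s => (h s).symm

theorem bottTwist_pt (z) : bottTwist B K m n (𝕜 := 𝕜) (Sph n).pt z = 0 := by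
  refine tensor_induction (p := fun z => bottTwist B K m n (Sph n).pt z = 0)
    (isClosed_eq (GrHom.continuous _) continuous_const)
    (fun x y hx hy => by rw [map_add, hx, hy, add_zero]) (fun f e => ?_) z
  rw [bottTwist, shuffle_tmul, midMult_comp_apply, bottSph_pt, GrHom.zero_apply, map_zero]
  rfl

/-- Two successive twists by vectors are the twist by the vector with the joined coordinates. -/
theorem bottTwist_bottTwist (v : EuclideanSpace ℝ (Fin (n + 1))) :
    ((bottTwist B K (m + n) 1 (Sph.ofVec (vecOne (v (Fin.last n))))).comp
      (tensorMap (GrHom.id (SAlg 𝕜)) (bottTwist B K m n (Sph.ofVec (initVec v))))).comp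
        (coact (comult 𝕜) _) = bottTwist B K m (n + 1) (Sph.ofVec v) := by
  have e1 : (cliffMap (inclRight (m + n) 1)).comp (bottSph (Sph.ofVec (vecOne (v (Fin.last n))))) =
      bottVec (𝕜 := 𝕜) (inclLast (m + n) (vecOne (v (Fin.last n)))) := by
    rw [bottSph_coe, cliffMap_bottVec, inclRight_one]
  have e2 : (cliffMap (inclLeft (m + n) 1)).comp ((cliffMap (inclRight m n)).comp
      (bottSph (Sph.ofVec (initVec v)))) =
      bottVec (𝕜 := 𝕜) (inclFirst (m + n) (inclRight m n (initVec v))) := by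
    rw [bottSph_coe, cliffMap_bottVec, cliffMap_bottVec, inclLeft_one]
  have e3 : (cliffMap (inclRight m (n + 1))).comp (bottSph (Sph.ofVec v)) =
      bottVec (𝕜 := 𝕜) (inclLast (m + n) (vecOne (v (Fin.last n))) +
        inclFirst (m + n) (inclRight m n (initVec v))) := by
    rw [bottSph_coe, cliffMap_bottVec, inclRight_succ]
  have e4 : (cliffMap (inclLeft (m + n) 1)).comp (cliffMap (inclLeft m n)) =
      cliffMap (𝕜 := 𝕜) (inclLeft m (n + 1)) := by
    rw [← cliffMap_comp, inclLeft_one]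
    congr 1
    ext w : 1
    exact (inclLeft_succ w).symm
  have hc := incl_commute (𝕜 := 𝕜) (m + n) 1
  have k : GradedCommute ((cliffMap (𝕜 := 𝕜) (inclRight (m + n) 1)).comp
      (bottSph (Sph.ofVec (vecOne (v (Fin.last n))))))
      ((cliffMap (inclLeft (m + n) 1)).comp ((cliffMap (inclRight m n)).comp
        (bottSph (Sph.ofVec (initVec v))))) := (hc.precomp_left _).precomp_right _
  -- the vectors are orthogonal, so the Bott maps convolve to the Bott map at their sum
  have e5 : (pairHom _ _ k).comp (comult 𝕜) =
      (cliffMap (inclRight m (n + 1))).comp (bottSph (Sph.ofVec v)) := by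
    rw [e3]
    have k' := k
    rw [e1, e2] at k'
    rw [← bottVec_add (inner_inclLast_inclFirst _ _) k']
    congr 1
    congr 1
  have k' : GradedCommute ((pairHom _ _ k).comp (comult 𝕜))
      ((cliffMap (inclLeft (m + n) 1)).comp (cliffMap (inclLeft m n))) := by
    rw [e5, e4]
    exact (incl_commute m (n + 1)).precomp_left _
  rw [bottTwist, bottTwist, bottTwist]
  exact (shuffle_shuffle (comult 𝕜) _ _ k k').trans (shuffle_congr _ _ e5 e4)

/-- The structure maps are compatible with the orthogonal actions on the Clifford algebras. -/
theorem midMap_bottTwist (H : O m) (U : O n) (s : (Sph n).carrier) :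
    (midMap B K (cliffMap (orthIso (blockSum H U)))).comp (bottTwist B K m n s) =
      (bottTwist B K m n (sphAct U s)).comp
        (tensorMap (GrHom.id (SAlg 𝕜)) (midMap B K (cliffMap (orthIso H)))) := by
  have h := (incl_commute (𝕜 := 𝕜) m n).precomp_left (bottSph s)
  have h' := (incl_commute (𝕜 := 𝕜) m n).precomp_left (bottSph (sphAct U s))
  rw [bottTwist, bottTwist, midMap_shuffle _ _ _ _ (h.postcomp _),
    shuffle_midMap _ _ _ _ (h'.precomp_right _)]
  refine shuffle_congr _ _ ?_ ?_
  · rw [← GrHom.comp_assoc, ← cliffMap_comp, orthIso_blockSum_inclRight, cliffMap_comp,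
      GrHom.comp_assoc, cliffMap_bottSph]
  · rw [← cliffMap_comp, orthIso_blockSum_inclLeft, cliffMap_comp]

theorem midMult_cliffUnit {M : ℕ} (x : (B.tensor ((CliffAlg 𝕜 M).tensor K)).carrier) :
    Mult.app (midMult B K (GrHom.id (CliffAlg 𝕜 M)) (cliffUnit 𝕜 M)) x = x := by
  refine mid_induction (p := fun x => Mult.app (midMult B K (GrHom.id (CliffAlg 𝕜 M))
    (cliffUnit 𝕜 M)) x = x) (isClosed_eq (ContinuousLinearMap.continuous _) continuous_id)
    (fun x y hx hy => by rw [map_add, hx, hy]) (fun i j b y k hb _ => ?_) x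
  have e : (CliffAlg 𝕜 M).toAlg.gradePow i (cliffUnit 𝕜 M) = cliffUnit 𝕜 M := by
    cases i
    · rfl
    · exact grade_cliffUnit
  rw [midMult_tmul _ _ hb, e, GrHom.id_apply, cliffUnit_mul]

variable {Q : GrCStar 𝕜}

/-- Convolution with the twist by the origin of `ℝ⁰` does nothing. -/
theorem conv_bottTwist_zero (v : EuclideanSpace ℝ (Fin 0))
    (F : GrHom ((SAlg 𝕜).tensor Q) (AsyAlg (B.tensor ((CliffAlg 𝕜 m).tensor K)))) :
    conv (comult 𝕜) (bottTwist B K m 0 (Sph.ofVec v)) F = F := by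
  -- `f ↦ f(0)` is the counit of `Δ`, and `𝔽_{0,0}` acts on `𝔽_{m,0}` by multiples of the unit
  have hv : v = 0 := by
    ext i
    exact i.elim0
  have e : bottTwist B K m 0 (Sph.ofVec v) = (shuffle B K (cliffMap (𝕜 := 𝕜) (inclRight m 0))
      (cliffMap (inclLeft m 0)) (incl_commute m 0)).comp (tensorMap (bottVec v) (GrHom.id _)) :=
    (shuffle_comp _ _ _ _ _).symm
  rw [e]
  refine conv_counit (e₀ := cliffUnit 𝕜 0) _ (fun f => ?_) (fun x => ?_) F
  · have h : (tensorMap (bottVec v) (GrHom.id (SAlg 𝕜))).comp (comult 𝕜) = GrHom.ofHom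
        { toFun := fun f => tmul (cliffUnit 𝕜 0) f
          map_smul' := fun c f => tmul_smul c _ f
          map_zero' := (tmulL _ _ _).map_zero
          map_add' := tmul_add _
          map_mul' := fun f g => by
            refine Eq.symm ((tmul_mul_homog (A := CliffAlg 𝕜 0) (B := SAlg 𝕜) (i := false)
              (cliffUnit 𝕜 0) (cliffUnit 𝕜 0) f g grade_cliffUnit).trans ?_)
            rw [cliffUnit_mul]
            rfl
          map_star' := fun f => by
            refine Eq.symm (((tensorClass (CliffAlg 𝕜 0) (SAlg 𝕜)).of_star _).symm.trans
              (congrArg _ ((AlgTensor.star_homog (P := (CliffAlg 𝕜 0).toAlg)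
                (Q := (SAlg 𝕜).toAlg) (i := false) f grade_cliffUnit).trans ?_)))
            rw [star_cliffUnit]
            rfl }
        (fun f => by
          refine Eq.symm ((grade_tmul _ _).trans ?_)
          rw [grade_cliffUnit]
          rfl) := by
      have h0 : cliffVec (𝕜 := 𝕜) (0 : EuclideanSpace ℝ (Fin 0)) = 0 := by
        have := cliffVec_smul (𝕜 := 𝕜) 0 (0 : EuclideanSpace ℝ (Fin 0))
        rwa [zero_smul, RCLike.ofReal_zero, zero_smul] at this
      have hu : bottVec v (genU 𝕜) = cliffUnit 𝕜 0 := by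
        rw [bottVec_genU, hv]
        simp
      have hv : bottVec v (genV 𝕜) = 0 := by
        rw [bottVec_genV, hv, h0, smul_zero]
      refine GrHom.gen_ext ?_ ?_
      · rw [GrHom.comp_apply, comult_genU, tensorMap_tmul, hu]
        rfl
      · have hz : tmul (0 : (CliffAlg 𝕜 0).carrier) (genU 𝕜) = 0 := (tmulL _ _).map_zero₂ _
        rw [GrHom.comp_apply, comult_genV, map_add, tensorMap_tmul, tensorMap_tmul, hu, hv,
          GrHom.id_apply, GrHom.id_apply, hz, add_zero]
        rfl
    exact congrArg (fun g : GrHom (SAlg 𝕜) ((CliffAlg 𝕜 0).tensor (SAlg 𝕜)) => g f) h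
  · have e2 : cliffMap (𝕜 := 𝕜) (inclLeft m 0) = GrHom.id (CliffAlg 𝕜 m) := by
      rw [← cliffMap_id]
      congr 1
      ext w : 1
      exact inclLeft_zero w
    have e3 := midMult_comp_apply (B := B) (K := K) (GrHom.id (CliffAlg 𝕜 (m + 0)))
      (cliffMap (𝕜 := 𝕜) (inclRight m 0)) (cliffUnit 𝕜 0)
    rw [GrHom.id_comp, cliffMap_unit] at e3
    have e4 : midMap B K (cliffMap (𝕜 := 𝕜) (inclLeft m 0)) x = x := by
      have : midMap B K (cliffMap (𝕜 := 𝕜) (inclLeft m 0)) = GrHom.id _ := by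
        rw [e2]
        exact (congrArg _ tensorMap_id).trans tensorMap_id
      rw [this]
      rfl
    rw [shuffle_tmul, e3]
    exact (midMult_cliffUnit _).trans e4

end Structure

/-! ### The orthogonal quasi-spectrum -/

section TheSpectrum

variable (B K Q : GrCStar 𝕜)

/-- The space `Asy_g(𝒮 ⊗̂ Q, B ⊗̂ 𝔽_{m,0} ⊗̂ K)`. -/
abbrev cliffSpace (m : ℕ) : BQSpace :=
  AsySpace ((SAlg 𝕜).tensor Q) (B.tensor ((CliffAlg 𝕜 m).tensor K))

/-- The map `(x, s) ↦ x ∧ s ↦ b(s) ∘ (id_𝒮 ⊗̂ x) ∘ Δ`, for a point `s` of the `n`-sphere. -/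
def convSph (m n : ℕ) (s : (Sph n).carrier) (x : (cliffSpace B K Q m).carrier) :
    (cliffSpace B K Q (m + n)).carrier :=
  asyCls (conv (comult 𝕜) (bottTwist B K m n s) (clsHat x))

variable {B K Q} {m n : ℕ}

/-- The map `convSph` is compatible with the base points, so it descends to the smash product. -/
theorem convSph_eq_pt {s : (Sph n).carrier} {x : (cliffSpace B K Q m).carrier}
    (h : x = (cliffSpace B K Q m).pt ∨ s = (Sph n).pt) :
    convSph B K Q m n s x = (cliffSpace B K Q (m + n)).pt := by
  rcases h with rfl | rfl
  · exact asyCls_eq_pt (conv_zero_right (Δ := comult 𝕜) _ clsHat_pt)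
  · exact asyCls_eq_pt (conv_zero_left (Δ := comult 𝕜) bottTwist_pt _)

/-- For a quasi-continuous family of classes over `Y`, represented by a homomorphism to the asymptotic
algebra of `C(Y, E)`, the convolution with the pointwise twists is the convolution with a single
homomorphism with values in continuous functions on `Y`. -/
theorem quasiCts_convSph : QuasiCts ((cliffSpace B K Q m).top.prod (Sph n).top)
    (cliffSpace B K Q (m + n)).top (fun p => convSph B K Q m n p.2 p.1) := by
  refine quasiCts_of_lift (Z := OnePoint (EuclideanSpace ℝ (Fin n))) (convSph B K Q m n)
    fun Y _ _ k hk G => ?_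
  let U : Y → GrHom ((SAlg 𝕜).tensor (CAlg Y (B.tensor ((CliffAlg 𝕜 m).tensor K))))
      (B.tensor ((CliffAlg 𝕜 (m + n)).tensor K)) := fun y =>
    (bottTwist B K m n (k y)).comp (tensorMap (GrHom.id (SAlg 𝕜)) (evalHom _ y))
  have hU : ∀ z, Continuous fun y => U y z := fun z => by
    refine continuous_family_apply (U := fun y => bottTwist B K m n (k y))
      (fun x => (continuous_bottTwist x).comp hk)
      (continuous_family_tensor (U := fun y => tensorMap (GrHom.id (SAlg 𝕜))
        (evalHom (B.tensor ((CliffAlg 𝕜 m).tensor K)) y)) (fun f e => ?_) z)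
    exact ((continuous_tmul_right f).comp (continuous_evalHom e)).congr fun y =>
      (tensorMap_tmul (GrHom.id (SAlg 𝕜)) (evalHom _ y) f e).symm
  refine ⟨conv (comult 𝕜) (famHom U hU) G, fun y => ?_⟩
  change asyCls (conv _ _ (clsHat _)) = _
  rw [clsHat_asyCls, conv_asyMap, asyMap_conv, evalHom_famHom]

variable (B K Q m n) in
/-- The map `X_m ∧ Sⁿ → X_{m+n}`. -/
def structMap : BasedMap (Smash (cliffSpace B K Q m) (Sph n)) (cliffSpace B K Q (m + n)) where
  toFun := Quotient.lift (s := smashSetoid (cliffSpace B K Q m) (Sph n))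
    (fun p => convSph B K Q m n p.2 p.1) (by
      rintro p q (h | ⟨h, h'⟩)
      · rw [h]
      · exact (convSph_eq_pt h).trans (convSph_eq_pt h').symm)
  map_pt := convSph_eq_pt (Or.inl rfl)
  quasiCts := by
    intro C _ _ _ g hg
    obtain ⟨C', _, _, _, p, g', hp, hs, hg', e⟩ := hg
    refine (cliffSpace B K Q (m + n)).top.surj C' C p _ hp hs ?_
    have h := quasiCts_convSph C' g' hg'
    refine cast (congrArg _ (funext fun c => ?_)) h
    exact congrArg (Quotient.lift (s := smashSetoid (cliffSpace B K Q m) (Sph n))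
      (fun p => convSph B K Q m n p.2 p.1) _) (e c)

theorem structMap_mk (x : (cliffSpace B K Q m).carrier) (s : (Sph n).carrier) :
    (structMap B K Q m n).toFun (Smash.mk x s) = convSph B K Q m n s x := rfl

/-- The iterated structure map is again convolution with a twist: this is coassociativity of `Δ`
together with the additivity of the Bott maps. -/
theorem iterVec_structMap (x : (cliffSpace B K Q m).carrier) : ∀ (n : ℕ) (v),
    iterVec (X := cliffSpace B K Q) (fun m => structMap B K Q m 1) m x n v =
      convSph B K Q m n (Sph.ofVec v) x
  | 0, v => by
    rw [convSph, conv_bottTwist_zero]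
    exact (asyCls_clsHat x).symm
  | n + 1, v => by
    rw [iterVec, structMap_mk, iterVec_structMap x n, convSph, convSph, clsHat_asyCls,
      conv_conv isCoassoc_comult, bottTwist_bottTwist]
    rfl

/-- All the iterated structure maps are of the form `structMap`, including the value at infinity. -/
theorem iter_structMap (m n : ℕ) :
    iter (X := cliffSpace B K Q) (fun m => structMap B K Q m 1) m n =
      (structMap B K Q m n).toFun := by
  funext p
  obtain ⟨⟨x, s⟩, rfl⟩ := Quotient.exists_rep p
  change iterFun _ m n x s = convSph B K Q m n s x
  induction s using OnePoint.rec with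
  | infty => exact (convSph_eq_pt (Or.inr rfl)).symm
  | coe v => exact iterVec_structMap x n v

variable (B K Q) in
/-- The action of `O(m)`, through the Clifford algebra. -/
def cliffAct (m : ℕ) (U : O m) : (cliffSpace B K Q m).carrier → (cliffSpace B K Q m).carrier :=
  AsySpace.post (midMap B K (cliffMap (orthIso U)))

theorem cliffAct_asyCls (U : O m) (F) : cliffAct B K Q m U (asyCls F) =
    asyCls ((asyMap (midMap B K (cliffMap (orthIso U)))).comp F) := post_asyCls _ F

theorem midMap_orthIso_one : midMap B K (cliffMap (orthIso (1 : O m))) = GrHom.id _ := by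
  rw [orthIso_one, cliffMap_id]
  exact (congrArg _ tensorMap_id).trans tensorMap_id

theorem midMap_orthIso_mul (U V : O m) : midMap B K (cliffMap (𝕜 := 𝕜) (orthIso (U * V))) =
    (midMap B K (cliffMap (orthIso U))).comp (midMap B K (cliffMap (orthIso V))) := by
  rw [orthIso_mul, cliffMap_comp, tensorMap_comp, tensorMap_comp]
  rfl

theorem quasiCts_cliffAct : QuasiCts ((QuasiTop.ofTop (O m)).prod (cliffSpace B K Q m).top)
    (cliffSpace B K Q m).top (fun p => cliffAct B K Q m p.1 p.2) := by
  have h : QuasiCts ((cliffSpace B K Q m).top.prod (QuasiTop.ofTop (O m)))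
      (cliffSpace B K Q m).top (fun p => cliffAct B K Q m p.2 p.1) := by
    refine quasiCts_of_lift (cliffAct B K Q m) fun Y _ _ k hk G => ?_
    let V : Y → GrHom (CAlg Y (B.tensor ((CliffAlg 𝕜 m).tensor K)))
        (B.tensor ((CliffAlg 𝕜 m).tensor K)) := fun y =>
      (midMap B K (cliffMap (orthIso (k y)))).comp (evalHom _ y)
    have hV : ∀ z, Continuous fun y => V y z := fun z => by
      refine continuous_family_apply (U := fun y => midMap B K (cliffMap (orthIso (k y))))
        (continuous_family_tensor fun b w => ?_) (continuous_evalHom z)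
      refine ((continuous_tmul_right b).comp (continuous_family_tensor
        (U := fun y => tensorMap (cliffMap (orthIso (k y))) (GrHom.id K)) (fun x c => ?_) w)).congr
          fun y => (tensorMap_tmul (GrHom.id B) (tensorMap (cliffMap (orthIso (k y))) (GrHom.id K)) b w).symm
      exact ((continuous_tmul_left c).comp ((continuous_cliffMap x).comp hk)).congr
        fun y => (tensorMap_tmul (cliffMap (orthIso (k y))) (GrHom.id K) x c).symm
    refine ⟨(asyMap (famHom V hV)).comp G, fun y => ?_⟩
    rw [cliffAct_asyCls, ← GrHom.comp_assoc, ← GrHom.comp_assoc, ← asyMap_comp', ← asyMap_comp',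
      evalHom_famHom]
  intro C _ _ _ g hg
  exact h C (fun c => ((g c).2, (g c).1)) ⟨hg.2, hg.1⟩

theorem isOrthogonalQuasiSpectrum_cliffSpace :
    IsOrthogonalQuasiSpectrum (X := cliffSpace B K Q) (cliffAct B K Q)
      (fun m => structMap B K Q m 1) where
  act_one m x := by
    obtain ⟨F, rfl⟩ := asyCls_surjective x
    rw [cliffAct_asyCls, midMap_orthIso_one, asyMap_id', GrHom.id_comp]
  act_mul m U V x := by
    obtain ⟨F, rfl⟩ := asyCls_surjective x
    rw [cliffAct_asyCls, cliffAct_asyCls, cliffAct_asyCls, midMap_orthIso_mul, asyMap_comp',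
      GrHom.comp_assoc]
  act_pt m U := by
    rw [← asyCls_clsHat (cliffSpace B K Q m).pt, cliffAct_asyCls, asyCls_clsHat]
    refine asyCls_eq_pt fun x => ?_
    rw [GrHom.comp_apply, clsHat_pt, map_zero]
  act_quasiCts m := quasiCts_cliffAct
  iter_quasiCts m n := by
    rw [iter_structMap]
    exact (structMap B K Q m n).quasiCts
  iter_equivariant m n U V x s := by
    rw [iter_structMap, structMap_mk, structMap_mk, convSph, convSph, cliffAct_asyCls, asyMap_conv,
      midMap_bottTwist, ← conv_asyMap]
    congr 2
    obtain ⟨F, rfl⟩ := asyCls_surjective x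
    rw [cliffAct_asyCls, clsHat_asyCls, clsHat_asyCls]

/-- On the sphere `S¹`, the twist is the composition of the Bott map with the shuffle
homomorphism. -/
theorem bottTwist_one (s : ℝ) : bottTwist B K m 1 (Sph.ofVec (vecOne s)) =
    (shuffle B K (cliffMap (inclLast m)) (cliffMap (inclFirst m)) (inclLast_commute m)).comp
      (tensorMap (bott s) (GrHom.id (B.tensor ((CliffAlg 𝕜 m).tensor K)))) := by
  rw [shuffle_comp _ _ _ _ ((inclLast_commute m).precomp_left _)]
  refine shuffle_congr _ _ ?_ ?_
  · rw [inclRight_one, bott_eq_bottVec, bottSph_coe]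
  · rw [inclLeft_one]

end TheSpectrum

end ETheory

end

/-- The sequence `X_m = Asy_g(𝒮 ⊗̂ A ⊗̂ 𝒦, B ⊗̂ 𝔽_{m,0} ⊗̂ 𝒦)`, with the action of `O(m)` on the Clifford
algebra and the structure maps `x ∧ s ↦ (b(s) ⊗̂ id) ∘ (id_𝒮 ⊗̂ x) ∘ (Δ ⊗̂ id)`, is an orthogonal
quasi-spectrum. -/
theorem mainTheorem3 {𝕜 : Type} [RCLike 𝕜] (A B : GrCStar 𝕜) {H : Type} [NormedAddCommGroup H]
    [InnerProductSpace 𝕜 H] [CompleteSpace H] (H₀ : Submodule 𝕜 H)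
    [H₀.HasOrthogonalProjection] :
    ∃ (Δ : GrHom (SAlg 𝕜) ((SAlg 𝕜).tensor (SAlg 𝕜)))
      (α : GrHom (((SAlg 𝕜).tensor (SAlg 𝕜)).tensor (A.tensor (KAlg H₀)))
        ((SAlg 𝕜).tensor (srcAlg A H₀)))
      (θ : ∀ m : ℕ, GrHom ((CliffAlg 𝕜 1).tensor (tgtAlg B H₀ m)) (tgtAlg B H₀ (m + 1)))
      (σ : ∀ m : ℕ, BasedMap (Smash (XSpace A B H₀ m) (Sph 1)) (XSpace A B H₀ (m + 1))),
      IsComult Δ ∧ IsAssoc α ∧ (∀ m, IsShuffle (θ m)) ∧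
      (∀ (m : ℕ) (x : Asy (srcAlg A H₀) (tgtAlg B H₀ m)),
        ∃ z : Asy ((SAlg 𝕜).tensor (srcAlg A H₀)) ((SAlg 𝕜).tensor (tgtAlg B H₀ m)),
          IsIdTensor x z ∧
          ∀ s : ℝ, (σ m).toFun (Smash.mk x.cls (Sph.ofVec (vecOne s))) =
            Asy.cls (((z.precomp (α.comp (tensorMap Δ (GrHom.id (A.tensor (KAlg H₀)))))).postcomp
              ((θ m).comp (tensorMap (bott s) (GrHom.id (tgtAlg B H₀ m))))))) ∧
      IsOrthogonalQuasiSpectrum (XAct A B H₀) σ := by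
  refine ⟨comult 𝕜, assocHom _ _ _, fun m => shuffle B (KAlg H₀) (cliffMap (inclLast m))
    (cliffMap (inclFirst m)) (inclLast_commute m), fun m => structMap B (KAlg H₀)
      (A.tensor (KAlg H₀)) m 1, isComult_comult, assocHom_tmul,
    fun m => isShuffle_shuffle (inclLast_commute m), fun m x => ?_,
    isOrthogonalQuasiSpectrum_cliffSpace⟩
  refine ⟨asyLift (idTensor (SAlg 𝕜) x.hat), (isIdTensor_iff _ _).2 (hat_asyLift _), fun s => ?_⟩
  refine (structMap_mk _ _).trans ?_
  rw [convSph, clsHat_cls, bottTwist_one, ← asyCls_hat, hat_postcomp, hat_precomp, hat_asyLift]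
  rfl
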